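/- **Theorem 6.1.** *Notation.* Let $n',n''\ge 1$ be integers, $n=n'+n''$, and write $x=(x',x'')\in\mathbb R^{n'}\times\mathbb R^{n''}=\mathbb R^n$; identify $\mathbb R^{n'}$ with the plane $x''=0$. Put $I^n=(-1,1)^n$, $Q^n_{k,m}=\prod_{i}(2^{-k}m_i,2^{-k}(m_i+1))$ for $k\in\mathbb N_0$, $m\in\mathbb Z^n$, and $\widetilde Q^n_{k,m}=\prod_i[2^{-k}m_i,2^{-k}(m_i+1))$. Functions are real-valued, and functions that agree almost everywhere are identified. For $0<p<\infty$, a *$p$-admissible weight sequence* on $\mathbb R^n$ is a sequence $\{t_k\}_{k\ge 0}$ of measurable functions $t_k:\mathbb R^n\to(0,\infty)$ with $t_k\in L_p^{\rm loc}(\mathbb R^n)$; put $$t_{k,m}=\|t_k\,|\,L_p(Q^n_{k,m})\|,\qquad \overline t_k=2^{kn/p}\sum_{m\in\mathbb Z^n}t_{k,m}\chi_{\widetilde Q^n_{k,m}}.$$ For $\alpha=(\alpha_1,\alpha_2)\in\mathbb R^2$, $\alpha_3\ge0$, $\sigma=(\sigma_1,\sigma_2)\in(0,\infty]^2$, the class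 $X^{\alpha_3}_{\alpha,\sigma,p}(\mathbb R^n)$ consists of the $p$-admissible weight sequences for which there are $C_1,C_2>0$ such that for all $0\le k\le j$ and $m\in\mathbb Z^n$ $$\Big(2^{kn}\!\int_{Q^n_{k,m}}\overline t_k^{\,p}\Big)^{1/p}\Big(2^{kn}\!\int_{Q^n_{k,m}}\overline t_j^{\,-\sigma_1}\Big)^{1/\sigma_1}\le C_12^{\alpha_1(k-j)},\qquad \Big(2^{kn}\!\int_{Q^n_{k,m}}\overline t_k^{\,p}\Big)^{-1/p}\Big(2^{kn}\!\int_{Q^n_{k,m}}\overline t_j^{\,\sigma_2}\Big)^{1/\sigma_2}\le C_22^{\alpha_2(j-k)}$$ (essential suprema when $\sigma_i=\infty$), and $0<t_{k,m}\le2^{\alpha_3}t_{k,\widetilde m}$ whenever $|m_i-\widetilde m_i|\le1$ for all $i$. The class $\widetilde X^{\alpha_3}_{\alpha,\sigma,p}$ consists of those sequences in $X^{\alpha_3}_{\alpha,\sigma,p}$ with $t_k=\overline t_k$ for all $k$. For $l\in\mathbb N$, $p,q\in(0,\infty)$, $r\in(0,\infty]$, let $\Delta^l(h)\varphi(x)=\sum_{j=0}^l(-1)^{l+j}\binom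 lj\varphi(x+jh)$ and, for a cube $Q$ of side length $s$, $\delta^l_r(Q)\varphi=\big(s^{-2n}\int_{sI^n}\int_Q|\Delta^l(h)\varphi(x)|^r\,dx\,dh\big)^{1/r}$ (an essential supremum when $r=\infty$). The space $\widetilde B^l_{p,q,r}(\mathbb R^n,\{t_k\})$ consists of all $\varphi\in L_r^{\rm loc}(\mathbb R^n)$ with finite quasi-norm $$\|\varphi\|=\Big[\sum_{k=1}^\infty\big\|t_k\,\delta^l_r(\cdot+2^{-k}I^n)\varphi\,\big|\,L_p(\mathbb R^n)\big\|^q\Big]^{1/q}+\Big(\int_{\mathbb R^n}t_0^p(x)\,\|\varphi\,|\,L_r(x+I^n)\|^p\,dx\Big)^{1/p}.$$ Given $\{t_k\}$ on $\mathbb R^n$, put $t'_k(x')=2^{kn'/p}\sum_{m'\in\mathbb Z^{n'}}t_{k,(m',0)}\chi_{\widetilde Q^{n'}_{k,m'}}(x')$ for $x'\in\mathbb R^{n'}$. *Trace.* Let $\Sigma^l$ be the set of all functions $S=\sum_{m\in\mathbb Z^n}\beta_mN^l_{k,m}$ with $k\in\mathbb N_0$, $\beta_m\in\mathbb R$, where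 $N^l_{k,m}(x)=\prod_{i=1}^nN^l(2^kx_i-m_i)$ and $N^l$ is the $B$-spline of degree $l$ with knots $0,1,\dots,l+1$. A function $\varphi'\in\widetilde B^{l'}_{p,q,r'}(\mathbb R^{n'},\{t'_k\})$ is the *trace* of $\varphi\in\widetilde B^l_{p,q,r}(\mathbb R^n,\{t_k\})$ on $x''=0$ if $\varphi$ is the limit in $\widetilde B^l_{p,q,r}(\mathbb R^n,\{t_k\})$ of some sequence from $\Sigma^l\cap\widetilde B^l_{p,q,r}(\mathbb R^n,\{t_k\})$ and, for every sequence $\{\varphi_j\}$ from $\Sigma^l\cap\widetilde B^l_{p,q,r}(\mathbb R^n,\{t_k\})$ converging to $\varphi$ in that space, $\varphi_j(\cdot,0)\to\varphi'$ in $\widetilde B^{l'}_{p,q,r'}(\mathbb R^{n'},\{t'_k\})$. The trace space $\mathrm{Tr}|_{x''=0}\widetilde B^l_{p,q,r}(\mathbb R^n,\{t_k\})$ is the set of all such traces, with quasi-norm $\inf\|\varphi\|$ over all $\varphi$ with trace $\varphi'$. *Statement.* Let $p,q\in(0,\infty)$, $r\in(0,\infty]$, $\theta\in(0,\min\{r,p\}]$,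 $\alpha_3\ge0$, $\alpha_1>n(\frac1\theta-\frac1r)$, $l\in\mathbb N$, $l>\alpha_2$, $\sigma_1=\theta\,\overline{p_\theta}$, $\sigma_2=p$, where $\overline{p_\theta}$ is the exponent dual to $p_\theta=p/\theta$ (so $\sigma_1=\infty$ if $\theta=p$), and let $\{t_k\}\in X^{\alpha_3}_{\alpha,\sigma,p}(\mathbb R^n)$. Let $l'\in\mathbb N$, $l'\ge l$, $r'\in(0,\infty]$, $\theta'\in(0,\min\{r',p\}]$, $\alpha'_3\ge0$, $\alpha'_1>n'(\frac1{\theta'}-\frac1{r'})$, $\alpha'_2<l'$, $\sigma'_1=\theta'\,\overline{p_{\theta'}}$, $\sigma'_2=p$, and suppose $\{t'_k\}\in\widetilde X^{\alpha'_3}_{\alpha',\sigma',p}(\mathbb R^{n'})$. Then every $\varphi\in\widetilde B^l_{p,q,r}(\mathbb R^n,\{t_k\})$ has exactly one trace $\mathrm{Tr}\,\varphi$, the operator $\mathrm{Tr}:\widetilde B^l_{p,q,r}(\mathbb R^n,\{t_k\})\to\widetilde B^{l'}_{p,q,r'}(\mathbb R^{n'},\{t'_k\})$ is linear and bounded, and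 there is a (in general nonlinear) bounded operator $\mathrm{Ext}:\widetilde B^{l'}_{p,q,r'}(\mathbb R^{n'},\{t'_k\})\to\widetilde B^l_{p,q,r}(\mathbb R^n,\{t_k\})$, i.e. $\|\mathrm{Ext}\,\psi\|\le C\|\psi\|$ for all $\psi$ with $C$ independent of $\psi$, such that $\mathrm{Tr}\circ\mathrm{Ext}=\mathrm{Id}$. In particular $$\mathrm{Tr}|_{x''=0}\widetilde B^l_{p,q,r}(\mathbb R^n,\{t_k\})=\widetilde B^{l'}_{p,q,r'}(\mathbb R^{n'},\{t'_k\}),$$ the corresponding quasi-norms being equivalent. -/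

import Mathlib

open MeasureTheory Filter Topology
open scoped ENNReal NNReal

noncomputable section

namespace VarBesov

/-! ## Cubes, differences, and the quasi-norm -/

/-- The open cube with centre `x` and side length `s`, sides parallel to the axes. -/
def cube {n : ℕ} (x : Fin n → ℝ) (s : ℝ) : Set (Fin n → ℝ) :=
  {y | ∀ i, |y i - x i| < s / 2}

/-- The open dyadic cube `∏ᵢ (mᵢ / 2^k, (mᵢ + 1) / 2^k)`. -/
def dyadicCube {n : ℕ} (k : ℕ) (m : Fin n → ℤ) : Set (Fin n → ℝ) :=
  {y | ∀ i, (m i : ℝ) / 2 ^ k < y i ∧ y i < ((m i : ℝ) + 1) / 2 ^ k}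

/-- The difference of order `l` with step `h`, on the whole space. -/
def diff {n : ℕ} (l : ℕ) (h : Fin n → ℝ) (φ : (Fin n → ℝ) → ℝ) (x : Fin n → ℝ) : ℝ :=
  ∑ j ∈ Finset.range (l + 1), (-1 : ℝ) ^ (l + j) * (l.choose j : ℝ) * φ (x + (j : ℝ) • h)

/-- `δ^l_r(Q) φ = ( |Q|⁻² ∫_{h ∈ (-s,s)^n} ∫_{y ∈ Q} |Δ^l(h) φ (y)|^r dy dh )^{1/r}` for the cube
`Q` with centre `x` and side length `s`; for `r = ∞` it is the essential supremum of
`|Δ^l(h) φ (y)|`. -/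
def delta {n : ℕ} (l : ℕ) (r : ℝ≥0∞) (x : Fin n → ℝ) (s : ℝ) (φ : (Fin n → ℝ) → ℝ) : ℝ≥0∞ :=
  eLpNorm (fun z : (Fin n → ℝ) × (Fin n → ℝ) => diff l z.1 φ z.2) r
    (ENNReal.ofReal ((s ^ (2 * n))⁻¹) • volume.restrict (cube 0 (2 * s) ×ˢ cube x s))

/-- The quasi-norm of `B̃^l_{p,q,r}(ℝⁿ, {t_k})` for `p, q ∈ (0, ∞)`, `r ∈ (0, ∞]`:
`( ∑_{k ≥ 1} ‖ t_k δ^l_r(· + 2^{-k} (-1,1)^n) φ | L_p ‖^q )^{1/q}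
  + ( ∫ t_0(x)^p ‖ φ | L_r(x + (-1,1)^n) ‖^p dx )^{1/p}`. -/
def besovNorm {n : ℕ} (l : ℕ) (p q : ℝ) (r : ℝ≥0∞) (t : ℕ → (Fin n → ℝ) → ℝ)
    (φ : (Fin n → ℝ) → ℝ) : ℝ≥0∞ :=
  (∑' k : ℕ, (∫⁻ x, (ENNReal.ofReal (t (k + 1) x) *
      delta l r x (2 * (1 / 2) ^ (k + 1)) φ) ^ p) ^ (q / p)) ^ (1 / q) +
  (∫⁻ x, (ENNReal.ofReal (t 0 x) * eLpNorm φ r (volume.restrict (cube x 2))) ^ p) ^ (1 / p)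

/-- `φ ∈ L_r^loc(ℝⁿ)`. -/
def MemLpLoc {n : ℕ} (r : ℝ≥0∞) (φ : (Fin n → ℝ) → ℝ) : Prop :=
  ∀ K : Set (Fin n → ℝ), IsCompact K → MemLp φ r (volume.restrict K)

/-- `φ` is a representative of an element of `B̃^l_{p,q,r}(ℝⁿ, {t_k})`. -/
def MemBesov {n : ℕ} (l : ℕ) (p q : ℝ) (r : ℝ≥0∞) (t : ℕ → (Fin n → ℝ) → ℝ)
    (φ : (Fin n → ℝ) → ℝ) : Prop :=
  MemLpLoc r φ ∧ besovNorm l p q r t φ < ∞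

/-! ## Weight sequences -/

/-- A `p`-admissible weight sequence: measurable functions with values in `(0, ∞)` that lie in
`L_p^loc`. -/
structure IsAdmissible {n : ℕ} (p : ℝ) (t : ℕ → (Fin n → ℝ) → ℝ) : Prop where
  measurable : ∀ k, Measurable (t k)
  pos : ∀ k x, 0 < t k x
  memLpLoc : ∀ k, MemLpLoc (ENNReal.ofReal p) (t k)

/-- The `p`-associated multiple sequence `t_{k,m} = ‖ t_k | L_p(Q_{k,m}) ‖`. -/
def assocSeq {n : ℕ} (p : ℝ) (t : ℕ → (Fin n → ℝ) → ℝ) (k : ℕ) (m : Fin n → ℤ) : ℝ :=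
  (eLpNorm (t k) (ENNReal.ofReal p) (volume.restrict (dyadicCube k m))).toReal

/-- The step function `2^{kn/p} ∑_m a_{k,m} χ_{k,m}(x)`, where `χ_{k,m}` is the indicator of the
half-open dyadic cube `∏ᵢ [mᵢ / 2^k, (mᵢ + 1) / 2^k)`; the one cube that contains `x` has the index
`mᵢ = ⌊2^k xᵢ⌋`. -/
def stepWeight {n : ℕ} (p : ℝ) (a : ℕ → (Fin n → ℤ) → ℝ) (k : ℕ) (x : Fin n → ℝ) : ℝ :=
  (2 : ℝ) ^ ((k : ℝ) * n / p) * a k (fun i => ⌊(2 : ℝ) ^ k * x i⌋)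

/-- The `p`-associated weight sequence `t̄_k`. -/
def assocWeight {n : ℕ} (p : ℝ) (t : ℕ → (Fin n → ℝ) → ℝ) : ℕ → (Fin n → ℝ) → ℝ :=
  stepWeight p (assocSeq p t)

/-- `(2^{kn} ∫_{Q_{k,m}} |f|^σ)^{1/σ}`, the essential supremum of `|f|` over `Q_{k,m}` for
`σ = ∞`. -/
def cubeMean {n : ℕ} (σ : ℝ≥0∞) (k : ℕ) (m : Fin n → ℤ) (f : (Fin n → ℝ) → ℝ) : ℝ≥0∞ :=
  eLpNorm f σ (((2 : ℝ≥0∞) ^ (k * n)) • volume.restrict (dyadicCube k m))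

/-- The class `X^{α₃}_{α,σ,p}(ℝⁿ)` with `α = (α₁, α₂)`, `σ = (σ₁, σ₂)`. -/
structure MemX {n : ℕ} (p α₁ α₂ α₃ : ℝ) (σ₁ σ₂ : ℝ≥0∞) (t : ℕ → (Fin n → ℝ) → ℝ) : Prop where
  admissible : IsAdmissible p t
  lower : ∃ C : ℝ, 0 < C ∧ ∀ (k j : ℕ) (m : Fin n → ℤ), k ≤ j →
    cubeMean (ENNReal.ofReal p) k m (assocWeight p t k) *
      cubeMean σ₁ k m (fun x => (assocWeight p t j x)⁻¹) ≤
        ENNReal.ofReal (C * (2 : ℝ) ^ (α₁ * ((k : ℝ) - j)))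
  upper : ∃ C : ℝ, 0 < C ∧ ∀ (k j : ℕ) (m : Fin n → ℤ), k ≤ j →
    (cubeMean (ENNReal.ofReal p) k m (assocWeight p t k))⁻¹ *
      cubeMean σ₂ k m (assocWeight p t j) ≤
        ENNReal.ofReal (C * (2 : ℝ) ^ (α₂ * ((j : ℝ) - k)))
  neighbour : ∀ (k : ℕ) (m m₁ : Fin n → ℤ), (∀ i, |m i - m₁ i| ≤ 1) →
    0 < assocSeq p t k m ∧ assocSeq p t k m ≤ (2 : ℝ) ^ α₃ * assocSeq p t k m₁

/-- The class `X̃^{α₃}_{α,σ,p}(ℝⁿ)`: the sequences in `X^{α₃}_{α,σ,p}(ℝⁿ)` with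
`{t_k} = {t̄_k}`. -/
def MemXTilde {n : ℕ} (p α₁ α₂ α₃ : ℝ) (σ₁ σ₂ : ℝ≥0∞) (t : ℕ → (Fin n → ℝ) → ℝ) : Prop :=
  MemX p α₁ α₂ α₃ σ₁ σ₂ t ∧ t = assocWeight p t

/-- The sequence `{t_k'}` on `ℝ^a` built from `{t_k}` on `ℝ^(a+b)`, with
`t_k'(x) = 2^{ka/p} t_{k,(m,0)}` for `x` in the half-open dyadic cube with index `(k, m)`. -/
def planeWeight {a b : ℕ} (p : ℝ) (t : ℕ → (Fin (a + b) → ℝ) → ℝ) : ℕ → (Fin a → ℝ) → ℝ :=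
  stepWeight p (fun k m => assocSeq p t k (Fin.append m (0 : Fin b → ℤ)))

/-- The exponent `θ · (p/θ)^*`, where `(p/θ)^*` is dual to `p/θ`; it is `∞` for `θ = p`. -/
def sigmaExp (p θ : ℝ) : ℝ≥0∞ :=
  ENNReal.ofReal θ * ENNReal.conjExponent (ENNReal.ofReal (p / θ))

lemma measurable_stepWeight {n : ℕ} (p : ℝ) (a : ℕ → (Fin n → ℤ) → ℝ) (k : ℕ) :
    Measurable (stepWeight p a k) := by
  have h : Measurable (fun x : Fin n → ℝ => fun i => ⌊(2 : ℝ) ^ k * x i⌋) :=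
    measurable_pi_lambda _ fun i => Int.measurable_floor.comp
      ((measurable_pi_apply i).const_mul _)
  exact ((measurable_of_countable (a k)).comp h).const_mul _

lemma measurable_planeWeight {a b : ℕ} (p : ℝ) (t : ℕ → (Fin (a + b) → ℝ) → ℝ) (k : ℕ) :
    Measurable (planeWeight p t k) :=
  measurable_stepWeight _ _ _

/-! ## The space as a vector space of classes of functions -/

lemma measurable_eLpNorm_restrict {X Z : Type*} [MeasurableSpace X] [MeasurableSpace Z]
    {μ : Measure Z} [SFinite μ] {F : Z → ℝ} (hF : AEStronglyMeasurable F μ) (r : ℝ≥0∞)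
    (c : ℝ≥0∞) {A : Set (X × Z)} (hA : MeasurableSet A) :
    Measurable fun x => eLpNorm F r (c • μ.restrict (Prod.mk x ⁻¹' A)) := by
  have hG : Measurable (hF.mk F) := hF.stronglyMeasurable_mk.measurable
  have hAx : ∀ x, MeasurableSet (Prod.mk x ⁻¹' A) := fun x => measurable_prodMk_left hA
  have hFG : ∀ x, eLpNorm F r (c • μ.restrict (Prod.mk x ⁻¹' A)) =
      eLpNorm (hF.mk F) r (c • μ.restrict (Prod.mk x ⁻¹' A)) := fun x =>
    eLpNorm_congr_ae ((Measure.ae_smul_measure (ae_restrict_of_ae hF.ae_eq_mk) c))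
  simp_rw [hFG]
  have key : ∀ g : Z → ℝ≥0∞, Measurable g →
      Measurable fun x => ∫⁻ z, g z ∂(c • μ.restrict (Prod.mk x ⁻¹' A)) := by
    intro g hg
    have h1 : (fun x => ∫⁻ z, g z ∂(c • μ.restrict (Prod.mk x ⁻¹' A))) =
        fun x => c * ∫⁻ z, A.indicator (fun w : X × Z => g w.2) (x, z) ∂μ := by
      funext x
      rw [lintegral_smul_measure, ← lintegral_indicator (hAx x)]
      rfl
    rw [h1]
    exact (((hg.comp measurable_snd).indicator hA).lintegral_prod_right').const_mul c
  rcases eq_or_ne r 0 with rfl | hr0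
  · simp
  rcases eq_or_ne r ∞ with rfl | hr
  · simp_rw [eLpNorm_exponent_top, eLpNormEssSup]
    refine measurable_of_Iic fun a => ?_
    have hs : MeasurableSet {z | a < ‖hF.mk F z‖ₑ} := hG.enorm measurableSet_Ioi
    have h2 := key _ (measurable_const.indicator hs (f := fun _ => (1 : ℝ≥0∞)))
    convert h2 (measurableSet_singleton 0) using 1
    ext x
    simp only [Set.mem_preimage, Set.mem_Iic, Set.mem_singleton_iff]
    rw [lintegral_indicator hs, setLIntegral_one]
    constructor
    · intro h
      have h3 := ENNReal.ae_le_essSup (μ := c • μ.restrict (Prod.mk x ⁻¹' A))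
        (fun z => ‖hF.mk F z‖ₑ)
      refine measure_mono_null ?_ (ae_iff.1 h3)
      intro z hz
      exact not_le.2 (h.trans_lt hz)
    · intro h
      refine essSup_le_of_ae_le _ (ae_iff.2 ?_)
      simpa only [not_le] using h
  · simp_rw [eLpNorm_eq_lintegral_rpow_enorm_toReal hr0 hr]
    exact (key _ (hG.enorm.pow_const _)).pow_const _

lemma quasiMeasurePreserving_shear {n : ℕ} (c : ℝ) :
    Measure.QuasiMeasurePreserving
      (fun z : (Fin n → ℝ) × (Fin n → ℝ) => z.2 + c • z.1) volume volume := by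
  have h : MeasurePreserving
      (fun z : (Fin n → ℝ) × (Fin n → ℝ) => (id z.1, z.2 + c • z.1))
      ((volume : Measure (Fin n → ℝ)).prod volume)
      ((volume : Measure (Fin n → ℝ)).prod volume) := by
    refine (MeasurePreserving.id volume).skew_product
      (g := fun a b : Fin n → ℝ => b + c • a) ?_ (Eventually.of_forall fun a => ?_)
    · exact measurable_snd.add (measurable_fst.const_smul c)
    · exact map_add_right_eq_self _ _
  exact Measure.quasiMeasurePreserving_snd.comp h.quasiMeasurePreserving

lemma aestronglyMeasurable_diff {n : ℕ} (l : ℕ) {φ : (Fin n → ℝ) → ℝ}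
    (hφ : AEStronglyMeasurable φ volume) :
    AEStronglyMeasurable
      (fun z : (Fin n → ℝ) × (Fin n → ℝ) => diff l z.1 φ z.2) volume := by
  unfold diff
  refine Finset.aestronglyMeasurable_fun_sum _ fun j _ => ?_
  exact (hφ.comp_quasiMeasurePreserving (quasiMeasurePreserving_shear (j : ℝ))).const_mul _

lemma diff_congr {n : ℕ} (l : ℕ) {φ ψ : (Fin n → ℝ) → ℝ} (h : φ =ᵐ[volume] ψ) :
    (fun z : (Fin n → ℝ) × (Fin n → ℝ) => diff l z.1 φ z.2) =ᵐ[volume]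
      fun z => diff l z.1 ψ z.2 := by
  have h1 : ∀ j : ℕ, ∀ᵐ z : (Fin n → ℝ) × (Fin n → ℝ),
      φ (z.2 + (j : ℝ) • z.1) = ψ (z.2 + (j : ℝ) • z.1) := fun j =>
    (quasiMeasurePreserving_shear (j : ℝ)).ae h
  filter_upwards [ae_all_iff.2 h1] with z hz
  unfold diff
  exact Finset.sum_congr rfl fun j _ => by rw [hz j]

lemma delta_congr {n : ℕ} (l : ℕ) (r : ℝ≥0∞) (x : Fin n → ℝ) (s : ℝ) {φ ψ : (Fin n → ℝ) → ℝ}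
    (h : φ =ᵐ[volume] ψ) : delta l r x s φ = delta l r x s ψ :=
  eLpNorm_congr_ae (Measure.ae_smul_measure (ae_restrict_of_ae (diff_congr l h)) _)

lemma besovNorm_congr {n : ℕ} (l : ℕ) (p q : ℝ) (r : ℝ≥0∞) (t : ℕ → (Fin n → ℝ) → ℝ)
    {φ ψ : (Fin n → ℝ) → ℝ} (h : φ =ᵐ[volume] ψ) :
    besovNorm l p q r t φ = besovNorm l p q r t ψ := by
  unfold besovNorm
  have h2 : ∀ x, eLpNorm φ r (volume.restrict (cube x 2)) =
      eLpNorm ψ r (volume.restrict (cube x 2)) := fun x =>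
    eLpNorm_congr_ae (ae_restrict_of_ae h)
  simp_rw [delta_congr l r _ _ h, h2]

lemma memBesov_congr {n : ℕ} {l : ℕ} {p q : ℝ} {r : ℝ≥0∞} {t : ℕ → (Fin n → ℝ) → ℝ}
    {φ ψ : (Fin n → ℝ) → ℝ} (h : φ =ᵐ[volume] ψ) (hφ : MemBesov l p q r t φ) :
    MemBesov l p q r t ψ :=
  ⟨fun K hK => (hφ.1 K hK).ae_eq (ae_restrict_of_ae h), besovNorm_congr l p q r t h ▸ hφ.2⟩

lemma measurableSet_cubeFamily {n : ℕ} (s : ℝ) :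
    MeasurableSet {w : (Fin n → ℝ) × (Fin n → ℝ) | w.2 ∈ cube w.1 s} := by
  have h : {w : (Fin n → ℝ) × (Fin n → ℝ) | w.2 ∈ cube w.1 s} =
      ⋂ i, {w : (Fin n → ℝ) × (Fin n → ℝ) | |w.2 i - w.1 i| < s / 2} := by
    ext w
    simp [cube]
  rw [h]
  refine MeasurableSet.iInter fun i => ?_
  exact (isOpen_lt (f := fun w : (Fin n → ℝ) × (Fin n → ℝ) => |w.2 i - w.1 i|)
    (by fun_prop) continuous_const).measurableSet

lemma measurable_localNorm {n : ℕ} (r : ℝ≥0∞) (s : ℝ) {φ : (Fin n → ℝ) → ℝ}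
    (hφ : AEStronglyMeasurable φ volume) :
    Measurable fun x => eLpNorm φ r (volume.restrict (cube x s)) := by
  have h := measurable_eLpNorm_restrict hφ r 1 (measurableSet_cubeFamily (n := n) s)
  have h2 : ∀ x : Fin n → ℝ,
      Prod.mk x ⁻¹' {w : (Fin n → ℝ) × (Fin n → ℝ) | w.2 ∈ cube w.1 s} = cube x s :=
    fun x => Set.ext fun y => Iff.rfl
  simpa only [one_smul, h2] using h

lemma measurable_delta {n : ℕ} (l : ℕ) (r : ℝ≥0∞) (s : ℝ) {φ : (Fin n → ℝ) → ℝ}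
    (hφ : AEStronglyMeasurable φ volume) : Measurable fun x => delta l r x s φ := by
  have h1 : Measurable
      (fun w : (Fin n → ℝ) × ((Fin n → ℝ) × (Fin n → ℝ)) => ((0 : Fin n → ℝ), w.2.1)) := by
    fun_prop
  have h2 : Measurable
      (fun w : (Fin n → ℝ) × ((Fin n → ℝ) × (Fin n → ℝ)) => (w.1, w.2.2)) := by
    fun_prop
  have hA := (h1 (measurableSet_cubeFamily (n := n) (2 * s))).inter
    (h2 (measurableSet_cubeFamily (n := n) s))
  have h := measurable_eLpNorm_restrict (aestronglyMeasurable_diff l hφ) r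
    (ENNReal.ofReal ((s ^ (2 * n))⁻¹)) hA
  refine (congrArg Measurable (funext fun x => ?_)).mpr h
  unfold delta
  congr 3

lemma lintegral_add_rpow_le {X : Type*} [MeasurableSpace X] {μ : Measure X} {p : ℝ} (hp : 0 < p)
    {u v w : X → ℝ≥0∞} {K : ℝ≥0∞} (hK : K ≠ ∞) (hu : Measurable u)
    (h : ∀ x, w x ≤ K * (u x + v x)) :
    ∫⁻ x, w x ^ p ∂μ ≤ K ^ p * ENNReal.LpAddConst (ENNReal.ofReal p)⁻¹ *
      (∫⁻ x, u x ^ p ∂μ + ∫⁻ x, v x ^ p ∂μ) := by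
  have hC : K ^ p * ENNReal.LpAddConst (ENNReal.ofReal p)⁻¹ ≠ ∞ :=
    ENNReal.mul_ne_top (ENNReal.rpow_ne_top_of_nonneg hp.le hK) (ENNReal.LpAddConst_lt_top _).ne
  rw [← lintegral_add_left (hu.pow_const p), ← lintegral_const_mul' _ _ hC]
  refine lintegral_mono fun x => ?_
  refine (ENNReal.rpow_le_rpow (h x) hp.le).trans ?_
  rw [ENNReal.mul_rpow_of_nonneg _ _ hp.le, mul_assoc]
  gcongr
  exact ENNReal.rpow_add_le_mul_rpow_add_rpow' _ _ hp.le

lemma delta_add_le {n : ℕ} (l : ℕ) (r : ℝ≥0∞) (x : Fin n → ℝ) (s : ℝ) {φ ψ : (Fin n → ℝ) → ℝ}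
    (hφ : AEStronglyMeasurable φ volume) (hψ : AEStronglyMeasurable ψ volume) :
    delta l r x s (φ + ψ) ≤ ENNReal.LpAddConst r * (delta l r x s φ + delta l r x s ψ) := by
  have h : (fun z : (Fin n → ℝ) × (Fin n → ℝ) => diff l z.1 (φ + ψ) z.2) =
      (fun z => diff l z.1 φ z.2) + fun z => diff l z.1 ψ z.2 := by
    funext z
    simp only [diff, Pi.add_apply, mul_add, Finset.sum_add_distrib]
  unfold delta
  rw [h]
  exact eLpNorm_add_le' ((aestronglyMeasurable_diff l hφ).restrict.smul_measure _)
    ((aestronglyMeasurable_diff l hψ).restrict.smul_measure _) r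

lemma delta_smul {n : ℕ} (l : ℕ) (r : ℝ≥0∞) (x : Fin n → ℝ) (s : ℝ) (c : ℝ)
    (φ : (Fin n → ℝ) → ℝ) : delta l r x s (c • φ) = ‖c‖ₑ * delta l r x s φ := by
  have h : (fun z : (Fin n → ℝ) × (Fin n → ℝ) => diff l z.1 (c • φ) z.2) =
      c • fun z => diff l z.1 φ z.2 := by
    funext z
    simp only [diff, Pi.smul_apply, smul_eq_mul, Finset.mul_sum]
    exact Finset.sum_congr rfl fun j _ => by ring
  unfold delta
  rw [h, eLpNorm_const_smul]

lemma besovNorm_lt_top_of_le {n : ℕ} {l : ℕ} {p q : ℝ} (hp : 0 < p) (hq : 0 < q) {r : ℝ≥0∞}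
    {t : ℕ → (Fin n → ℝ) → ℝ} (ht : ∀ k, Measurable (t k)) {φ ψ χ : (Fin n → ℝ) → ℝ}
    (hφm : AEStronglyMeasurable φ volume) {K : ℝ≥0∞} (hK : K ≠ ∞)
    (hd : ∀ x s, delta l r x s χ ≤ K * (delta l r x s φ + delta l r x s ψ))
    (he : ∀ x, eLpNorm χ r (volume.restrict (cube x 2)) ≤
      K * (eLpNorm φ r (volume.restrict (cube x 2)) + eLpNorm ψ r (volume.restrict (cube x 2))))
    (hφ : besovNorm l p q r t φ < ∞) (hψ : besovNorm l p q r t ψ < ∞) :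
    besovNorm l p q r t χ < ∞ := by
  have hqp : 0 < q / p := div_pos hq hp
  have hC : K ^ p * ENNReal.LpAddConst (ENNReal.ofReal p)⁻¹ ≠ ∞ :=
    ENNReal.mul_ne_top (ENNReal.rpow_ne_top_of_nonneg hp.le hK) (ENNReal.LpAddConst_lt_top _).ne
  unfold besovNorm at hφ hψ ⊢
  rw [ENNReal.add_lt_top, ENNReal.rpow_lt_top_iff_of_pos (one_div_pos.2 hq),
    ENNReal.rpow_lt_top_iff_of_pos (one_div_pos.2 hp)] at hφ hψ ⊢
  constructor
  · have hk : ∀ k : ℕ, (∫⁻ x, (ENNReal.ofReal (t (k + 1) x) *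
        delta l r x (2 * (1 / 2) ^ (k + 1)) χ) ^ p) ^ (q / p) ≤
        ((K ^ p * ENNReal.LpAddConst (ENNReal.ofReal p)⁻¹) ^ (q / p) *
          ENNReal.LpAddConst (ENNReal.ofReal (q / p))⁻¹) *
        ((∫⁻ x, (ENNReal.ofReal (t (k + 1) x) *
          delta l r x (2 * (1 / 2) ^ (k + 1)) φ) ^ p) ^ (q / p) +
        (∫⁻ x, (ENNReal.ofReal (t (k + 1) x) *
          delta l r x (2 * (1 / 2) ^ (k + 1)) ψ) ^ p) ^ (q / p)) := by
      intro k
      have h1 := lintegral_add_rpow_le (μ := volume) hp hK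
        (u := fun x => ENNReal.ofReal (t (k + 1) x) * delta l r x (2 * (1 / 2) ^ (k + 1)) φ)
        (v := fun x => ENNReal.ofReal (t (k + 1) x) * delta l r x (2 * (1 / 2) ^ (k + 1)) ψ)
        (w := fun x => ENNReal.ofReal (t (k + 1) x) * delta l r x (2 * (1 / 2) ^ (k + 1)) χ)
        ((ht (k + 1)).ennreal_ofReal.mul (measurable_delta l r _ hφm))
        (fun x => by
          rw [← mul_add, mul_left_comm]
          exact mul_le_mul_right (hd x _) _)
      refine (ENNReal.rpow_le_rpow h1 hqp.le).trans ?_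
      rw [ENNReal.mul_rpow_of_nonneg _ _ hqp.le, mul_assoc]
      exact mul_le_mul_right (ENNReal.rpow_add_le_mul_rpow_add_rpow' _ _ hqp.le) _
    refine (ENNReal.tsum_le_tsum hk).trans_lt ?_
    rw [ENNReal.tsum_mul_left, ENNReal.tsum_add]
    exact ENNReal.mul_lt_top (ENNReal.mul_lt_top
      (ENNReal.rpow_lt_top_of_nonneg hqp.le hC) (ENNReal.LpAddConst_lt_top _))
      (ENNReal.add_lt_top.2 ⟨hφ.1, hψ.1⟩)
  · refine (lintegral_add_rpow_le (μ := volume) hp hK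
      (u := fun x => ENNReal.ofReal (t 0 x) * eLpNorm φ r (volume.restrict (cube x 2)))
      (v := fun x => ENNReal.ofReal (t 0 x) * eLpNorm ψ r (volume.restrict (cube x 2)))
      ((ht 0).ennreal_ofReal.mul (measurable_localNorm r 2 hφm))
      (fun x => by
        rw [← mul_add, mul_left_comm]
        exact mul_le_mul_right (he x) _)).trans_lt ?_
    exact ENNReal.mul_lt_top hC.lt_top (ENNReal.add_lt_top.2 ⟨hφ.2, hψ.2⟩)

lemma memBesov_add {n : ℕ} {l : ℕ} {p q : ℝ} (hp : 0 < p) (hq : 0 < q) {r : ℝ≥0∞}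
    {t : ℕ → (Fin n → ℝ) → ℝ} (ht : ∀ k, Measurable (t k)) {φ ψ : (Fin n → ℝ) → ℝ}
    (hφm : AEStronglyMeasurable φ volume) (hψm : AEStronglyMeasurable ψ volume)
    (hφ : MemBesov l p q r t φ) (hψ : MemBesov l p q r t ψ) : MemBesov l p q r t (φ + ψ) :=
  ⟨fun K hK => (hφ.1 K hK).add (hψ.1 K hK),
    besovNorm_lt_top_of_le hp hq ht hφm (ENNReal.LpAddConst_lt_top r).ne
      (fun x s => delta_add_le l r x s hφm hψm)
      (fun _ => eLpNorm_add_le' hφm.restrict hψm.restrict r) hφ.2 hψ.2⟩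

lemma memBesov_smul {n : ℕ} {l : ℕ} {p q : ℝ} (hp : 0 < p) (hq : 0 < q) {r : ℝ≥0∞}
    {t : ℕ → (Fin n → ℝ) → ℝ} (ht : ∀ k, Measurable (t k)) (c : ℝ) {φ : (Fin n → ℝ) → ℝ}
    (hφm : AEStronglyMeasurable φ volume)
    (hφ : MemBesov l p q r t φ) : MemBesov l p q r t (c • φ) :=
  ⟨fun K hK => (hφ.1 K hK).const_smul c,
    besovNorm_lt_top_of_le hp hq ht hφm (K := ‖c‖ₑ) enorm_ne_top
      (fun x s => by rw [delta_smul]; gcongr; exact le_self_add)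
      (fun _ => by rw [eLpNorm_const_smul]; gcongr; exact le_self_add) hφ.2 hφ.2⟩

lemma memBesov_zero {n : ℕ} {l : ℕ} {p q : ℝ} (hp : 0 < p) (hq : 0 < q) {r : ℝ≥0∞}
    {t : ℕ → (Fin n → ℝ) → ℝ} : MemBesov l p q r t (0 : (Fin n → ℝ) → ℝ) := by
  refine ⟨fun K _ => MemLp.zero, ?_⟩
  have h : ∀ x s, delta l r x s (0 : (Fin n → ℝ) → ℝ) = 0 := fun x s => by
    have := delta_smul l r x s 0 0
    simpa using this
  simp [besovNorm, h, hp, hq, div_pos hq hp]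

/-- The space `B̃^l_{p,q,r}(ℝⁿ, {t_k})`, as a space of classes of functions that coincide almost
everywhere. -/
def besovSpace {n : ℕ} (l : ℕ) {p q : ℝ} (hp : 0 < p) (hq : 0 < q) (r : ℝ≥0∞)
    {t : ℕ → (Fin n → ℝ) → ℝ} (ht : ∀ k, Measurable (t k)) :
    Submodule ℝ ((Fin n → ℝ) →ₘ[volume] ℝ) where
  carrier := {φ | MemBesov l p q r t φ}
  add_mem' {φ ψ} hφ hψ := memBesov_congr (AEEqFun.coeFn_add φ ψ).symm
    (memBesov_add hp hq ht φ.aestronglyMeasurable ψ.aestronglyMeasurable hφ hψ)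
  zero_mem' := memBesov_congr AEEqFun.coeFn_zero.symm (memBesov_zero hp hq)
  smul_mem' c φ hφ := memBesov_congr (AEEqFun.coeFn_smul c φ).symm
    (memBesov_smul hp hq ht c φ.aestronglyMeasurable hφ)

/-! ## Splines and traces -/

/-- The cardinal `B`-spline of degree `l` with knots `0, 1, …, l + 1`, normalised so that its
integer translates sum to `1`; it is a nonzero constant multiple of the divided difference of
`(x - ·)_+^l` over these knots. Used for `l ≥ 1`. -/
def bspline (l : ℕ) (x : ℝ) : ℝ :=
  (l.factorial : ℝ)⁻¹ * ∑ j ∈ Finset.range (l + 2),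
    (-1 : ℝ) ^ j * ((l + 1).choose j : ℝ) * (max (x - j) 0) ^ l

/-- The tensor-product spline `N^l_{k,m}(x) = ∏ᵢ N^l(2^k (xᵢ - mᵢ / 2^k))`. -/
def tensorSpline {n : ℕ} (l k : ℕ) (m : Fin n → ℤ) (x : Fin n → ℝ) : ℝ :=
  ∏ i, bspline l ((2 : ℝ) ^ k * (x i - (m i : ℝ) / 2 ^ k))

/-- `S ∈ Σ^l = ⋃_k Σ^l_k`: the function `S` is `∑_m β_m N^l_{k,m}` for some `k` and some real
coefficients `β_m`. At each point only finitely many terms are nonzero. -/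
def IsSpline {n : ℕ} (l : ℕ) (S : (Fin n → ℝ) → ℝ) : Prop :=
  ∃ (k : ℕ) (β : (Fin n → ℤ) → ℝ), ∀ x, S x = ∑' m : Fin n → ℤ, β m * tensorSpline l k m x

/-- `{S_j} ⊂ Σ^l ∩ B̃^l_{p,q,r}(ℝⁿ, {t_k})` converges to `φ` in `B̃^l_{p,q,r}(ℝⁿ, {t_k})`. -/
def SplinesTendTo {n : ℕ} (l : ℕ) (p q : ℝ) (r : ℝ≥0∞) (t : ℕ → (Fin n → ℝ) → ℝ)
    (S : ℕ → (Fin n → ℝ) → ℝ) (φ : (Fin n → ℝ) →ₘ[volume] ℝ) : Prop :=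
  (∀ j, IsSpline l (S j) ∧ MemBesov l p q r t (S j)) ∧
    Tendsto (fun j => besovNorm l p q r t (fun x => φ x - S j x)) atTop (𝓝 0)

/-- `ψ ∈ B̃^l'_{p,q,r'}(ℝ^a, {t_k'})` is the trace on the plane `{(x, 0)}` of
`φ ∈ B̃^l_{p,q,r}(ℝ^(a+b), {t_k})`: `φ` can be approximated by splines in `Σ^l`, and for every
sequence of splines `S_j → φ` the pointwise traces `S_j(·, 0)` converge to `ψ`. -/
def IsTrace {a b : ℕ} (l l' : ℕ) (p q : ℝ) (r r' : ℝ≥0∞) (t : ℕ → (Fin (a + b) → ℝ) → ℝ)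
    (φ : (Fin (a + b) → ℝ) →ₘ[volume] ℝ) (ψ : (Fin a → ℝ) →ₘ[volume] ℝ) : Prop :=
  MemBesov l p q r t φ ∧ MemBesov l' p q r' (planeWeight p t) ψ ∧
  (∃ S, SplinesTendTo l p q r t S φ) ∧
  ∀ S, SplinesTendTo l p q r t S φ →
    Tendsto (fun j => besovNorm l' p q r' (planeWeight p t)
      (fun x => ψ x - S j (Fin.append x (0 : Fin b → ℝ)))) atTop (𝓝 0)

/-- The trace space of `B̃^l_{p,q,r}(ℝ^(a+b), {t_k})` on the plane `{(x, 0)}`. -/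
def traceSpace {a b : ℕ} (l l' : ℕ) (p q : ℝ) (r r' : ℝ≥0∞)
    (t : ℕ → (Fin (a + b) → ℝ) → ℝ) : Set ((Fin a → ℝ) →ₘ[volume] ℝ) :=
  {ψ | ∃ φ, IsTrace l l' p q r r' t φ ψ}

/-- The quasi-norm of the trace space, `inf ‖φ‖` over all `φ` with trace `ψ`. -/
def traceNorm {a b : ℕ} (l l' : ℕ) (p q : ℝ) (r r' : ℝ≥0∞)
    (t : ℕ → (Fin (a + b) → ℝ) → ℝ) (ψ : (Fin a → ℝ) →ₘ[volume] ℝ) : ℝ≥0∞ :=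
  ⨅ (φ : (Fin (a + b) → ℝ) →ₘ[volume] ℝ) (_ : IsTrace l l' p q r r' t φ ψ),
    besovNorm l p q r t φ

end VarBesov

end

open MeasureTheory Filter Topology
open scoped ENNReal NNReal

noncomputable section

namespace VarBesov

/-! ## Sums with geometric weights -/

/-! Everything passes through a sequence space. The quasi-norm is compared with the sum over k of
(∑_m (b_{k,m} t_{k,m})^p)^{q/p}, raised to 1/q, where the b_{k,m} are the coefficients of a
decomposition into blocks: functions whose differences of order i ≤ l at scale 2^{-k} are bounded by
b_{k,m} (2^k |h|)^i. On that level the trace is almost trivial. Restriction to the plane turns a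
block into a block whose coefficients are those with index (m', 0), and the plane weight is built
from exactly the numbers t_{k,(m',0)}, so the sequence quasi-norm can only drop. Conversely, a block
on the plane times a B-spline bump in the normal variables, normalised to equal 1 on the plane, is a
block on the whole space, living on boundedly many layers of cubes where the weights are comparable
with those of the plane.

Two analytic facts carry this. Synthesis (`besovNorm_series_le`): a series of blocks has quasi-norm
at most that of its coefficients. At scale 2^{-k} the coarser blocks are controlled by their
smoothness, which beats the growth of the weight because l > α₂; the finer ones by size alone, where
Hölder's inequality with the negative moments of the weight and a Nikolskii-type inequality leave a
positive decay because α₁ > n (1/θ - 1/r). A Hardy-type inequality sums the levels. Analysis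
(`exists_isSplineExpansion`): every function of the space is a limit of splines S_k whose increments
are blocks with coefficients bounded by local moduli of smoothness. The S_k are quasi-interpolants
of local polynomials; the quasi-interpolant reproduces polynomials by Marsden's identity.

The local polynomials come from a Whitney-type inequality in L_θ with θ ≤ 1
(`exists_polynomial_approx`), proved by hand because neither duality nor the triangle inequality is
available. A polynomial interpolates f on a lattice in a large box. The error is controlled on the
lattice by axis-parallel differences, and off the lattice by a discrete Marchaud inequality along
segments, whose main term is a small multiple of the error itself and is absorbed. Averaging over
translations of the lattice removes the dependence on point values.

For continuous f the splines converge at every point, hence also on the plane, which is a null set.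
So restriction to the plane is bounded on the continuous functions of the space
(`IsTraceSetting.restrictionBounded`), and this determines the limit of S_j(·, 0) for every
approximating sequence of splines. The extension operator applies the bump construction to the
increments of a spline expansion on the plane; it is nonlinear because the local polynomials are
chosen. Only the exponent α₂ of the full weight limits the order of the splines, also on the plane
(`isDiscreteWeight_plane`); therefore splines of order l suffice for the trace although the plane
space has order l' ≥ l. -/

/-- The geometric weight `2^{ε |j - k|}`. -/
def geo (ε : ℝ) (k j : ℕ) : ℝ≥0∞ := (2 : ℝ≥0∞) ^ (ε * (Nat.dist k j : ℝ))

lemma geo_add (ε δ : ℝ) (k j : ℕ) : geo (ε + δ) k j = geo ε k j * geo δ k j := by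
  unfold geo
  rw [add_mul, ENNReal.rpow_add _ _ two_ne_zero ENNReal.ofNat_ne_top]

lemma geo_zero (k j : ℕ) : geo 0 k j = 1 := by simp [geo]

lemma geo_neg_mul_self (ε : ℝ) (k j : ℕ) : geo (-ε) k j * geo ε k j = 1 := by
  rw [← geo_add, neg_add_cancel, geo_zero]

lemma geo_comm (ε : ℝ) (k j : ℕ) : geo ε k j = geo ε j k := by
  unfold geo
  rw [Nat.dist_comm]

lemma geo_rpow (ε : ℝ) (u : ℝ) (k j : ℕ) : geo ε k j ^ u = geo (ε * u) k j := by
  unfold geo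
  rw [← ENNReal.rpow_mul]
  congr 1
  ring

lemma geo_mono {ε δ : ℝ} (h : ε ≤ δ) (k j : ℕ) : geo ε k j ≤ geo δ k j := by
  unfold geo
  exact ENNReal.rpow_le_rpow_of_exponent_le (by norm_num) (by gcongr)

lemma geo_add_right (ε : ℝ) (k d : ℕ) : geo ε k (k + d) = (2 : ℝ≥0∞) ^ (ε * d) := by
  unfold geo
  simp [Nat.dist]

lemma geo_add_left (ε : ℝ) (k d : ℕ) : geo ε (k + d) k = (2 : ℝ≥0∞) ^ (ε * d) := by
  rw [geo_comm, geo_add_right]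

/-- An upper bound for `∑ⱼ 2^{-ε |j - k|}` that does not depend on `k`. -/
def geoSum (ε : ℝ) : ℝ≥0∞ := ∑' z : ℤ, ((2 : ℝ≥0∞) ^ (-ε)) ^ z.natAbs

lemma geoSum_ne_top {ε : ℝ} (hε : 0 < ε) : geoSum ε ≠ ∞ := by
  unfold geoSum
  have h1 : (2 : ℝ≥0∞) ^ (-ε) < 1 := ENNReal.rpow_lt_one_of_one_lt_of_neg (by norm_num) (by linarith)
  rw [tsum_of_nat_of_neg_add_one ENNReal.summable ENNReal.summable]
  have h2 : ∀ n : ℕ, ((2 : ℝ≥0∞) ^ (-ε)) ^ (-((n : ℤ) + 1)).natAbs =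
      (2 : ℝ≥0∞) ^ (-ε) * ((2 : ℝ≥0∞) ^ (-ε)) ^ n := by
    intro n
    rw [show (-((n : ℤ) + 1)).natAbs = n + 1 by omega, pow_succ']
  simp_rw [h2, Int.natAbs_natCast, ENNReal.tsum_mul_left, ENNReal.tsum_geometric]
  have h3 : (1 - (2 : ℝ≥0∞) ^ (-ε))⁻¹ ≠ ∞ := by
    simpa [ENNReal.inv_eq_top, tsub_eq_zero_iff_le] using h1
  exact ENNReal.add_ne_top.2 ⟨h3, ENNReal.mul_ne_top h1.ne_top h3⟩

lemma tsum_geo_le (ε : ℝ) (k : ℕ) : ∑' j, geo (-ε) k j ≤ geoSum ε := by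
  have hinj : Function.Injective fun j : ℕ => (j : ℤ) - k := fun i j h => by
    simpa using h
  refine le_trans (le_of_eq ?_) (ENNReal.tsum_comp_le_tsum_of_injective hinj _)
  refine tsum_congr fun j => ?_
  unfold geo
  rw [← ENNReal.rpow_natCast, ← ENNReal.rpow_mul]
  congr 3
  simp only [Nat.dist]
  omega

/-- If S is the weighted sum on the right, each term satisfies x_j ≤ 2^{-ε|k-j|/u} S^{1/u}, and the
geometric factors have a sum bounded uniformly in k. The argument treats all u > 0 alike, with no
case distinction at u = 1. The price is a geometric loss with ε as small as desired, which later
decay absorbs. -/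
lemma tsum_rpow_le {u : ℝ} (hu : 0 < u) (ε : ℝ) (k : ℕ) (x : ℕ → ℝ≥0∞) :
    (∑' j, x j) ^ u ≤ geoSum (ε / u) ^ u * ∑' j, geo ε k j * x j ^ u := by
  set S := ∑' j, geo ε k j * x j ^ u with hS
  have h1 : ∀ j, x j ≤ geo (-(ε / u)) k j * S ^ (1 / u) := by
    intro j
    have h2 : geo ε k j * x j ^ u ≤ S := ENNReal.le_tsum j
    have h3 : x j ^ u ≤ geo (-ε) k j * S := by
      calc x j ^ u = geo (-ε) k j * (geo ε k j * x j ^ u) := by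
            rw [← mul_assoc, geo_neg_mul_self, one_mul]
        _ ≤ _ := by gcongr
    calc x j = (x j ^ u) ^ (1 / u) := by
          rw [← ENNReal.rpow_mul, mul_one_div_cancel hu.ne', ENNReal.rpow_one]
      _ ≤ (geo (-ε) k j * S) ^ (1 / u) := ENNReal.rpow_le_rpow h3 (by positivity)
      _ = _ := by
          rw [ENNReal.mul_rpow_of_nonneg _ _ (by positivity), geo_rpow]
          congr 2
          ring
  have h4 : ∑' j, x j ≤ geoSum (ε / u) * S ^ (1 / u) := by
    refine (ENNReal.tsum_le_tsum h1).trans ?_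
    rw [ENNReal.tsum_mul_right]
    gcongr
    exact tsum_geo_le _ _
  refine (ENNReal.rpow_le_rpow h4 hu.le).trans (le_of_eq ?_)
  rw [ENNReal.mul_rpow_of_nonneg _ _ hu.le, ← ENNReal.rpow_mul, one_div_mul_cancel hu.ne',
    ENNReal.rpow_one]

/-- Half of the decay rate pays for exchanging the power with the sum; the other half survives. -/
lemma rpow_le_of_le_tsum_geo {ε s : ℝ} (hs : 0 < s) (hε : 0 < ε) {C X : ℝ≥0∞} {k : ℕ}
    {y : ℕ → ℝ≥0∞} (h : X ≤ C * ∑' j, geo (-ε) k j * y j) :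
    X ^ s ≤ C ^ s * geoSum (ε / 2) ^ s * ∑' j, geo (-(ε * s / 2)) k j * y j ^ s := by
  refine (ENNReal.rpow_le_rpow h hs.le).trans ?_
  rw [ENNReal.mul_rpow_of_nonneg _ _ hs.le, mul_assoc]
  gcongr
  refine (tsum_rpow_le hs (ε * s / 2) k _).trans (le_of_eq ?_)
  rw [show ε * s / 2 / s = ε / 2 by field_simp]
  congr 1
  refine tsum_congr fun j => ?_
  rw [ENNReal.mul_rpow_of_nonneg _ _ hs.le, geo_rpow, ← mul_assoc, ← geo_add]
  congr 2
  ring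

/-- A Hardy-type inequality: convolution with a geometric weight is bounded on `ℓ_s`. -/
lemma hardy_tsum {ε s : ℝ} (hs : 0 < s) (hε : 0 < ε) {C : ℝ≥0∞} {X y : ℕ → ℝ≥0∞}
    (h : ∀ k, X k ≤ C * ∑' j, geo (-ε) k j * y j) :
    ∑' k, X k ^ s ≤ C ^ s * geoSum (ε / 2) ^ s * geoSum (ε * s / 2) * ∑' j, y j ^ s := by
  refine (ENNReal.tsum_le_tsum fun k => rpow_le_of_le_tsum_geo hs hε (h k)).trans ?_
  rw [ENNReal.tsum_mul_left, mul_assoc (C ^ s * geoSum (ε / 2) ^ s)]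
  gcongr
  rw [ENNReal.tsum_comm]
  simp_rw [ENNReal.tsum_mul_right]
  rw [← ENNReal.tsum_mul_left]
  refine ENNReal.tsum_le_tsum fun j => ?_
  gcongr
  simp_rw [geo_comm _ _ j]
  exact tsum_geo_le _ _

/-- The version for a single level, needed for the isolated level 0 term of the quasi-norm. -/
lemma rpow_le_tsum_of_le_tsum_geo {ε s : ℝ} (hs : 0 < s) (hε : 0 < ε) {C X : ℝ≥0∞} {k : ℕ}
    {y : ℕ → ℝ≥0∞} (h : X ≤ C * ∑' j, geo (-ε) k j * y j) :
    X ^ s ≤ C ^ s * geoSum (ε / 2) ^ s * ∑' j, y j ^ s := by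
  refine (rpow_le_of_le_tsum_geo hs hε h).trans ?_
  gcongr with j
  have h1 : geo (-(ε * s / 2)) k j ≤ 1 := by
    rw [← geo_zero k j]
    exact geo_mono (by linarith [mul_pos hε hs]) k j
  exact mul_le_of_le_one_left' h1

lemma sum_rpow_le {ι : Type*} (s : Finset ι) {u : ℝ} (hu : 0 < u) (x : ι → ℝ≥0∞) :
    (∑ i ∈ s, x i) ^ u ≤ (s.card : ℝ≥0∞) ^ u * ∑ i ∈ s, x i ^ u := by
  have h1 : ∀ i ∈ s, x i ≤ (∑ i ∈ s, x i ^ u) ^ (1 / u) := by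
    intro i hi
    calc x i = (x i ^ u) ^ (1 / u) := by
          rw [← ENNReal.rpow_mul, mul_one_div_cancel hu.ne', ENNReal.rpow_one]
      _ ≤ _ := ENNReal.rpow_le_rpow
          (Finset.single_le_sum (f := fun i => x i ^ u) (fun _ _ => zero_le) hi) (by positivity)
  have h2 : ∑ i ∈ s, x i ≤ s.card * (∑ i ∈ s, x i ^ u) ^ (1 / u) := by
    refine (Finset.sum_le_sum h1).trans ?_
    simp
  refine (ENNReal.rpow_le_rpow h2 hu.le).trans (le_of_eq ?_)
  rw [ENNReal.mul_rpow_of_nonneg _ _ hu.le, ← ENNReal.rpow_mul, one_div_mul_cancel hu.ne',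
    ENNReal.rpow_one]

/-! ## Dyadic indices -/

variable {n : ℕ}

/-- The index of the half-open dyadic cube of level `k` that contains `x`. -/
def idx (k : ℕ) (x : Fin n → ℝ) : Fin n → ℤ := fun i => ⌊(2 : ℝ) ^ k * x i⌋

/-- The half-open dyadic cube of level `k` with index `m`. -/
def hcube (k : ℕ) (m : Fin n → ℤ) : Set (Fin n → ℝ) := {x | idx k x = m}

/-- The index, `d` levels up, of the dyadic cube that contains the cube with index `M`. -/
def par (d : ℕ) (M : Fin n → ℤ) : Fin n → ℤ := fun i => M i / 2 ^ d

/-- The integer vectors with all coordinates in `[-c, c]`. -/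
def nbhd (n c : ℕ) : Finset (Fin n → ℤ) := Fintype.piFinset fun _ => Finset.Icc (-(c : ℤ)) c

lemma mem_nbhd {c : ℕ} {e : Fin n → ℤ} : e ∈ nbhd n c ↔ ∀ i, |e i| ≤ c := by
  simp [nbhd, abs_le]

lemma par_zero (M : Fin n → ℤ) : par 0 M = M := by
  funext i
  simp [par]

lemma par_idx (k d : ℕ) (x : Fin n → ℝ) : par d (idx (k + d) x) = idx k x := by
  funext i
  simp only [par, idx]
  have h := Int.floor_div_natCast ((2 : ℝ) ^ (k + d) * x i) (2 ^ d)
  push_cast at h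
  rw [← h]
  congr 1
  rw [pow_add]
  field_simp

lemma measurable_idx (k : ℕ) : Measurable (idx k : (Fin n → ℝ) → Fin n → ℤ) :=
  measurable_pi_lambda _ fun i => Int.measurable_floor.comp ((measurable_pi_apply i).const_mul _)

lemma measurableSet_hcube (k : ℕ) (m : Fin n → ℤ) : MeasurableSet (hcube k m) :=
  measurable_idx k (measurableSet_singleton m)

lemma hcube_eq_pi (k : ℕ) (m : Fin n → ℤ) :
    hcube k m = Set.univ.pi fun i => Set.Ico ((m i : ℝ) / 2 ^ k) (((m i : ℝ) + 1) / 2 ^ k) := by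
  ext x
  have h2 : (0 : ℝ) < 2 ^ k := by positivity
  simp only [hcube, idx, Set.mem_ofPred_eq, Set.mem_univ_pi, Set.mem_Ico, funext_iff, Int.floor_eq_iff,
    div_le_iff₀ h2, lt_div_iff₀ h2, mul_comm]

lemma dyadicCube_ae_eq_hcube (k : ℕ) (m : Fin n → ℤ) :
    (dyadicCube k m : Set (Fin n → ℝ)) =ᵐ[volume] hcube k m := by
  have h : (dyadicCube k m : Set (Fin n → ℝ)) =
      Set.univ.pi fun i => Set.Ioo ((m i : ℝ) / 2 ^ k) (((m i : ℝ) + 1) / 2 ^ k) := by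
    ext x
    simp [dyadicCube]
  rw [h, hcube_eq_pi]
  exact (Measure.univ_pi_Ioo_ae_eq_Icc).trans (Measure.univ_pi_Ico_ae_eq_Icc).symm

lemma volume_hcube (k : ℕ) (m : Fin n → ℤ) :
    volume (hcube k m) = ((2 : ℝ≥0∞) ^ (k * n))⁻¹ := by
  rw [hcube_eq_pi, Real.volume_pi_Ico]
  have h : ∀ i, ENNReal.ofReal (((m i : ℝ) + 1) / 2 ^ k - (m i : ℝ) / 2 ^ k) = ((2 : ℝ≥0∞) ^ k)⁻¹ := by
    intro i
    rw [show ((m i : ℝ) + 1) / 2 ^ k - (m i : ℝ) / 2 ^ k = ((2 : ℝ) ^ k)⁻¹ by ring,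
      ENNReal.ofReal_inv_of_pos (by positivity), ENNReal.ofReal_pow (by norm_num)]
    simp
  simp_rw [h]
  rw [Finset.prod_const, Finset.card_univ, Fintype.card_fin, ← ENNReal.inv_pow, ← pow_mul]

lemma lintegral_eq_tsum_hcube (k : ℕ) (f : (Fin n → ℝ) → ℝ≥0∞) (μ : Measure (Fin n → ℝ)) :
    ∫⁻ x, f x ∂μ = ∑' m, ∫⁻ x in hcube k m, f x ∂μ := by
  have h1 : (⋃ m : Fin n → ℤ, hcube k m) = Set.univ := by
    ext x
    simp [hcube]
  rw [← lintegral_iUnion (measurableSet_hcube k) ?_ f, h1, Measure.restrict_univ]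
  intro m m' hm
  refine Set.disjoint_left.2 fun x hx hx' => hm ?_
  exact hx.symm.trans hx'

lemma setLIntegral_hcube_eq_tsum (k d : ℕ) (m : Fin n → ℤ) (f : (Fin n → ℝ) → ℝ≥0∞) :
    ∫⁻ x in hcube k m, f x =
      ∑' M, if par d M = m then ∫⁻ x in hcube (k + d) M, f x else 0 := by
  rw [lintegral_eq_tsum_hcube (k + d) f]
  refine tsum_congr fun M => ?_
  rw [Measure.restrict_restrict (measurableSet_hcube _ _)]
  split_ifs with h
  · rw [Set.inter_eq_left.2]
    intro x hx
    rw [hcube, Set.mem_ofPred_eq] at hx ⊢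
    rw [← par_idx k d, hx, h]
  · rw [show hcube (k + d) M ∩ hcube k m = ∅ from ?_]
    · simp
    · ext x
      simp only [hcube, Set.mem_inter_iff, Set.mem_ofPred_eq, Set.mem_empty_iff_false, iff_false, not_and]
      intro hx hx'
      rw [← par_idx k d, hx] at hx'
      exact h hx'

lemma setLIntegral_idx (k : ℕ) (m : Fin n → ℤ) (G : (Fin n → ℤ) → ℝ≥0∞) :
    ∫⁻ x in hcube k m, G (idx k x) = ((2 : ℝ≥0∞) ^ (k * n))⁻¹ * G m := by
  rw [setLIntegral_congr_fun (g := fun _ => G m) (measurableSet_hcube k m)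
    (fun x hx => by rw [show idx k x = m from hx])]
  rw [setLIntegral_const, volume_hcube, mul_comm]

lemma tsum_ite_par {d : ℕ} (f : (Fin n → ℤ) → ℝ≥0∞) :
    ∑' m, ∑' M, (if par d M = m then f M else 0) = ∑' M, f M := by
  rw [ENNReal.tsum_comm]
  refine tsum_congr fun M => ?_
  simp only [eq_comm (a := par d M)]
  exact tsum_ite_eq _ _

/-- Points at sup-distance at most `c 2^{-k}` have level `k` indices that differ by at most
`c + 1`. -/
lemma idx_sub_mem_nbhd {k c : ℕ} {x y : Fin n → ℝ} (h : ∀ i, |y i - x i| ≤ c / 2 ^ k) :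
    idx k y - idx k x ∈ nbhd n (c + 1) := by
  rw [mem_nbhd]
  intro i
  have h2 : (0 : ℝ) < 2 ^ k := by positivity
  have h3 := abs_le.1 (h i)
  have h4 : (2 : ℝ) ^ k * y i - 2 ^ k * x i ≤ c := by
    have := mul_le_mul_of_nonneg_left h3.2 h2.le
    rw [mul_div_cancel₀ _ h2.ne'] at this
    linarith
  have h5 : (2 : ℝ) ^ k * x i - 2 ^ k * y i ≤ c := by
    have := mul_le_mul_of_nonneg_left h3.1 h2.le
    rw [mul_neg, mul_div_cancel₀ _ h2.ne'] at this
    linarith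
  simp only [idx, Pi.sub_apply]
  have h6 := Int.floor_le ((2 : ℝ) ^ k * y i)
  have h7 := Int.lt_floor_add_one ((2 : ℝ) ^ k * y i)
  have h8 := Int.floor_le ((2 : ℝ) ^ k * x i)
  have h9 := Int.lt_floor_add_one ((2 : ℝ) ^ k * x i)
  rw [abs_le]
  constructor
  · have : (-((c + 1 : ℕ) : ℤ) : ℝ) - 1 < ((⌊(2 : ℝ) ^ k * y i⌋ - ⌊(2 : ℝ) ^ k * x i⌋ : ℤ) : ℝ) := by
      push_cast
      linarith
    exact_mod_cast (by exact_mod_cast this : (-((c + 1 : ℕ) : ℤ)) - 1 < _ )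
  · have : ((⌊(2 : ℝ) ^ k * y i⌋ - ⌊(2 : ℝ) ^ k * x i⌋ : ℤ) : ℝ) < ((c + 1 : ℕ) : ℤ) + 1 := by
      push_cast
      linarith
    exact Int.lt_add_one_iff.1 (by exact_mod_cast this)

/-! ## Discrete weights -/

/-- The discrete form of the conditions that define the classes of weight sequences. -/
structure IsDiscreteWeight (p θ α₁ α₂ : ℝ) (T : ℕ → (Fin n → ℤ) → ℝ≥0∞) : Prop where
  ne_zero : ∀ k m, T k m ≠ 0
  ne_top : ∀ k m, T k m ≠ ∞
  neighbour : ∃ C : ℝ≥0∞, C ≠ ∞ ∧ ∀ k m m', (∀ i, |m i - m' i| ≤ 1) → T k m ≤ C * T k m'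
  upper : ∃ C : ℝ≥0∞, C ≠ ∞ ∧ ∀ k d m, ∑' M, (if par d M = m then T (k + d) M ^ p else 0) ≤
    C * 2 ^ (α₂ * p * d) * T k m ^ p
  lower : ∃ C : ℝ≥0∞, C ≠ ∞ ∧ ∀ k d m (c : (Fin n → ℤ) → ℝ≥0∞),
    T k m * (((2 : ℝ≥0∞) ^ (d * n))⁻¹ * ∑' M, if par d M = m then c M ^ θ else 0) ^ (1 / θ) ≤
      C * 2 ^ (-(α₁ * d)) * (∑' M, if par d M = m then (c M * T (k + d) M) ^ p else 0) ^ (1 / p)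

lemma two_pow_mul_inv (k d : ℕ) :
    (2 : ℝ≥0∞) ^ (k * n) * ((2 : ℝ≥0∞) ^ ((k + d) * n))⁻¹ = ((2 : ℝ≥0∞) ^ (d * n))⁻¹ := by
  rw [add_mul, pow_add, ENNReal.mul_inv (by simp) (by simp), ← mul_assoc,
    ENNReal.mul_inv_cancel (by simp) (by simp), one_mul]

lemma cubeMean_step {s : ℝ} (hs : 0 < s) (k d : ℕ) (m : Fin n → ℤ) (G : (Fin n → ℤ) → ℝ) :
    cubeMean (ENNReal.ofReal s) k m (fun x => G (idx (k + d) x)) =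
      (((2 : ℝ≥0∞) ^ (d * n))⁻¹ * ∑' M, if par d M = m then ‖G M‖ₑ ^ s else 0) ^ (1 / s) := by
  unfold cubeMean
  rw [eLpNorm_eq_lintegral_rpow_enorm_toReal (by simpa using hs) ENNReal.ofReal_ne_top,
    ENNReal.toReal_ofReal hs.le, lintegral_smul_measure,
    Measure.restrict_congr_set (dyadicCube_ae_eq_hcube k m), setLIntegral_hcube_eq_tsum k d]
  congr 1
  simp_rw [setLIntegral_idx (k + d) _ fun M => ‖G M‖ₑ ^ s]
  rw [← two_pow_mul_inv k d, mul_assoc, ← ENNReal.tsum_mul_left, smul_eq_mul]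
  congr 2
  funext M
  split_ifs <;> simp

/-- The normalising factor `2^{kn/p}`. -/
def normFactor (n : ℕ) (p : ℝ) (k : ℕ) : ℝ≥0∞ := (2 : ℝ≥0∞) ^ ((k : ℝ) * n / p)

lemma normFactor_ne_zero (p : ℝ) (k : ℕ) : normFactor n p k ≠ 0 := by
  simp [normFactor, ENNReal.rpow_eq_zero_iff]

lemma normFactor_ne_top (p : ℝ) (k : ℕ) : normFactor n p k ≠ ∞ := by
  simp [normFactor, ENNReal.rpow_eq_top_iff]

lemma normFactor_rpow {p : ℝ} (hp : 0 < p) (k : ℕ) :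
    normFactor n p k ^ p = (2 : ℝ≥0∞) ^ (k * n) := by
  unfold normFactor
  rw [← ENNReal.rpow_mul, div_mul_cancel₀ _ hp.ne', ← ENNReal.rpow_natCast]
  push_cast
  rfl

lemma enorm_stepCoeff {p : ℝ} (k : ℕ) (y : ℝ) :
    ‖(2 : ℝ) ^ ((k : ℝ) * n / p) * y‖ₑ = normFactor n p k * ‖y‖ₑ := by
  rw [enorm_mul]
  congr 1
  unfold normFactor
  rw [Real.enorm_eq_ofReal (by positivity), ← ENNReal.ofReal_rpow_of_pos (by norm_num)]
  simp

/-- The factors 2^{jn/p} in the associated weights turn normalised p-means over a cube into plain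
ℓ_p-sums over its descendants, so the discrete conditions carry no volume factors on that side. -/
lemma weighted_sum_rescale {p : ℝ} (hp : 0 < p) (k d : ℕ) (m : Fin n → ℤ)
    (X : (Fin n → ℤ) → ℝ≥0∞) :
    (((2 : ℝ≥0∞) ^ (d * n))⁻¹ *
      ∑' M, if par d M = m then (normFactor n p (k + d) * X M) ^ p else 0) ^ (1 / p) =
      normFactor n p k * (∑' M, if par d M = m then X M ^ p else 0) ^ (1 / p) := by
  have h1 : ∀ M, (if par d M = m then (normFactor n p (k + d) * X M) ^ p else 0) =
      (2 : ℝ≥0∞) ^ ((k + d) * n) * if par d M = m then X M ^ p else 0 := by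
    intro M
    split_ifs
    · rw [ENNReal.mul_rpow_of_nonneg _ _ hp.le, normFactor_rpow hp]
    · simp
  simp_rw [h1]
  rw [ENNReal.tsum_mul_left, ← mul_assoc]
  have h2 : ((2 : ℝ≥0∞) ^ (d * n))⁻¹ * 2 ^ ((k + d) * n) = normFactor n p k ^ p := by
    rw [normFactor_rpow hp, add_mul, pow_add, mul_comm (2 ^ (k * n)), ← mul_assoc,
      ENNReal.inv_mul_cancel (by simp) (by simp), one_mul]
  rw [h2, ENNReal.mul_rpow_of_nonneg _ _ (by positivity), ← ENNReal.rpow_mul,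
    mul_one_div_cancel hp.ne', ENNReal.rpow_one]

lemma cubeMean_assocWeight {p : ℝ} (hp : 0 < p) (t : ℕ → (Fin n → ℝ) → ℝ) (k d : ℕ)
    (m : Fin n → ℤ) :
    cubeMean (ENNReal.ofReal p) k m (assocWeight p t (k + d)) =
      normFactor n p k *
        (∑' M, if par d M = m then ENNReal.ofReal (assocSeq p t (k + d) M) ^ p else 0) ^ (1 / p) := by
  have h := cubeMean_step hp k d m
    (fun M => (2 : ℝ) ^ (((k + d : ℕ) : ℝ) * n / p) * assocSeq p t (k + d) M)
  rw [← weighted_sum_rescale hp]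
  simp_rw [enorm_stepCoeff] at h
  refine h.trans ?_
  have h0 : ∀ M, ‖assocSeq p t (k + d) M‖ₑ = ENNReal.ofReal (assocSeq p t (k + d) M) := fun M =>
    Real.enorm_eq_ofReal ENNReal.toReal_nonneg
  simp_rw [h0]

lemma cubeMean_assocWeight_self {p : ℝ} (hp : 0 < p) (t : ℕ → (Fin n → ℝ) → ℝ) (k : ℕ)
    (m : Fin n → ℤ) :
    cubeMean (ENNReal.ofReal p) k m (assocWeight p t k) =
      normFactor n p k * ENNReal.ofReal (assocSeq p t k m) := by
  have h := cubeMean_assocWeight hp t k 0 m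
  rw [add_zero] at h
  rw [h]
  simp_rw [par_zero]
  rw [tsum_ite_eq, ← ENNReal.rpow_mul, mul_one_div_cancel hp.ne', ENNReal.rpow_one]

/-- The exponent σ₁ is the one with 1/p + 1/σ₁ = 1/θ: divide the relation between p/θ and its dual
by θ. The extended exponents include σ₁ = ∞, which occurs for θ = p. -/
lemma holderTriple_sigmaExp {p θ : ℝ} (hθ : 0 < θ) (hθp : θ ≤ p) :
    ENNReal.HolderTriple (ENNReal.ofReal p) (sigmaExp p θ) (ENNReal.ofReal θ) := by
  have h1 : 1 ≤ ENNReal.ofReal (p / θ) := by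
    rw [ENNReal.one_le_ofReal, le_div_iff₀ hθ, one_mul]
    exact hθp
  have h2 := (ENNReal.HolderConjugate.conjExponent h1).inv_add_inv_eq_inv
  refine ⟨?_⟩
  have hθ0 : ENNReal.ofReal θ ≠ 0 := by simpa using hθ
  unfold sigmaExp
  have h3 : ENNReal.ofReal p = ENNReal.ofReal θ * ENNReal.ofReal (p / θ) := by
    rw [← ENNReal.ofReal_mul hθ.le, mul_div_cancel₀ _ hθ.ne']
  rw [h3, ENNReal.mul_inv (Or.inl hθ0) (Or.inl ENNReal.ofReal_ne_top),
    ENNReal.mul_inv (Or.inl hθ0) (Or.inl ENNReal.ofReal_ne_top), ← mul_add, h2, inv_one, mul_one]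

/-! ### From the classes of weight sequences to discrete weights. -/

section FromMemX

variable {p α₁ α₂ α₃ θ : ℝ} {σ₁ : ℝ≥0∞} {t : ℕ → (Fin n → ℝ) → ℝ}

/-- Since σ₂ = p, both means in the upper condition are ℓ_p-sums with the same normalising factor,
which cancels. -/
lemma MemX.upper_discrete (hp : 0 < p) (ht : MemX p α₁ α₂ α₃ σ₁ (ENNReal.ofReal p) t) :
    ∃ C : ℝ≥0∞, C ≠ ∞ ∧ ∀ k d m,
      ∑' M, (if par d M = m then ENNReal.ofReal (assocSeq p t (k + d) M) ^ p else 0) ≤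
        C * 2 ^ (α₂ * p * d) * ENNReal.ofReal (assocSeq p t k m) ^ p := by
  obtain ⟨C, hC, h⟩ := ht.upper
  refine ⟨ENNReal.ofReal C ^ p, by simp [ENNReal.rpow_eq_top_iff, not_lt.2 hp.le], ?_⟩
  intro k d m
  have h1 := h k (k + d) m (Nat.le_add_right k d)
  rw [cubeMean_assocWeight_self hp, cubeMean_assocWeight hp] at h1
  set T := ENNReal.ofReal (assocSeq p t k m) with hT
  set S := ∑' M, (if par d M = m then ENNReal.ofReal (assocSeq p t (k + d) M) ^ p else 0) with hS
  have hT0 : T ≠ 0 := by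
    simpa [hT] using (ht.neighbour k m m (by simp)).1
  have hT1 : T ≠ ∞ := ENNReal.ofReal_ne_top
  have h2 : S ^ (1 / p) ≤ ENNReal.ofReal (C * 2 ^ (α₂ * (((k + d : ℕ) : ℝ) - k))) * T := by
    calc S ^ (1 / p) = (normFactor n p k * T)⁻¹ * (normFactor n p k * S ^ (1 / p)) * T := by
          rw [ENNReal.mul_inv (Or.inl (normFactor_ne_zero p k)) (Or.inl (normFactor_ne_top p k))]
          rw [show (normFactor n p k)⁻¹ * T⁻¹ * (normFactor n p k * S ^ (1 / p)) * T =
            ((normFactor n p k)⁻¹ * normFactor n p k) * (T⁻¹ * T) * S ^ (1 / p) by ring,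
            ENNReal.inv_mul_cancel (normFactor_ne_zero p k) (normFactor_ne_top p k),
            ENNReal.inv_mul_cancel hT0 hT1]
          simp
      _ ≤ _ := by gcongr
  have h3 := ENNReal.rpow_le_rpow h2 hp.le
  rw [← ENNReal.rpow_mul, one_div_mul_cancel hp.ne', ENNReal.rpow_one,
    ENNReal.mul_rpow_of_nonneg _ _ hp.le, ENNReal.ofReal_mul hC.le,
    ENNReal.mul_rpow_of_nonneg _ _ hp.le, ← ENNReal.ofReal_rpow_of_pos (by norm_num),
    ← ENNReal.rpow_mul] at h3
  refine h3.trans (le_of_eq ?_)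
  congr 3
  · simp
  · push_cast
    ring

/-- Hölder's inequality with 1/θ = 1/p + 1/σ₁, applied to c = (c t̄_j) · t̄_j^{-1} on a cube of
level k. Tested against all coefficients c in this way, the negative moment condition no longer
mentions σ₁. -/
lemma MemX.lower_discrete (hp : 0 < p) (hθ : 0 < θ) (hθp : θ ≤ p)
    (ht : MemX p α₁ α₂ α₃ (sigmaExp p θ) (ENNReal.ofReal p) t) :
    ∃ C : ℝ≥0∞, C ≠ ∞ ∧ ∀ k d m (c : (Fin n → ℤ) → ℝ≥0∞),
      ENNReal.ofReal (assocSeq p t k m) *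
        (((2 : ℝ≥0∞) ^ (d * n))⁻¹ * ∑' M, if par d M = m then c M ^ θ else 0) ^ (1 / θ) ≤
      C * 2 ^ (-(α₁ * d)) * (∑' M, if par d M = m then
        (c M * ENNReal.ofReal (assocSeq p t (k + d) M)) ^ p else 0) ^ (1 / p) := by
  obtain ⟨C, hC, h⟩ := ht.lower
  refine ⟨ENNReal.ofReal C, ENNReal.ofReal_ne_top, ?_⟩
  intro k d m c
  have hT0 : ∀ k m, ENNReal.ofReal (assocSeq p t k m) ≠ 0 := fun k m => by
    simpa using (ht.neighbour k m m (by simp)).1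
  -- Real-valued Hölder needs finite coefficients. An infinite coefficient makes the right side
  -- infinite, because the weights are positive.
  by_cases hc : ∀ M, par d M = m → c M ≠ ∞
  · have h1 := h k (k + d) m (Nat.le_add_right k d)
    rw [cubeMean_assocWeight_self hp] at h1
    have := holderTriple_sigmaExp hθ hθp
    have hmeas : ∀ G : (Fin n → ℤ) → ℝ, AEStronglyMeasurable (fun x => G (idx (k + d) x))
        (((2 : ℝ≥0∞) ^ (k * n)) • volume.restrict (dyadicCube k m)) := fun G =>
      ((measurable_of_countable G).comp (measurable_idx (k + d))).aestronglyMeasurable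
    have h2 := eLpNorm_smul_le_mul_eLpNorm (p := ENNReal.ofReal p) (q := sigmaExp p θ)
      (r := ENNReal.ofReal θ)
      (hmeas fun M => ((2 : ℝ) ^ (((k + d : ℕ) : ℝ) * n / p) * assocSeq p t (k + d) M)⁻¹)
      (hmeas fun M => (2 : ℝ) ^ (((k + d : ℕ) : ℝ) * n / p) * ((c M).toReal * assocSeq p t (k + d) M))
    have h3 : ((fun x => (2 : ℝ) ^ (((k + d : ℕ) : ℝ) * n / p) *
        ((c (idx (k + d) x)).toReal * assocSeq p t (k + d) (idx (k + d) x))) •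
        fun x => ((2 : ℝ) ^ (((k + d : ℕ) : ℝ) * n / p) * assocSeq p t (k + d) (idx (k + d) x))⁻¹) =
        fun x => (c (idx (k + d) x)).toReal := by
      funext x
      have ha := (ht.neighbour (k + d) (idx (k + d) x) (idx (k + d) x) (by simp)).1
      have hb : (0 : ℝ) < (2 : ℝ) ^ (((k + d : ℕ) : ℝ) * n / p) := by positivity
      simp only [Pi.smul_apply', smul_eq_mul]
      field_simp
    rw [h3] at h2
    have h4 := cubeMean_step hθ k d m (fun M => (c M).toReal)
    have h5 := cubeMean_step hp k d m
      (fun M => (2 : ℝ) ^ (((k + d : ℕ) : ℝ) * n / p) * ((c M).toReal * assocSeq p t (k + d) M))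
    simp_rw [enorm_stepCoeff] at h5
    rw [weighted_sum_rescale hp] at h5
    have hcn : ∀ M, par d M = m → ‖(c M).toReal‖ₑ = c M := fun M hM => by
      rw [Real.enorm_eq_ofReal ENNReal.toReal_nonneg, ENNReal.ofReal_toReal (hc M hM)]
    have h6 : ∀ M, (if par d M = m then ‖(c M).toReal‖ₑ ^ θ else 0) =
        if par d M = m then c M ^ θ else 0 := fun M => by
      split_ifs with hM
      · rw [hcn M hM]
      · rfl
    have h7 : ∀ M, (if par d M = m then ‖(c M).toReal * assocSeq p t (k + d) M‖ₑ ^ p else 0) =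
        if par d M = m then (c M * ENNReal.ofReal (assocSeq p t (k + d) M)) ^ p else 0 := fun M => by
      split_ifs with hM
      · rw [enorm_mul, hcn M hM,
          Real.enorm_eq_ofReal (ht.neighbour (k + d) M M (by simp)).1.le]
      · rfl
    simp_rw [h6] at h4
    simp_rw [h7] at h5
    rw [← h4]
    change eLpNorm _ _ _ = _ at h5
    rw [h5] at h2
    set S := (∑' M, if par d M = m then
        (c M * ENNReal.ofReal (assocSeq p t (k + d) M)) ^ p else 0) ^ (1 / p) with hS
    set N := normFactor n p k with hN
    have hN0 : N ≠ 0 := normFactor_ne_zero p k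
    have hN1 : N ≠ ∞ := normFactor_ne_top p k
    set T := ENNReal.ofReal (assocSeq p t k m) with hT
    have hfin : ENNReal.ofReal (C * 2 ^ (α₁ * ((k : ℝ) - (k + d : ℕ)))) =
        ENNReal.ofReal C * 2 ^ (-(α₁ * d)) := by
      rw [ENNReal.ofReal_mul hC.le, ← ENNReal.ofReal_rpow_of_pos (by norm_num)]
      congr 2
      · simp
      · push_cast
        ring
    rw [hfin] at h1
    calc T * cubeMean (ENNReal.ofReal θ) k m (fun x => (c (idx (k + d) x)).toReal)
        ≤ T * (N * S * cubeMean (sigmaExp p θ) k m fun x => (assocWeight p t (k + d) x)⁻¹) := by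
          gcongr
          exact h2
      _ = (N * T * cubeMean (sigmaExp p θ) k m fun x => (assocWeight p t (k + d) x)⁻¹) * S := by
          ring
      _ ≤ _ := by gcongr
  · push Not at hc
    obtain ⟨M, hM, hcM⟩ := hc
    have h1 : (∑' M, if par d M = m then
        (c M * ENNReal.ofReal (assocSeq p t (k + d) M)) ^ p else 0) = ∞ := by
      refine ENNReal.tsum_eq_top_of_eq_top ⟨M, ?_⟩
      rw [if_pos hM, hcM, ENNReal.top_mul (hT0 _ _), ENNReal.top_rpow_of_pos hp]
    rw [h1, ENNReal.top_rpow_of_pos (by positivity), ENNReal.mul_top]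
    · exact le_top
    · refine mul_ne_zero (by simpa using hC) ?_
      simp [ENNReal.rpow_eq_zero_iff]

lemma MemX.isDiscreteWeight (hp : 0 < p) (hθ : 0 < θ) (hθp : θ ≤ p)
    (ht : MemX p α₁ α₂ α₃ (sigmaExp p θ) (ENNReal.ofReal p) t) :
    IsDiscreteWeight p θ α₁ α₂ fun k m => ENNReal.ofReal (assocSeq p t k m) where
  ne_zero k m := by simpa using (ht.neighbour k m m (by simp)).1
  ne_top _ _ := ENNReal.ofReal_ne_top
  neighbour := by
    refine ⟨ENNReal.ofReal (2 ^ α₃), ENNReal.ofReal_ne_top, fun k m m' h => ?_⟩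
    rw [← ENNReal.ofReal_mul (by positivity)]
    exact ENNReal.ofReal_le_ofReal (ht.neighbour k m m' h).2
  upper := ht.upper_discrete hp
  lower := ht.lower_discrete hp hθ hθp

lemma IsAdmissible.setLIntegral_rpow (hp : 0 < p) (ht : IsAdmissible p t) (k : ℕ) (m : Fin n → ℤ) :
    ∫⁻ x in hcube k m, ENNReal.ofReal (t k x) ^ p = ENNReal.ofReal (assocSeq p t k m) ^ p := by
  have hsub : dyadicCube k m ⊆ Set.Icc (fun i => (m i : ℝ) / 2 ^ k) (fun i => ((m i : ℝ) + 1) / 2 ^ k) :=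
    fun x hx => ⟨fun i => (hx i).1.le, fun i => (hx i).2.le⟩
  have hfin : eLpNorm (t k) (ENNReal.ofReal p) (volume.restrict (dyadicCube k m)) ≠ ∞ :=
    ((eLpNorm_mono_measure _ (Measure.restrict_mono hsub le_rfl)).trans_lt
      (ht.memLpLoc k _ isCompact_Icc).2).ne
  unfold assocSeq
  rw [ENNReal.ofReal_toReal hfin,
    eLpNorm_eq_lintegral_rpow_enorm_toReal (by simpa using hp) ENNReal.ofReal_ne_top,
    ENNReal.toReal_ofReal hp.le, ← ENNReal.rpow_mul, one_div_mul_cancel hp.ne', ENNReal.rpow_one,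
    Measure.restrict_congr_set (dyadicCube_ae_eq_hcube k m)]
  refine lintegral_congr fun x => ?_
  rw [Real.enorm_eq_ofReal (ht.pos k x).le]

end FromMemX

/-! ### Comparison of a discrete weight on nearby cubes. -/

namespace IsDiscreteWeight

variable {p θ α₁ α₂ : ℝ} {T : ℕ → (Fin n → ℤ) → ℝ≥0∞}

lemma neighbour_iterate (hT : IsDiscreteWeight p θ α₁ α₂ T) (c : ℕ) :
    ∃ C : ℝ≥0∞, C ≠ ∞ ∧ ∀ k m m', (∀ i, |m i - m' i| ≤ (c : ℤ)) → T k m ≤ C * T k m' := by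
  obtain ⟨C, hC, h⟩ := hT.neighbour
  refine ⟨C ^ c, ENNReal.pow_ne_top hC, ?_⟩
  induction c with
  | zero =>
    intro k m m' hm
    have : m = m' := funext fun i => by
      have := hm i
      simp only [Nat.cast_zero, abs_nonpos_iff] at this
      omega
    simp [this]
  | succ c ih =>
    intro k m m' hm
    -- The vector m' moved by one towards m in each coordinate where they differ: within c of m and
    -- within 1 of m'.
    let m₁ : Fin n → ℤ := fun i =>
      if m i < m' i then m' i - 1 else if m' i < m i then m' i + 1 else m' i
    have h1 : ∀ i, |m i - m₁ i| ≤ (c : ℤ) := fun i => by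
      have := hm i
      simp only [m₁]
      push_cast at this
      rw [abs_le] at this ⊢
      split_ifs <;> constructor <;> omega
    have h2 : ∀ i, |m₁ i - m' i| ≤ 1 := fun i => by
      simp only [m₁]
      rw [abs_le]
      split_ifs <;> constructor <;> omega
    calc T k m ≤ C ^ c * T k m₁ := ih k m m₁ h1
      _ ≤ C ^ c * (C * T k m') := by gcongr; exact h k m₁ m' h2
      _ = C ^ (c + 1) * T k m' := by ring

/-- The weight can be moved to the shifted cube at bounded cost; after that, each shift is only a
reindexing of the sum. -/
lemma tsum_shift_le (hp : 0 < p) (hT : IsDiscreteWeight p θ α₁ α₂ T) (c : ℕ) :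
    ∃ C : ℝ≥0∞, C ≠ ∞ ∧ ∀ k (X : (Fin n → ℤ) → ℝ≥0∞),
      ∑' m, (T k m * ∑ e ∈ nbhd n c, X (m + e)) ^ p ≤ C * ∑' m, (X m * T k m) ^ p := by
  obtain ⟨C, hC, h⟩ := hT.neighbour_iterate c
  refine ⟨((nbhd n c).card : ℝ≥0∞) ^ p * ((nbhd n c).card * C ^ p), ?_, ?_⟩
  · exact ENNReal.mul_ne_top (ENNReal.rpow_ne_top_of_nonneg hp.le (by simp))
      (ENNReal.mul_ne_top (by simp) (ENNReal.rpow_ne_top_of_nonneg hp.le hC))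
  intro k X
  have h1 : ∀ m, (T k m * ∑ e ∈ nbhd n c, X (m + e)) ^ p ≤
      ((nbhd n c).card : ℝ≥0∞) ^ p *
        ∑ e ∈ nbhd n c, C ^ p * (X (m + e) * T k (m + e)) ^ p := by
    intro m
    rw [Finset.mul_sum]
    refine (sum_rpow_le _ hp _).trans ?_
    gcongr with e he
    rw [← ENNReal.mul_rpow_of_nonneg _ _ hp.le]
    refine ENNReal.rpow_le_rpow ?_ hp.le
    calc T k m * X (m + e) ≤ (C * T k (m + e)) * X (m + e) := by
          gcongr
          refine h k m (m + e) fun i => ?_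
          have := mem_nbhd.1 he i
          simpa using this
      _ = _ := by ring
  refine (ENNReal.tsum_le_tsum h1).trans ?_
  rw [ENNReal.tsum_mul_left, mul_assoc]
  gcongr
  rw [Summable.tsum_finsetSum fun _ _ => ENNReal.summable]
  have h2 : ∀ e, ∑' m, C ^ p * (X (m + e) * T k (m + e)) ^ p = C ^ p * ∑' m, (X m * T k m) ^ p := by
    intro e
    rw [ENNReal.tsum_mul_left]
    congr 1
    exact (Equiv.addRight e).tsum_eq fun m => (X m * T k m) ^ p
  simp_rw [h2]
  rw [Finset.sum_const, nsmul_eq_mul, mul_assoc]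

end IsDiscreteWeight

/-! ## Quasi-norms of sums and of compositions -/

/-- The embedding of ℓ_1 in ℓ_v: write x_i^v = x_i x_i^{v-1} and bound the second factor by the
power of the total. -/
lemma tsum_rpow_le_rpow_tsum {ι : Type*} {v : ℝ} (hv : 1 ≤ v) (x : ι → ℝ≥0∞) :
    ∑' i, x i ^ v ≤ (∑' i, x i) ^ v := by
  set S := ∑' i, x i with hS
  have h1 : ∀ y : ℝ≥0∞, y ^ v = y * y ^ (v - 1) := fun y => by
    conv_rhs => rw [← ENNReal.rpow_one y, ← ENNReal.rpow_mul, one_mul]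
    rw [← ENNReal.rpow_add_of_nonneg _ _ zero_le_one (by linarith)]
    congr 1
    ring
  rw [h1 S]
  conv_rhs => rw [hS, ← ENNReal.tsum_mul_right]
  refine ENNReal.tsum_le_tsum fun i => ?_
  rw [h1]
  gcongr
  exact ENNReal.le_tsum i

/-- The constant in the quasi-triangle inequality for series. -/
def tsumConst (r : ℝ≥0∞) (ε : ℝ) : ℝ≥0∞ :=
  1 + geoSum (ε * r.toReal / 2) ^ (1 / r.toReal) * geoSum (ε / 2)

lemma tsumConst_ne_top {r : ℝ≥0∞} (hr : r ≠ 0) {ε : ℝ} (hε : 0 < ε) : tsumConst r ε ≠ ∞ := by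
  unfold tsumConst
  refine ENNReal.add_ne_top.2 ⟨ENNReal.one_ne_top, ENNReal.mul_ne_top ?_ (geoSum_ne_top (by positivity))⟩
  rcases eq_or_ne r ∞ with rfl | hr'
  · simp
  · have : 0 < r.toReal := ENNReal.toReal_pos hr hr'
    exact ENNReal.rpow_ne_top_of_nonneg (by positivity) (geoSum_ne_top (by positivity))

/-- A substitute for the triangle inequality that holds for every r > 0. For finite r,
`tsum_rpow_le` is used twice, with the exponent r inside the integral and with 1/r outside it; each
use loses half of ε. For r = ∞ the sum of the essential suprema suffices. -/
lemma eLpNorm_tsum_le {α : Type*} [MeasurableSpace α] {μ : Measure α} {r : ℝ≥0∞} (hr : r ≠ 0)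
    {ε : ℝ} (hε : 0 < ε) (k : ℕ) {f : ℕ → α → ℝ≥0∞} (hf : ∀ j, Measurable (f j)) :
    eLpNorm (fun z => ∑' j, f j z) r μ ≤ tsumConst r ε * ∑' j, geo ε k j * eLpNorm (f j) r μ := by
  have hgeo : ∀ j, 1 ≤ geo ε k j := fun j => by
    rw [← geo_zero k j]
    exact geo_mono hε.le k j
  rcases eq_or_ne r ∞ with rfl | hr'
  · have h1 : eLpNorm (fun z => ∑' j, f j z) ∞ μ ≤ ∑' j, eLpNorm (f j) ∞ μ := by
      rw [eLpNorm_exponent_top]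
      refine eLpNormEssSup_le_of_ae_enorm_bound ?_
      have h2 : ∀ᵐ z ∂μ, ∀ j, f j z ≤ eLpNorm (f j) ∞ μ := by
        rw [ae_all_iff]
        intro j
        rw [eLpNorm_exponent_top]
        exact ae_le_eLpNormEssSup (f := f j)
      filter_upwards [h2] with z hz
      exact ENNReal.tsum_le_tsum hz
    refine h1.trans ?_
    calc ∑' j, eLpNorm (f j) ∞ μ ≤ 1 * ∑' j, geo ε k j * eLpNorm (f j) ∞ μ := by
          rw [one_mul]
          exact ENNReal.tsum_le_tsum fun j => le_mul_of_one_le_left' (hgeo j)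
      _ ≤ _ := by
          gcongr
          exact le_self_add
  · have hs : 0 < r.toReal := ENNReal.toReal_pos hr hr'
    set s := r.toReal with hsdef
    simp_rw [eLpNorm_eq_lintegral_rpow_enorm_toReal hr hr', ← hsdef]
    change (∫⁻ z, (∑' j, f j z) ^ s ∂μ) ^ (1 / s) ≤
      tsumConst r ε * ∑' j, geo ε k j * (∫⁻ z, f j z ^ s ∂μ) ^ (1 / s)
    have h1 : ∫⁻ z, (∑' j, f j z) ^ s ∂μ ≤
        geoSum (ε / 2) ^ s * ∑' j, geo (ε * s / 2) k j * ∫⁻ z, f j z ^ s ∂μ := by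
      calc ∫⁻ z, (∑' j, f j z) ^ s ∂μ
          ≤ ∫⁻ z, geoSum (ε / 2) ^ s * ∑' j, geo (ε * s / 2) k j * f j z ^ s ∂μ := by
            refine lintegral_mono fun z => ?_
            have := tsum_rpow_le hs (ε * s / 2) k fun j => f j z
            rwa [show ε * s / 2 / s = ε / 2 by field_simp] at this
        _ = _ := by
            rw [lintegral_const_mul _ (Measurable.tsum fun j =>
              ((hf j).pow_const s).const_mul _), lintegral_tsum fun j =>
              (((hf j).pow_const s).const_mul _).aemeasurable]
            congr 2
            funext j
            rw [lintegral_const_mul _ ((hf j).pow_const s)]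
    refine (ENNReal.rpow_le_rpow h1 (by positivity)).trans ?_
    rw [ENNReal.mul_rpow_of_nonneg _ _ (by positivity), ← ENNReal.rpow_mul,
      mul_one_div_cancel hs.ne', ENNReal.rpow_one]
    have h2 := tsum_rpow_le (u := 1 / s) (by positivity) (ε / 2) k
      fun j => geo (ε * s / 2) k j * ∫⁻ z, f j z ^ s ∂μ
    rw [show ε / 2 / (1 / s) = ε * s / 2 by field_simp] at h2
    calc geoSum (ε / 2) * (∑' j, geo (ε * s / 2) k j * ∫⁻ z, f j z ^ s ∂μ) ^ (1 / s)
        ≤ geoSum (ε / 2) * (geoSum (ε * s / 2) ^ (1 / s) *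
          ∑' j, geo (ε / 2) k j * (geo (ε * s / 2) k j * ∫⁻ z, f j z ^ s ∂μ) ^ (1 / s)) := by
          gcongr
      _ = (geoSum (ε * s / 2) ^ (1 / s) * geoSum (ε / 2)) *
          ∑' j, geo ε k j * (∫⁻ z, f j z ^ s ∂μ) ^ (1 / s) := by
          rw [← mul_assoc, mul_comm (geoSum (ε / 2))]
          congr 2
          funext j
          rw [ENNReal.mul_rpow_of_nonneg _ _ (by positivity), geo_rpow, ← mul_assoc, ← geo_add]
          congr 2
          field_simp
          ring
      _ ≤ _ := by
          gcongr
          exact le_add_self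

lemma eLpNorm_sum_le_card {α ι : Type*} [MeasurableSpace α] {μ : Measure α} {r : ℝ≥0∞} (hr : r ≠ 0)
    (s : Finset ι) {f : ι → α → ℝ≥0∞} (hf : ∀ j, Measurable (f j)) :
    eLpNorm (fun z => ∑ j ∈ s, f j z) r μ ≤
      s.card * ((s.card : ℝ≥0∞) ^ (1 / r.toReal) * ∑ j ∈ s, eLpNorm (f j) r μ) := by
  rcases s.eq_empty_or_nonempty with rfl | hne
  · simp
  have hcard : (1 : ℝ≥0∞) ≤ s.card := by exact_mod_cast hne.card_pos
  rcases eq_or_ne r ∞ with rfl | hr'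
  · have h1 : eLpNorm (fun z => ∑ j ∈ s, f j z) ∞ μ ≤ ∑ j ∈ s, eLpNorm (f j) ∞ μ := by
      rw [eLpNorm_exponent_top]
      refine eLpNormEssSup_le_of_ae_enorm_bound ?_
      have h2 : ∀ᵐ z ∂μ, ∀ j ∈ s, f j z ≤ eLpNorm (f j) ∞ μ := by
        rw [Filter.eventually_all_finset]
        intro j _
        rw [eLpNorm_exponent_top]
        exact ae_le_eLpNormEssSup (f := f j)
      filter_upwards [h2] with z hz
      exact Finset.sum_le_sum hz
    refine h1.trans ?_
    simp only [ENNReal.toReal_top, div_zero, ENNReal.rpow_zero, one_mul]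
    exact le_mul_of_one_le_left' hcard
  · have hs : 0 < r.toReal := ENNReal.toReal_pos hr hr'
    set u := r.toReal with hu
    simp_rw [eLpNorm_eq_lintegral_rpow_enorm_toReal hr hr', ← hu]
    change (∫⁻ z, (∑ j ∈ s, f j z) ^ u ∂μ) ^ (1 / u) ≤
      s.card * ((s.card : ℝ≥0∞) ^ (1 / u) * ∑ j ∈ s, (∫⁻ z, f j z ^ u ∂μ) ^ (1 / u))
    have h1 : ∫⁻ z, (∑ j ∈ s, f j z) ^ u ∂μ ≤ (s.card : ℝ≥0∞) ^ u * ∑ j ∈ s, ∫⁻ z, f j z ^ u ∂μ := by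
      refine (lintegral_mono fun z => sum_rpow_le s hs fun j => f j z).trans (le_of_eq ?_)
      rw [lintegral_const_mul _ (Finset.measurable_fun_sum _ fun j _ => (hf j).pow_const u),
        lintegral_finsetSum _ fun j _ => (hf j).pow_const u]
    refine (ENNReal.rpow_le_rpow h1 (by positivity)).trans ?_
    rw [ENNReal.mul_rpow_of_nonneg _ _ (by positivity), ← ENNReal.rpow_mul,
      mul_one_div_cancel hs.ne', ENNReal.rpow_one]
    gcongr
    exact sum_rpow_le s (by positivity) _

/-! ### Local norms over unions of cubes, over sheared products and of step functions. -/

lemma eLpNorm_restrict_le_sum_hcube {r : ℝ≥0∞} (hr : r ≠ 0) {k c : ℕ} {m : Fin n → ℤ}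
    {U : Set (Fin n → ℝ)} (hU : ∀ z ∈ U, idx k z - m ∈ nbhd n c) {g : (Fin n → ℝ) → ℝ≥0∞}
    (hg : Measurable g) :
    eLpNorm g r (volume.restrict U) ≤ (nbhd n c).card * (((nbhd n c).card : ℝ≥0∞) ^ (1 / r.toReal) *
      ∑ e ∈ nbhd n c, eLpNorm g r (volume.restrict (hcube k (m + e)))) := by
  set U' := {z : Fin n → ℝ | idx k z - m ∈ nbhd n c} with hU'
  have hU'm : MeasurableSet U' := by
    have : U' = idx k ⁻¹' {M | M - m ∈ nbhd n c} := rfl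
    rw [this]
    exact measurable_idx k (Set.to_countable _).measurableSet
  have h1 : eLpNorm g r (volume.restrict U) ≤
      eLpNorm (fun z => ∑ e ∈ nbhd n c, (hcube k (m + e)).indicator g z) r volume := by
    refine (eLpNorm_mono_measure g (Measure.restrict_mono (show U ⊆ U' from hU) le_rfl)).trans ?_
    rw [← eLpNorm_indicator_eq_eLpNorm_restrict hU'm]
    refine eLpNorm_mono_enorm fun z => ?_
    by_cases hz : z ∈ U'
    · rw [Set.indicator_of_mem hz]
      have h2 : (hcube k (m + (idx k z - m))).indicator g z = g z := by
        rw [Set.indicator_of_mem]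
        simp [hcube]
      rw [← h2]
      exact Finset.single_le_sum (f := fun e => (hcube k (m + e)).indicator g z)
        (fun _ _ => zero_le) hz
    · simp [Set.indicator_of_notMem hz]
  refine h1.trans ?_
  refine (eLpNorm_sum_le_card hr _ fun e => hg.indicator (measurableSet_hcube _ _)).trans (le_of_eq ?_)
  simp_rw [eLpNorm_indicator_eq_eLpNorm_restrict (measurableSet_hcube _ _)]

/-- For a fixed step the shear is a translation, so the inner integral is at most the one over U;
the integral over the steps contributes κ |A|. For r = ∞ the exponent 1 / r.toReal is 0 by
convention and the factor disappears, as it must. -/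
lemma eLpNorm_shear_le {r : ℝ≥0∞} (hr : r ≠ 0) {A B U : Set (Fin n → ℝ)}
    (hU : MeasurableSet U) (hA : MeasurableSet A) (hB : MeasurableSet B) (c : ℝ)
    (hABU : ∀ a ∈ A, ∀ b ∈ B, b + c • a ∈ U) {g : (Fin n → ℝ) → ℝ≥0∞} (hg : Measurable g)
    (κ : ℝ≥0∞) :
    eLpNorm (fun z : (Fin n → ℝ) × (Fin n → ℝ) => g (z.2 + c • z.1)) r
      (κ • volume.restrict (A ×ˢ B)) ≤
      (κ * volume A) ^ (1 / r.toReal) * eLpNorm g r (volume.restrict U) := by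
  rcases eq_or_ne r ∞ with rfl | hr'
  · simp only [ENNReal.toReal_top, div_zero, ENNReal.rpow_zero, one_mul, eLpNorm_exponent_top]
    refine eLpNormEssSup_le_of_ae_enorm_bound ?_
    refine Measure.ae_smul_measure ?_ κ
    rw [ae_restrict_iff' (hA.prod hB)]
    have h1 : ∀ᵐ z ∂(volume : Measure (Fin n → ℝ)), z ∈ U →
        g z ≤ eLpNormEssSup g (volume.restrict U) :=
      (ae_restrict_iff' hU).1 (ae_le_eLpNormEssSup (f := g))
    filter_upwards [(quasiMeasurePreserving_shear c).ae h1] with z hz hzAB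
    exact hz (hABU _ hzAB.1 _ hzAB.2)
  · have hs : 0 < r.toReal := ENNReal.toReal_pos hr hr'
    set s := r.toReal with hsdef
    simp_rw [eLpNorm_eq_lintegral_rpow_enorm_toReal hr hr', ← hsdef]
    change (∫⁻ z, g (z.2 + c • z.1) ^ s ∂(κ • volume.restrict (A ×ˢ B))) ^ (1 / s) ≤
      (κ * volume A) ^ (1 / s) * (∫⁻ z in U, g z ^ s) ^ (1 / s)
    rw [← ENNReal.mul_rpow_of_nonneg _ _ (by positivity), lintegral_smul_measure]
    refine ENNReal.rpow_le_rpow ?_ (by positivity)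
    rw [smul_eq_mul, mul_assoc]
    gcongr
    have hm : Measurable fun z : (Fin n → ℝ) × (Fin n → ℝ) => g (z.2 + c • z.1) ^ s :=
      (hg.comp (measurable_snd.add (measurable_fst.const_smul c))).pow_const s
    rw [Measure.volume_eq_prod, ← Measure.prod_restrict, lintegral_prod _ hm.aemeasurable]
    calc ∫⁻ a in A, ∫⁻ b in B, g (b + c • a) ^ s
        ≤ ∫⁻ _ in A, ∫⁻ z in U, g z ^ s := by
          refine setLIntegral_mono' hA fun a ha => ?_
          rw [← lintegral_indicator hB, ← lintegral_indicator hU,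
            ← lintegral_add_right_eq_self (fun z => U.indicator (fun z => g z ^ s) z) (c • a)]
          refine lintegral_mono fun b => ?_
          by_cases hb : b ∈ B
          · rw [Set.indicator_of_mem hb, Set.indicator_of_mem (hABU a ha b hb)]
          · rw [Set.indicator_of_notMem hb]
            exact zero_le
      _ = _ := by
          rw [setLIntegral_const, mul_comm]

/-- A Nikolskii-type inequality. A step function d levels finer has its L_r-norm bounded by its
L_θ-norm through the embedding of ℓ_θ in ℓ_r, and the difference between the two normalisations is
the factor 2^{dn(1/θ - 1/r)}. -/
lemma eLpNorm_step_le {r : ℝ≥0∞} (hr : r ≠ 0) {θ : ℝ} (hθ : 0 < θ) (hθr : ENNReal.ofReal θ ≤ r)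
    (k d : ℕ) (m : Fin n → ℤ) (b : (Fin n → ℤ) → ℝ≥0∞) :
    ((2 : ℝ≥0∞) ^ (k * n)) ^ (1 / r.toReal) *
      eLpNorm (fun z => b (idx (k + d) z)) r (volume.restrict (hcube k m)) ≤
      2 ^ ((d : ℝ) * (n * (1 / θ - (r⁻¹).toReal))) *
        (((2 : ℝ≥0∞) ^ (d * n))⁻¹ * ∑' M, if par d M = m then b M ^ θ else 0) ^ (1 / θ) := by
  set S := ∑' M, (if par d M = m then b M ^ θ else 0) with hS
  have hfac : (2 : ℝ≥0∞) ^ ((d : ℝ) * (n * (1 / θ - (r⁻¹).toReal))) *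
      (((2 : ℝ≥0∞) ^ (d * n))⁻¹ * S) ^ (1 / θ) =
      2 ^ (-((d : ℝ) * n * (r⁻¹).toReal)) * S ^ (1 / θ) := by
    rw [ENNReal.mul_rpow_of_nonneg _ _ (by positivity), ← mul_assoc]
    congr 1
    rw [← ENNReal.rpow_natCast, ← ENNReal.rpow_neg, ← ENNReal.rpow_mul,
      ← ENNReal.rpow_add _ _ two_ne_zero ENNReal.ofNat_ne_top]
    congr 1
    push_cast
    ring
  rw [hfac]
  rcases eq_or_ne r ∞ with rfl | hr'
  · simp only [ENNReal.toReal_top, div_zero, ENNReal.rpow_zero, one_mul, eLpNorm_exponent_top,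
      ENNReal.inv_top, ENNReal.toReal_zero, mul_zero, neg_zero]
    refine eLpNormEssSup_le_of_ae_enorm_bound ?_
    rw [ae_restrict_iff' (measurableSet_hcube k m)]
    refine Eventually.of_forall fun z hz => ?_
    have h1 : b (idx (k + d) z) ^ θ ≤ S := by
      refine le_trans (le_of_eq ?_) (ENNReal.le_tsum (idx (k + d) z))
      rw [if_pos]
      rw [par_idx]
      exact hz
    calc b (idx (k + d) z) = (b (idx (k + d) z) ^ θ) ^ (1 / θ) := by
          rw [← ENNReal.rpow_mul, mul_one_div_cancel hθ.ne', ENNReal.rpow_one]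
      _ ≤ _ := ENNReal.rpow_le_rpow h1 (by positivity)
  · have hs : 0 < r.toReal := ENNReal.toReal_pos hr hr'
    have hθs : θ ≤ r.toReal := (ENNReal.ofReal_le_iff_le_toReal hr').1 hθr
    rw [ENNReal.toReal_inv]
    set s := r.toReal with hsdef
    simp_rw [eLpNorm_eq_lintegral_rpow_enorm_toReal hr hr', ← hsdef]
    change ((2 : ℝ≥0∞) ^ (k * n)) ^ (1 / s) * (∫⁻ z in hcube k m, b (idx (k + d) z) ^ s) ^ (1 / s) ≤ _
    rw [setLIntegral_hcube_eq_tsum k d]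
    simp_rw [setLIntegral_idx (k + d) _ fun M => b M ^ s]
    rw [← ENNReal.mul_rpow_of_nonneg _ _ (by positivity), ← ENNReal.tsum_mul_left]
    have h1 : ∀ M, (2 : ℝ≥0∞) ^ (k * n) *
        (if par d M = m then ((2 : ℝ≥0∞) ^ ((k + d) * n))⁻¹ * b M ^ s else 0) =
        ((2 : ℝ≥0∞) ^ (d * n))⁻¹ * (if par d M = m then b M ^ θ else 0) ^ (s / θ) := by
      intro M
      split_ifs
      · rw [← mul_assoc, two_pow_mul_inv, ← ENNReal.rpow_mul, mul_div_cancel₀ _ hθ.ne']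
      · rw [ENNReal.zero_rpow_of_pos (by positivity)]
        simp
    simp_rw [h1]
    rw [ENNReal.tsum_mul_left, ENNReal.mul_rpow_of_nonneg _ _ (by positivity)]
    refine mul_le_mul' (le_of_eq ?_) ?_
    · rw [← ENNReal.rpow_natCast, ← ENNReal.rpow_neg, ← ENNReal.rpow_mul]
      congr 1
      push_cast
      field_simp
    · calc (∑' M, (if par d M = m then b M ^ θ else 0) ^ (s / θ)) ^ (1 / s)
          ≤ (S ^ (s / θ)) ^ (1 / s) := by
            refine ENNReal.rpow_le_rpow (tsum_rpow_le_rpow_tsum ?_ _) (by positivity)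
            rwa [le_div_iff₀ hθ, one_mul]
        _ = _ := by
            rw [← ENNReal.rpow_mul]
            congr 1
            field_simp

/-! ## Differences -/

lemma diff_eq_fwdDiff (l : ℕ) (h : Fin n → ℝ) (φ : (Fin n → ℝ) → ℝ) :
    diff l h φ = (fwdDiff h)^[l] φ := by
  funext x
  rw [fwdDiff_iter_eq_sum_shift]
  unfold diff
  refine Finset.sum_congr rfl fun j hj => ?_
  have hj' : j ≤ l := Nat.lt_succ_iff.1 (Finset.mem_range.1 hj)
  have h1 : (-1 : ℝ) ^ (l + j) = (-1) ^ (l - j) := by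
    rw [show l + j = (l - j) + 2 * j by omega, pow_add, pow_mul]
    simp
  rw [h1, zsmul_eq_mul, Nat.cast_smul_eq_nsmul]
  push_cast
  ring

lemma diff_add_order (a b : ℕ) (h : Fin n → ℝ) (φ : (Fin n → ℝ) → ℝ) :
    diff (a + b) h φ = diff a h (diff b h φ) := by
  simp only [diff_eq_fwdDiff, Function.iterate_add_apply]

@[simp] lemma diff_zero_order (h : Fin n → ℝ) (φ : (Fin n → ℝ) → ℝ) : diff 0 h φ = φ := by
  simp [diff_eq_fwdDiff]

lemma diff_one (h : Fin n → ℝ) (φ : (Fin n → ℝ) → ℝ) (x : Fin n → ℝ) :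
    diff 1 h φ x = φ (x + h) - φ x := by
  simp [diff_eq_fwdDiff, fwdDiff]

lemma diff_add (l : ℕ) (h : Fin n → ℝ) (φ ψ : (Fin n → ℝ) → ℝ) :
    diff l h (φ + ψ) = diff l h φ + diff l h ψ := by
  simp only [diff_eq_fwdDiff, fwdDiff_iter_add]

lemma diff_const_smul (l : ℕ) (h : Fin n → ℝ) (c : ℝ) (φ : (Fin n → ℝ) → ℝ) :
    diff l h (c • φ) = c • diff l h φ := by
  simp only [diff_eq_fwdDiff, fwdDiff_iter_const_smul]

lemma diff_sub (l : ℕ) (h : Fin n → ℝ) (φ ψ : (Fin n → ℝ) → ℝ) :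
    diff l h (φ - ψ) = diff l h φ - diff l h ψ := by
  rw [sub_eq_add_neg, ← neg_one_smul ℝ ψ, diff_add, diff_const_smul, neg_one_smul, sub_eq_add_neg]

lemma enorm_diff_le (l : ℕ) (h : Fin n → ℝ) (φ : (Fin n → ℝ) → ℝ) (x : Fin n → ℝ) :
    ‖diff l h φ x‖ₑ ≤ ∑ j ∈ Finset.range (l + 1), (2 : ℝ≥0∞) ^ l * ‖φ (x + (j : ℝ) • h)‖ₑ := by
  unfold diff
  refine (enorm_sum_le _ _).trans (Finset.sum_le_sum fun j _ => ?_)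
  rw [enorm_mul, enorm_mul, enorm_pow, enorm_neg]
  simp only [enorm_one, one_pow, one_mul]
  gcongr
  rw [Real.enorm_eq_ofReal (by positivity), ENNReal.ofReal_natCast]
  exact_mod_cast Nat.choose_le_two_pow l j

/-! ## Blocks -/

/-- `φ` is smooth of order `l` at the scale `2^{-k}`, with local bounds `b`. -/
def IsBlock (k l : ℕ) (φ : (Fin n → ℝ) → ℝ) (b : (Fin n → ℤ) → ℝ≥0∞) : Prop :=
  ∀ x h, ∀ i ≤ l, ‖h‖ ≤ ((2 : ℝ) ^ k)⁻¹ →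
    ‖diff i h φ x‖ₑ ≤ b (idx k x) * ENNReal.ofReal (2 ^ k * ‖h‖) ^ i

lemma IsBlock.enorm_le {k l : ℕ} {φ : (Fin n → ℝ) → ℝ} {b : (Fin n → ℤ) → ℝ≥0∞}
    (hb : IsBlock k l φ b) (x : Fin n → ℝ) : ‖φ x‖ₑ ≤ b (idx k x) := by
  simpa using hb x 0 0 (Nat.zero_le l) (by simp)

lemma isBlock_zero (k l : ℕ) (b : (Fin n → ℤ) → ℝ≥0∞) : IsBlock k l (0 : (Fin n → ℝ) → ℝ) b := by
  intro x h i _ _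
  have h0 : diff i h (0 : (Fin n → ℝ) → ℝ) = 0 := by
    have := diff_const_smul i h 0 (0 : (Fin n → ℝ) → ℝ)
    simpa using this
  rw [h0]
  simp

lemma IsBlock.mono_order {k l l' : ℕ} {φ : (Fin n → ℝ) → ℝ} {b : (Fin n → ℤ) → ℝ≥0∞}
    (hb : IsBlock k l φ b) (h : l' ≤ l) : IsBlock k l' φ b :=
  fun x v i hi => hb x v i (hi.trans h)

/-- Differences of a block at a finer scale. -/
lemma IsBlock.enorm_diff_le {j l L d : ℕ} {φ : (Fin n → ℝ) → ℝ} {b : (Fin n → ℤ) → ℝ≥0∞}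
    (hb : IsBlock j l φ b) (hlL : l ≤ L) (hd : 1 ≤ d) {x y h : Fin n → ℝ}
    (hy : ∀ i, |y i - x i| ≤ (1 / 2) ^ (j + d)) (hh : ‖h‖ ≤ 2 * (1 / 2) ^ (j + d)) :
    ‖diff L h φ y‖ₑ ≤ (L + 1) * (2 ^ L * 2 ^ l) *
      (geo (-(l : ℝ)) (j + d) j * ∑ e ∈ nbhd n (2 * L + 2), b (idx j x + e)) := by
  -- Split the difference of order L = l + a: the inner difference of order l brings the decay
  -- 2^{-ld}, and the outer one is only a bounded combination of translates.
  obtain ⟨a, rfl⟩ := Nat.exists_eq_add_of_le hlL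
  have hjd : (1 / 2 : ℝ) ^ (j + d) = (1 / 2) ^ d * ((2 : ℝ) ^ j)⁻¹ := by
    rw [pow_add, one_div_pow (2 : ℝ) j]
    ring
  have hd1 : (1 / 2 : ℝ) ^ d ≤ 1 / 2 := by
    calc (1 / 2 : ℝ) ^ d ≤ (1 / 2) ^ 1 := pow_le_pow_of_le_one (by norm_num) (by norm_num) hd
      _ = _ := by norm_num
  have h2j : (0 : ℝ) < ((2 : ℝ) ^ j)⁻¹ := by positivity
  have hh' : ‖h‖ ≤ ((2 : ℝ) ^ j)⁻¹ := by
    refine hh.trans ?_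
    rw [hjd]
    nlinarith
  rw [add_comm l a, diff_add_order]
  refine (VarBesov.enorm_diff_le a h _ y).trans ?_
  have hscale : ENNReal.ofReal (2 ^ j * ‖h‖) ^ l ≤ 2 ^ l * geo (-(l : ℝ)) (j + d) j := by
    have h1 : (2 : ℝ) ^ j * ‖h‖ ≤ 2 * (1 / 2) ^ d := by
      calc (2 : ℝ) ^ j * ‖h‖ ≤ 2 ^ j * (2 * ((1 / 2) ^ d * ((2 : ℝ) ^ j)⁻¹)) := by
            rw [← hjd]
            gcongr
        _ = _ := by field_simp
    have h2 : ENNReal.ofReal (2 * (1 / 2) ^ d) = 2 * (2 : ℝ≥0∞) ^ (-(d : ℝ)) := by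
      rw [ENNReal.ofReal_mul (by norm_num), ENNReal.ofReal_pow (by norm_num), ENNReal.rpow_neg,
        ENNReal.rpow_natCast, one_div, ENNReal.ofReal_inv_of_pos (by norm_num)]
      simp [ENNReal.inv_pow]
    calc ENNReal.ofReal (2 ^ j * ‖h‖) ^ l ≤ ENNReal.ofReal (2 * (1 / 2) ^ d) ^ l := by gcongr
      _ = 2 ^ l * geo (-(l : ℝ)) (j + d) j := by
          rw [h2, mul_pow, geo_add_left, ← ENNReal.rpow_natCast ((2 : ℝ≥0∞) ^ (-(d : ℝ))),
            ← ENNReal.rpow_mul]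
          congr 2
          ring
  have hterm : ∀ i ∈ Finset.range (a + 1), (2 : ℝ≥0∞) ^ a * ‖diff l h φ (y + (i : ℝ) • h)‖ₑ ≤
      (2 ^ (l + a) * 2 ^ l) *
        (geo (-(l : ℝ)) (j + d) j * ∑ e ∈ nbhd n (2 * (l + a) + 2), b (idx j x + e)) := by
    intro i hi
    have hia : i ≤ a := Nat.lt_succ_iff.1 (Finset.mem_range.1 hi)
    have h1 := hb (y + (i : ℝ) • h) h l le_rfl hh'
    -- The translated points stay within (2L + 1) 2^{-j} of x; rounding to indices costs one more,
    -- whence the radius 2L + 2.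
    have h2 : idx j (y + (i : ℝ) • h) - idx j x ∈ nbhd n (2 * (l + a) + 1 + 1) := by
      refine idx_sub_mem_nbhd fun s => ?_
      have e1 := hy s
      have e2 : |h s| ≤ 2 * (1 / 2) ^ (j + d) := (norm_le_pi_norm h s).trans hh
      have e3 : |y s + i * h s - x s| ≤ |y s - x s| + i * |h s| := by
        calc |y s + i * h s - x s| = |(y s - x s) + i * h s| := by ring_nf
          _ ≤ _ := (abs_add_le _ _).trans (by rw [abs_mul, Nat.abs_cast])
      have e4 : (i : ℝ) ≤ a := by exact_mod_cast hia
      have e6 : (i : ℝ) * |h s| ≤ a * (2 * (1 / 2) ^ (j + d)) := by gcongr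
      simp only [Pi.add_apply, Pi.smul_apply, smul_eq_mul]
      refine e3.trans ((add_le_add e1 e6).trans ?_)
      have e5 : (1 / 2 : ℝ) ^ (j + d) ≤ ((2 : ℝ) ^ j)⁻¹ := by rw [hjd]; nlinarith
      push_cast
      rw [div_eq_mul_inv]
      calc (1 / 2 : ℝ) ^ (j + d) + a * (2 * (1 / 2) ^ (j + d))
          = (2 * a + 1) * (1 / 2) ^ (j + d) := by ring
        _ ≤ (2 * (l + a) + 1) * ((2 : ℝ) ^ j)⁻¹ := by
            gcongr
            linarith [(Nat.cast_nonneg l : (0 : ℝ) ≤ l)]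
    have h3 : b (idx j (y + (i : ℝ) • h)) ≤ ∑ e ∈ nbhd n (2 * (l + a) + 2), b (idx j x + e) := by
      have := Finset.single_le_sum (f := fun e => b (idx j x + e)) (fun _ _ => zero_le) h2
      simpa using this
    calc (2 : ℝ≥0∞) ^ a * ‖diff l h φ (y + (i : ℝ) • h)‖ₑ
        ≤ 2 ^ (l + a) * ((∑ e ∈ nbhd n (2 * (l + a) + 2), b (idx j x + e)) *
          (2 ^ l * geo (-(l : ℝ)) (j + d) j)) := by
          gcongr
          · norm_num
          · omega
          · exact h1.trans (by gcongr)
      _ = _ := by ring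
  refine (Finset.sum_le_sum hterm).trans ?_
  rw [Finset.sum_const, nsmul_eq_mul, Finset.card_range, mul_assoc ((((a + l : ℕ) : ℝ≥0∞) + 1)),
    add_comm a l]
  gcongr
  push_cast
  gcongr
  exact le_add_self

/-! ## Local quasi-norms of a series of blocks -/

/-- The normalised `L_r`-quasi-norm over a level `k` cube of the step function with coefficients
`b` at level `j`. -/
def stepNorm (r : ℝ≥0∞) (k j : ℕ) (b : (Fin n → ℤ) → ℝ≥0∞) (m : Fin n → ℤ) : ℝ≥0∞ :=
  ((2 : ℝ≥0∞) ^ (k * n)) ^ (1 / r.toReal) *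
    eLpNorm (fun z => b (idx j z)) r (volume.restrict (hcube k m))

/-- The contribution of level `j` to the local quasi-norms at level `k`. -/
def levelTerm (r : ℝ≥0∞) (l c : ℕ) (ε : ℝ) (b : ℕ → (Fin n → ℤ) → ℝ≥0∞) (k j : ℕ)
    (m : Fin n → ℤ) : ℝ≥0∞ :=
  if j < k then geo (-(l : ℝ)) k j * ∑ e ∈ nbhd n c, b j (par (k - j) m + e)
  else ∑ e ∈ nbhd n c, geo ε k j * stepNorm r k j (b j) (m + e)

/-- The majorant of the part of a series of blocks with levels at least `k`. -/
def tailMajorant (b : ℕ → (Fin n → ℤ) → ℝ≥0∞) (k : ℕ) (z : Fin n → ℝ) : ℝ≥0∞ :=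
  ∑' j, if k ≤ j then b j (idx j z) else 0

lemma measurable_comp_idx (j : ℕ) (b : (Fin n → ℤ) → ℝ≥0∞) :
    Measurable fun z : Fin n → ℝ => b (idx j z) :=
  (measurable_of_countable b).comp (measurable_idx j)

lemma measurable_tailMajorant_term (b : ℕ → (Fin n → ℤ) → ℝ≥0∞) (k j : ℕ) :
    Measurable fun z : Fin n → ℝ => if k ≤ j then b j (idx j z) else 0 := by
  split_ifs
  · exact measurable_comp_idx j (b j)
  · exact measurable_const

lemma measurable_tailMajorant (b : ℕ → (Fin n → ℤ) → ℝ≥0∞) (k : ℕ) :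
    Measurable (tailMajorant b k : (Fin n → ℝ) → ℝ≥0∞) :=
  Measurable.tsum fun j => measurable_tailMajorant_term b k j

/-- Cover U by the neighbouring cubes of level k and apply the quasi-triangle inequality for series
on each. Levels coarser than k are absent from the tail, so bounding them by their level terms is
free. -/
lemma eLpNorm_tailMajorant_le {r : ℝ≥0∞} (hr : r ≠ 0) {ε : ℝ} (hε : 0 < ε) (l c : ℕ)
    (b : ℕ → (Fin n → ℤ) → ℝ≥0∞) (k : ℕ) (m : Fin n → ℤ) {U : Set (Fin n → ℝ)}
    (hU : ∀ z ∈ U, idx k z - m ∈ nbhd n c) :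
    ((2 : ℝ≥0∞) ^ (k * n)) ^ (1 / r.toReal) * eLpNorm (tailMajorant b k) r (volume.restrict U) ≤
      (nbhd n c).card * (((nbhd n c).card : ℝ≥0∞) ^ (1 / r.toReal) * tsumConst r ε) *
        ∑' j, levelTerm r l c ε b k j m := by
  set N := ((2 : ℝ≥0∞) ^ (k * n)) ^ (1 / r.toReal) with hN
  have h1 : ∀ e, eLpNorm (tailMajorant b k) r (volume.restrict (hcube k (m + e))) ≤
      tsumConst r ε * ∑' j, geo ε k j * eLpNorm (fun z => if k ≤ j then b j (idx j z) else 0) r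
        (volume.restrict (hcube k (m + e))) := fun e =>
    eLpNorm_tsum_le hr hε k (measurable_tailMajorant_term b k)
  calc N * eLpNorm (tailMajorant b k) r (volume.restrict U)
      ≤ N * ((nbhd n c).card * (((nbhd n c).card : ℝ≥0∞) ^ (1 / r.toReal) *
        ∑ e ∈ nbhd n c, tsumConst r ε * ∑' j, geo ε k j *
          eLpNorm (fun z => if k ≤ j then b j (idx j z) else 0) r
          (volume.restrict (hcube k (m + e))))) := by
        gcongr
        refine (eLpNorm_restrict_le_sum_hcube hr hU (measurable_tailMajorant b k)).trans ?_
        gcongr with e he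
        exact h1 e
    _ = (nbhd n c).card * (((nbhd n c).card : ℝ≥0∞) ^ (1 / r.toReal) * tsumConst r ε) *
        ∑' j, ∑ e ∈ nbhd n c, geo ε k j * (N *
          eLpNorm (fun z => if k ≤ j then b j (idx j z) else 0) r
          (volume.restrict (hcube k (m + e)))) := by
        rw [Summable.tsum_finsetSum fun _ _ => ENNReal.summable, ← Finset.mul_sum]
        have : ∀ e, ∑' j, geo ε k j * (N *
            eLpNorm (fun z => if k ≤ j then b j (idx j z) else 0) r
            (volume.restrict (hcube k (m + e)))) = N * ∑' j, geo ε k j *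
            eLpNorm (fun z => if k ≤ j then b j (idx j z) else 0) r
            (volume.restrict (hcube k (m + e))) := fun e => by
          rw [← ENNReal.tsum_mul_left]
          exact tsum_congr fun j => by ring
        simp_rw [this]
        rw [← Finset.mul_sum]
        ring
    _ ≤ _ := by
        gcongr with j
        unfold levelTerm
        rcases lt_or_ge j k with hjk | hjk
        · refine le_trans (le_of_eq ?_) (zero_le)
          refine Finset.sum_eq_zero fun e _ => ?_
          simp only [not_le.2 hjk, if_false]
          rw [eLpNorm_zero']
          simp
        · rw [if_neg (not_lt.2 hjk)]
          refine Finset.sum_le_sum fun e _ => ?_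
          simp only [hjk, if_true]
          exact le_rfl

section Series

variable {l : ℕ} {φ : ℕ → (Fin n → ℝ) → ℝ} {b : ℕ → (Fin n → ℤ) → ℝ≥0∞}

lemma enorm_series_le (hb : ∀ j, IsBlock j l (φ j) (b j)) (z : Fin n → ℝ) :
    ∑' j, ‖φ j z‖ₑ ≤ tailMajorant b 0 z := by
  refine ENNReal.tsum_le_tsum fun j => ?_
  simpa using (hb j).enorm_le z

lemma volume_cube (x : Fin n → ℝ) (s : ℝ) : volume (cube x s) = ENNReal.ofReal s ^ n := by
  have h : cube x s = Set.univ.pi fun i => Set.Ioo (x i - s / 2) (x i + s / 2) := by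
    ext y
    simp only [cube, Set.mem_ofPred_eq, Set.mem_univ_pi, Set.mem_Ioo, abs_lt]
    refine forall_congr' fun i => ?_
    constructor <;> rintro ⟨h1, h2⟩ <;> constructor <;> linarith
  rw [h, Real.volume_pi_Ioo]
  have : ∀ i, x i + s / 2 - (x i - s / 2) = s := fun i => by ring
  simp_rw [this]
  simp

lemma measurableSet_cube (x : Fin n → ℝ) (s : ℝ) : MeasurableSet (cube x s) :=
  measurable_prodMk_left (measurableSet_cubeFamily s)

lemma idx_sub_mem_of_mem_cube {k : ℕ} {x z : Fin n → ℝ} (hz : z ∈ cube x (2 * (1 / 2) ^ k)) :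
    idx k z - idx k x ∈ nbhd n 2 := by
  refine idx_sub_mem_nbhd (c := 1) fun i => ?_
  have := hz i
  rw [one_div_pow] at this
  push_cast
  linarith

lemma nbhd_mono {c c' : ℕ} (h : c ≤ c') : nbhd n c ⊆ nbhd n c' := fun e he => by
  rw [mem_nbhd] at he ⊢
  intro i
  exact (he i).trans (by exact_mod_cast h)

/-- The series is split at the level k of the cube. For j < k the difference of order L gains
2^{-l(k-j)} from the smoothness of the blocks. For j ≥ k smoothness is useless, and the difference
is bounded by translates of the majorant of the tail. -/
lemma delta_series_le {r : ℝ≥0∞} (hr : r ≠ 0) {ε : ℝ} (hε : 0 < ε) (l : ℕ) {L : ℕ} (hlL : l ≤ L) :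
    ∃ C : ℝ≥0∞, C ≠ ∞ ∧ ∀ (φ : ℕ → (Fin n → ℝ) → ℝ) (b : ℕ → (Fin n → ℤ) → ℝ≥0∞)
      (Φ : (Fin n → ℝ) → ℝ), (∀ j, IsBlock j l (φ j) (b j)) →
      (∀ᵐ z, HasSum (fun j => φ j z) (Φ z)) → ∀ k x,
      delta L r x (2 * (1 / 2) ^ k) Φ ≤
        C * ∑' j, levelTerm r l (2 * L + 2) ε b k j (idx k x) := by
  set c := 2 * L + 2 with hc
  set C₁ : ℝ≥0∞ := (L + 1) * (2 ^ L * 2 ^ l) with hC₁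
  set C₂ : ℝ≥0∞ := (nbhd n c).card * (((nbhd n c).card : ℝ≥0∞) ^ (1 / r.toReal) * tsumConst r ε)
    with hC₂
  have hrp : 0 ≤ 1 / r.toReal := by positivity
  have hC₂t : C₂ ≠ ∞ := ENNReal.mul_ne_top (by simp) (ENNReal.mul_ne_top
    (ENNReal.rpow_ne_top_of_nonneg hrp (by simp)) (tsumConst_ne_top hr hε))
  set K : ℝ≥0∞ := ((L + 1 : ℕ) : ℝ≥0∞) * (((L + 1 : ℕ) : ℝ≥0∞) ^ (1 / r.toReal) *
    ((L + 1 : ℕ) * (2 ^ L * C₂))) with hK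
  refine ⟨ENNReal.LpAddConst r * (((2 : ℝ≥0∞) ^ n) ^ (1 / r.toReal) * C₁ + K), ?_, ?_⟩
  · refine ENNReal.mul_ne_top (ENNReal.LpAddConst_lt_top r).ne (ENNReal.add_ne_top.2 ⟨?_, ?_⟩)
    · refine ENNReal.mul_ne_top (ENNReal.rpow_ne_top_of_nonneg hrp (by simp)) ?_
      rw [hC₁]
      finiteness
    · rw [hK]
      exact ENNReal.mul_ne_top (by simp) (ENNReal.mul_ne_top
        (ENNReal.rpow_ne_top_of_nonneg hrp (by simp))
        (ENNReal.mul_ne_top (by simp) (ENNReal.mul_ne_top (by simp) hC₂t)))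
  intro φ b Φ hb hΦ k x
  set s : ℝ := 2 * (1 / 2) ^ k with hs
  have hs0 : 0 < s := by positivity
  set Y := ∑' j, levelTerm r l c ε b k j (idx k x) with hY
  set Lo : ℝ≥0∞ := ∑' j, if j < k then levelTerm r l c ε b k j (idx k x) else 0 with hLo
  have hLoY : Lo ≤ Y := ENNReal.tsum_le_tsum fun j => by split_ifs <;> simp
  set A : Set (Fin n → ℝ) := cube 0 (2 * s) with hA
  set B : Set (Fin n → ℝ) := cube x s with hB
  set κ : ℝ≥0∞ := ENNReal.ofReal ((s ^ (2 * n))⁻¹) with hκ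
  set U : Set (Fin n → ℝ) := {z | idx k z - idx k x ∈ nbhd n c} with hU
  have hUm : MeasurableSet U := by
    have : U = idx k ⁻¹' {M | M - idx k x ∈ nbhd n c} := rfl
    rw [this]
    exact measurable_idx k (Set.to_countable _).measurableSet
  have hmem : ∀ h ∈ A, ∀ y ∈ B, ∀ i ∈ Finset.range (L + 1), y + (i : ℝ) • h ∈ U := by
    intro h hh y hy i hi
    have hiL : (i : ℝ) ≤ L := by exact_mod_cast Nat.lt_succ_iff.1 (Finset.mem_range.1 hi)
    refine idx_sub_mem_nbhd (c := 2 * L + 1) fun u => ?_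
    have e1 := (hy u).le
    have e2 : |h u| ≤ s := by
      have := (hh u).le
      simp only [Pi.zero_apply, sub_zero] at this
      linarith
    simp only [Pi.add_apply, Pi.smul_apply, smul_eq_mul]
    have e3 : |y u + i * h u - x u| ≤ |y u - x u| + i * |h u| := by
      calc |y u + i * h u - x u| = |(y u - x u) + i * h u| := by ring_nf
        _ ≤ _ := (abs_add_le _ _).trans (by rw [abs_mul, Nat.abs_cast])
    have e4 : (i : ℝ) * |h u| ≤ L * s := by gcongr
    refine e3.trans ((add_le_add e1 e4).trans (le_of_eq ?_))
    rw [hs, one_div_pow]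
    push_cast
    ring
  -- The coarse part is bounded by a constant on the whole product set; only the fine part depends
  -- on the point.
  have hpt : ∀ᵐ z ∂(κ • volume.restrict (A ×ˢ B)), ‖diff L z.1 Φ z.2‖ₑ ≤
      C₁ * Lo + ∑ i ∈ Finset.range (L + 1), 2 ^ L * tailMajorant b k (z.2 + (i : ℝ) • z.1) := by
    refine Measure.ae_smul_measure ?_ κ
    rw [ae_restrict_iff' ((measurableSet_cube _ _).prod (measurableSet_cube _ _))]
    have hall : ∀ᵐ z : (Fin n → ℝ) × (Fin n → ℝ), ∀ i : ℕ,
        HasSum (fun j => φ j (z.2 + (i : ℝ) • z.1)) (Φ (z.2 + (i : ℝ) • z.1)) :=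
      ae_all_iff.2 fun i => (quasiMeasurePreserving_shear (i : ℝ)).ae hΦ
    filter_upwards [hall] with z hz hzAB
    obtain ⟨hz1, hz2⟩ := hzAB
    have hsum : HasSum (fun j => diff L z.1 (φ j) z.2) (diff L z.1 Φ z.2) := by
      unfold diff
      exact hasSum_sum fun i _ => (hz i).mul_left _
    rw [← hsum.tsum_eq]
    refine enorm_tsum_le_tsum_enorm.trans ?_
    have hj : ∀ j, ‖diff L z.1 (φ j) z.2‖ₑ ≤
        C₁ * (if j < k then levelTerm r l c ε b k j (idx k x) else 0) +
        ∑ i ∈ Finset.range (L + 1), 2 ^ L *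
          (if k ≤ j then b j (idx j (z.2 + (i : ℝ) • z.1)) else 0) := by
      intro j
      by_cases hjk : j < k
      · obtain ⟨d, hd⟩ := Nat.exists_eq_add_of_lt hjk
        have h1 := (hb j).enorm_diff_le hlL (d := d + 1) (by omega) (x := x) (y := z.2) (h := z.1)
          (fun i => by
            have := (hz2 i).le
            rw [← add_assoc, ← hd]
            rw [hs] at this
            linarith)
          (by
            rw [← add_assoc, ← hd, ← hs]
            rw [pi_norm_le_iff_of_nonneg hs0.le]
            intro i
            have := (hz1 i).le
            simp only [Pi.zero_apply, sub_zero] at this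
            rw [Real.norm_eq_abs]
            linarith)
        rw [if_pos hjk]
        refine le_trans h1 (le_trans (le_of_eq ?_) le_self_add)
        unfold levelTerm
        rw [if_pos hjk]
        have hk : k = j + (d + 1) := by omega
        rw [hk, Nat.add_sub_cancel_left, par_idx]
      · rw [if_neg hjk, mul_zero, zero_add]
        refine (enorm_diff_le L z.1 (φ j) z.2).trans ?_
        gcongr with i hi
        rw [if_pos (not_lt.1 hjk)]
        exact (hb j).enorm_le _
    refine (ENNReal.tsum_le_tsum hj).trans (le_of_eq ?_)
    rw [ENNReal.tsum_add, ENNReal.tsum_mul_left, Summable.tsum_finsetSum fun _ _ => ENNReal.summable]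
    simp_rw [ENNReal.tsum_mul_left]
    rfl
  have hmeasi : ∀ i : ℕ, Measurable fun z : (Fin n → ℝ) × (Fin n → ℝ) =>
      2 ^ L * tailMajorant b k (z.2 + (i : ℝ) • z.1) := fun i =>
    ((measurable_tailMajorant b k).comp
      (measurable_snd.add (measurable_fst.const_smul (i : ℝ)))).const_mul _
  -- The normalised measure of the set of steps is exactly the factor that normalises an L_r-norm
  -- over a cube of level k.
  have hκA : κ * volume A = (2 : ℝ≥0∞) ^ (k * n) := by
    rw [hκ, hA, volume_cube, ← ENNReal.ofReal_pow (by positivity), ← ENNReal.ofReal_mul (by positivity)]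
    rw [show (s ^ (2 * n))⁻¹ * (2 * s) ^ n = 2 ^ (k * n) from ?_]
    · rw [ENNReal.ofReal_pow (by norm_num)]
      simp
    · have : (2 * s) ^ n = s ^ (2 * n) * 2 ^ (k * n) := by
        rw [pow_mul s, pow_mul (2 : ℝ), ← mul_pow]
        congr 1
        rw [hs, one_div_pow]
        field_simp
      rw [this]
      field_simp
  have hconst : eLpNorm (fun _ : (Fin n → ℝ) × (Fin n → ℝ) => C₁ * Lo) r
      (κ • volume.restrict (A ×ˢ B)) ≤ ((2 : ℝ≥0∞) ^ n) ^ (1 / r.toReal) * C₁ * Y := by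
    have hmass : (κ • volume.restrict (A ×ˢ B)) Set.univ = (2 : ℝ≥0∞) ^ n := by
      rw [Measure.smul_apply, Measure.restrict_apply_univ, Measure.volume_eq_prod, Measure.prod_prod,
        smul_eq_mul, ← mul_assoc, hκA, hB, volume_cube, pow_mul, ← mul_pow]
      congr 1
      rw [hs, ENNReal.ofReal_mul (by norm_num), ENNReal.ofReal_pow (by norm_num), one_div,
        ENNReal.ofReal_inv_of_pos (by norm_num)]
      simp only [ENNReal.ofReal_ofNat]
      rw [mul_comm 2, ← mul_assoc, ← mul_pow, ENNReal.mul_inv_cancel (by simp) (by simp), one_pow,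
        one_mul]
    refine (eLpNorm_le_of_ae_enorm_bound (C := C₁ * Lo) (Eventually.of_forall fun _ => le_rfl)).trans ?_
    rw [hmass, smul_eq_mul, ← one_div]
    refine le_trans (le_of_eq (by ring : _ = ((2 : ℝ≥0∞) ^ n) ^ (1 / r.toReal) * C₁ * Lo)) ?_
    gcongr
  have hsumi : eLpNorm (fun z : (Fin n → ℝ) × (Fin n → ℝ) => ∑ i ∈ Finset.range (L + 1),
      2 ^ L * tailMajorant b k (z.2 + (i : ℝ) • z.1)) r (κ • volume.restrict (A ×ˢ B)) ≤ K * Y := by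
    refine (eLpNorm_sum_le_card hr _ hmeasi).trans ?_
    rw [Finset.card_range, hK, mul_assoc, mul_assoc]
    gcongr
    have hi : ∀ i ∈ Finset.range (L + 1), eLpNorm (fun z : (Fin n → ℝ) × (Fin n → ℝ) =>
        2 ^ L * tailMajorant b k (z.2 + (i : ℝ) • z.1)) r (κ • volume.restrict (A ×ˢ B)) ≤
        2 ^ L * C₂ * Y := by
      intro i hi
      have h1 := eLpNorm_shear_le hr hUm (measurableSet_cube 0 (2 * s)) (measurableSet_cube x s) (i : ℝ)
        (fun h hh y hy => hmem h hh y hy i hi) (measurable_tailMajorant b k) κ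
      rw [hκA] at h1
      have h2 := h1.trans (eLpNorm_tailMajorant_le hr hε l c b k (idx k x) (U := U) fun z hz => hz)
      have h3 := eLpNorm_le_nnreal_smul_eLpNorm_of_ae_le_mul' (p := r)
        (μ := κ • volume.restrict (A ×ˢ B)) (c := 2 ^ L)
        (f := fun z : (Fin n → ℝ) × (Fin n → ℝ) => 2 ^ L * tailMajorant b k (z.2 + (i : ℝ) • z.1))
        (g := fun z : (Fin n → ℝ) × (Fin n → ℝ) => tailMajorant b k (z.2 + (i : ℝ) • z.1))
        (Eventually.of_forall fun z => by simp)
      refine h3.trans ?_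
      rw [ENNReal.smul_def, smul_eq_mul, mul_assoc]
      push_cast
      gcongr
    refine (Finset.sum_le_sum hi).trans (le_of_eq ?_)
    rw [Finset.sum_const, Finset.card_range, nsmul_eq_mul]
    ring
  unfold delta
  calc eLpNorm (fun z : (Fin n → ℝ) × (Fin n → ℝ) => diff L z.1 Φ z.2) r
        (κ • volume.restrict (A ×ˢ B))
      ≤ eLpNorm ((fun _ => C₁ * Lo) + fun z : (Fin n → ℝ) × (Fin n → ℝ) =>
          ∑ i ∈ Finset.range (L + 1), 2 ^ L * tailMajorant b k (z.2 + (i : ℝ) • z.1)) r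
          (κ • volume.restrict (A ×ˢ B)) := eLpNorm_mono_enorm_ae hpt
    _ ≤ ENNReal.LpAddConst r * (((2 : ℝ≥0∞) ^ n) ^ (1 / r.toReal) * C₁ * Y + K * Y) := by
        refine (eLpNorm_add_le' measurable_const.aestronglyMeasurable
          (Finset.measurable_fun_sum _ fun i _ => hmeasi i).aestronglyMeasurable r).trans ?_
        gcongr
    _ = _ := by ring

end Series

/-! ## The quasi-norm of a series of blocks -/

/-- The `p`-th power of the weighted `ℓ_p`-quasi-norm of the coefficients at level `k`. -/
def levelSum (p : ℝ) (T : ℕ → (Fin n → ℤ) → ℝ≥0∞) (b : ℕ → (Fin n → ℤ) → ℝ≥0∞) (k : ℕ) : ℝ≥0∞ :=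
  ∑' m, (b k m * T k m) ^ p

/-- The `q`-th power of the sequence space quasi-norm of the coefficients. -/
def seqSum (p q : ℝ) (T : ℕ → (Fin n → ℤ) → ℝ≥0∞) (b : ℕ → (Fin n → ℤ) → ℝ≥0∞) : ℝ≥0∞ :=
  ∑' k, levelSum p T b k ^ (q / p)

/-- Group the cubes of level j + d by their ancestors, on which B is constant; the upper condition
sums the weights within each group. -/
lemma tsum_parent_le {p θ α₁ α₂ : ℝ} (hp : 0 < p) {T : ℕ → (Fin n → ℤ) → ℝ≥0∞}
    (hT : IsDiscreteWeight p θ α₁ α₂ T) :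
    ∃ C : ℝ≥0∞, C ≠ ∞ ∧ ∀ j d (B : (Fin n → ℤ) → ℝ≥0∞),
      ∑' m, (T (j + d) m * B (par d m)) ^ p ≤ C * 2 ^ (α₂ * p * d) * ∑' M, (T j M * B M) ^ p := by
  obtain ⟨C, hC, h⟩ := hT.upper
  refine ⟨C, hC, fun j d B => ?_⟩
  rw [← tsum_ite_par (d := d), ← ENNReal.tsum_mul_left]
  refine ENNReal.tsum_le_tsum fun M => ?_
  have h1 : ∀ m, (if par d m = M then (T (j + d) m * B (par d m)) ^ p else 0) =
      B M ^ p * if par d m = M then T (j + d) m ^ p else 0 := by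
    intro m
    split_ifs with hm
    · rw [hm, ENNReal.mul_rpow_of_nonneg _ _ hp.le, mul_comm]
    · simp
  simp_rw [h1]
  rw [ENNReal.tsum_mul_left, ENNReal.mul_rpow_of_nonneg _ _ hp.le, mul_comm (T j M ^ p), ← mul_assoc,
    mul_comm _ (B M ^ p), mul_assoc]
  gcongr
  exact h j d M

/-- The Nikolskii loss n (1/θ - 1/r) per level meets the gain α₁ of the lower condition. What
remains is the positive decay rate of the fine levels. -/
lemma stepNorm_weighted_le {p θ α₁ α₂ : ℝ} (hp : 0 < p) (hθ : 0 < θ)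
    {T : ℕ → (Fin n → ℤ) → ℝ≥0∞} (hT : IsDiscreteWeight p θ α₁ α₂ T) {r : ℝ≥0∞} (hr : r ≠ 0)
    (hθr : ENNReal.ofReal θ ≤ r) :
    ∃ C : ℝ≥0∞, C ≠ ∞ ∧ ∀ k d (b : (Fin n → ℤ) → ℝ≥0∞),
      ∑' m, (stepNorm r k (k + d) b m * T k m) ^ p ≤
        C * 2 ^ (-((α₁ - n * (1 / θ - (r⁻¹).toReal)) * p * d)) *
          ∑' M, (b M * T (k + d) M) ^ p := by
  obtain ⟨C, hC, h⟩ := hT.lower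
  refine ⟨C ^ p, ENNReal.rpow_ne_top_of_nonneg hp.le hC, fun k d b => ?_⟩
  set δ := α₁ - n * (1 / θ - (r⁻¹).toReal) with hδ
  have h1 : ∀ m, (stepNorm r k (k + d) b m * T k m) ^ p ≤ C ^ p * 2 ^ (-(δ * p * d)) *
      ∑' M, (if par d M = m then (b M * T (k + d) M) ^ p else 0) := by
    intro m
    have h2 : stepNorm r k (k + d) b m * T k m ≤ C * 2 ^ (-(δ * d)) *
        (∑' M, (if par d M = m then (b M * T (k + d) M) ^ p else 0)) ^ (1 / p) := by
      calc stepNorm r k (k + d) b m * T k m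
          ≤ (2 ^ ((d : ℝ) * (n * (1 / θ - (r⁻¹).toReal))) *
            (((2 : ℝ≥0∞) ^ (d * n))⁻¹ * ∑' M, if par d M = m then b M ^ θ else 0) ^ (1 / θ)) *
            T k m := by
            gcongr
            exact eLpNorm_step_le hr hθ hθr k d m b
        _ = 2 ^ ((d : ℝ) * (n * (1 / θ - (r⁻¹).toReal))) * (T k m *
            (((2 : ℝ≥0∞) ^ (d * n))⁻¹ * ∑' M, if par d M = m then b M ^ θ else 0) ^ (1 / θ)) := by
            ring
        _ ≤ 2 ^ ((d : ℝ) * (n * (1 / θ - (r⁻¹).toReal))) * (C * 2 ^ (-(α₁ * d)) *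
            (∑' M, (if par d M = m then (b M * T (k + d) M) ^ p else 0)) ^ (1 / p)) := by
            exact mul_le_mul_right (h k d m b) _
        _ = C * (2 ^ ((d : ℝ) * (n * (1 / θ - (r⁻¹).toReal))) * 2 ^ (-(α₁ * d))) *
            (∑' M, (if par d M = m then (b M * T (k + d) M) ^ p else 0)) ^ (1 / p) := by
            ring
        _ = _ := by
            rw [← ENNReal.rpow_add _ _ two_ne_zero ENNReal.ofNat_ne_top]
            congr 3
            rw [hδ]
            ring
    refine (ENNReal.rpow_le_rpow h2 hp.le).trans (le_of_eq ?_)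
    rw [ENNReal.mul_rpow_of_nonneg _ _ hp.le, ENNReal.mul_rpow_of_nonneg _ _ hp.le,
      ← ENNReal.rpow_mul, ← ENNReal.rpow_mul, one_div_mul_cancel hp.ne', ENNReal.rpow_one]
    congr 3
    ring
  refine (ENNReal.tsum_le_tsum h1).trans (le_of_eq ?_)
  rw [ENNReal.tsum_mul_left, tsum_ite_par]

/-- Both directions decay at rate ε. Coarse levels: smoothness l against weight growth α₂ leaves l -
α₂ ≥ ε. Fine levels: the rate is at least 2ε, one ε of which was already spent on the quasi-triangle
inequality. -/
lemma tsum_levelTerm_le {p θ α₁ α₂ : ℝ} (hp : 0 < p) (hθ : 0 < θ)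
    {T : ℕ → (Fin n → ℤ) → ℝ≥0∞} (hT : IsDiscreteWeight p θ α₁ α₂ T) {r : ℝ≥0∞} (hr : r ≠ 0)
    (hθr : ENNReal.ofReal θ ≤ r) {l : ℕ} (c : ℕ) {ε : ℝ}
    (h1 : ε ≤ l - α₂) (h2 : 2 * ε ≤ α₁ - n * (1 / θ - (r⁻¹).toReal)) :
    ∃ C : ℝ≥0∞, C ≠ ∞ ∧ ∀ (b : ℕ → (Fin n → ℤ) → ℝ≥0∞) k j,
      ∑' m, (T k m * levelTerm r l c ε b k j m) ^ p ≤
        C * (geo (-(ε * p)) k j * levelSum p T b j) := by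
  obtain ⟨C₁, hC₁, hup⟩ := tsum_parent_le hp hT
  obtain ⟨C₂, hC₂, hlo⟩ := stepNorm_weighted_le hp hθ hT hr hθr
  obtain ⟨C₃, hC₃, hsh⟩ := hT.tsum_shift_le hp c
  refine ⟨C₁ * C₃ + C₃ * C₂, ENNReal.add_ne_top.2 ⟨ENNReal.mul_ne_top hC₁ hC₃,
    ENNReal.mul_ne_top hC₃ hC₂⟩, fun b k j => ?_⟩
  rcases lt_or_ge j k with hjk | hjk
  · obtain ⟨d, rfl⟩ := Nat.exists_eq_add_of_lt hjk
    rw [add_assoc]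
    set d' := d + 1 with hd'
    have e1 : ∀ m, (T (j + d') m * levelTerm r l c ε b (j + d') j m) ^ p =
        geo (-((l : ℝ) * p)) (j + d') j *
          (T (j + d') m * ∑ e ∈ nbhd n c, b j (par d' m + e)) ^ p := by
      intro m
      unfold levelTerm
      rw [if_pos (by omega), Nat.add_sub_cancel_left, mul_left_comm,
        ENNReal.mul_rpow_of_nonneg _ _ hp.le, geo_rpow, neg_mul]
    simp_rw [e1]
    rw [ENNReal.tsum_mul_left]
    calc geo (-((l : ℝ) * p)) (j + d') j *
          ∑' m, (T (j + d') m * ∑ e ∈ nbhd n c, b j (par d' m + e)) ^ p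
        ≤ geo (-((l : ℝ) * p)) (j + d') j * (C₁ * 2 ^ (α₂ * p * d') *
          (C₃ * levelSum p T b j)) := by
          gcongr
          refine (hup j d' fun M => ∑ e ∈ nbhd n c, b j (M + e)).trans ?_
          gcongr
          exact hsh j (b j)
      _ = (geo (-((l : ℝ) * p)) (j + d') j * geo (α₂ * p) (j + d') j) *
          (C₁ * C₃ * levelSum p T b j) := by
          rw [geo_add_left (α₂ * p)]
          ring
      _ ≤ geo (-(ε * p)) (j + d') j * ((C₁ * C₃ + C₃ * C₂) * levelSum p T b j) := by
          rw [← geo_add]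
          gcongr
          · refine geo_mono ?_ _ _
            nlinarith
          · exact le_self_add
      _ = _ := by ring
  · obtain ⟨d, rfl⟩ := Nat.exists_eq_add_of_le hjk
    have e1 : ∀ m, levelTerm r l c ε b k (k + d) m =
        ∑ e ∈ nbhd n c, (fun m => geo ε k (k + d) * stepNorm r k (k + d) (b (k + d)) m) (m + e) := by
      intro m
      unfold levelTerm
      rw [if_neg (by omega)]
    simp_rw [e1]
    calc _ ≤ C₃ * ∑' m, (geo ε k (k + d) * stepNorm r k (k + d) (b (k + d)) m * T k m) ^ p :=
          hsh k _
      _ = C₃ * (geo (ε * p) k (k + d) *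
          ∑' m, (stepNorm r k (k + d) (b (k + d)) m * T k m) ^ p) := by
          rw [← ENNReal.tsum_mul_left (a := geo (ε * p) k (k + d))]
          congr 2
          funext m
          rw [mul_assoc, ENNReal.mul_rpow_of_nonneg _ _ hp.le, geo_rpow]
      _ ≤ C₃ * (geo (ε * p) k (k + d) * (C₂ *
          2 ^ (-((α₁ - n * (1 / θ - (r⁻¹).toReal)) * p * d)) * levelSum p T b (k + d))) := by
          gcongr
          exact hlo k d _
      _ = (geo (ε * p) k (k + d) * geo (-((α₁ - n * (1 / θ - (r⁻¹).toReal)) * p)) k (k + d)) *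
          (C₃ * C₂ * levelSum p T b (k + d)) := by
          rw [geo_add_right (-((α₁ - n * (1 / θ - (r⁻¹).toReal)) * p)), neg_mul]
          ring
      _ ≤ geo (-(ε * p)) k (k + d) * ((C₁ * C₃ + C₃ * C₂) * levelSum p T b (k + d)) := by
          rw [← geo_add]
          gcongr
          · refine geo_mono ?_ _ _
            nlinarith
          · exact le_add_self
      _ = _ := by ring

/-- Summing over j inside the p-th power again costs a geometric factor, chosen as half of the
available decay. -/
lemma tsum_levels_le {p θ α₁ α₂ : ℝ} (hp : 0 < p) (hθ : 0 < θ)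
    {T : ℕ → (Fin n → ℤ) → ℝ≥0∞} (hT : IsDiscreteWeight p θ α₁ α₂ T) {r : ℝ≥0∞} (hr : r ≠ 0)
    (hθr : ENNReal.ofReal θ ≤ r) {l : ℕ} (c : ℕ) {ε : ℝ} (hε : 0 < ε)
    (h1 : ε ≤ l - α₂) (h2 : 2 * ε ≤ α₁ - n * (1 / θ - (r⁻¹).toReal)) :
    ∃ C : ℝ≥0∞, C ≠ ∞ ∧ ∀ (b : ℕ → (Fin n → ℤ) → ℝ≥0∞) k,
      ∑' m, (T k m * ∑' j, levelTerm r l c ε b k j m) ^ p ≤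
        C * ∑' j, geo (-(ε * p / 2)) k j * levelSum p T b j := by
  obtain ⟨C, hC, h⟩ := tsum_levelTerm_le hp hθ hT hr hθr c h1 h2
  refine ⟨geoSum (ε * p / 2 / p) ^ p * C, ENNReal.mul_ne_top
    (ENNReal.rpow_ne_top_of_nonneg hp.le (geoSum_ne_top (by positivity))) hC, fun b k => ?_⟩
  have e1 : ∀ m, (T k m * ∑' j, levelTerm r l c ε b k j m) ^ p ≤
      geoSum (ε * p / 2 / p) ^ p *
        ∑' j, geo (ε * p / 2) k j * (T k m * levelTerm r l c ε b k j m) ^ p := by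
    intro m
    rw [← ENNReal.tsum_mul_left]
    exact tsum_rpow_le hp _ k _
  refine (ENNReal.tsum_le_tsum e1).trans ?_
  rw [ENNReal.tsum_mul_left, mul_assoc, ENNReal.tsum_comm]
  gcongr
  rw [← ENNReal.tsum_mul_left]
  refine ENNReal.tsum_le_tsum fun j => ?_
  rw [ENNReal.tsum_mul_left]
  calc geo (ε * p / 2) k j * ∑' m, (T k m * levelTerm r l c ε b k j m) ^ p
      ≤ geo (ε * p / 2) k j * (C * (geo (-(ε * p)) k j * levelSum p T b j)) := by
        gcongr
        exact h b k j
    _ = C * ((geo (ε * p / 2) k j * geo (-(ε * p)) k j) * levelSum p T b j) := by ring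
    _ = _ := by
        rw [← geo_add]
        congr 4
        ring

lemma ae_lt_top_of_eLpNorm_ne_top {α : Type*} [MeasurableSpace α] {μ : Measure α} {r : ℝ≥0∞}
    (hr : r ≠ 0) {g : α → ℝ≥0∞} (hg : Measurable g) (h : eLpNorm g r μ ≠ ∞) :
    ∀ᵐ z ∂μ, g z < ∞ := by
  rcases eq_or_ne r ∞ with rfl | hr'
  · rw [eLpNorm_exponent_top] at h
    filter_upwards [ae_le_eLpNormEssSup (f := g) (μ := μ)] with z hz
    exact lt_of_le_of_lt hz h.lt_top
  · have hs : 0 < r.toReal := ENNReal.toReal_pos hr hr'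
    rw [eLpNorm_eq_lintegral_rpow_enorm_toReal hr hr'] at h
    have h1 : ∫⁻ z, g z ^ r.toReal ∂μ ≠ ∞ := by
      intro h0
      apply h
      change (∫⁻ z, g z ^ r.toReal ∂μ) ^ (1 / r.toReal) = ∞
      rw [h0, ENNReal.top_rpow_of_pos (by positivity)]
    filter_upwards [ae_lt_top (hg.pow_const _) h1] with z hz
    exact (ENNReal.rpow_lt_top_iff_of_pos hs).1 hz

/-- A function bounded by constants on the dyadic cubes sees the weight only through its integrals
over these cubes. This is why the numbers t_{k,m} can replace the functions t_k. -/
lemma lintegral_le_tsum_of_le {p : ℝ} (hp : 0 < p) {T : ℕ → (Fin n → ℤ) → ℝ≥0∞} {t : (Fin n → ℝ) → ℝ}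
    (ht : Measurable t) {k : ℕ}
    (hTt : ∀ m, ∫⁻ x in hcube k m, ENNReal.ofReal (t x) ^ p = T k m ^ p)
    {F : (Fin n → ℝ) → ℝ≥0∞} {Y : (Fin n → ℤ) → ℝ≥0∞} (h : ∀ x, F x ≤ Y (idx k x)) :
    ∫⁻ x, (ENNReal.ofReal (t x) * F x) ^ p ≤ ∑' m, (T k m * Y m) ^ p := by
  rw [lintegral_eq_tsum_hcube k]
  refine ENNReal.tsum_le_tsum fun m => ?_
  rw [ENNReal.mul_rpow_of_nonneg _ _ hp.le, ← hTt, ← lintegral_mul_const _ (by fun_prop)]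
  refine setLIntegral_mono' (measurableSet_hcube k m) fun x hx => ?_
  rw [← ENNReal.mul_rpow_of_nonneg _ _ hp.le]
  refine ENNReal.rpow_le_rpow ?_ hp.le
  gcongr
  rw [← show idx k x = m from hx]
  exact h x

/-- A series of blocks with coefficients in the weighted sequence space converges almost
everywhere, and its sum lies in the space, with an estimate of its quasi-norm. -/
theorem besovNorm_series_le {p q θ α₁ α₂ : ℝ} (hp : 0 < p) (hq : 0 < q) (hθ : 0 < θ)
    {T : ℕ → (Fin n → ℤ) → ℝ≥0∞} (hT : IsDiscreteWeight p θ α₁ α₂ T) {r : ℝ≥0∞} (hr : r ≠ 0)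
    (hθr : ENNReal.ofReal θ ≤ r) {t : ℕ → (Fin n → ℝ) → ℝ} (ht : ∀ k, Measurable (t k))
    (hTt : ∀ k m, ∫⁻ x in hcube k m, ENNReal.ofReal (t k x) ^ p = T k m ^ p)
    {l L : ℕ} (hlL : l ≤ L) (hα₂ : α₂ < l) (hα₁ : n * (1 / θ - (r⁻¹).toReal) < α₁) :
    ∃ C : ℝ≥0∞, C ≠ ∞ ∧ ∀ (φ : ℕ → (Fin n → ℝ) → ℝ) (b : ℕ → (Fin n → ℤ) → ℝ≥0∞),
      (∀ j, Measurable (φ j)) → (∀ j, IsBlock j l (φ j) (b j)) → seqSum p q T b ≠ ∞ →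
      (∀ᵐ x, ∑' j, ‖φ j x‖ₑ < ∞) ∧ MemLpLoc r (fun x => ∑' j, φ j x) ∧
      besovNorm L p q r t (fun x => ∑' j, φ j x) ≤ C * seqSum p q T b ^ (1 / q) := by
  -- The half in the second entry reserves one ε for the quasi-triangle inequality and one for the
  -- decay that remains.
  set ε := min (l - α₂) ((α₁ - n * (1 / θ - (r⁻¹).toReal)) / 2) with hε
  have hε0 : 0 < ε := lt_min (by linarith) (by linarith)
  have hε1 : ε ≤ l - α₂ := min_le_left _ _
  have hε2 : 2 * ε ≤ α₁ - n * (1 / θ - (r⁻¹).toReal) := by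
    have : ε ≤ (α₁ - n * (1 / θ - (r⁻¹).toReal)) / 2 := min_le_right _ _
    linarith
  set c := 2 * L + 2 with hc
  have hqp : 0 < q / p := div_pos hq hp
  have hrp : 0 ≤ 1 / r.toReal := by positivity
  obtain ⟨C₁, hC₁, hlev⟩ := tsum_levels_le hp hθ hT hr hθr (l := l) c hε0 hε1 hε2
  obtain ⟨C₂, hC₂, hdel⟩ := delta_series_le (n := n) hr hε0 l hlL
  set C₃ : ℝ≥0∞ := (nbhd n c).card * (((nbhd n c).card : ℝ≥0∞) ^ (1 / r.toReal) * tsumConst r ε)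
    with hC₃
  have hC₃t : C₃ ≠ ∞ := ENNReal.mul_ne_top (by simp) (ENNReal.mul_ne_top
    (ENNReal.rpow_ne_top_of_nonneg hrp (by simp)) (tsumConst_ne_top hr hε0))
  set K₁ : ℝ≥0∞ := (C₂ ^ p * C₁) ^ (q / p) * geoSum (ε * p / 2 / 2) ^ (q / p) *
    geoSum (ε * p / 2 * (q / p) / 2) with hK₁
  set K₂ : ℝ≥0∞ := (C₃ ^ p * C₁) ^ (q / p) * geoSum (ε * p / 2 / 2) ^ (q / p) with hK₂
  have hK₁t : K₁ ≠ ∞ := ENNReal.mul_ne_top (ENNReal.mul_ne_top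
    (ENNReal.rpow_ne_top_of_nonneg hqp.le (ENNReal.mul_ne_top
      (ENNReal.rpow_ne_top_of_nonneg hp.le hC₂) hC₁))
    (ENNReal.rpow_ne_top_of_nonneg hqp.le (geoSum_ne_top (by positivity))))
    (geoSum_ne_top (by positivity))
  have hK₂t : K₂ ≠ ∞ := ENNReal.mul_ne_top
    (ENNReal.rpow_ne_top_of_nonneg hqp.le (ENNReal.mul_ne_top
      (ENNReal.rpow_ne_top_of_nonneg hp.le hC₃t) hC₁))
    (ENNReal.rpow_ne_top_of_nonneg hqp.le (geoSum_ne_top (by positivity)))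
  refine ⟨K₁ ^ (1 / q) + K₂ ^ (1 / q), ENNReal.add_ne_top.2
    ⟨ENNReal.rpow_ne_top_of_nonneg (by positivity) hK₁t,
      ENNReal.rpow_ne_top_of_nonneg (by positivity) hK₂t⟩, ?_⟩
  intro φ b hφm hb hfin
  set Φ : (Fin n → ℝ) → ℝ := fun x => ∑' j, φ j x with hΦ
  set Y : ℕ → (Fin n → ℤ) → ℝ≥0∞ := fun k m => ∑' j, levelTerm r l c ε b k j m with hY
  -- One infinite local majorant would make the weighted sum at level 0 infinite, since the weights
  -- do not vanish. Finiteness here gives absolute convergence almost everywhere.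
  have hY0 : ∀ m, Y 0 m ≠ ∞ := by
    intro m hm
    have h1 : (∑' m, (T 0 m * Y 0 m) ^ p) ^ (q / p) ≤
        C₁ ^ (q / p) * geoSum (ε * p / 2 / 2) ^ (q / p) * seqSum p q T b :=
      rpow_le_tsum_of_le_tsum_geo hqp (by positivity) (hlev b 0)
    have h2 : (T 0 m * Y 0 m) ^ p = ∞ := by
      rw [hm, ENNReal.mul_top (hT.ne_zero 0 m), ENNReal.top_rpow_of_pos hp]
    rw [ENNReal.tsum_eq_top_of_eq_top ⟨m, h2⟩, ENNReal.top_rpow_of_pos hqp, top_le_iff] at h1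
    exact ENNReal.mul_ne_top (ENNReal.mul_ne_top (ENNReal.rpow_ne_top_of_nonneg hqp.le hC₁)
      (ENNReal.rpow_ne_top_of_nonneg hqp.le (geoSum_ne_top (by positivity)))) hfin h1
  have htail : ∀ (m : Fin n → ℤ) (U : Set (Fin n → ℝ)), (∀ z ∈ U, idx 0 z - m ∈ nbhd n c) →
      eLpNorm (tailMajorant b 0) r (volume.restrict U) ≤ C₃ * Y 0 m := by
    intro m U hU
    have := eLpNorm_tailMajorant_le hr hε0 l c b 0 m hU
    rwa [zero_mul, pow_zero, ENNReal.one_rpow, one_mul] at this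
  have hae : ∀ᵐ x, ∑' j, ‖φ j x‖ₑ < ∞ := by
    have h1 : ∀ m : Fin n → ℤ, ∀ᵐ x, x ∈ hcube 0 m → tailMajorant b 0 x < ∞ := by
      intro m
      refine (ae_restrict_iff' (measurableSet_hcube 0 m)).1 ?_
      refine ae_lt_top_of_eLpNorm_ne_top hr (measurable_tailMajorant b 0) ?_
      refine ne_top_of_le_ne_top (ENNReal.mul_ne_top hC₃t (hY0 m)) (htail m _ fun z hz => ?_)
      rw [show idx 0 z = m from hz, sub_self, mem_nbhd]
      simp
    filter_upwards [ae_all_iff.2 h1] with x hx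
    exact (enorm_series_le hb x).trans_lt (hx (idx 0 x) rfl)
  have hsum : ∀ᵐ x, HasSum (fun j => φ j x) (Φ x) := by
    filter_upwards [hae] with x hx
    have : Summable fun j => ‖φ j x‖₊ := by
      rw [← ENNReal.tsum_coe_ne_top_iff_summable]
      exact hx.ne
    exact (Summable.of_nnnorm this).hasSum
  have hΦm : AEStronglyMeasurable Φ volume := by
    refine aestronglyMeasurable_of_tendsto_ae atTop
      (f := fun (N : ℕ) x => ∑ j ∈ Finset.range N, φ j x)
      (fun N => (Finset.measurable_fun_sum _ fun j _ => hφm j).aestronglyMeasurable) ?_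
    filter_upwards [hsum] with x hx
    exact hx.tendsto_sum_nat
  have hΦle : ∀ x, ‖Φ x‖ₑ ≤ tailMajorant b 0 x := fun x =>
    enorm_tsum_le_tsum_enorm.trans (enorm_series_le hb x)
  refine ⟨hae, ?_, ?_⟩
  · intro K hK
    refine ⟨hΦm.restrict, ?_⟩
    obtain ⟨R, hR⟩ := hK.isBounded.exists_norm_le
    have hcov : ∀ z ∈ K, idx 0 z - 0 ∈ nbhd n (⌈R⌉₊ + 1) := by
      intro z hz
      have h0 : idx 0 (0 : Fin n → ℝ) = 0 := by
        funext i
        simp [idx]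
      rw [← h0]
      refine idx_sub_mem_nbhd fun i => ?_
      simp only [Pi.zero_apply, sub_zero, pow_zero, div_one]
      exact (norm_le_pi_norm z i).trans ((hR z hz).trans (Nat.le_ceil R))
    refine (eLpNorm_mono_enorm (g := tailMajorant b 0) hΦle).trans_lt ?_
    refine (eLpNorm_restrict_le_sum_hcube hr hcov (measurable_tailMajorant b 0)).trans_lt ?_
    refine ENNReal.mul_lt_top (by simp) (ENNReal.mul_lt_top
      (ENNReal.rpow_lt_top_of_nonneg hrp (by simp)) (ENNReal.sum_lt_top.2 fun e _ => ?_))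
    refine (htail (0 + e) _ fun z hz => ?_).trans_lt (ENNReal.mul_lt_top hC₃t.lt_top (hY0 _).lt_top)
    rw [show idx 0 z = 0 + e from hz, sub_self, mem_nbhd]
    simp
  · unfold besovNorm
    rw [add_mul]
    have hmulp : ∀ (k : ℕ) (C : ℝ≥0∞), ∑' m, (T k m * (C * Y k m)) ^ p ≤
        (C ^ p * C₁) * ∑' j, geo (-(ε * p / 2)) k j * levelSum p T b j := by
      intro k C
      have : ∀ m, (T k m * (C * Y k m)) ^ p = C ^ p * (T k m * Y k m) ^ p := fun m => by
        rw [mul_left_comm, ENNReal.mul_rpow_of_nonneg _ _ hp.le]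
      simp_rw [this]
      rw [ENNReal.tsum_mul_left, mul_assoc]
      gcongr
      exact hlev b k
    refine add_le_add ?_ ?_
    · rw [← ENNReal.mul_rpow_of_nonneg _ _ (by positivity)]
      refine ENNReal.rpow_le_rpow ?_ (by positivity)
      -- The levels are summed in ℓ_{q/p} at once; the shift from k to k + 1 in the quasi-norm only
      -- drops the term of level 0.
      have h1 := hardy_tsum (s := q / p) hqp (by positivity) (fun k => hmulp k C₂)
      refine le_trans ?_ h1
      refine le_trans (ENNReal.tsum_le_tsum fun k => ENNReal.rpow_le_rpow
        (lintegral_le_tsum_of_le hp (ht (k + 1)) (hTt (k + 1)) (Y := fun m => C₂ * Y (k + 1) m) fun x => hdel φ b Φ hb hsum (k + 1) x)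
        hqp.le) ?_
      exact ENNReal.tsum_comp_le_tsum_of_injective (add_left_injective 1)
        fun k => (∑' m, (T k m * (C₂ * Y k m)) ^ p) ^ (q / p)
    · have h1 : ∫⁻ x, (ENNReal.ofReal (t 0 x) * eLpNorm Φ r (volume.restrict (cube x 2))) ^ p ≤
          ∑' m, (T 0 m * (C₃ * Y 0 m)) ^ p := by
        refine lintegral_le_tsum_of_le hp (ht 0) (hTt 0) (Y := fun m => C₃ * Y 0 m) fun x => ?_
        refine (eLpNorm_mono_enorm (g := tailMajorant b 0) hΦle).trans (htail _ _ fun z hz => ?_)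
        refine nbhd_mono ?_ (idx_sub_mem_of_mem_cube (k := 0) (by simpa using hz))
        omega
      have h2 := rpow_le_tsum_of_le_tsum_geo (s := q / p) hqp (by positivity)
        (h1.trans (hmulp 0 C₃))
      have h3 := ENNReal.rpow_le_rpow h2 (show 0 ≤ 1 / q by positivity)
      rw [← ENNReal.rpow_mul, show q / p * (1 / q) = 1 / p by field_simp,
        ENNReal.mul_rpow_of_nonneg _ _ (by positivity)] at h3
      exact h3

/-! ## Cardinal B-splines -/

lemma bspline_one (x : ℝ) : bspline 1 x = max x 0 - 2 * max (x - 1) 0 + max (x - 2) 0 := by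
  simp only [bspline, Finset.sum_range_succ, Finset.sum_range_zero]
  norm_num [Nat.choose]
  ring

lemma sum_choose_shift (l : ℕ) (c y : ℕ → ℝ) :
    ∑ j ∈ Finset.range (l + 2), c j * ((l + 1).choose j : ℝ) * y j =
      ∑ j ∈ Finset.range (l + 2), c (j + 1) * ((l + 1).choose (j + 1) : ℝ) * y (j + 1) + c 0 * y 0 := by
  have h := Finset.sum_range_succ' (fun j => c j * ((l + 1).choose j : ℝ) * y j) (l + 2)
  rw [Finset.sum_range_succ] at h
  simpa using h

/-- Write the truncated power of order l + 1 as (x - j) times the one of order l and compare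
coefficients. Pascal's rule and (l + 2) C(l+1, j) = (j + 1) C(l+2, j+1) give the identity term by
term. -/
lemma bspline_recurrence {l : ℕ} (hl : 1 ≤ l) (x : ℝ) :
    (l + 1) * bspline (l + 1) x = x * bspline l x + (l + 2 - x) * bspline l (x - 1) := by
  have hpow : ∀ u : ℝ, max u 0 ^ (l + 1) = u * max u 0 ^ l := by
    intro u
    rcases le_total u 0 with h | h
    · rw [max_eq_right h, zero_pow (by omega), zero_pow (by omega), mul_zero]
    · rw [max_eq_left h, pow_succ']
  unfold bspline
  have hf : ((l + 1).factorial : ℝ)⁻¹ = ((l : ℝ) + 1)⁻¹ * (l.factorial : ℝ)⁻¹ := by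
    rw [Nat.factorial_succ]
    push_cast
    rw [mul_inv]
  rw [hf]
  have hl1 : (l : ℝ) + 1 ≠ 0 := by positivity
  have key : ∑ j ∈ Finset.range (l + 1 + 2), (-1 : ℝ) ^ j * ((l + 1 + 1).choose j : ℝ) *
      max (x - j) 0 ^ (l + 1) =
      x * (∑ j ∈ Finset.range (l + 2), (-1 : ℝ) ^ j * ((l + 1).choose j : ℝ) * max (x - j) 0 ^ l) +
      (l + 2 - x) * ∑ j ∈ Finset.range (l + 2), (-1 : ℝ) ^ j * ((l + 1).choose j : ℝ) *
        max (x - 1 - j) 0 ^ l := by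
    rw [Finset.sum_range_succ', sum_choose_shift l (fun j => (-1 : ℝ) ^ j)
      (fun j => max (x - j) 0 ^ l), mul_add, Finset.mul_sum, Finset.mul_sum]
    refine Eq.trans ?_ (add_right_comm _ _ _)
    rw [← Finset.sum_add_distrib]
    congr 1
    · refine Finset.sum_congr rfl fun j _ => ?_
      rw [hpow]
      have h1 : ((l + 1 + 1).choose (j + 1) : ℝ) = (l + 1).choose j + (l + 1).choose (j + 1) := by
        rw [Nat.choose_succ_succ]
        push_cast
        ring
      have h2 : ((l : ℝ) + 2) * (l + 1).choose j = ((l + 1 + 1).choose (j + 1) : ℝ) * (j + 1) := by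
        have := Nat.add_one_mul_choose_eq (l + 1) j
        have h3 : (((l + 1 + 1) * (l + 1).choose j : ℕ) : ℝ) =
          (((l + 1 + 1).choose (j + 1) * (j + 1) : ℕ) : ℝ) := by exact_mod_cast this
        push_cast at h3
        linarith
      have h4 : x - ((j + 1 : ℕ) : ℝ) = x - 1 - j := by
        push_cast
        ring
      rw [h4, pow_succ]
      rw [h1] at h2 ⊢
      linear_combination (-((-1 : ℝ) ^ j * max (x - 1 - j) 0 ^ l)) * h2
    · rw [hpow]
      simp
  rw [key]
  field_simp

lemma bspline_of_nonpos {l : ℕ} (hl : 1 ≤ l) {x : ℝ} (hx : x ≤ 0) : bspline l x = 0 := by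
  unfold bspline
  rw [Finset.sum_eq_zero, mul_zero]
  intro j _
  have : x - j ≤ 0 := by
    have : (0 : ℝ) ≤ j := by positivity
    linarith
  rw [max_eq_right this, zero_pow (by omega), mul_zero]

/-- The case l = 1 is explicit, and the recurrence carries the vanishing to the right of the knots
from l to l + 1. -/
lemma bspline_of_le {l : ℕ} (hl : 1 ≤ l) {x : ℝ} (hx : (l : ℝ) + 1 ≤ x) : bspline l x = 0 := by
  induction l, hl using Nat.le_induction generalizing x with
  | base =>
    norm_num at hx
    rw [bspline_one, max_eq_left (by linarith), max_eq_left (by linarith), max_eq_left (by linarith)]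
    ring
  | succ l hl ih =>
    push_cast at hx
    have h := bspline_recurrence hl x
    rw [ih (by linarith), ih (by linarith), mul_zero, mul_zero, add_zero] at h
    rcases mul_eq_zero.1 h with h | h
    · exfalso
      have : (0 : ℝ) < (l : ℝ) + 1 := by positivity
      linarith
    · exact h

/-- At 1 only the truncated power with knot 0 survives. The value is needed to normalise the bump in
the extension. -/
lemma bspline_at_one_ne_zero {l : ℕ} (hl : 1 ≤ l) : bspline l 1 ≠ 0 := by
  unfold bspline
  rw [Finset.sum_range_succ', Finset.sum_eq_zero]
  · simp [Nat.factorial_ne_zero]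
  · intro j _
    have h1 : (1 : ℝ) - ((j + 1 : ℕ) : ℝ) ≤ 0 := by
      push_cast
      have : (0 : ℝ) ≤ j := by positivity
      linarith
    rw [max_eq_right h1, zero_pow (by omega), mul_zero]

lemma continuous_bspline (l : ℕ) : Continuous (bspline l) := by
  unfold bspline
  fun_prop

lemma bspline_bounded {l : ℕ} (hl : 1 ≤ l) : ∃ C : ℝ, 0 ≤ C ∧ ∀ x, |bspline l x| ≤ C := by
  obtain ⟨C, hC⟩ := isCompact_Icc.exists_bound_of_continuousOn
    (s := Set.Icc (0 : ℝ) (l + 1)) (continuous_bspline l).continuousOn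
  refine ⟨max C 0, le_max_right _ _, fun x => ?_⟩
  by_cases hx : x ∈ Set.Icc (0 : ℝ) (l + 1)
  · exact (hC x hx).trans (le_max_left _ _)
  · have : bspline l x = 0 := by
      rw [Set.mem_Icc, not_and_or, not_le, not_le] at hx
      rcases hx with hx | hx
      · exact bspline_of_nonpos hl hx.le
      · exact bspline_of_le hl hx.le
    rw [this, abs_zero]
    exact le_max_right _ _

lemma hasDerivAt_posPart_pow {l : ℕ} (hl : 1 ≤ l) (x : ℝ) :
    HasDerivAt (fun u : ℝ => max u 0 ^ (l + 1)) ((l + 1) * max x 0 ^ l) x := by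
  rcases lt_trichotomy x 0 with hx | hx | hx
  · rw [max_eq_right hx.le, zero_pow (by omega), mul_zero]
    refine (hasDerivAt_const x (0 : ℝ)).congr_of_eventuallyEq ?_
    filter_upwards [Iio_mem_nhds hx] with u hu
    rw [max_eq_right (Set.mem_Iio.1 hu).le, zero_pow (by omega)]
  · subst hx
    rw [max_self, zero_pow (by omega), mul_zero]
    rw [hasDerivAt_iff_isLittleO_nhds_zero]
    simp only [zero_add, max_self, ne_eq, Nat.add_eq_zero_iff, one_ne_zero, and_false,
      not_false_eq_true, zero_pow, sub_zero, smul_zero]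
    rw [Asymptotics.isLittleO_iff]
    intro c hc
    have h1 : ∀ᶠ u : ℝ in 𝓝 0, |u| < min c 1 := by
      have : Tendsto (fun u : ℝ => |u|) (𝓝 0) (𝓝 |(0 : ℝ)|) := continuous_abs.tendsto 0
      rw [abs_zero] at this
      exact this.eventually (Iio_mem_nhds (lt_min hc one_pos))
    filter_upwards [h1] with u hu
    have h2 : max u 0 ≤ |u| := max_le (le_abs_self u) (abs_nonneg u)
    have h3 : (0 : ℝ) ≤ max u 0 := le_max_right _ _
    rw [Real.norm_eq_abs, Real.norm_eq_abs, abs_of_nonneg (by positivity)]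
    calc max u 0 ^ (l + 1) ≤ |u| ^ (l + 1) := by gcongr
      _ = |u| ^ l * |u| := pow_succ _ _
      _ ≤ c * |u| := by
          gcongr
          calc |u| ^ l ≤ |u| ^ 1 := pow_le_pow_of_le_one (abs_nonneg u)
                (hu.le.trans (min_le_right _ _)) hl
            _ ≤ c := by
                rw [pow_one]
                exact hu.le.trans (min_le_left _ _)
  · rw [max_eq_left hx.le]
    have h1 := hasDerivAt_pow (l + 1) x
    simp only [Nat.add_sub_cancel, Nat.cast_add, Nat.cast_one] at h1
    refine h1.congr_of_eventuallyEq ?_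
    filter_upwards [Ioi_mem_nhds hx] with u hu
    rw [max_eq_left (Set.mem_Ioi.1 hu).le]

lemma hasDerivAt_bspline {l : ℕ} (hl : 1 ≤ l) (x : ℝ) :
    HasDerivAt (bspline (l + 1)) (bspline l x - bspline l (x - 1)) x := by
  have h1 : HasDerivAt (fun x : ℝ => ((l + 1).factorial : ℝ)⁻¹ * ∑ j ∈ Finset.range (l + 1 + 2),
      (-1 : ℝ) ^ j * ((l + 1 + 1).choose j : ℝ) * (max (x - j) 0) ^ (l + 1))
      (((l + 1).factorial : ℝ)⁻¹ * ∑ j ∈ Finset.range (l + 1 + 2),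
      (-1 : ℝ) ^ j * ((l + 1 + 1).choose j : ℝ) * ((l + 1) * max (x - j) 0 ^ l)) x := by
    refine HasDerivAt.const_mul _ (HasDerivAt.fun_sum fun j _ => HasDerivAt.const_mul _ ?_)
    exact HasDerivAt.comp_sub_const x (j : ℝ) (hasDerivAt_posPart_pow hl (x - j))
  refine HasDerivAt.congr_deriv (f := bspline (l + 1)) h1 ?_
  unfold bspline
  rw [Finset.sum_range_succ', sum_choose_shift l (fun j => (-1 : ℝ) ^ j) (fun j => max (x - j) 0 ^ l)]
  have hf : ((l + 1).factorial : ℝ) = ((l : ℝ) + 1) * (l.factorial : ℝ) := by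
    rw [Nat.factorial_succ]
    push_cast
    ring
  have hf0 : (l.factorial : ℝ) ≠ 0 := by positivity
  have hl1 : (l : ℝ) + 1 ≠ 0 := by positivity
  have h2 : ∑ j ∈ Finset.range (l + 1 + 1), (-1 : ℝ) ^ (j + 1) * ((l + 1 + 1).choose (j + 1) : ℝ) *
      ((l + 1) * max (x - ((j + 1 : ℕ) : ℝ)) 0 ^ l) =
      (l + 1) * (∑ j ∈ Finset.range (l + 2), (-1 : ℝ) ^ (j + 1) * ((l + 1).choose (j + 1) : ℝ) *
        max (x - ((j + 1 : ℕ) : ℝ)) 0 ^ l) -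
      (l + 1) * ∑ j ∈ Finset.range (l + 2), (-1 : ℝ) ^ j * ((l + 1).choose j : ℝ) *
        max (x - 1 - j) 0 ^ l := by
    rw [Finset.mul_sum, Finset.mul_sum, ← Finset.sum_sub_distrib]
    refine Finset.sum_congr rfl fun j _ => ?_
    have h4 : x - ((j + 1 : ℕ) : ℝ) = x - 1 - j := by
      push_cast
      ring
    rw [h4, Nat.choose_succ_succ, pow_succ]
    push_cast
    ring
  rw [h2, hf]
  simp only [Nat.choose_zero_right, Nat.cast_zero, sub_zero, pow_zero, Nat.cast_one, mul_one, one_mul]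
  field_simp
  ring

lemma hasDerivAt_fwdDiff_iterate {f f' : ℝ → ℝ} (hf : ∀ x, HasDerivAt f (f' x) x) (h : ℝ) (i : ℕ)
    (x : ℝ) : HasDerivAt ((fwdDiff h)^[i] f) ((fwdDiff h)^[i] f' x) x := by
  induction i generalizing x with
  | zero => simpa using hf x
  | succ i ih =>
    rw [Function.iterate_succ_apply', Function.iterate_succ_apply']
    exact ((ih (x + h)).comp_add_const x h).sub (ih x)

lemma fwdDiff_iterate_sub (h : ℝ) (f g : ℝ → ℝ) (i : ℕ) :
    (fwdDiff h)^[i] (fun x => f x - g x) = fun x => (fwdDiff h)^[i] f x - (fwdDiff h)^[i] g x := by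
  funext x
  simp only [fwdDiff_iter_eq_sum_shift, smul_sub, Finset.sum_sub_distrib]

/-- Induction on l through the derivative formula and the mean value inequality, which trade one
order of difference for a factor |h|. The induction starts at the Lipschitz hat function. Thus the
full order l is reached although the spline is only of class C^{l-1}. -/
lemma fwdDiff_bspline_bound {l : ℕ} (hl : 1 ≤ l) :
    ∃ C : ℝ, 0 ≤ C ∧ ∀ i ≤ l, ∀ h x : ℝ, |(fwdDiff h)^[i] (bspline l) x| ≤ C * |h| ^ i := by
  induction l, hl using Nat.le_induction with
  | base =>
    obtain ⟨C, hC0, hC⟩ := bspline_bounded (l := 1) le_rfl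
    refine ⟨max C 4, by positivity, fun i hi h x => ?_⟩
    interval_cases i
    · simpa using (hC x).trans (le_max_left C 4)
    · simp only [Function.iterate_one, fwdDiff, pow_one]
      have hlip : ∀ u v : ℝ, |max u 0 - max v 0| ≤ |u - v| := fun u v => abs_max_sub_max_le_abs u v 0
      rw [bspline_one, bspline_one]
      have h1 := hlip (x + h) x
      have h2 := hlip (x + h - 1) (x - 1)
      have h3 := hlip (x + h - 2) (x - 2)
      rw [show x + h - x = h by ring] at h1
      rw [show x + h - 1 - (x - 1) = h by ring] at h2
      rw [show x + h - 2 - (x - 2) = h by ring] at h3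
      have h4 : |h| * 4 ≤ |h| * max C 4 := by gcongr; exact le_max_right _ _
      rw [abs_le] at h1 h2 h3 ⊢
      constructor <;> linarith [h1.1, h1.2, h2.1, h2.2, h3.1, h3.2]
  | succ l hl ih =>
    obtain ⟨C, hC0, hC⟩ := ih
    obtain ⟨C', hC'0, hC'⟩ := bspline_bounded (l := l + 1) (by omega)
    refine ⟨max C' (2 * C), by positivity, fun i hi h x => ?_⟩
    rcases i with _ | i
    · simpa using (hC' x).trans (le_max_left C' (2 * C))
    · rw [Function.iterate_succ_apply']
      have hderiv := hasDerivAt_fwdDiff_iterate (hasDerivAt_bspline hl) h i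
      have hbound : ∀ u, ‖(fwdDiff h)^[i] (fun x => bspline l x - bspline l (x - 1)) u‖ ≤
          2 * C * |h| ^ i := by
        intro u
        rw [fwdDiff_iterate_sub, Real.norm_eq_abs]
        beta_reduce
        have e1 := hC i (by omega) h u
        have e2 : (fwdDiff h)^[i] (fun x => bspline l (x - 1)) u = (fwdDiff h)^[i] (bspline l) (u - 1) := by
          have := fwdDiff_iter_comp_add h (bspline l) (-1) i u
          simpa only [sub_eq_add_neg] using this
        have e3 := hC i (by omega) h (u - 1)
        rw [e2]
        rw [abs_le] at e1 e3 ⊢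
        constructor <;> linarith [e1.1, e1.2, e3.1, e3.2]
      have hmv := Convex.norm_image_sub_le_of_norm_hasDerivWithin_le (s := Set.univ) (x := x)
        (y := x + h) (fun u _ => (hderiv u).hasDerivWithinAt) (fun u _ => hbound u) convex_univ
        (Set.mem_univ _) (Set.mem_univ _)
      rw [add_sub_cancel_left, Real.norm_eq_abs, Real.norm_eq_abs] at hmv
      refine hmv.trans ?_
      rw [pow_succ, ← mul_assoc]
      gcongr
      exact le_max_right _ _

/-! ## Reproduction of polynomials -/

lemma bspline_sub_intCast_eq_zero {l : ℕ} (hl : 1 ≤ l) {x : ℝ} {m : ℤ}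
    (h : m ∉ Finset.Icc (⌊x⌋ - l) ⌊x⌋) : bspline l (x - m) = 0 := by
  rw [Finset.mem_Icc, not_and_or, not_le, not_le] at h
  rcases h with h | h
  · refine bspline_of_le hl ?_
    have h1 : (m : ℝ) + 1 ≤ (⌊x⌋ : ℝ) - l := by exact_mod_cast h
    linarith [Int.floor_le x]
  · refine bspline_of_nonpos hl ?_
    have h1 : (⌊x⌋ : ℝ) + 1 ≤ m := by exact_mod_cast h
    linarith [Int.lt_floor_add_one x]

lemma summable_mul_bspline {l : ℕ} (hl : 1 ≤ l) (c : ℤ → ℝ) (x : ℝ) :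
    Summable fun m : ℤ => c m * bspline l (x - m) :=
  summable_of_ne_finset_zero (s := Finset.Icc (⌊x⌋ - l) ⌊x⌋) fun m hm => by
    rw [bspline_sub_intCast_eq_zero hl hm, mul_zero]

/-- Marsden's identity. -/
lemma marsden {l : ℕ} (hl : 1 ≤ l) (x y : ℝ) :
    ∑' m : ℤ, (∏ i ∈ Finset.range l, ((m : ℝ) + 1 + i - y)) * bspline l (x - m) = (x - y) ^ l := by
  induction l, hl using Nat.le_induction with
  | base =>
    rw [tsum_eq_sum (s := Finset.Icc (⌊x⌋ - 1) ⌊x⌋) fun m hm => by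
      rw [bspline_sub_intCast_eq_zero le_rfl (by simpa using hm), mul_zero]]
    have : Finset.Icc (⌊x⌋ - 1) ⌊x⌋ = {⌊x⌋ - 1, ⌊x⌋} := by
      ext m
      simp only [Finset.mem_Icc, Finset.mem_insert, Finset.mem_singleton]
      omega
    rw [this, Finset.sum_pair (by omega)]
    have h1 := Int.floor_le x
    have h2 := Int.lt_floor_add_one x
    simp only [Finset.range_one, Finset.prod_singleton, Int.cast_sub, Int.cast_one, bspline_one]
    rw [max_eq_left (by linarith), max_eq_left (by linarith), max_eq_right (by linarith),
      max_eq_left (by linarith), max_eq_right (by linarith), max_eq_right (by linarith)]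
    push_cast
    ring
  | succ l hl ih =>
    have hl1 : (l : ℝ) + 1 ≠ 0 := by positivity
    -- The recurrence splits the sum in two. After an index shift in the second part, the
    -- coefficients of the same spline combine to (l + 1)(x - y) times the Marsden coefficient of
    -- order l.
    have h1 : ∀ m : ℤ, (∏ i ∈ Finset.range (l + 1), ((m : ℝ) + 1 + i - y)) * bspline (l + 1) (x - m) =
        ((l : ℝ) + 1)⁻¹ * ((∏ i ∈ Finset.range (l + 1), ((m : ℝ) + 1 + i - y)) * (x - m) *
          bspline l (x - m)) +
        ((l : ℝ) + 1)⁻¹ * ((∏ i ∈ Finset.range (l + 1), ((m : ℝ) + 1 + i - y)) * (l + 2 - (x - m)) *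
          bspline l (x - ((m + 1 : ℤ) : ℝ))) := by
      intro m
      have h := bspline_recurrence hl (x - m)
      have h2 : x - ((m + 1 : ℤ) : ℝ) = x - m - 1 := by
        push_cast
        ring
      rw [h2]
      field_simp
      linear_combination (∏ i ∈ Finset.range (l + 1), ((m : ℝ) + 1 + i - y)) * h
    simp_rw [h1]
    set c : ℤ → ℝ := fun m => (∏ i ∈ Finset.range (l + 1), ((m : ℝ) + 1 + i - y)) with hc
    have hs1 := summable_mul_bspline hl (fun m => c m * (x - m)) x
    have hs2 := summable_mul_bspline hl (fun m => c (m - 1) * (l + 1 - (x - m))) x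
    have e2 : (fun m : ℤ => c m * (l + 2 - (x - m)) * bspline l (x - ((m + 1 : ℤ) : ℝ))) =
        (fun m : ℤ => c (m - 1) * (l + 1 - (x - m)) * bspline l (x - m)) ∘ (Equiv.addRight (1 : ℤ)) := by
      funext m
      simp only [Function.comp_apply, Equiv.coe_addRight, add_sub_cancel_right]
      push_cast
      ring
    have e3 : ∑' m : ℤ, c m * (l + 2 - (x - m)) * bspline l (x - ((m + 1 : ℤ) : ℝ)) =
        ∑' m : ℤ, c (m - 1) * (l + 1 - (x - m)) * bspline l (x - m) := by
      rw [e2]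
      exact (Equiv.addRight (1 : ℤ)).tsum_eq
        (fun m : ℤ => c (m - 1) * (l + 1 - (x - m)) * bspline l (x - m))
    have hs3 : Summable fun m : ℤ => c m * (l + 2 - (x - m)) * bspline l (x - ((m + 1 : ℤ) : ℝ)) := by
      rw [e2]
      exact (Equiv.summable_iff _).2 hs2
    rw [Summable.tsum_add (hs1.mul_left _) (hs3.mul_left _), tsum_mul_left, tsum_mul_left, e3, ← mul_add,
      ← Summable.tsum_add hs1 hs2, pow_succ, ← ih, ← tsum_mul_right, ← tsum_mul_left]
    refine tsum_congr fun m => ?_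
    have d1 : c m = (∏ i ∈ Finset.range l, ((m : ℝ) + 1 + i - y)) * (m + 1 + l - y) := by
      simp only [hc]
      rw [Finset.prod_range_succ]
    have d2 : c (m - 1) = (∏ i ∈ Finset.range l, ((m : ℝ) + 1 + i - y)) * (m - y) := by
      simp only [hc]
      rw [Finset.prod_range_succ']
      congr 1
      · refine Finset.prod_congr rfl fun i _ => ?_
        push_cast
        ring
      · push_cast
        ring
    rw [d1, d2]
    field_simp
    ring

/-- The powers (x - g)^l with g = 0, …, l span the polynomials of degree at most l: comparing
coefficients leads to a Vandermonde system with distinct nodes -g. -/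
lemma exists_eq_sum_shifted_pow (l : ℕ) (q : Polynomial ℝ) (hq : q.natDegree ≤ l) :
    ∃ a : Fin (l + 1) → ℝ, ∀ x : ℝ, q.eval x = ∑ g, a g * (x - (g : ℕ)) ^ l := by
  set V : Matrix (Fin (l + 1)) (Fin (l + 1)) ℝ := Matrix.vandermonde fun g => -((g : ℕ) : ℝ) with hV
  have hdet : V.det ≠ 0 := by
    rw [hV, Matrix.det_vandermonde_ne_zero_iff]
    intro g g' h
    simpa [Fin.ext_iff] using h
  have hunit : IsUnit V.det := isUnit_iff_ne_zero.2 hdet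
  set c : Fin (l + 1) → ℝ := fun e => q.coeff (l - e) / (l.choose e) with hc
  refine ⟨Matrix.vecMul c V⁻¹, fun x => ?_⟩
  have ha : ∀ e : Fin (l + 1), ∑ g, Matrix.vecMul c V⁻¹ g * (-((g : ℕ) : ℝ)) ^ (e : ℕ) = c e := by
    intro e
    have h : Matrix.vecMul (Matrix.vecMul c V⁻¹) V = c := by
      rw [Matrix.vecMul_vecMul, Matrix.nonsing_inv_mul _ hunit, Matrix.vecMul_one]
    have := congrFun h e
    simpa [Matrix.vecMul, dotProduct, hV, Matrix.vandermonde_apply] using this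
  set a := Matrix.vecMul c V⁻¹ with hadef
  have h1 : ∀ g : Fin (l + 1), (x - (g : ℕ)) ^ l =
      ∑ e : Fin (l + 1), (-((g : ℕ) : ℝ)) ^ (e : ℕ) * x ^ (l - e) * (l.choose e) := by
    intro g
    rw [sub_eq_add_neg, add_comm, add_pow, Finset.sum_range]
  calc q.eval x = ∑ i ∈ Finset.range (l + 1), q.coeff i * x ^ i :=
        Polynomial.eval_eq_sum_range' (by omega) x
    _ = ∑ e ∈ Finset.range (l + 1), q.coeff (l - e) * x ^ (l - e) := by
        rw [← Finset.sum_range_reflect]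
        refine Finset.sum_congr rfl fun e _ => ?_
        simp
    _ = ∑ e : Fin (l + 1), c e * (x ^ (l - e) * (l.choose e)) := by
        rw [Finset.sum_range]
        refine Finset.sum_congr rfl fun e _ => ?_
        have : (l.choose e : ℝ) ≠ 0 := by
          exact_mod_cast (Nat.choose_pos (Nat.lt_succ_iff.1 e.2)).ne'
        simp only [hc]
        field_simp
    _ = ∑ e : Fin (l + 1), ∑ g, a g * ((-((g : ℕ) : ℝ)) ^ (e : ℕ) * x ^ (l - e) * (l.choose e)) := by
        refine Finset.sum_congr rfl fun e _ => ?_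
        rw [← ha e, Finset.sum_mul]
        exact Finset.sum_congr rfl fun g _ => by ring
    _ = _ := by
        rw [Finset.sum_comm]
        refine Finset.sum_congr rfl fun g _ => ?_
        rw [h1, Finset.mul_sum]

/-- There is a functional, a combination of values at `0, …, l`, that gives the coefficients of
polynomials of degree at most `l` with respect to the B-splines. -/
lemma exists_quasiInterpolant {l : ℕ} (hl : 1 ≤ l) :
    ∃ ω : Fin (l + 1) → ℝ, ∀ q : Polynomial ℝ, q.natDegree ≤ l → ∀ x : ℝ,
      ∑' m : ℤ, (∑ g, ω g * q.eval ((m : ℝ) + (g : ℕ))) * bspline l (x - m) = q.eval x := by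
  -- By Marsden's identity the coefficients of (x - y)^l are, up to sign, Q(y - m). Expanding Q in
  -- shifted powers expresses them through the values of (· - y)^l at m + g, and linearity extends
  -- this to all q.
  set Q : Polynomial ℝ := ∏ i ∈ Finset.range l,
    (Polynomial.C ((i : ℝ) + 1) - Polynomial.X) with hQ
  have hQd : Q.natDegree ≤ l := by
    refine (Polynomial.natDegree_prod_le _ _).trans ?_
    refine (Finset.sum_le_card_nsmul _ _ 1 fun i _ => ?_).trans (by simp)
    exact (Polynomial.natDegree_sub_le _ _).trans
      (max_le (by rw [Polynomial.natDegree_C]; omega) Polynomial.natDegree_X_le)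
  obtain ⟨w, hw⟩ := exists_eq_sum_shifted_pow l Q hQd
  refine ⟨fun g => (-1) ^ l * w g, fun q hq x => ?_⟩
  have hω : ∀ (m : ℤ) (y : ℝ), ∑ g : Fin (l + 1), ((-1) ^ l * w g) * ((m : ℝ) + (g : ℕ) - y) ^ l =
      ∏ i ∈ Finset.range l, ((m : ℝ) + 1 + i - y) := by
    intro m y
    have h1 := hw (y - m)
    rw [hQ, Polynomial.eval_prod] at h1
    calc ∑ g : Fin (l + 1), ((-1) ^ l * w g) * ((m : ℝ) + (g : ℕ) - y) ^ l
        = ∑ g : Fin (l + 1), w g * (y - m - (g : ℕ)) ^ l := by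
          refine Finset.sum_congr rfl fun g _ => ?_
          rw [show y - m - ((g : ℕ) : ℝ) = (-1) * (m + (g : ℕ) - y) by ring, mul_pow]
          ring
      _ = _ := by
          rw [← h1]
          refine Finset.prod_congr rfl fun i _ => ?_
          simp only [Polynomial.eval_sub, Polynomial.eval_C, Polynomial.eval_X]
          ring
  obtain ⟨a, ha⟩ := exists_eq_sum_shifted_pow l q hq
  have h2 : ∀ m : ℤ, (∑ g : Fin (l + 1), ((-1) ^ l * w g) * q.eval ((m : ℝ) + (g : ℕ))) *
      bspline l (x - m) = ∑ g' : Fin (l + 1), a g' *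
        ((∏ i ∈ Finset.range l, ((m : ℝ) + 1 + i - ((g' : ℕ) : ℝ))) * bspline l (x - m)) := by
    intro m
    have h3 : ∑ g : Fin (l + 1), ((-1) ^ l * w g) * q.eval ((m : ℝ) + (g : ℕ)) =
        ∑ g' : Fin (l + 1), a g' * ∏ i ∈ Finset.range l, ((m : ℝ) + 1 + i - ((g' : ℕ) : ℝ)) := by
      simp_rw [ha, ← hω, Finset.mul_sum]
      rw [Finset.sum_comm]
      refine Finset.sum_congr rfl fun g' _ => Finset.sum_congr rfl fun g _ => ?_
      ring
    rw [h3, Finset.sum_mul]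
    exact Finset.sum_congr rfl fun g' _ => by ring
  simp_rw [h2]
  rw [Summable.tsum_finsetSum fun g' _ => (summable_mul_bspline hl _ x).mul_left _, ha x]
  refine Finset.sum_congr rfl fun g' _ => ?_
  rw [tsum_mul_left, marsden hl]

/-! ## Splines on `ℝⁿ` -/

/-- The product rule Δ(uv) = Δu · v + u · Δv + Δu · Δv, iterated. Each step produces three terms,
hence 3^i; s ≤ 1 is used for the last of them, which has one factor s too many. -/
lemma enorm_diff_mul_le {s : ℝ≥0∞} (hs : s ≤ 1) (h x : Fin n → ℝ) (i : ℕ) :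
    ∀ (u v : (Fin n → ℝ) → ℝ) (A B : ℝ≥0∞), (∀ j ≤ i, ‖diff j h u x‖ₑ ≤ A * s ^ j) →
      (∀ j ≤ i, ‖diff j h v x‖ₑ ≤ B * s ^ j) →
      ‖diff i h (fun y => u y * v y) x‖ₑ ≤ 3 ^ i * (A * B) * s ^ i := by
  induction i with
  | zero =>
    intro u v A B hu hv
    have h1 := hu 0 le_rfl
    have h2 := hv 0 le_rfl
    simp only [diff_zero_order, pow_zero, mul_one, one_mul] at h1 h2 ⊢
    rw [enorm_mul]
    exact mul_le_mul' h1 h2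
  | succ i ih =>
    intro u v A B hu hv
    have hd : diff 1 h (fun y => u y * v y) = (fun y => diff 1 h u y * v y) +
        ((fun y => u y * diff 1 h v y) + fun y => diff 1 h u y * diff 1 h v y) := by
      funext y
      simp only [diff_one, Pi.add_apply]
      ring
    have hu1 : ∀ j ≤ i, ‖diff j h (diff 1 h u) x‖ₑ ≤ (A * s) * s ^ j := fun j hj => by
      rw [← diff_add_order, mul_assoc, ← pow_succ']
      exact hu (j + 1) (by omega)
    have hv1 : ∀ j ≤ i, ‖diff j h (diff 1 h v) x‖ₑ ≤ (B * s) * s ^ j := fun j hj => by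
      rw [← diff_add_order, mul_assoc, ← pow_succ']
      exact hv (j + 1) (by omega)
    have hu0 : ∀ j ≤ i, ‖diff j h u x‖ₑ ≤ A * s ^ j := fun j hj => hu j (by omega)
    have hv0 : ∀ j ≤ i, ‖diff j h v x‖ₑ ≤ B * s ^ j := fun j hj => hv j (by omega)
    rw [diff_add_order, hd, diff_add, diff_add, Pi.add_apply, Pi.add_apply]
    refine (enorm_add_le _ _).trans ((add_le_add_right (enorm_add_le _ _) _).trans ?_)
    have e1 := ih _ _ _ _ hu1 hv0
    have e2 := ih _ _ _ _ hu0 hv1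
    have e3 := ih _ _ _ _ hu1 hv1
    have e3' : (3 : ℝ≥0∞) ^ i * (A * s * (B * s)) * s ^ i ≤ 3 ^ i * (A * B) * s ^ (i + 1) := by
      calc (3 : ℝ≥0∞) ^ i * (A * s * (B * s)) * s ^ i = 3 ^ i * (A * B) * s ^ (i + 1) * s := by ring
        _ ≤ 3 ^ i * (A * B) * s ^ (i + 1) * 1 := by gcongr
        _ = _ := mul_one _
    calc _ ≤ 3 ^ i * (A * s * B) * s ^ i + (3 ^ i * (A * (B * s)) * s ^ i +
          3 ^ i * (A * B) * s ^ (i + 1)) := add_le_add e1 (add_le_add e2 (e3.trans e3'))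
      _ = 3 ^ (i + 1) * (A * B) * s ^ (i + 1) := by ring

lemma enorm_diff_prod_le {ι : Type*} {s : ℝ≥0∞} (hs : s ≤ 1) (h x : Fin n → ℝ) (l : ℕ)
    {C : ℝ≥0∞} (F : Finset ι) (u : ι → (Fin n → ℝ) → ℝ)
    (hu : ∀ a ∈ F, ∀ j ≤ l, ‖diff j h (u a) x‖ₑ ≤ C * s ^ j) :
    ∀ i ≤ l, ‖diff i h (fun y => ∏ a ∈ F, u a y) x‖ₑ ≤ (3 ^ l * C) ^ F.card * s ^ i := by
  classical
  induction F using Finset.induction_on with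
  | empty =>
    intro i hi
    simp only [Finset.prod_empty, Finset.card_empty, pow_zero, one_mul]
    rcases i with _ | i
    · simp
    · have : diff 1 h (fun _ : Fin n → ℝ => (1 : ℝ)) = (0 : ℝ) • fun _ => (1 : ℝ) := by
        funext y
        simp [diff_one]
      rw [diff_add_order, this, diff_const_smul]
      simp
  | insert a F ha ih =>
    intro i hi
    simp only [Finset.prod_insert ha]
    have h1 := enorm_diff_mul_le hs h x i (u a) (fun y => ∏ a ∈ F, u a y) C ((3 ^ l * C) ^ F.card)
      (fun j hj => hu a (Finset.mem_insert_self _ _) j (hj.trans hi))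
      (fun j hj => ih (fun a' ha' => hu a' (Finset.mem_insert_of_mem ha')) j (hj.trans hi))
    refine h1.trans ?_
    rw [Finset.card_insert_of_notMem ha, pow_succ' (3 ^ l * C), ← mul_assoc]
    gcongr
    norm_num

lemma tensorSpline_eq (l k : ℕ) (m : Fin n → ℤ) (x : Fin n → ℝ) :
    tensorSpline l k m x = ∏ i, bspline l ((2 : ℝ) ^ k * x i - m i) := by
  unfold tensorSpline
  refine Finset.prod_congr rfl fun i _ => ?_
  congr 1
  field_simp

lemma continuous_tensorSpline (l k : ℕ) (m : Fin n → ℤ) : Continuous (tensorSpline l k m) := by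
  unfold tensorSpline
  exact continuous_finsetProd _ fun i _ => (continuous_bspline l).comp (by fun_prop)

lemma exists_enorm_diff_tensorSpline_le (n : ℕ) {l : ℕ} (hl : 1 ≤ l) :
    ∃ C : ℝ≥0∞, C ≠ ∞ ∧ ∀ (k : ℕ) (m : Fin n → ℤ) (x h : Fin n → ℝ), ∀ i ≤ l,
      ‖h‖ ≤ ((2 : ℝ) ^ k)⁻¹ →
      ‖diff i h (tensorSpline l k m) x‖ₑ ≤ C * ENNReal.ofReal (2 ^ k * ‖h‖) ^ i := by
  obtain ⟨C, hC0, hC⟩ := fwdDiff_bspline_bound hl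
  refine ⟨(3 ^ l * ENNReal.ofReal (C)) ^ n, by finiteness, fun k m x h i hi hh => ?_⟩
  have hs : ENNReal.ofReal (2 ^ k * ‖h‖) ≤ 1 := by
    rw [ENNReal.ofReal_le_one]
    calc (2 : ℝ) ^ k * ‖h‖ ≤ 2 ^ k * (2 ^ k)⁻¹ := by gcongr
      _ = 1 := mul_inv_cancel₀ (by positivity)
  have h1 := enorm_diff_prod_le hs h x l (C := ENNReal.ofReal (C))
    Finset.univ (fun (a : Fin n) y => bspline l ((2 : ℝ) ^ k * y a - m a)) ?_ i hi
  · simp only [Finset.card_univ, Fintype.card_fin] at h1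
    have h2 : (fun y : Fin n → ℝ => ∏ a, bspline l ((2 : ℝ) ^ k * y a - m a)) = tensorSpline l k m :=
      funext fun y => (tensorSpline_eq l k m y).symm
    rwa [h2] at h1
  · intro a _ j hj
    have e1 : diff j h (fun y : Fin n → ℝ => bspline l ((2 : ℝ) ^ k * y a - m a)) x =
        (fwdDiff ((2 : ℝ) ^ k * h a))^[j] (bspline l) ((2 : ℝ) ^ k * x a - m a) := by
      rw [diff_eq_fwdDiff, fwdDiff_iter_eq_sum_shift, fwdDiff_iter_eq_sum_shift]
      refine Finset.sum_congr rfl fun c _ => ?_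
      congr 2
      rw [Pi.add_apply, Pi.smul_apply, nsmul_eq_mul, nsmul_eq_mul]
      ring
    rw [e1, Real.enorm_eq_ofReal_abs, ← ENNReal.ofReal_pow (by positivity),
      ← ENNReal.ofReal_mul (by positivity)]
    refine ENNReal.ofReal_le_ofReal ((hC j hj _ _).trans ?_)
    rw [abs_mul, abs_of_pos (by positivity : (0 : ℝ) < 2 ^ k)]
    gcongr
    exact norm_le_pi_norm h a

lemma tensorSpline_eq_zero {l : ℕ} (hl : 1 ≤ l) {k : ℕ} {m : Fin n → ℤ} {x : Fin n → ℝ}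
    (h : m - idx k x ∉ nbhd n l) : tensorSpline l k m x = 0 := by
  rw [mem_nbhd] at h
  push Not at h
  obtain ⟨i, hi⟩ := h
  rw [tensorSpline_eq]
  refine Finset.prod_eq_zero (Finset.mem_univ i) (bspline_sub_intCast_eq_zero hl ?_)
  rw [Finset.mem_Icc]
  rintro ⟨h1, h2⟩
  have : |(m - idx k x) i| ≤ l := by
    rw [Pi.sub_apply, abs_le]
    simp only [idx]
    constructor <;> linarith
  omega

/-- The spline `∑_m β_m N^l_{k,m}`. -/
def splineSum (l k : ℕ) (β : (Fin n → ℤ) → ℝ) (x : Fin n → ℝ) : ℝ :=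
  ∑' m : Fin n → ℤ, β m * tensorSpline l k m x

lemma isSpline_splineSum (l k : ℕ) (β : (Fin n → ℤ) → ℝ) : IsSpline l (splineSum l k β) :=
  ⟨k, β, fun _ => rfl⟩

/-- The index set depends on x alone and serves all y within c 2^{-k}. Continuity and bounds for
differences therefore reduce to a fixed finite sum. -/
lemma splineSum_eq_sum {l : ℕ} (hl : 1 ≤ l) {k c : ℕ} (β : (Fin n → ℤ) → ℝ) {x y : Fin n → ℝ}
    (hy : ∀ i, |y i - x i| ≤ c / 2 ^ k) :
    splineSum l k β y = ∑ e ∈ nbhd n (l + c + 1), β (idx k x + e) * tensorSpline l k (idx k x + e) y := by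
  unfold splineSum
  rw [← (Equiv.addLeft (idx k x)).tsum_eq, tsum_eq_sum (s := nbhd n (l + c + 1))]
  · rfl
  · intro e he
    rw [tensorSpline_eq_zero hl, mul_zero]
    intro h
    apply he
    have h1 := idx_sub_mem_nbhd hy
    rw [mem_nbhd] at h h1 ⊢
    intro i
    have h2 := h i
    have h3 := h1 i
    simp only [Equiv.coe_addLeft, Pi.sub_apply, Pi.add_apply] at h2 h3
    rw [abs_le] at h2 h3 ⊢
    push_cast at h2 h3 ⊢
    constructor <;> linarith

lemma splineSum_sub {l : ℕ} (hl : 1 ≤ l) (k : ℕ) (β γ : (Fin n → ℤ) → ℝ) :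
    splineSum l k (β - γ) = splineSum l k β - splineSum l k γ := by
  funext x
  have h : ∀ i, |x i - x i| ≤ ((0 : ℕ) : ℝ) / 2 ^ k := by simp
  rw [Pi.sub_apply, splineSum_eq_sum hl _ h, splineSum_eq_sum hl _ h, splineSum_eq_sum hl _ h,
    ← Finset.sum_sub_distrib]
  exact Finset.sum_congr rfl fun e _ => by rw [Pi.sub_apply, sub_mul]

lemma splineSum_zero (l k : ℕ) : splineSum l k (0 : (Fin n → ℤ) → ℝ) = 0 := by
  funext x
  simp [splineSum]

lemma continuous_splineSum {l : ℕ} (hl : 1 ≤ l) (k : ℕ) (β : (Fin n → ℤ) → ℝ) :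
    Continuous (splineSum l k β) := by
  rw [continuous_iff_continuousAt]
  intro x
  have h1 : Continuous fun y : Fin n → ℝ =>
      ∑ e ∈ nbhd n (l + 1 + 1), β (idx k x + e) * tensorSpline l k (idx k x + e) y :=
    continuous_finsetSum _ fun e _ => (continuous_tensorSpline l k _).const_mul _
  refine h1.continuousAt.congr ?_
  filter_upwards [Metric.ball_mem_nhds x (show (0 : ℝ) < 1 / 2 ^ k by positivity)] with y hy
  refine (splineSum_eq_sum hl β fun i => ?_).symm
  have := (dist_le_pi_dist y x i).trans (Metric.mem_ball.1 hy).le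
  rw [Real.dist_eq] at this
  exact_mod_cast this

/-- The points x + jh with j ≤ l stay within l 2^{-k} of x, and a spline reaches l cubes further;
with one for rounding this is the neighbourhood of radius l + l + 1. -/
lemma exists_isBlock_splineSum (n : ℕ) {l : ℕ} (hl : 1 ≤ l) :
    ∃ C : ℝ≥0∞, C ≠ ∞ ∧ ∀ (k : ℕ) (β : (Fin n → ℤ) → ℝ),
      IsBlock k l (splineSum l k β) fun m => C * ∑ e ∈ nbhd n (l + l + 1), ‖β (m + e)‖ₑ := by
  obtain ⟨C, hC, hN⟩ := exists_enorm_diff_tensorSpline_le n hl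
  refine ⟨C, hC, fun k β x h i hi hh => ?_⟩
  have h1 : diff i h (splineSum l k β) x = ∑ e ∈ nbhd n (l + l + 1),
      β (idx k x + e) * diff i h (tensorSpline l k (idx k x + e)) x := by
    unfold diff
    simp_rw [Finset.mul_sum]
    rw [Finset.sum_comm]
    refine Finset.sum_congr rfl fun j hj => ?_
    rw [splineSum_eq_sum (c := l) (x := x) hl, Finset.mul_sum]
    · exact Finset.sum_congr rfl fun e _ => by ring
    · intro a
      rw [Pi.add_apply, add_sub_cancel_left, Pi.smul_apply, smul_eq_mul, abs_mul, Nat.abs_cast,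
        div_eq_mul_inv]
      have hj' : (j : ℝ) ≤ l := by
        exact_mod_cast (Nat.lt_succ_iff.1 (Finset.mem_range.1 hj)).trans hi
      exact mul_le_mul hj' ((norm_le_pi_norm h a).trans hh) (abs_nonneg _) (by positivity)
  rw [h1]
  refine (enorm_sum_le _ _).trans ?_
  beta_reduce
  rw [Finset.mul_sum, Finset.sum_mul]
  refine Finset.sum_le_sum fun e _ => ?_
  rw [enorm_mul, mul_right_comm, mul_comm]
  gcongr
  exact hN k _ x h i hi hh

/-! ## Polynomials of coordinate degree less than `l` -/

/-- The polynomial functions on `ℝⁿ` that have degree less than `l` in each variable. -/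
def polySpace (n l : ℕ) : Submodule ℝ ((Fin n → ℝ) → ℝ) :=
  Submodule.span ℝ {P | ∃ q : Fin n → Polynomial ℝ, (∀ i, (q i).natDegree < l) ∧
    P = fun x => ∏ i, (q i).eval (x i)}

lemma continuous_of_mem_polySpace {l : ℕ} {P : (Fin n → ℝ) → ℝ} (hP : P ∈ polySpace n l) :
    Continuous P := by
  induction hP using Submodule.span_induction with
  | mem P hP =>
    obtain ⟨q, -, rfl⟩ := hP
    exact continuous_finsetProd _ fun i _ => (q i).continuous.comp (continuous_apply i)
  | zero => exact continuous_zero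
  | add P Q _ _ h1 h2 => exact h1.add h2
  | smul c P _ h => exact h.const_smul c

lemma const_mem_polySpace {l : ℕ} (hl : 1 ≤ l) (c : ℝ) : (fun _ => c) ∈ polySpace n l := by
  have h1 : (fun _ : Fin n → ℝ => (1 : ℝ)) ∈ polySpace n l :=
    Submodule.subset_span ⟨fun _ => 1, fun i => by rw [Polynomial.natDegree_one]; omega, by simp⟩
  convert (polySpace n l).smul_mem c h1 using 1
  funext x
  simp

lemma comp_affine_mem_polySpace {l : ℕ} {P : (Fin n → ℝ) → ℝ} (hP : P ∈ polySpace n l) (c : ℝ)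
    (d : Fin n → ℝ) : (fun x => P (c • x + d)) ∈ polySpace n l := by
  induction hP using Submodule.span_induction with
  | mem P hP =>
    obtain ⟨q, hq, rfl⟩ := hP
    refine Submodule.subset_span ⟨fun i => (q i).comp (Polynomial.C c * Polynomial.X +
      Polynomial.C (d i)), fun i => ?_, ?_⟩
    · refine lt_of_le_of_lt (Polynomial.natDegree_comp_le.trans ?_) (hq i)
      calc _ ≤ (q i).natDegree * 1 := Nat.mul_le_mul_left _ (Polynomial.natDegree_linear_le)
        _ = _ := mul_one _
    · funext x
      simp
  | zero => exact (polySpace n l).zero_mem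
  | add P Q _ _ h1 h2 => exact (polySpace n l).add_mem h1 h2
  | smul c P _ h => exact (polySpace n l).smul_mem c h

/-- Only the coordinates that move along the line contribute to the degree. In a general direction
this gives at most n (l - 1), killed by differences of order (n + 1) l; along an axis at most l - 1,
killed already by differences of order l. -/
lemma exists_polynomial_along_line {l : ℕ} {P : (Fin n → ℝ) → ℝ} (hP : P ∈ polySpace n l)
    (x h : Fin n → ℝ) : ∃ Q : Polynomial ℝ,
      Q.natDegree ≤ (Finset.univ.filter fun i => h i ≠ 0).card * (l - 1) ∧
      ∀ t : ℝ, P (x + t • h) = Q.eval t := by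
  induction hP using Submodule.span_induction with
  | mem P hP =>
    obtain ⟨q, hq, rfl⟩ := hP
    refine ⟨∏ i, (q i).comp (Polynomial.C (h i) * Polynomial.X + Polynomial.C (x i)), ?_, ?_⟩
    · refine (Polynomial.natDegree_prod_le _ _).trans ?_
      rw [Finset.card_filter, Finset.sum_mul]
      refine Finset.sum_le_sum fun i _ => Polynomial.natDegree_comp_le.trans ?_
      by_cases hi : h i = 0
      · simp [hi]
      · simp only [hi, ne_eq, not_false_eq_true, if_true, one_mul]
        calc _ ≤ (q i).natDegree * 1 := Nat.mul_le_mul_left _ (Polynomial.natDegree_linear_le)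
          _ ≤ l - 1 := by have := hq i; omega
    · intro t
      simp only [Polynomial.eval_prod, Polynomial.eval_comp, Polynomial.eval_add, Polynomial.eval_mul,
        Polynomial.eval_C, Polynomial.eval_X]
      refine Finset.prod_congr rfl fun i _ => ?_
      congr 1
      simp only [Pi.add_apply, Pi.smul_apply, smul_eq_mul]
      ring
  | zero => exact ⟨0, by simp, by simp⟩
  | add P Q _ _ h1 h2 =>
    obtain ⟨A, hA, hA'⟩ := h1
    obtain ⟨B, hB, hB'⟩ := h2
    exact ⟨A + B, (Polynomial.natDegree_add_le _ _).trans (max_le hA hB), fun t => by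
      rw [Pi.add_apply, hA', hB', Polynomial.eval_add]⟩
  | smul c P _ h =>
    obtain ⟨A, hA, hA'⟩ := h
    exact ⟨Polynomial.C c * A, (Polynomial.natDegree_C_mul_le _ _).trans hA, fun t => by
      rw [Pi.smul_apply, hA', smul_eq_mul, Polynomial.eval_mul, Polynomial.eval_C]⟩

lemma diff_eq_zero_of_polynomial {L : ℕ} {φ : (Fin n → ℝ) → ℝ} {x h : Fin n → ℝ} {Q : Polynomial ℝ}
    (hQ : Q.natDegree < L) (hφ : ∀ t : ℝ, φ (x + t • h) = Q.eval t) : diff L h φ x = 0 := by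
  have h1 := congrFun (Polynomial.fwdDiff_iter_eq_zero_of_degree_lt hQ) 0
  rw [fwdDiff_iter_eq_sum_shift] at h1
  rw [diff_eq_fwdDiff, fwdDiff_iter_eq_sum_shift]
  rw [Pi.zero_apply] at h1
  refine Eq.trans (Finset.sum_congr rfl fun j _ => ?_) h1
  congr 1
  rw [← Nat.cast_smul_eq_nsmul ℝ, hφ]
  simp

lemma diff_eq_zero_of_mem_polySpace {l : ℕ} (hl : 1 ≤ l) {P : (Fin n → ℝ) → ℝ}
    (hP : P ∈ polySpace n l) (x h : Fin n → ℝ) : diff ((n + 1) * l) h P x = 0 := by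
  obtain ⟨Q, hQ, hQ'⟩ := exists_polynomial_along_line hP x h
  refine diff_eq_zero_of_polynomial (lt_of_le_of_lt hQ ?_) hQ'
  calc _ ≤ n * (l - 1) := Nat.mul_le_mul_right _ (by
        simpa using Finset.card_filter_le (Finset.univ : Finset (Fin n)) (fun i => h i ≠ 0))
    _ ≤ n * l := Nat.mul_le_mul_left _ (by omega)
    _ < (n + 1) * l := by nlinarith

lemma diff_single_eq_zero_of_mem_polySpace {l : ℕ} (hl : 1 ≤ l) {P : (Fin n → ℝ) → ℝ}
    (hP : P ∈ polySpace n l) (x : Fin n → ℝ) (i : Fin n) (s : ℝ) :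
    diff l (Pi.single i s) P x = 0 := by
  obtain ⟨Q, hQ, hQ'⟩ := exists_polynomial_along_line hP x (Pi.single i s)
  refine diff_eq_zero_of_polynomial (lt_of_le_of_lt hQ ?_) hQ'
  have h1 : (Finset.univ.filter fun j => (Pi.single i s : Fin n → ℝ) j ≠ 0).card ≤ 1 := by
    rw [Finset.card_le_one]
    intro a ha b hb
    simp only [Finset.mem_filter, Finset.mem_univ, true_and, ne_eq, Pi.single_apply, ite_eq_right_iff,
      Classical.not_imp] at ha hb
    rw [ha.1, hb.1]
  calc _ ≤ 1 * (l - 1) := Nat.mul_le_mul_right _ h1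
    _ < l := by omega

/-! ### Tensor-product Lagrange interpolation on the grid. -/

/-- The Lagrange polynomials with nodes `0, …, l - 1`. -/
def lagr (l : ℕ) (j : Fin l) : Polynomial ℝ :=
  Lagrange.basis Finset.univ (fun j : Fin l => ((j : ℕ) : ℝ)) j

lemma injOn_nodes (l : ℕ) : Set.InjOn (fun j : Fin l => ((j : ℕ) : ℝ)) (Finset.univ : Finset (Fin l)) := by
  intro a _ b _ h
  simpa [Fin.ext_iff] using h

lemma natDegree_lagr (l : ℕ) (j : Fin l) : (lagr l j).natDegree < l := by
  unfold lagr
  rw [Lagrange.natDegree_basis (injOn_nodes l) (Finset.mem_univ j)]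
  have := j.2
  simp only [Finset.card_univ, Fintype.card_fin]
  omega

lemma eval_lagr (l : ℕ) (j j' : Fin l) : (lagr l j).eval ((j' : ℕ) : ℝ) = if j = j' then 1 else 0 := by
  unfold lagr
  split_ifs with h
  · subst h
    exact Lagrange.eval_basis_self (injOn_nodes l) (Finset.mem_univ _)
  · exact Lagrange.eval_basis_of_ne (v := fun j : Fin l => ((j : ℕ) : ℝ)) h (Finset.mem_univ _)

lemma eval_eq_sum_lagr {l : ℕ} {q : Polynomial ℝ} (hq : q.natDegree < l) (x : ℝ) :
    q.eval x = ∑ j : Fin l, q.eval ((j : ℕ) : ℝ) * (lagr l j).eval x := by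
  have hdeg : q.degree < (Finset.univ : Finset (Fin l)).card := by
    rw [Finset.card_univ, Fintype.card_fin]
    exact lt_of_le_of_lt Polynomial.degree_le_natDegree (by exact_mod_cast hq)
  have h1 := Lagrange.eq_interpolate (injOn_nodes l) hdeg
  conv_lhs => rw [h1]
  rw [Lagrange.interpolate_apply, Polynomial.eval_finsetSum]
  exact Finset.sum_congr rfl fun j _ => by rw [Polynomial.eval_mul, Polynomial.eval_C]; rfl

/-- The grid points `{0, …, l - 1}ⁿ`. -/
def gridPoint {l : ℕ} (κ : Fin n → Fin l) : Fin n → ℝ := fun i => ((κ i : ℕ) : ℝ)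

lemma exists_mem_polySpace_interpolating (l : ℕ) (c : (Fin n → Fin l) → ℝ) :
    ∃ P ∈ polySpace n l, ∀ κ, P (gridPoint κ) = c κ := by
  refine ⟨∑ κ, c κ • fun x => ∏ i, (lagr l (κ i)).eval (x i),
    Submodule.sum_mem _ fun κ _ => Submodule.smul_mem _ _ (Submodule.subset_span
      ⟨fun i => lagr l (κ i), fun i => natDegree_lagr l _, rfl⟩), fun κ => ?_⟩
  rw [Finset.sum_apply, Finset.sum_eq_single κ]
  · simp [gridPoint, eval_lagr]
  · intro κ' _ hκ
    have : ∃ i, κ' i ≠ κ i := by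
      by_contra! h
      exact hκ (funext h)
    obtain ⟨i, hi⟩ := this
    rw [Pi.smul_apply, smul_eq_mul, Finset.prod_eq_zero (Finset.mem_univ i), mul_zero]
    rw [gridPoint, eval_lagr, if_neg hi]
  · simp

lemma eq_sum_lagr_of_mem_polySpace {l : ℕ} {P : (Fin n → ℝ) → ℝ} (hP : P ∈ polySpace n l)
    (x : Fin n → ℝ) :
    P x = ∑ κ : Fin n → Fin l, P (gridPoint κ) * ∏ i, (lagr l (κ i)).eval (x i) := by
  induction hP using Submodule.span_induction with
  | mem P hP =>
    obtain ⟨q, hq, rfl⟩ := hP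
    simp_rw [← Finset.prod_mul_distrib, gridPoint]
    rw [Finset.prod_congr rfl fun i _ => eval_eq_sum_lagr (hq i) (x i), Finset.prod_univ_sum,
      Fintype.piFinset_univ]
  | zero => simp
  | add P Q _ _ h1 h2 => simp only [Pi.add_apply, add_mul, Finset.sum_add_distrib, ← h1, ← h2]
  | smul c P _ h => simp only [Pi.smul_apply, smul_eq_mul, mul_assoc, ← Finset.mul_sum, ← h]

lemma enorm_sum_rpow_le {ι : Type*} (s : Finset ι) {θ : ℝ} (hθ : 0 < θ) (hθ1 : θ ≤ 1) (f : ι → ℝ) :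
    ‖∑ i ∈ s, f i‖ₑ ^ θ ≤ ∑ i ∈ s, ‖f i‖ₑ ^ θ := by
  classical
  induction s using Finset.induction_on with
  | empty => simp [hθ]
  | insert a s ha ih =>
    rw [Finset.sum_insert ha, Finset.sum_insert ha]
    refine (ENNReal.rpow_le_rpow (enorm_add_le _ _) hθ.le).trans ?_
    exact (ENNReal.rpow_add_le_add_rpow _ _ hθ.le hθ1).trans (add_le_add_right ih _)

/-- On bounded sets a polynomial is controlled by its values on a box, in the mean of order `θ`. -/
lemma exists_enorm_le_of_mem_polySpace (n l R : ℕ) {θ : ℝ} (hθ : 0 < θ) (hθ1 : θ ≤ 1) :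
    ∃ C : ℝ≥0∞, C ≠ ∞ ∧ ∀ P ∈ polySpace n l, ∀ x : Fin n → ℝ, ‖x‖ ≤ R →
      ‖P x‖ₑ ^ θ ≤ C * ∫⁻ z in Set.Icc 0 (fun _ => (l : ℝ)), ‖P z‖ₑ ^ θ := by
  have hcont : ∀ κ : Fin n → Fin l, Continuous fun u : Fin n → ℝ => ∏ i, (lagr l (κ i)).eval (u i) :=
    fun κ => continuous_finsetProd _ fun i _ => (lagr l (κ i)).continuous.comp (continuous_apply i)
  have hK : ∀ κ : Fin n → Fin l, ∃ B : ℝ, ∀ u ∈ Metric.closedBall (0 : Fin n → ℝ) (R + 1),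
      ‖∏ i, (lagr l (κ i)).eval (u i)‖ ≤ B := fun κ =>
    (isCompact_closedBall _ _).exists_bound_of_continuousOn (hcont κ).continuousOn
  choose B hB using hK
  refine ⟨∑ κ, ENNReal.ofReal (B κ) ^ θ, ENNReal.sum_ne_top.2 fun κ _ =>
    ENNReal.rpow_ne_top_of_nonneg hθ.le ENNReal.ofReal_ne_top, fun P hP x hx => ?_⟩
  set U : Set (Fin n → ℝ) := Set.pi Set.univ fun _ => Set.Ico (0 : ℝ) 1 with hU
  have hUvol : volume U = 1 := by
    rw [hU, volume_pi_pi]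
    simp
  have hUm : MeasurableSet U := MeasurableSet.univ_pi fun _ => measurableSet_Ico
  -- Interpolation at the grid translated by y. Averaging over y in the unit cube turns point values
  -- into integrals, since the translated unit cubes lie in [0, l]ⁿ.
  have hpt : ∀ y ∈ U, ‖P x‖ₑ ^ θ ≤ ∑ κ : Fin n → Fin l,
      ENNReal.ofReal (B κ) ^ θ * ‖P (gridPoint κ + y)‖ₑ ^ θ := by
    intro y hy
    have h1 := eq_sum_lagr_of_mem_polySpace (comp_affine_mem_polySpace hP 1 y) (x - y)
    simp only [one_smul, sub_add_cancel] at h1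
    rw [h1]
    refine (enorm_sum_rpow_le _ hθ hθ1 _).trans (Finset.sum_le_sum fun κ _ => ?_)
    rw [enorm_mul, ENNReal.mul_rpow_of_nonneg _ _ hθ.le, mul_comm]
    gcongr
    rw [← ofReal_norm]
    refine ENNReal.ofReal_le_ofReal (hB κ (x - y) ?_)
    rw [mem_closedBall_zero_iff]
    refine (norm_sub_le _ _).trans (add_le_add hx ?_)
    rw [pi_norm_le_iff_of_nonneg zero_le_one]
    intro i
    have := hy i (Set.mem_univ i)
    rw [Real.norm_eq_abs, abs_of_nonneg this.1]
    exact this.2.le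
  calc ‖P x‖ₑ ^ θ = ∫⁻ y in U, ‖P x‖ₑ ^ θ := by rw [setLIntegral_const, hUvol, mul_one]
    _ ≤ ∫⁻ y in U, ∑ κ : Fin n → Fin l, ENNReal.ofReal (B κ) ^ θ * ‖P (gridPoint κ + y)‖ₑ ^ θ :=
        setLIntegral_mono' hUm hpt
    _ = ∑ κ : Fin n → Fin l, ENNReal.ofReal (B κ) ^ θ * ∫⁻ y in U, ‖P (gridPoint κ + y)‖ₑ ^ θ := by
        have hPm := (continuous_of_mem_polySpace hP).measurable
        rw [lintegral_finsetSum _ fun κ _ => by fun_prop]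
        exact Finset.sum_congr rfl fun κ _ => lintegral_const_mul _ (by fun_prop)
    _ ≤ ∑ κ : Fin n → Fin l, ENNReal.ofReal (B κ) ^ θ *
          ∫⁻ z in Set.Icc 0 (fun _ => (l : ℝ)), ‖P z‖ₑ ^ θ := by
        refine Finset.sum_le_sum fun κ _ => ?_
        refine mul_le_mul_right ?_ _
        have h2 : ∫⁻ y in U, ‖P (gridPoint κ + y)‖ₑ ^ θ =
            ∫⁻ z in (fun y => gridPoint κ + y) '' U, ‖P z‖ₑ ^ θ := by
          rw [← (measurePreserving_add_left volume (gridPoint κ)).setLIntegral_comp_emb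
            (measurableEmbedding_addLeft _)]
        rw [h2]
        refine lintegral_mono_set ?_
        rintro _ ⟨y, hy, rfl⟩
        rw [Set.mem_Icc]
        refine ⟨fun i => ?_, fun i => ?_⟩
        · have := (hy i (Set.mem_univ i)).1
          simp only [Pi.zero_apply, Pi.add_apply, gridPoint]
          positivity
        · have := (hy i (Set.mem_univ i)).2.le
          have h3 : ((κ i : ℕ) : ℝ) + 1 ≤ l := by exact_mod_cast (κ i).2
          simp only [Pi.add_apply, gridPoint]
          linarith
    _ = _ := by rw [Finset.sum_mul]

/-! ## Coefficients of polynomials with respect to the B-splines -/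

/-- The functional `∑_κ (∏ᵢ ω_{κᵢ}) P(2^{-k} (m + κ))`, `κ ∈ {0, …, l}ⁿ`. -/
def splineCoeff {l : ℕ} (ω : Fin (l + 1) → ℝ) (k : ℕ) (m : Fin n → ℤ) (P : (Fin n → ℝ) → ℝ) : ℝ :=
  ∑ κ : Fin n → Fin (l + 1), (∏ i, ω (κ i)) *
    P (((2 : ℝ) ^ k)⁻¹ • ((fun i => (m i : ℝ)) + gridPoint κ))

lemma splineCoeff_sub {l : ℕ} (ω : Fin (l + 1) → ℝ) (k : ℕ) (m : Fin n → ℤ) (P Q : (Fin n → ℝ) → ℝ) :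
    splineCoeff ω k m (P - Q) = splineCoeff ω k m P - splineCoeff ω k m Q := by
  simp only [splineCoeff, Pi.sub_apply, mul_sub, Finset.sum_sub_distrib]

/-- For a product of one-variable polynomials both the coefficient and the spline factorise, and the
one-dimensional reproduction applies in each variable. The general case is linear. -/
lemma splineSum_splineCoeff {l : ℕ} (hl : 1 ≤ l) {ω : Fin (l + 1) → ℝ}
    (hω : ∀ q : Polynomial ℝ, q.natDegree ≤ l → ∀ x : ℝ,
      ∑' m : ℤ, (∑ g, ω g * q.eval ((m : ℝ) + (g : ℕ))) * bspline l (x - m) = q.eval x)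
    (k : ℕ) {P : (Fin n → ℝ) → ℝ} (hP : P ∈ polySpace n l) :
    splineSum l k (fun m => splineCoeff ω k m P) = P := by
  funext x
  have hx : ∀ i, |x i - x i| ≤ ((0 : ℕ) : ℝ) / 2 ^ k := by simp
  induction hP using Submodule.span_induction with
  | mem P hP =>
    obtain ⟨q, hq, rfl⟩ := hP
    set q' : Fin n → Polynomial ℝ := fun i => (q i).comp (Polynomial.C ((2 : ℝ) ^ k)⁻¹ * Polynomial.X)
    have hq' : ∀ i, (q' i).natDegree ≤ l := fun i => by
      refine (Polynomial.natDegree_comp_le.trans ?_).trans (hq i).le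
      calc _ ≤ (q i).natDegree * 1 := Nat.mul_le_mul_left _
            ((Polynomial.natDegree_C_mul_le _ _).trans Polynomial.natDegree_X_le)
        _ = _ := mul_one _
    have hcoef : ∀ m : Fin n → ℤ, splineCoeff ω k m (fun x => ∏ i, (q i).eval (x i)) =
        ∏ i, ∑ g, ω g * (q' i).eval ((m i : ℝ) + (g : ℕ)) := by
      intro m
      rw [Finset.prod_univ_sum, Fintype.piFinset_univ]
      unfold splineCoeff
      refine Finset.sum_congr rfl fun κ _ => ?_
      rw [← Finset.prod_mul_distrib]
      refine Finset.prod_congr rfl fun i _ => ?_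
      simp [q', gridPoint]
    have hsupp : ∀ i, ∀ m : ℤ, m ∉ Finset.Icc (⌊(2 : ℝ) ^ k * x i⌋ - l) ⌊(2 : ℝ) ^ k * x i⌋ →
        (∑ g, ω g * (q' i).eval ((m : ℝ) + (g : ℕ))) * bspline l ((2 : ℝ) ^ k * x i - m) = 0 :=
      fun i m hm => by rw [bspline_sub_intCast_eq_zero hl hm, mul_zero]
    unfold splineSum
    simp_rw [hcoef, tensorSpline_eq, ← Finset.prod_mul_distrib]
    rw [tsum_eq_sum (s := Fintype.piFinset fun i =>
      Finset.Icc (⌊(2 : ℝ) ^ k * x i⌋ - (l : ℤ)) ⌊(2 : ℝ) ^ k * x i⌋),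
      ← Finset.prod_univ_sum (fun i => Finset.Icc (⌊(2 : ℝ) ^ k * x i⌋ - (l : ℤ)) ⌊(2 : ℝ) ^ k * x i⌋)
        (fun i (m : ℤ) => (∑ g, ω g * (q' i).eval ((m : ℝ) + (g : ℕ))) *
          bspline l ((2 : ℝ) ^ k * x i - m))]
    · refine Finset.prod_congr rfl fun i _ => ?_
      rw [← tsum_eq_sum (L := .unconditional ℤ) (hsupp i), hω _ (hq' i)]
      simp only [q', Polynomial.eval_comp, Polynomial.eval_mul, Polynomial.eval_C, Polynomial.eval_X]
      congr 1
      field_simp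
    · intro m hm
      rw [Fintype.mem_piFinset] at hm
      push Not at hm
      obtain ⟨i, hi⟩ := hm
      exact Finset.prod_eq_zero (Finset.mem_univ i) (hsupp i _ hi)
  | zero => simp [splineCoeff, splineSum]
  | add P Q _ _ h1 h2 =>
    rw [Pi.add_apply, ← h1, ← h2, splineSum_eq_sum hl _ hx, splineSum_eq_sum hl _ hx,
      splineSum_eq_sum hl _ hx, ← Finset.sum_add_distrib]
    refine Finset.sum_congr rfl fun e _ => ?_
    simp only [splineCoeff, Pi.add_apply, mul_add, Finset.sum_add_distrib, add_mul]
  | smul c P _ h =>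
    rw [Pi.smul_apply, ← h, splineSum_eq_sum hl _ hx, splineSum_eq_sum hl _ hx, Finset.smul_sum]
    refine Finset.sum_congr rfl fun e _ => ?_
    simp only [splineCoeff, Pi.smul_apply, smul_eq_mul, Finset.sum_mul, Finset.mul_sum]
    exact Finset.sum_congr rfl fun κ _ => by ring

/-! ## Recurrences -/

lemma enorm_signed_choose (L i j : ℕ) : ‖(-1 : ℝ) ^ i * (L.choose j : ℝ)‖ₑ = (L.choose j : ℝ≥0∞) := by
  rw [enorm_mul, enorm_pow, enorm_neg, enorm_one, one_pow, one_mul,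
    Real.enorm_eq_ofReal (by positivity), ENNReal.ofReal_natCast]

/-- The top term of the difference has coefficient 1, so u (i + L) can be solved for in terms of
earlier values; this multiplies the bound by at most 2^L + 1. -/
lemma enorm_le_of_recurrence {L : ℕ} (u : ℕ → ℝ) {B S : ℝ≥0∞} {N : ℕ}
    (hB : ∀ j < L, ‖u j‖ₑ ≤ B)
    (hS : ∀ j, j + L ≤ N →
      ‖∑ i ∈ Finset.range (L + 1), (-1 : ℝ) ^ (L + i) * (L.choose i : ℝ) * u (j + i)‖ₑ ≤ S) :
    ∀ j ≤ N, ‖u j‖ₑ ≤ (2 ^ L + 1) ^ j * (B + S) := by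
  intro j
  induction j using Nat.strong_induction_on with
  | _ j ih =>
    intro hj
    have hA : (1 : ℝ≥0∞) ≤ 2 ^ L + 1 := le_add_self
    rcases lt_or_ge j L with h | h
    · calc ‖u j‖ₑ ≤ 1 * (B + S) := by
            rw [one_mul]
            exact (hB j h).trans le_self_add
        _ ≤ _ := by
            gcongr
            exact one_le_pow₀ hA
    · obtain ⟨i, rfl⟩ := Nat.exists_eq_add_of_le' h
      rcases Nat.eq_zero_or_pos L with rfl | hL
      · have := hS i hj
        simp only [zero_add, Finset.range_one, Finset.sum_singleton, add_zero, pow_zero,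
          Nat.choose_self, Nat.cast_one, one_mul] at this
        calc ‖u i‖ₑ ≤ 1 * (B + S) := by
              rw [one_mul]
              exact this.trans le_add_self
          _ ≤ _ := by
              gcongr
              exact one_le_pow₀ hA
      have h1 : u (i + L) = (∑ a ∈ Finset.range (L + 1), (-1 : ℝ) ^ (L + a) * (L.choose a : ℝ) * u (i + a))
          - ∑ a ∈ Finset.range L, (-1 : ℝ) ^ (L + a) * (L.choose a : ℝ) * u (i + a) := by
        rw [Finset.sum_range_succ, add_sub_cancel_left, ← two_mul, pow_mul]
        simp
      obtain ⟨c, hc⟩ : ∃ c, i + L = c + 1 := ⟨i + L - 1, by omega⟩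
      have h2 : ‖∑ a ∈ Finset.range L, (-1 : ℝ) ^ (L + a) * (L.choose a : ℝ) * u (i + a)‖ₑ ≤
          2 ^ L * ((2 ^ L + 1) ^ c * (B + S)) := by
        refine (enorm_sum_le _ _).trans ?_
        calc _ ≤ ∑ a ∈ Finset.range L, (L.choose a : ℝ≥0∞) * ((2 ^ L + 1) ^ c * (B + S)) := by
              refine Finset.sum_le_sum fun a ha => ?_
              rw [Finset.mem_range] at ha
              rw [enorm_mul, enorm_signed_choose]
              refine mul_le_mul_right ((ih (i + a) (by omega) (by omega)).trans ?_) _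
              gcongr
              omega
          _ ≤ ∑ a ∈ Finset.range (L + 1), (L.choose a : ℝ≥0∞) * ((2 ^ L + 1) ^ c * (B + S)) :=
              Finset.sum_le_sum_of_subset (Finset.range_mono (by omega))
          _ = _ := by
              rw [← Finset.sum_mul]
              congr 1
              exact_mod_cast Nat.sum_range_choose L
      rw [h1]
      refine (enorm_sub_le).trans ((add_le_add (hS i hj) h2).trans ?_)
      rw [hc]
      calc S + 2 ^ L * ((2 ^ L + 1) ^ c * (B + S))
          ≤ (2 ^ L + 1) ^ c * (B + S) + 2 ^ L * ((2 ^ L + 1) ^ c * (B + S)) := by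
            gcongr
            calc S ≤ 1 * (B + S) := by rw [one_mul]; exact le_add_self
              _ ≤ _ := by
                  gcongr
                  exact one_le_pow₀ hA
        _ = _ := by ring

/-- Evaluated at x = 1 / M this is the source of the small factor 1 / M in the next lemma. -/
lemma lagr_increment_le (L : ℕ) (κ : Fin L) :
    ∃ C : ℝ, 0 ≤ C ∧ ∀ x : ℝ, 0 ≤ x → x ≤ 1 → |(lagr L κ).eval x - (lagr L κ).eval 0| ≤ C * x := by
  obtain ⟨C, hC⟩ := isCompact_Icc.exists_bound_of_continuousOn (s := Set.Icc (0 : ℝ) 1)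
    ((lagr L κ).divX.continuous.continuousOn)
  refine ⟨max C 0, le_max_right _ _, fun x hx hx1 => ?_⟩
  have h1 : ∀ y, (lagr L κ).eval y = (lagr L κ).divX.eval y * y + (lagr L κ).coeff 0 := fun y => by
    conv_lhs => rw [← Polynomial.divX_mul_X_add (lagr L κ)]
    simp
  rw [h1 x, h1 0, mul_zero, zero_add, add_sub_cancel_right, abs_mul, abs_of_nonneg hx]
  gcongr
  exact (hC x ⟨hx, hx1⟩).trans (le_max_left _ _)

/-- A discrete Marchaud-type inequality. -/
lemma exists_increment_le (L : ℕ) (hL : 1 ≤ L) : ∃ C₀ : ℝ≥0∞, C₀ ≠ ∞ ∧ ∀ M : ℕ, 1 ≤ M →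
    ∃ C₁ : ℝ≥0∞, C₁ ≠ ∞ ∧ ∀ (v : ℕ → ℝ) (S : ℝ≥0∞), (∀ j, j + L ≤ L * M →
      ‖∑ i ∈ Finset.range (L + 1), (-1 : ℝ) ^ (L + i) * (L.choose i : ℝ) * v (j + i)‖ₑ ≤ S) →
      ‖v 1 - v 0‖ₑ ≤ (C₀ / M) * ∑ κ : Fin L, ‖v (κ * M)‖ₑ + C₁ * S := by
  choose C hC0 hC using lagr_increment_le L
  set C₀ : ℝ≥0∞ := ∑ κ, ENNReal.ofReal (C κ) with hC₀
  refine ⟨C₀, ENNReal.sum_ne_top.2 fun κ _ => ENNReal.ofReal_ne_top, fun M hM => ?_⟩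
  set A : ℝ≥0∞ := (2 ^ L + 1) ^ (L * M) with hA
  have hM0 : (M : ℝ≥0∞) ≠ 0 := by exact_mod_cast (by omega : M ≠ 0)
  have hC₀t : C₀ ≠ ∞ := ENNReal.sum_ne_top.2 fun κ _ => ENNReal.ofReal_ne_top
  refine ⟨C₀ / M * (L * A) + 2 * A, ?_, fun v S hS => ?_⟩
  · exact ENNReal.add_ne_top.2 ⟨ENNReal.mul_ne_top (ENNReal.div_ne_top hC₀t hM0)
      (by finiteness), by finiteness⟩
  -- The interpolant of the first L values has vanishing differences of order L, so v - Q solves the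
  -- recurrence with zero initial values and is of size S, with a constant that depends on M.
  set Q : Polynomial ℝ := ∑ κ : Fin L, Polynomial.C (v κ) * lagr L κ with hQ
  have hQd : Q.natDegree < L := by
    refine lt_of_le_of_lt (Polynomial.natDegree_sum_le_of_forall_le (n := L - 1) _ _ fun κ _ => ?_)
      (by omega)
    refine (Polynomial.natDegree_C_mul_le _ _).trans ?_
    have := natDegree_lagr L κ
    omega
  have hQv : ∀ j < L, Q.eval (j : ℝ) = v j := by
    intro j hj
    rw [hQ, Polynomial.eval_finsetSum, Finset.sum_eq_single (⟨j, hj⟩ : Fin L)]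
    · rw [Polynomial.eval_mul, Polynomial.eval_C]
      have := eval_lagr L ⟨j, hj⟩ ⟨j, hj⟩
      simp only [if_true] at this
      rw [this, mul_one]
    · intro κ _ hκ
      rw [Polynomial.eval_mul]
      have := eval_lagr L κ ⟨j, hj⟩
      simp only [hκ, if_false] at this
      rw [this, mul_zero]
    · simp
  have hdiff : ∀ j : ℕ, ∑ i ∈ Finset.range (L + 1), (-1 : ℝ) ^ (L + i) * (L.choose i : ℝ) *
      Q.eval ((j + i : ℕ) : ℝ) = 0 := by
    intro j
    have h1 : diff L (fun _ : Fin 1 => (1 : ℝ)) (fun x => Q.eval (x 0)) (fun _ => (j : ℝ)) = 0 := by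
      refine diff_eq_zero_of_polynomial (Q := Q.comp (Polynomial.X + Polynomial.C (j : ℝ))) ?_ ?_
      · refine lt_of_le_of_lt Polynomial.natDegree_comp_le ?_
        rwa [Polynomial.natDegree_X_add_C, mul_one]
      · intro t
        simp [add_comm]
    unfold diff at h1
    refine Eq.trans (Finset.sum_congr rfl fun i _ => ?_) h1
    simp
  have hu := enorm_le_of_recurrence (L := L) (fun j => v j - Q.eval (j : ℝ)) (B := 0) (S := S)
    (N := L * M) (fun j hj => by simp [hQv j hj]) (fun j hj => by
      simp only [mul_sub, Finset.sum_sub_distrib]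
      rw [hdiff j, sub_zero]
      exact hS j hj)
  simp only [zero_add] at hu
  have hu' : ∀ j ≤ L * M, ‖v j - Q.eval (j : ℝ)‖ₑ ≤ A * S := fun j hj => by
    refine (hu j hj).trans ?_
    rw [hA]
    gcongr
    exact le_add_self
  have hLM : 1 ≤ L * M := Nat.mul_pos hL hM
  have hMr : (M : ℝ) ≠ 0 := by exact_mod_cast (by omega : M ≠ 0)
  -- The same polynomial interpolated at the widely spaced nodes κM: between 0 and 1 the rescaled
  -- Lagrange polynomials change only by O(1/M), with a constant that depends on L alone.
  have hQi : Q.eval 1 - Q.eval 0 = ∑ κ : Fin L, Q.eval ((κ * M : ℕ) : ℝ) *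
      ((lagr L κ).eval (1 / M : ℝ) - (lagr L κ).eval 0) := by
    set Q' := Q.comp (Polynomial.C (M : ℝ) * Polynomial.X) with hQ'
    have hd : Q'.natDegree < L := by
      refine lt_of_le_of_lt Polynomial.natDegree_comp_le (lt_of_le_of_lt ?_ hQd)
      calc _ ≤ Q.natDegree * 1 := Nat.mul_le_mul_left _
            ((Polynomial.natDegree_C_mul_le _ _).trans Polynomial.natDegree_X_le)
        _ = _ := mul_one _
    have he : ∀ x, Q'.eval x = Q.eval (M * x) := fun x => by simp [hQ']
    have e1 := eval_eq_sum_lagr hd (1 / M)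
    have e2 := eval_eq_sum_lagr hd 0
    rw [he, mul_one_div_cancel hMr] at e1
    rw [he, mul_zero] at e2
    rw [e1, e2, ← Finset.sum_sub_distrib]
    refine Finset.sum_congr rfl fun κ _ => ?_
    rw [he, mul_sub]
    push_cast
    rw [mul_comm (M : ℝ)]
  have hinc : ‖Q.eval 1 - Q.eval 0‖ₑ ≤ C₀ / M * (∑ κ : Fin L, ‖v (κ * M)‖ₑ + L * (A * S)) := by
    rw [hQi]
    refine (enorm_sum_le _ _).trans ?_
    have hsum : ∑ κ : Fin L, ‖v (κ * M)‖ₑ + L * (A * S) = ∑ κ : Fin L, (‖v (κ * M)‖ₑ + A * S) := by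
      rw [Finset.sum_add_distrib]
      simp
    rw [hsum, Finset.mul_sum]
    refine Finset.sum_le_sum fun κ _ => ?_
    rw [enorm_mul, mul_comm]
    refine mul_le_mul' ?_ ?_
    · rw [Real.enorm_eq_ofReal_abs]
      have h1 : (1 : ℝ) / M ≤ 1 := by
        rw [div_le_one (by positivity)]
        exact_mod_cast hM
      refine (ENNReal.ofReal_le_ofReal (hC κ _ (by positivity) h1)).trans ?_
      rw [ENNReal.ofReal_mul (hC0 κ), ENNReal.ofReal_div_of_pos (by positivity), ENNReal.ofReal_one,
        ENNReal.ofReal_natCast, mul_one_div]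
      gcongr
      exact Finset.single_le_sum (f := fun κ => ENNReal.ofReal (C κ)) (fun _ _ => zero_le)
        (Finset.mem_univ κ)
    · have h1 : Q.eval ((κ * M : ℕ) : ℝ) = v (κ * M) - (v (κ * M) - Q.eval ((κ * M : ℕ) : ℝ)) := by ring
      rw [h1]
      exact enorm_sub_le.trans (add_le_add_right (hu' _ (Nat.mul_le_mul_right _ κ.2.le)) _)
  have hfin : v 1 - v 0 = (Q.eval 1 - Q.eval 0) + ((v 1 - Q.eval ((1 : ℕ) : ℝ)) -
      (v 0 - Q.eval ((0 : ℕ) : ℝ))) := by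
    push_cast
    ring
  rw [hfin]
  refine (enorm_add_le _ _).trans ((add_le_add hinc (enorm_sub_le.trans
    (add_le_add (hu' 1 hLM) (hu' 0 (Nat.zero_le _))))).trans (le_of_eq ?_))
  ring

/-- A function on a box of `ℕⁿ` that vanishes on the grid `{0, …, l - 1}ⁿ` is controlled by its
differences in the coordinate directions. -/
lemma enorm_le_of_grid {l N : ℕ} (hlN : l ≤ N) (w : (Fin n → ℕ) → ℝ) {S : ℝ≥0∞}
    (h0 : ∀ g : Fin n → ℕ, (∀ i, g i < l) → w g = 0)
    (hS : ∀ (g : Fin n → ℕ) (i : Fin n), (∀ a, g a ≤ N) →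
      ‖∑ j ∈ Finset.range (l + 1), (-1 : ℝ) ^ (l + j) * (l.choose j : ℝ) *
        w (Function.update g i (g i + j))‖ₑ ≤ S)
    (g : Fin n → ℕ) (hg : ∀ i, g i ≤ N) : ‖w g‖ₑ ≤ (2 * (2 ^ l + 1) ^ N) ^ n * S := by
  -- Induction on the number k of coordinates that may leave {0, …, l - 1}: along the newly freed
  -- axis the recurrence starts from values already bounded.
  have key : ∀ k ≤ n, ∀ g : Fin n → ℕ, (∀ i, g i ≤ N) → (∀ i : Fin n, k ≤ i → g i < l) →
      ‖w g‖ₑ ≤ (2 * (2 ^ l + 1) ^ N) ^ k * S := by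
    intro k
    induction k with
    | zero =>
      intro _ g _ h
      rw [h0 g fun i => h i (Nat.zero_le _), enorm_zero]
      exact zero_le
    | succ k ih =>
      intro hk g hg h
      set i : Fin n := ⟨k, hk⟩ with hi
      have hA : (1 : ℝ≥0∞) ≤ 2 ^ l + 1 := le_add_self
      have hA1 : (1 : ℝ≥0∞) ≤ (2 * (2 ^ l + 1) ^ N) ^ k := by
        refine one_le_pow₀ ?_
        calc (1 : ℝ≥0∞) = 1 * 1 := (one_mul 1).symm
          _ ≤ _ := mul_le_mul' (by norm_num) (one_le_pow₀ hA)
      have hu := enorm_le_of_recurrence (L := l) (fun j => w (Function.update g i j))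
        (B := (2 * (2 ^ l + 1) ^ N) ^ k * S) (S := S) (N := N) ?_ ?_ (g i) (hg i)
      · simp only [Function.update_eq_self] at hu
        refine hu.trans ?_
        calc (2 ^ l + 1) ^ g i * ((2 * (2 ^ l + 1) ^ N) ^ k * S + S)
            ≤ (2 ^ l + 1) ^ N * ((2 * (2 ^ l + 1) ^ N) ^ k * S + (2 * (2 ^ l + 1) ^ N) ^ k * S) := by
              gcongr
              · exact hg i
              · calc S = 1 * S := (one_mul S).symm
                  _ ≤ _ := by gcongr
          _ = _ := by ring
      · intro j hj
        have hjN : j ≤ N := by omega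
        refine ih (by omega) _ (fun a => ?_) (fun a ha => ?_)
        · by_cases ha : a = i
          · subst ha; simpa using hjN
          · rw [Function.update_of_ne ha]; exact hg a
        · by_cases ha' : a = i
          · subst ha'; simpa using hj
          · rw [Function.update_of_ne ha']
            refine h a ?_
            have : (a : ℕ) ≠ k := fun h => ha' (Fin.ext h)
            omega
      · intro j hj
        have := hS (Function.update g i j) i (fun a => by
          by_cases ha : a = i
          · subst ha; simp; omega
          · rw [Function.update_of_ne ha]; exact hg a)
        simpa using this
  exact key n le_rfl g hg fun i hi => absurd i.2 (by omega)

/-! ## Averages of differences -/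

lemma lintegral_comp_affine (F : (Fin n → ℝ) → ℝ≥0∞) (a : Fin n → ℝ) {c : ℝ} (hc : 0 < c) :
    ∫⁻ x, F (a + c • x) = ENNReal.ofReal ((c ^ n)⁻¹) * ∫⁻ x, F x := by
  have h1 : ∫⁻ x, F (a + c • x) = ∫⁻ x, F (a + x) ∂(Measure.map (fun x => c • x) volume) := by
    have hme : MeasurableEmbedding (fun x : Fin n → ℝ => c • x) :=
      measurableEmbedding_const_smul₀ hc.ne'
    rw [hme.lintegral_map]
  rw [h1, Measure.map_addHaar_smul _ hc.ne', lintegral_smul_measure, lintegral_add_left_eq_self,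
    smul_eq_mul, Module.finrank_fin_fun, abs_of_pos (by positivity)]

lemma setLIntegral_comp_add_le (F : (Fin n → ℝ) → ℝ≥0∞) (a : Fin n → ℝ) {A B : Set (Fin n → ℝ)}
    (hA : MeasurableSet A) (hB : MeasurableSet B) (h : ∀ x ∈ A, a + x ∈ B) :
    ∫⁻ x in A, F (a + x) ≤ ∫⁻ x in B, F x := by
  rw [← lintegral_indicator hA, ← lintegral_indicator hB,
    ← lintegral_add_left_eq_self (μ := volume) (B.indicator F) a]
  refine lintegral_mono fun x => ?_
  by_cases hx : x ∈ A
  · rw [Set.indicator_of_mem hx, Set.indicator_of_mem (h x hx)]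
  · rw [Set.indicator_of_notMem hx]
    exact zero_le

lemma setLIntegral_comp_affine_le (F : (Fin n → ℝ) → ℝ≥0∞) (a : Fin n → ℝ) {c : ℝ} (hc : 1 ≤ c)
    {A B : Set (Fin n → ℝ)} (hA : MeasurableSet A) (hB : MeasurableSet B)
    (h : ∀ x ∈ A, a + c • x ∈ B) : ∫⁻ x in A, F (a + c • x) ≤ ∫⁻ x in B, F x := by
  rw [← lintegral_indicator hA, ← lintegral_indicator hB]
  calc ∫⁻ x, A.indicator (fun x => F (a + c • x)) x ≤ ∫⁻ x, B.indicator F (a + c • x) := by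
        refine lintegral_mono fun x => ?_
        by_cases hx : x ∈ A
        · rw [Set.indicator_of_mem hx, Set.indicator_of_mem (h x hx)]
        · rw [Set.indicator_of_notMem hx]
          exact zero_le
    _ ≤ 1 * ∫⁻ x, B.indicator F x := by
        rw [lintegral_comp_affine _ _ (by linarith)]
        gcongr
        rw [ENNReal.ofReal_le_one]
        exact inv_le_one_of_one_le₀ (one_le_pow₀ hc)
    _ = _ := one_mul _

lemma measurable_diff_uncurry (l : ℕ) {f : (Fin n → ℝ) → ℝ} (hf : Measurable f) :
    Measurable fun z : (Fin n → ℝ) × (Fin n → ℝ) => diff l z.1 f z.2 := by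
  unfold diff
  refine Finset.measurable_fun_sum _ fun j _ => ?_
  exact (hf.comp (measurable_snd.add (measurable_fst.const_smul (j : ℝ)))).const_mul _

/-- The mean modulus of smoothness `∫_{‖h‖ < 2} ∫_{‖x‖ ≤ R} |Δ^l(h) f(x)|^θ dx dh`. -/
def meanModulus (l : ℕ) (θ : ℝ) (f : (Fin n → ℝ) → ℝ) (R : ℝ) : ℝ≥0∞ :=
  ∫⁻ h in Metric.ball 0 2, ∫⁻ x in Metric.closedBall 0 R, ‖diff l h f x‖ₑ ^ θ

lemma meanModulus_mono (l : ℕ) (θ : ℝ) (f : (Fin n → ℝ) → ℝ) {R R' : ℝ} (h : R ≤ R') :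
    meanModulus l θ f R ≤ meanModulus l θ f R' :=
  lintegral_mono fun _ => lintegral_mono_set (Metric.closedBall_subset_closedBall h)

/-- The double sum over f(x + i (h + j s)) can be read as differences in i or as differences in j.
Equating the two readings and isolating the term j = 0 expresses a difference with the given step h
through differences whose steps involve the free vector s, over which one can average. -/
lemma diff_eq_sum_diff {l : ℕ} (hl : 1 ≤ l) (f : (Fin n → ℝ) → ℝ) (h s x : Fin n → ℝ) :
    diff l h f x = ∑ j ∈ Finset.range l, (-1 : ℝ) ^ (j + 1) * (l.choose (j + 1) : ℝ) *
      (diff l (((j + 1 : ℕ) : ℝ) • s) f (((j + 1 : ℕ) : ℝ) • h + x) -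
        diff l (h + ((j + 1 : ℕ) : ℝ) • s) f x) := by
  have h0 : diff l 0 f x = 0 := by
    obtain ⟨c, rfl⟩ := Nat.exists_eq_add_of_le' hl
    have : diff 1 0 f = (0 : ℝ) • f := by
      funext y
      simp [diff_one]
    rw [diff_add_order, this, diff_const_smul]
    simp
  have hswap : ∑ j ∈ Finset.range (l + 1), (-1 : ℝ) ^ j * (l.choose j : ℝ) * diff l (h + (j : ℝ) • s) f x
      = ∑ i ∈ Finset.range (l + 1), (-1 : ℝ) ^ i * (l.choose i : ℝ) *
        diff l ((i : ℝ) • s) f ((i : ℝ) • h + x) := by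
    unfold diff
    simp_rw [Finset.mul_sum]
    rw [Finset.sum_comm]
    refine Finset.sum_congr rfl fun i _ => Finset.sum_congr rfl fun j _ => ?_
    have : x + (i : ℝ) • (h + (j : ℝ) • s) = (i : ℝ) • h + x + (j : ℝ) • (i : ℝ) • s := by
      rw [smul_add, smul_comm]
      abel
    rw [this]
    ring
  rw [Finset.sum_range_succ', Finset.sum_range_succ' (fun i => (-1 : ℝ) ^ i * (l.choose i : ℝ) *
        diff l ((i : ℝ) • s) f ((i : ℝ) • h + x))] at hswap
  simp only [Nat.cast_zero, zero_smul, add_zero, zero_add, h0, pow_zero, Nat.choose_zero_right,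
    Nat.cast_one, one_mul] at hswap
  simp_rw [mul_sub]
  rw [Finset.sum_sub_distrib]
  linarith

/-- Averaged differences control the differences with a fixed step. -/
lemma exists_lintegral_diff_le (n : ℕ) {l : ℕ} (hl : 1 ≤ l) {θ : ℝ} (hθ : 0 < θ) (hθ1 : θ ≤ 1) :
    ∃ C : ℝ≥0∞, C ≠ ∞ ∧ ∀ (f : (Fin n → ℝ) → ℝ), Measurable f → ∀ (R : ℝ) (h : Fin n → ℝ), ‖h‖ ≤ 1 →
      ∫⁻ x in Metric.closedBall 0 R, ‖diff l h f x‖ₑ ^ θ ≤ C * meanModulus l θ f (R + l) := by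
  have hl0 : (0 : ℝ) < l := by exact_mod_cast hl
  -- With |s| < 1/l and |h| ≤ 1 every step h + (j + 1) s stays in the ball of radius 2 over which
  -- the modulus averages.
  set U : Set (Fin n → ℝ) := Metric.ball 0 (l : ℝ)⁻¹ with hU
  have hUpos : volume U ≠ 0 := (Metric.measure_ball_pos volume _ (by positivity)).ne'
  have hUtop : volume U ≠ ∞ := measure_ball_lt_top.ne
  set c : ℝ≥0∞ := ((2 : ℝ≥0∞) ^ l) ^ θ with hc
  have hct : c ≠ ∞ := by finiteness
  refine ⟨(volume U)⁻¹ * (l * (c * 2)), ENNReal.mul_ne_top (ENNReal.inv_ne_top.2 hUpos)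
    (by finiteness), fun f hf R h hh => ?_⟩
  set Ω := meanModulus l θ f (R + l)
  have hdm := measurable_diff_uncurry l hf
  set G : (Fin n → ℝ) → ℝ≥0∞ := fun v => ∫⁻ x in Metric.closedBall 0 (R + l), ‖diff l v f x‖ₑ ^ θ
    with hG
  have hpt : ∀ s x : Fin n → ℝ, ‖diff l h f x‖ₑ ^ θ ≤ ∑ j ∈ Finset.range l,
      c * (‖diff l (((j + 1 : ℕ) : ℝ) • s) f (((j + 1 : ℕ) : ℝ) • h + x)‖ₑ ^ θ +
        ‖diff l (h + ((j + 1 : ℕ) : ℝ) • s) f x‖ₑ ^ θ) := by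
    intro s x
    rw [diff_eq_sum_diff hl f h s x]
    refine (enorm_sum_rpow_le _ hθ hθ1 _).trans (Finset.sum_le_sum fun j _ => ?_)
    rw [enorm_mul, enorm_signed_choose, ENNReal.mul_rpow_of_nonneg _ _ hθ.le]
    refine mul_le_mul' ?_ ?_
    · rw [hc]
      gcongr
      exact_mod_cast Nat.choose_le_two_pow l (j + 1)
    · exact (ENNReal.rpow_le_rpow enorm_sub_le hθ.le).trans
        (ENNReal.rpow_add_le_add_rpow _ _ hθ.le hθ1)
  have hjl : ∀ j ∈ Finset.range l, ((j + 1 : ℕ) : ℝ) ≤ l := fun j hj => by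
    exact_mod_cast Finset.mem_range.1 hj
  have hInt : ∀ s : Fin n → ℝ, ∫⁻ x in Metric.closedBall 0 R, ‖diff l h f x‖ₑ ^ θ ≤
      ∑ j ∈ Finset.range l, c * (G (0 + ((j + 1 : ℕ) : ℝ) • s) + G (h + ((j + 1 : ℕ) : ℝ) • s)) := by
    intro s
    refine (lintegral_mono (hpt s)).trans ?_
    have hm1 : ∀ v w : Fin n → ℝ, Measurable fun x => ‖diff l v f (w + x)‖ₑ ^ θ := fun v w =>
      ((hdm.comp (measurable_const.prodMk (measurable_id.const_add w))).enorm.pow_const θ :)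
    have hm2 : ∀ v : Fin n → ℝ, Measurable fun x => ‖diff l v f x‖ₑ ^ θ := fun v =>
      ((hdm.comp (measurable_const.prodMk measurable_id)).enorm.pow_const θ :)
    rw [lintegral_finsetSum _ fun j _ => ((hm1 _ _).fun_add (hm2 _)).const_mul _]
    refine Finset.sum_le_sum fun j hj => ?_
    rw [lintegral_const_mul _ ((hm1 _ _).fun_add (hm2 _)), lintegral_add_left (hm1 _ _)]
    refine mul_le_mul_right (add_le_add ?_ ?_) _
    · rw [zero_add]
      refine setLIntegral_comp_add_le (fun x => ‖diff l (((j + 1 : ℕ) : ℝ) • s) f x‖ₑ ^ θ) _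
        Metric.isClosed_closedBall.measurableSet Metric.isClosed_closedBall.measurableSet
        fun x hx => ?_
      rw [mem_closedBall_zero_iff] at hx ⊢
      have : ‖((j + 1 : ℕ) : ℝ) • h‖ ≤ l := by
        rw [norm_smul, Real.norm_natCast]
        calc _ ≤ (l : ℝ) * 1 := mul_le_mul (hjl j hj) hh (norm_nonneg _) hl0.le
          _ = l := mul_one _
      linarith [norm_add_le (((j + 1 : ℕ) : ℝ) • h) x]
    · exact lintegral_mono_set (Metric.closedBall_subset_closedBall (by linarith))
  have hUm : MeasurableSet U := Metric.isOpen_ball.measurableSet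
  have hGm : Measurable G := by
    have : Measurable fun z : (Fin n → ℝ) × (Fin n → ℝ) => ‖diff l z.1 f z.2‖ₑ ^ θ :=
      hdm.enorm.pow_const θ
    exact this.lintegral_prod_right'
  have hGU : ∀ v : Fin n → ℝ, ‖v‖ ≤ 1 → ∀ j ∈ Finset.range l,
      ∫⁻ s in U, G (v + ((j + 1 : ℕ) : ℝ) • s) ≤ Ω := by
    intro v hv j hj
    refine setLIntegral_comp_affine_le G v (by push_cast; linarith [(Nat.cast_nonneg j : (0 : ℝ) ≤ j)])
      hUm Metric.isOpen_ball.measurableSet fun s hs => ?_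
    rw [hU, mem_ball_zero_iff] at hs
    rw [mem_ball_zero_iff]
    have h1 : ‖((j + 1 : ℕ) : ℝ) • s‖ < 1 := by
      rw [norm_smul, Real.norm_natCast]
      calc _ ≤ (l : ℝ) * ‖s‖ := mul_le_mul_of_nonneg_right (hjl j hj) (norm_nonneg _)
        _ < l * (l : ℝ)⁻¹ := by gcongr
        _ = 1 := mul_inv_cancel₀ hl0.ne'
    linarith [norm_add_le v (((j + 1 : ℕ) : ℝ) • s)]
  have hmul : (∫⁻ x in Metric.closedBall 0 R, ‖diff l h f x‖ₑ ^ θ) * volume U ≤ l * (c * 2) * Ω := by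
    rw [← setLIntegral_const]
    refine (lintegral_mono hInt).trans ?_
    have hm : ∀ (v : Fin n → ℝ) (a : ℝ), Measurable fun s => G (v + a • s) := fun v a =>
      hGm.comp ((measurable_id.const_smul a).const_add v)
    rw [lintegral_finsetSum _ fun j _ => ((hm _ _).fun_add (hm _ _)).const_mul _]
    calc _ ≤ ∑ j ∈ Finset.range l, c * (Ω + Ω) := by
          refine Finset.sum_le_sum fun j hj => ?_
          rw [lintegral_const_mul _ ((hm _ _).fun_add (hm _ _)), lintegral_add_left (hm _ _)]
          exact mul_le_mul_right (add_le_add (hGU 0 (by simp) j hj) (hGU h hh j hj)) _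
      _ = _ := by
          rw [Finset.sum_const, Finset.card_range, nsmul_eq_mul]
          ring
  calc _ = (∫⁻ x in Metric.closedBall 0 R, ‖diff l h f x‖ₑ ^ θ) * volume U * (volume U)⁻¹ := by
        rw [mul_assoc, ENNReal.mul_inv_cancel hUpos hUtop, mul_one]
    _ ≤ l * (c * 2) * Ω * (volume U)⁻¹ := by gcongr
    _ = _ := by ring

/-! ## Polynomial approximation in the mean -/

lemma sum_rpow_le_of_le_one {ι : Type*} (s : Finset ι) {θ : ℝ} (hθ : 0 < θ) (hθ1 : θ ≤ 1)
    (x : ι → ℝ≥0∞) : (∑ i ∈ s, x i) ^ θ ≤ ∑ i ∈ s, x i ^ θ := by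
  classical
  induction s using Finset.induction_on with
  | empty => simp [hθ]
  | insert a s ha ih =>
    rw [Finset.sum_insert ha, Finset.sum_insert ha]
    exact (ENNReal.rpow_add_le_add_rpow _ _ hθ.le hθ1).trans (add_le_add_right ih _)

/-! ### Cells of a box and their dilations. -/

/-- The unit cells of the box `[0, N]ⁿ`. -/
def unitCell {N : ℕ} (g : Fin n → Fin N) : Set (Fin n → ℝ) :=
  Set.pi Set.univ fun i => Set.Ico ((g i : ℕ) : ℝ) ((g i : ℕ) + 1)

/-- The vertex of a cell of `[0, 2 G]ⁿ` that is farthest from the centre. -/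
def outerVertex (G : ℕ) {N : ℕ} (g : Fin n → Fin N) (i : Fin n) : ℕ :=
  if (g i : ℕ) < G then g i else g i + 1

/-- The box `[0, N]ⁿ`. -/
def box (n N : ℕ) : Set (Fin n → ℝ) := Set.Icc 0 fun _ => (N : ℝ)

lemma mem_box {N : ℕ} {x : Fin n → ℝ} : x ∈ box n N ↔ ∀ i, 0 ≤ x i ∧ x i ≤ N := by
  simp only [box, Set.mem_Icc, Pi.le_def, Pi.zero_apply, forall_and]

lemma measurableSet_box (N : ℕ) : MeasurableSet (box n N) := measurableSet_Icc

lemma isCompact_box (N : ℕ) : IsCompact (box n N) := isCompact_Icc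

lemma measurableSet_unitCell {N : ℕ} (g : Fin n → Fin N) : MeasurableSet (unitCell g) :=
  MeasurableSet.univ_pi fun _ => measurableSet_Ico

lemma volume_unitCell {N : ℕ} (g : Fin n → Fin N) : volume (unitCell g) = 1 := by
  rw [unitCell, volume_pi_pi]
  simp

lemma lintegral_box_le_sum (N : ℕ) (F : (Fin n → ℝ) → ℝ≥0∞) :
    ∫⁻ x in box n N, F x ≤ ∑ g : Fin n → Fin N, ∫⁻ x in unitCell g, F x := by
  have h1 : ∫⁻ x in box n N, F x = ∫⁻ x in Set.pi Set.univ (fun _ : Fin n => Set.Ico (0 : ℝ) N), F x :=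
    setLIntegral_congr (Measure.univ_pi_Ico_ae_eq_Icc (f := fun _ : Fin n => (0 : ℝ))
      (g := fun _ => (N : ℝ)) (μ := fun _ => volume)).symm
  rw [h1]
  refine (lintegral_mono_set (t := ⋃ g : Fin n → Fin N, unitCell g) fun x hx => ?_).trans
    ((lintegral_iUnion_le _ _).trans (tsum_fintype _).le)
  have hx' : ∀ i, 0 ≤ x i ∧ x i < N := fun i => hx i (Set.mem_univ i)
  refine Set.mem_iUnion.2 ⟨fun i => ⟨⌊x i⌋₊, (Nat.floor_lt (hx' i).1).2 (hx' i).2⟩, fun i _ => ?_⟩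
  exact ⟨Nat.floor_le (hx' i).1, Nat.lt_floor_add_one _⟩

/-- The outer vertex as a point of `ℝⁿ`. -/
def outerPoint (G : ℕ) {N : ℕ} (g : Fin n → Fin N) : Fin n → ℝ := fun i => (outerVertex G g i : ℝ)

lemma outerVertex_le (G : ℕ) {N : ℕ} (g : Fin n → Fin N) (i : Fin n) : outerVertex G g i ≤ N := by
  unfold outerVertex
  have := (g i).2
  split_ifs <;> omega

lemma norm_sub_outerPoint_le (G : ℕ) {N : ℕ} {g : Fin n → Fin N} {x : Fin n → ℝ} (hx : x ∈ unitCell g) :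
    ‖x - outerPoint G g‖ ≤ 1 := by
  rw [pi_norm_le_iff_of_nonneg zero_le_one]
  intro i
  have h := hx i (Set.mem_univ i)
  rw [Pi.sub_apply, outerPoint, outerVertex, Real.norm_eq_abs, abs_le]
  split_ifs
  · constructor <;> linarith [h.1, h.2]
  · push_cast
    constructor <;> linarith [h.1, h.2]

/-- From the outer vertex a point of the cell lies in the direction of the centre in every
coordinate, so a dilation by at most G does not leave the box of side 2 G. -/
lemma outerPoint_add_mem_box {G : ℕ} {g : Fin n → Fin (2 * G)} {x : Fin n → ℝ} (hx : x ∈ unitCell g)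
    {j : ℕ} (hj : j ≤ G) : outerPoint G g + (j : ℝ) • (x - outerPoint G g) ∈ box n (2 * G) := by
  rw [mem_box]
  intro i
  have h := hx i (Set.mem_univ i)
  have hj' : (j : ℝ) ≤ G := by exact_mod_cast hj
  have hj0 : (0 : ℝ) ≤ j := by positivity
  have hgN : ((g i : ℕ) : ℝ) + 1 ≤ 2 * G := by exact_mod_cast (g i).2
  simp only [Pi.add_apply, Pi.smul_apply, Pi.sub_apply, smul_eq_mul, outerPoint, outerVertex]
  push_cast
  split_ifs with hg
  · have hg' : ((g i : ℕ) : ℝ) + 1 ≤ G := by exact_mod_cast hg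
    have h1 : 0 ≤ x i - (g i : ℕ) := by linarith [h.1]
    have h2 : x i - (g i : ℕ) ≤ 1 := by linarith [h.2]
    constructor
    · positivity
    · nlinarith [mul_le_mul hj' h2 h1 (by positivity)]
  · have hg' : (G : ℝ) ≤ (g i : ℕ) := by exact_mod_cast not_lt.1 hg
    have h1 : 0 ≤ (g i : ℕ) + 1 - x i := by linarith [h.2]
    have h2 : (g i : ℕ) + 1 - x i ≤ 1 := by linarith [h.1]
    have h3 := mul_le_mul hj' h2 h1 (by positivity)
    have h4 : 0 ≤ (j : ℝ) * ((g i : ℕ) + 1 - x i) := by positivity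
    constructor <;> nlinarith

-- Distinct cells have distinct outer vertices, so the count is one of lattice points in a cube of
-- side 2 K.
open Classical in
lemma card_outerPoint_near_le (G : ℕ) {N : ℕ} (z : Fin n → ℝ) (K : ℕ) :
    (Finset.univ.filter fun g : Fin n → Fin N => z ∈ Metric.closedBall (outerPoint G g) K).card ≤
      (2 * K + 1) ^ n := by
  have hcard : (Fintype.piFinset fun i : Fin n => Finset.Icc ⌈z i - K⌉ ⌊z i + K⌋).card ≤
      (2 * K + 1) ^ n := by
    rw [Fintype.card_piFinset]
    calc ∏ i : Fin n, (Finset.Icc ⌈z i - K⌉ ⌊z i + K⌋).card ≤ ∏ _i : Fin n, (2 * K + 1) := by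
          refine Finset.prod_le_prod' fun i _ => ?_
          rw [Int.card_Icc]
          have h1 := Int.le_ceil (z i - K)
          have h2 := Int.floor_le (z i + K)
          have h3 : (⌊z i + K⌋ : ℝ) - ⌈z i - K⌉ ≤ 2 * K := by linarith
          have h4 : ⌊z i + K⌋ - ⌈z i - K⌉ ≤ 2 * K := by exact_mod_cast h3
          omega
      _ = _ := by simp
  refine le_trans (Finset.card_le_card_of_injOn (fun g i => ((outerVertex G g i : ℕ) : ℤ)) ?_ ?_) hcard
  · intro g hg
    simp only [Finset.coe_filter, Finset.mem_univ, true_and, Set.mem_ofPred_eq] at hg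
    rw [Finset.mem_coe, Fintype.mem_piFinset]
    intro i
    have h1 : |z i - outerVertex G g i| ≤ K := by
      have := (dist_le_pi_dist z (outerPoint G g) i).trans (Metric.mem_closedBall.1 hg)
      rwa [Real.dist_eq] at this
    rw [abs_le] at h1
    rw [Finset.mem_Icc, Int.ceil_le, Int.le_floor]
    push_cast
    constructor <;> linarith [h1.1, h1.2]
  · intro g _ g' _ h
    funext i
    have h1 := congrFun h i
    simp only [outerVertex, Nat.cast_inj] at h1
    apply Fin.ext
    split_ifs at h1 <;> omega

/-- Dilations of the cells about their outer vertices have bounded overlap. -/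
lemma sum_lintegral_dilation_le {G K : ℕ} (hK : 1 ≤ K) (hKG : K ≤ G) {F : (Fin n → ℝ) → ℝ≥0∞}
    (hF : Measurable F) :
    ∑ g : Fin n → Fin (2 * G), ∫⁻ x in unitCell g,
      F (outerPoint G g + (K : ℝ) • (x - outerPoint G g)) ≤ 3 ^ n * ∫⁻ x in box n (2 * G), F x := by
  classical
  have hK0 : (0 : ℝ) < K := by exact_mod_cast hK
  set A : (Fin n → Fin (2 * G)) → Set (Fin n → ℝ) := fun g =>
    box n (2 * G) ∩ Metric.closedBall (outerPoint G g) K with hA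
  have hAm : ∀ g, MeasurableSet (A g) := fun g =>
    (measurableSet_box _).inter Metric.isClosed_closedBall.measurableSet
  have h1 : ∀ g : Fin n → Fin (2 * G), ∫⁻ x in unitCell g,
      F (outerPoint G g + (K : ℝ) • (x - outerPoint G g)) ≤
      ENNReal.ofReal (((K : ℝ) ^ n)⁻¹) * ∫⁻ z, (A g).indicator F z := by
    intro g
    rw [← lintegral_comp_affine _ (outerPoint G g - (K : ℝ) • outerPoint G g) hK0,
      ← lintegral_indicator (measurableSet_unitCell g)]
    refine lintegral_mono fun x => ?_
    by_cases hx : x ∈ unitCell g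
    · have e : outerPoint G g - (K : ℝ) • outerPoint G g + (K : ℝ) • x =
          outerPoint G g + (K : ℝ) • (x - outerPoint G g) := by
        rw [smul_sub]
        abel
      rw [Set.indicator_of_mem hx, e, Set.indicator_of_mem]
      refine ⟨outerPoint_add_mem_box hx hKG, ?_⟩
      rw [Metric.mem_closedBall, dist_eq_norm, add_sub_cancel_left, norm_smul, Real.norm_natCast]
      calc (K : ℝ) * ‖x - outerPoint G g‖ ≤ K * 1 := by
            gcongr
            exact norm_sub_outerPoint_le G hx
        _ = K := mul_one _
    · rw [Set.indicator_of_notMem hx]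
      exact zero_le
  -- The overlap (2K + 1)^n is offset by the Jacobian K^{-n} of the dilation. Their product is at
  -- most 3^n, whatever K is.
  have h2 : ∀ z, ∑ g, (A g).indicator F z ≤ ((2 * K + 1 : ℕ) : ℝ≥0∞) ^ n * (box n (2 * G)).indicator F z := by
    intro z
    calc ∑ g, (A g).indicator F z ≤ ∑ g : Fin n → Fin (2 * G),
          if z ∈ Metric.closedBall (outerPoint G g) K then (box n (2 * G)).indicator F z else 0 := by
          refine Finset.sum_le_sum fun g _ => ?_
          by_cases hz : z ∈ A g
          · rw [Set.indicator_of_mem hz, if_pos hz.2, Set.indicator_of_mem hz.1]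
          · rw [Set.indicator_of_notMem hz]
            exact zero_le
      _ = (Finset.univ.filter fun g : Fin n → Fin (2 * G) =>
            z ∈ Metric.closedBall (outerPoint G g) K).card * (box n (2 * G)).indicator F z := by
          rw [← Finset.sum_filter, Finset.sum_const, nsmul_eq_mul]
      _ ≤ _ := by
          gcongr
          exact_mod_cast card_outerPoint_near_le G z K
  calc _ ≤ ∑ g, ENNReal.ofReal (((K : ℝ) ^ n)⁻¹) * ∫⁻ z, (A g).indicator F z :=
        Finset.sum_le_sum fun g _ => h1 g
    _ = ENNReal.ofReal (((K : ℝ) ^ n)⁻¹) * ∫⁻ z, ∑ g, (A g).indicator F z := by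
        rw [← Finset.mul_sum, lintegral_finsetSum _ fun g _ => hF.indicator (hAm g)]
    _ ≤ ENNReal.ofReal (((K : ℝ) ^ n)⁻¹) *
          ∫⁻ z, ((2 * K + 1 : ℕ) : ℝ≥0∞) ^ n * (box n (2 * G)).indicator F z := by
        gcongr with z
        exact h2 z
    _ = ENNReal.ofReal (((K : ℝ) ^ n)⁻¹) * ((2 * K + 1 : ℕ) : ℝ≥0∞) ^ n * ∫⁻ z in box n (2 * G), F z := by
        rw [lintegral_const_mul _ (hF.indicator (measurableSet_box _)),
          lintegral_indicator (measurableSet_box _), mul_assoc]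
    _ ≤ _ := by
        gcongr
        rw [← ENNReal.ofReal_natCast, ← ENNReal.ofReal_pow (by positivity),
          ← ENNReal.ofReal_mul (by positivity)]
        have : (3 : ℝ≥0∞) ^ n = ENNReal.ofReal (3 ^ n) := by
          rw [ENNReal.ofReal_pow (by norm_num)]
          norm_num
        rw [this]
        refine ENNReal.ofReal_le_ofReal ?_
        rw [← inv_pow, ← mul_pow]
        refine pow_le_pow_left₀ (by positivity) ?_ n
        rw [inv_mul_le_iff₀ hK0]
        push_cast
        have : (1 : ℝ) ≤ K := by exact_mod_cast hK
        linarith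

/-- The differences, on the lattice and along the segments that join the lattice with the points of
the cells, that control the approximation on the box `[0, 2 G]ⁿ`. -/
def boxModulus (l L G : ℕ) (θ : ℝ) (F : (Fin n → ℝ) → ℝ) : ℝ≥0∞ :=
  ∑ g : Fin n → Fin (2 * G + 1), ∑ i : Fin n, ‖diff l (Pi.single i 1) F (gridPoint g)‖ₑ ^ θ +
  ∑ g : Fin n → Fin (2 * G), ∑ j ∈ Finset.range (G + 1), ∫⁻ x in unitCell g,
    ‖diff L (x - outerPoint G g) F (outerPoint G g + (j : ℝ) • (x - outerPoint G g))‖ₑ ^ θ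

lemma exists_pow_div_le {C₀ D : ℝ≥0∞} (hC₀ : C₀ ≠ ∞) (hD : D ≠ ∞) {θ : ℝ} (hθ : 0 < θ)
    (R : ℕ) : ∃ M : ℕ, 1 ≤ M ∧ R ≤ M ∧ (C₀ / M) ^ θ * D ≤ 1 := by
  obtain ⟨M, hM⟩ := ENNReal.exists_nat_gt (r := C₀ * D ^ (1 / θ) + R + 1) (by
    have : D ^ (1 / θ) ≠ ∞ := ENNReal.rpow_ne_top_of_nonneg (by positivity) hD
    finiteness)
  have hM1 : ((R + 1 : ℕ) : ℝ≥0∞) < M := lt_of_le_of_lt (by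
    push_cast
    rw [add_assoc]
    exact le_add_self) hM
  have hM2 : R + 1 < M := by exact_mod_cast hM1
  refine ⟨M, by omega, by omega, ?_⟩
  have hM0 : (M : ℝ≥0∞) ≠ 0 := by exact_mod_cast (by omega : M ≠ 0)
  have h1 : C₀ * D ^ (1 / θ) ≤ M := by
    refine le_trans ?_ hM.le
    rw [add_assoc]
    exact le_self_add
  have h2 : C₀ / M * D ^ (1 / θ) ≤ 1 := by
    rw [ENNReal.div_eq_inv_mul, mul_assoc]
    calc _ ≤ (M : ℝ≥0∞)⁻¹ * M := by gcongr
      _ = 1 := ENNReal.inv_mul_cancel hM0 (ENNReal.natCast_ne_top M)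
  calc (C₀ / M) ^ θ * D = (C₀ / M * D ^ (1 / θ)) ^ θ := by
        rw [ENNReal.mul_rpow_of_nonneg _ _ hθ.le, ← ENNReal.rpow_mul, one_div_mul_cancel hθ.ne',
          ENNReal.rpow_one]
    _ ≤ 1 ^ θ := by gcongr
    _ = 1 := ENNReal.one_rpow θ

/-- Take P interpolating F on the grid {0, …, l - 1}ⁿ and let w = F - P. On the whole lattice w is
controlled by axis-parallel differences of order l. At a point x of a cell with outer vertex v, the
Marchaud-type inequality along the segment from v through x bounds w(x) - w(v) by differences of
order L = (n + 1) l, which do not see P, and by C₀ / M times values of w at dilated points.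
Integrated over all cells, those values give at most a constant times the integral of w itself, with
a factor that is small for large M. -/
lemma exists_polynomial_on_box (n : ℕ) {l : ℕ} (hl : 1 ≤ l) {θ : ℝ} (hθ : 0 < θ) (hθ1 : θ ≤ 1) (R : ℕ) :
    ∃ G : ℕ, R ≤ G ∧ ∃ C : ℝ≥0∞, C ≠ ∞ ∧ ∀ F : (Fin n → ℝ) → ℝ, Measurable F →
      ∫⁻ x in box n (2 * G), ‖F x‖ₑ ^ θ ≠ ∞ → ∃ P ∈ polySpace n l,
        ∫⁻ x in box n (2 * G), ‖F x - P x‖ₑ ^ θ ≤ C * boxModulus l ((n + 1) * l) G θ F := by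
  set L := (n + 1) * l with hLdef
  have hlL : l ≤ L := by rw [hLdef]; nlinarith
  have hL : 1 ≤ L := hl.trans hlL
  obtain ⟨C₀, hC₀, hinc⟩ := exists_increment_le L hL
  -- The constant C₀ depends on L only, so M can be chosen after it; the second constant, which
  -- depends on M, is fixed afterwards. The factor 2 in D prepares the absorption of half of the
  -- error.
  obtain ⟨M, hM, hRM, hMsmall⟩ := exists_pow_div_le (D := 2 * (L * 3 ^ n)) hC₀ (by finiteness) hθ R
  obtain ⟨C₁, hC₁, hinc⟩ := hinc M hM
  set G := L * M with hG
  have hMG : M ≤ G := by rw [hG]; exact Nat.le_mul_of_pos_left _ (by omega)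
  have hLG : L ≤ G := by rw [hG]; exact Nat.le_mul_of_pos_right _ (by omega)
  have hM0 : (M : ℝ≥0∞) ≠ 0 := by exact_mod_cast (by omega : M ≠ 0)
  set q : ℝ≥0∞ := (C₀ / M) ^ θ with hq
  have hqt : q ≠ ∞ := ENNReal.rpow_ne_top_of_nonneg hθ.le (ENNReal.div_ne_top hC₀ hM0)
  set Cg : ℝ≥0∞ := ((2 * (2 ^ l + 1) ^ (2 * G)) ^ n) ^ θ with hCg
  have hCgt : Cg ≠ ∞ := ENNReal.rpow_ne_top_of_nonneg hθ.le (by finiteness)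
  have hC₁t : C₁ ^ θ ≠ ∞ := ENNReal.rpow_ne_top_of_nonneg hθ.le hC₁
  refine ⟨G, hRM.trans hMG, 2 * ((1 + q * L) * ((((2 * G) ^ n : ℕ) : ℝ≥0∞) * Cg) + C₁ ^ θ), by finiteness,
    fun F hF hFint => ?_⟩
  obtain ⟨P, hP, hPF⟩ := exists_mem_polySpace_interpolating l fun κ : Fin n → Fin l => F (gridPoint κ)
  refine ⟨P, hP, ?_⟩
  set w : (Fin n → ℝ) → ℝ := F - P with hw
  have hPc := continuous_of_mem_polySpace hP
  have hwm : Measurable w := hF.sub hPc.measurable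
  set Y := ∑ g : Fin n → Fin (2 * G + 1), ∑ i : Fin n, ‖diff l (Pi.single i 1) F (gridPoint g)‖ₑ ^ θ with hY
  set Z := ∑ g : Fin n → Fin (2 * G), ∑ j ∈ Finset.range (G + 1), ∫⁻ x in unitCell g,
    ‖diff L (x - outerPoint G g) F (outerPoint G g + (j : ℝ) • (x - outerPoint G g))‖ₑ ^ θ with hZ
  have hmod : boxModulus l L G θ F = Y + Z := rfl
  rw [hmod]
  -- values on the lattice
  have hzero : ∀ g : Fin n → ℕ, (∀ i, g i < l) → (w fun i => (g i : ℝ)) = 0 := by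
    intro g hg
    have h1 : P (fun i => (g i : ℝ)) = F fun i => (g i : ℝ) := hPF fun i => ⟨g i, hg i⟩
    rw [hw, Pi.sub_apply, h1, sub_self]
  have hlatdiff : ∀ (g : Fin n → ℕ) (i : Fin n), (∀ a, g a ≤ 2 * G) →
      ‖∑ j ∈ Finset.range (l + 1), (-1 : ℝ) ^ (l + j) * (l.choose j : ℝ) *
        w (fun a => ((Function.update g i (g i + j) a : ℕ) : ℝ))‖ₑ ≤
      ∑ g : Fin n → Fin (2 * G + 1), ∑ i : Fin n, ‖diff l (Pi.single i 1) F (gridPoint g)‖ₑ := by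
    intro g i hg
    have e1 : ∑ j ∈ Finset.range (l + 1), (-1 : ℝ) ^ (l + j) * (l.choose j : ℝ) *
        w (fun a => ((Function.update g i (g i + j) a : ℕ) : ℝ)) =
        diff l (Pi.single i 1) w (fun a => (g a : ℝ)) := by
      unfold diff
      refine Finset.sum_congr rfl fun j _ => ?_
      congr 2
      funext a
      by_cases ha : a = i
      · subst ha
        simp
      · simp [ha]
    rw [e1, hw, diff_sub, Pi.sub_apply, diff_single_eq_zero_of_mem_polySpace hl hP, sub_zero]
    set g' : Fin n → Fin (2 * G + 1) := fun a => ⟨g a, Nat.lt_succ_of_le (hg a)⟩ with hg'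
    have e2 : (fun a => (g a : ℝ)) = gridPoint g' := rfl
    rw [e2]
    have e3 : ‖diff l (Pi.single i 1) F (gridPoint g')‖ₑ ≤
        ∑ i : Fin n, ‖diff l (Pi.single i 1) F (gridPoint g')‖ₑ :=
      Finset.single_le_sum (f := fun i : Fin n => ‖diff l (Pi.single i 1) F (gridPoint g')‖ₑ)
        (fun _ _ => zero_le) (Finset.mem_univ i)
    exact e3.trans (Finset.single_le_sum (f := fun g : Fin n → Fin (2 * G + 1) =>
      ∑ i : Fin n, ‖diff l (Pi.single i 1) F (gridPoint g)‖ₑ) (fun _ _ => zero_le) (Finset.mem_univ g'))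
  have hlat : ∀ g : Fin n → ℕ, (∀ i, g i ≤ 2 * G) → ‖w fun i => (g i : ℝ)‖ₑ ^ θ ≤ Cg * Y := by
    intro g hg
    have h1 := enorm_le_of_grid (l := l) (N := 2 * G) (by omega) (fun g : Fin n → ℕ => w fun i => (g i : ℝ))
      hzero hlatdiff g hg
    refine (ENNReal.rpow_le_rpow h1 hθ.le).trans ?_
    rw [ENNReal.mul_rpow_of_nonneg _ _ hθ.le]
    refine mul_le_mul_right ((sum_rpow_le_of_le_one _ hθ hθ1 _).trans
      (Finset.sum_le_sum fun g _ => sum_rpow_le_of_le_one _ hθ hθ1 _)) _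
  set W := ∑ g : Fin n → Fin (2 * G), ‖w (outerPoint G g)‖ₑ ^ θ with hW
  have hWle : W ≤ (((2 * G) ^ n : ℕ) : ℝ≥0∞) * (Cg * Y) := by
    refine (Finset.sum_le_card_nsmul _ _ (Cg * Y) fun g _ => hlat (outerVertex G g)
      (outerVertex_le G g)).trans ?_
    rw [nsmul_eq_mul, Finset.card_univ, Fintype.card_fun, Fintype.card_fin, Fintype.card_fin]
  -- pointwise estimate in a cell
  have hpt : ∀ g : Fin n → Fin (2 * G), ∀ x ∈ unitCell g, ‖w x‖ₑ ^ θ ≤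
      ‖w (outerPoint G g)‖ₑ ^ θ + (q * ∑ κ : Fin L,
        ‖w (outerPoint G g + ((κ * M : ℕ) : ℝ) • (x - outerPoint G g))‖ₑ ^ θ +
      C₁ ^ θ * ∑ j ∈ Finset.range (G + 1),
        ‖diff L (x - outerPoint G g) F (outerPoint G g + (j : ℝ) • (x - outerPoint G g))‖ₑ ^ θ) := by
    intro g x _
    set b := outerPoint G g
    set h := x - b with hh
    have h1 := hinc (fun j => w (b + (j : ℝ) • h))
      (∑ j ∈ Finset.range (G + 1), ‖diff L h F (b + (j : ℝ) • h)‖ₑ) (fun j hj => by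
        have e1 : ∑ i ∈ Finset.range (L + 1), (-1 : ℝ) ^ (L + i) * (L.choose i : ℝ) *
            w (b + ((j + i : ℕ) : ℝ) • h) = diff L h w (b + (j : ℝ) • h) := by
          unfold diff
          refine Finset.sum_congr rfl fun i _ => ?_
          rw [add_assoc, ← add_smul]
          push_cast
          rfl
        rw [e1, hw, diff_sub, Pi.sub_apply, diff_eq_zero_of_mem_polySpace hl hP, sub_zero]
        exact Finset.single_le_sum (f := fun j : ℕ => ‖diff L h F (b + (j : ℝ) • h)‖ₑ)
          (fun _ _ => zero_le) (Finset.mem_range.2 (by omega)))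
    have e2 : w x = w b + (w (b + ((1 : ℕ) : ℝ) • h) - w (b + ((0 : ℕ) : ℝ) • h)) := by
      simp [hh]
    rw [e2]
    refine (ENNReal.rpow_le_rpow (enorm_add_le _ _) hθ.le).trans
      ((ENNReal.rpow_add_le_add_rpow _ _ hθ.le hθ1).trans (add_le_add_right ?_ _))
    refine (ENNReal.rpow_le_rpow h1 hθ.le).trans ((ENNReal.rpow_add_le_add_rpow _ _ hθ.le hθ1).trans ?_)
    rw [ENNReal.mul_rpow_of_nonneg _ _ hθ.le, ENNReal.mul_rpow_of_nonneg _ _ hθ.le]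
    exact add_le_add (mul_le_mul_right (sum_rpow_le_of_le_one _ hθ hθ1 _) _)
      (mul_le_mul_right (sum_rpow_le_of_le_one _ hθ hθ1 _) _)
  set a := ∫⁻ x in box n (2 * G), ‖w x‖ₑ ^ θ with ha
  -- Finiteness is essential: a / 2 is subtracted from both sides at the end.
  have hat : a ≠ ∞ := by
    have h1 : a ≤ ∫⁻ x in box n (2 * G), (‖F x‖ₑ ^ θ + ‖P x‖ₑ ^ θ) := by
      refine lintegral_mono fun x => ?_
      exact (ENNReal.rpow_le_rpow enorm_sub_le hθ.le).trans (ENNReal.rpow_add_le_add_rpow _ _ hθ.le hθ1)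
    refine ne_top_of_le_ne_top ?_ h1
    rw [lintegral_add_left (hF.enorm.pow_const θ)]
    refine ENNReal.add_ne_top.2 ⟨hFint, ?_⟩
    obtain ⟨B, hB⟩ := (isCompact_box (n := n) (2 * G)).exists_bound_of_continuousOn hPc.continuousOn
    refine ne_top_of_le_ne_top ?_ (setLIntegral_mono' (g := fun _ => ENNReal.ofReal B ^ θ)
      (measurableSet_box _) fun x hx => ?_)
    · rw [setLIntegral_const]
      exact ENNReal.mul_ne_top (ENNReal.rpow_ne_top_of_nonneg hθ.le ENNReal.ofReal_ne_top)
        (isCompact_box _).measure_lt_top.ne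
    · rw [← ofReal_norm]
      exact ENNReal.rpow_le_rpow (ENNReal.ofReal_le_ofReal (hB x hx)) hθ.le
  have hm1 : ∀ (b : Fin n → ℝ) (c : ℝ), Measurable fun x => ‖w (b + c • (x - b))‖ₑ ^ θ := fun b c => by
    fun_prop
  have hm2 : ∀ (b : Fin n → ℝ) (c : ℝ), Measurable fun x => ‖diff L (x - b) F (b + c • (x - b))‖ₑ ^ θ := by
    intro b c
    have h1 := measurable_diff_uncurry L hF
    have h2 : Measurable fun x : Fin n → ℝ => (x - b, b + c • (x - b)) := by fun_prop
    exact (h1.comp h2).enorm.pow_const θ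
  -- For κ = 0 the dilation collapses to the vertex and yields the lattice sum; otherwise the
  -- bounded overlap of the dilated cells applies.
  have hκ : ∀ κ : Fin L, ∑ g : Fin n → Fin (2 * G), ∫⁻ x in unitCell g,
      ‖w (outerPoint G g + ((κ * M : ℕ) : ℝ) • (x - outerPoint G g))‖ₑ ^ θ ≤ W + 3 ^ n * a := by
    intro κ
    rcases Nat.eq_zero_or_pos (κ * M : ℕ) with h0 | h0
    · refine le_trans (le_of_eq ?_) le_self_add
      refine Finset.sum_congr rfl fun g _ => ?_
      rw [h0]
      simp [volume_unitCell]
    · refine le_trans ?_ le_add_self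
      exact sum_lintegral_dilation_le h0 (Nat.mul_le_mul_right _ κ.2.le) (hwm.enorm.pow_const θ)
  have hmain : a ≤ W + (q * (L * (W + 3 ^ n * a)) + C₁ ^ θ * Z) := by
    refine (lintegral_box_le_sum _ _).trans ?_
    have h1 : ∀ g : Fin n → Fin (2 * G), ∫⁻ x in unitCell g, ‖w x‖ₑ ^ θ ≤ ‖w (outerPoint G g)‖ₑ ^ θ +
        (q * (∑ κ : Fin L, ∫⁻ x in unitCell g,
          ‖w (outerPoint G g + ((κ * M : ℕ) : ℝ) • (x - outerPoint G g))‖ₑ ^ θ) +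
        C₁ ^ θ * ∑ j ∈ Finset.range (G + 1), ∫⁻ x in unitCell g,
          ‖diff L (x - outerPoint G g) F (outerPoint G g + (j : ℝ) • (x - outerPoint G g))‖ₑ ^ θ) := by
      intro g
      refine (setLIntegral_mono' (measurableSet_unitCell g) (hpt g)).trans (le_of_eq ?_)
      rw [lintegral_add_left measurable_const, setLIntegral_const, volume_unitCell, mul_one,
        lintegral_add_left ((Finset.measurable_fun_sum _ fun κ _ => hm1 _ _).const_mul _),
        lintegral_const_mul _ (Finset.measurable_fun_sum _ fun κ _ => hm1 _ _),
        lintegral_const_mul _ (Finset.measurable_fun_sum _ fun κ _ => hm2 _ _),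
        lintegral_finsetSum _ fun κ _ => hm1 _ _, lintegral_finsetSum _ fun κ _ => hm2 _ _]
    refine (Finset.sum_le_sum fun g _ => h1 g).trans ?_
    rw [Finset.sum_add_distrib, Finset.sum_add_distrib, ← Finset.mul_sum, ← Finset.mul_sum,
      Finset.sum_comm]
    refine add_le_add_right (add_le_add_left (mul_le_mul_right ?_ _) _) _
    refine (Finset.sum_le_card_nsmul _ _ _ fun κ _ => hκ κ).trans ?_
    rw [nsmul_eq_mul, Finset.card_univ, Fintype.card_fin]
  have hhalf : q * (L * (3 ^ n * a)) ≤ a / 2 := by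
    rw [ENNReal.le_div_iff_mul_le (Or.inl two_ne_zero) (Or.inl ENNReal.ofNat_ne_top)]
    calc q * (L * (3 ^ n * a)) * 2 = q * (2 * (L * 3 ^ n)) * a := by ring
      _ ≤ 1 * a := by gcongr
      _ = a := one_mul a
  have h3 : a ≤ ((1 + q * L) * W + C₁ ^ θ * Z) + a / 2 := by
    calc a ≤ _ := hmain
      _ = ((1 + q * L) * W + C₁ ^ θ * Z) + q * (L * (3 ^ n * a)) := by ring
      _ ≤ _ := by gcongr
  have h4 : a / 2 ≤ (1 + q * L) * W + C₁ ^ θ * Z := by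
    have h5 : a / 2 + a / 2 ≤ ((1 + q * L) * W + C₁ ^ θ * Z) + a / 2 := by
      rwa [ENNReal.add_halves]
    exact (ENNReal.add_le_add_iff_right (ENNReal.div_ne_top hat two_ne_zero)).1 h5
  calc a = 2 * (a / 2) := (ENNReal.mul_div_cancel two_ne_zero ENNReal.ofNat_ne_top).symm
    _ ≤ 2 * ((1 + q * L) * W + C₁ ^ θ * Z) := by gcongr
    _ ≤ 2 * ((1 + q * L) * ((((2 * G) ^ n : ℕ) : ℝ≥0∞) * (Cg * (Y + Z))) + C₁ ^ θ * (Y + Z)) := by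
        gcongr
        · exact hWle.trans (by gcongr; exact le_self_add)
        · exact le_add_self
    _ = _ := by ring

lemma diff_comp_affine (l : ℕ) (f : (Fin n → ℝ) → ℝ) (a : Fin n → ℝ) (c : ℝ) (h x : Fin n → ℝ) :
    diff l h (fun x => f (a + c • x)) x = diff l (c • h) f (a + c • x) := by
  unfold diff
  refine Finset.sum_congr rfl fun j _ => ?_
  beta_reduce
  rw [smul_add, add_assoc, smul_comm]

lemma diff_comp_add (l : ℕ) (f : (Fin n → ℝ) → ℝ) (a h x : Fin n → ℝ) :
    diff l h (fun x => f (a + x)) x = diff l h f (a + x) := by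
  have := diff_comp_affine l f a 1 h x
  simpa only [one_smul] using this

lemma lintegral_diff_higher_le {l L : ℕ} (hlL : l ≤ L) {θ : ℝ} (hθ : 0 < θ) (hθ1 : θ ≤ 1)
    {f : (Fin n → ℝ) → ℝ} (hf : Measurable f) (R : ℝ) {h : Fin n → ℝ} (hh : ‖h‖ ≤ 1) :
    ∫⁻ x in Metric.closedBall 0 R, ‖diff L h f x‖ₑ ^ θ ≤ ((L + 1 : ℕ) : ℝ≥0∞) * ((2 : ℝ≥0∞) ^ L) ^ θ *
      ∫⁻ x in Metric.closedBall 0 (R + L), ‖diff l h f x‖ₑ ^ θ := by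
  obtain ⟨d, rfl⟩ := Nat.exists_eq_add_of_le' hlL
  have hm : ∀ w : Fin n → ℝ, Measurable fun x => ‖diff l h f (w + x)‖ₑ ^ θ := fun w =>
    (((measurable_diff_uncurry l hf).comp
      (measurable_const.prodMk (measurable_id.const_add w))).enorm.pow_const θ :)
  have h1 : ∀ x, ‖diff (d + l) h f x‖ₑ ^ θ ≤ ∑ j ∈ Finset.range (d + 1),
      ((2 : ℝ≥0∞) ^ d) ^ θ * ‖diff l h f ((j : ℝ) • h + x)‖ₑ ^ θ := by
    intro x
    rw [diff_add_order]
    refine (ENNReal.rpow_le_rpow (enorm_diff_le d h _ x) hθ.le).trans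
      ((sum_rpow_le_of_le_one _ hθ hθ1 _).trans (Finset.sum_le_sum fun j _ => ?_))
    rw [ENNReal.mul_rpow_of_nonneg _ _ hθ.le, add_comm x]
  refine (lintegral_mono h1).trans ?_
  rw [lintegral_finsetSum _ fun j _ => (hm _).const_mul _]
  calc _ ≤ ∑ j ∈ Finset.range (d + 1), ((2 : ℝ≥0∞) ^ (d + l)) ^ θ *
        ∫⁻ x in Metric.closedBall 0 (R + (d + l : ℕ)), ‖diff l h f x‖ₑ ^ θ := by
        refine Finset.sum_le_sum fun j hj => ?_
        rw [lintegral_const_mul _ (hm _)]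
        refine mul_le_mul' ?_ (setLIntegral_comp_add_le (fun x => ‖diff l h f x‖ₑ ^ θ) _
          Metric.isClosed_closedBall.measurableSet Metric.isClosed_closedBall.measurableSet
          fun x hx => ?_)
        · gcongr
          · norm_num
          · omega
        · rw [mem_closedBall_zero_iff] at hx ⊢
          have hj' : (j : ℝ) ≤ (d + l : ℕ) := by
            have := Finset.mem_range.1 hj
            exact_mod_cast (by omega : j ≤ d + l)
          have h2 : ‖(j : ℝ) • h‖ ≤ (d + l : ℕ) := by
            rw [norm_smul, Real.norm_natCast]
            calc (j : ℝ) * ‖h‖ ≤ (d + l : ℕ) * 1 := mul_le_mul hj' hh (norm_nonneg _) (by positivity)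
              _ = _ := mul_one _
          linarith [norm_add_le ((j : ℝ) • h) x]
    _ = ((d + 1 : ℕ) : ℝ≥0∞) * ((2 : ℝ≥0∞) ^ (d + l)) ^ θ *
        ∫⁻ x in Metric.closedBall 0 (R + (d + l : ℕ)), ‖diff l h f x‖ₑ ^ θ := by
        rw [Finset.sum_const, Finset.card_range, nsmul_eq_mul, mul_assoc]
    _ ≤ _ := by
        gcongr
        omega

lemma norm_le_of_mem_box {N : ℕ} {x : Fin n → ℝ} (hx : x ∈ box n N) : ‖x‖ ≤ N := by
  rw [pi_norm_le_iff_of_nonneg (by positivity)]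
  intro i
  have := mem_box.1 hx i
  rw [Real.norm_eq_abs, abs_of_nonneg this.1]
  exact this.2

/-- The box modulus contains values of F on a lattice, which mean nothing for a class of functions.
Averaged over translations by the unit cube they become integrals of differences with fixed steps,
and these are bounded by the mean modulus. -/
lemma exists_lintegral_boxModulus_le (n : ℕ) {l L : ℕ} (hl : 1 ≤ l) (hlL : l ≤ L) (G : ℕ) {θ : ℝ}
    (hθ : 0 < θ) (hθ1 : θ ≤ 1) : ∃ C : ℝ≥0∞, C ≠ ∞ ∧ ∀ F : (Fin n → ℝ) → ℝ, Measurable F →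
      Measurable (fun y => boxModulus l L G θ fun x => F (y + x)) ∧
      ∫⁻ y in box n 1, boxModulus l L G θ (fun x => F (y + x)) ≤
        C * meanModulus l θ F (2 * G + 1 + L) := by
  obtain ⟨C₁, hC₁, hW⟩ := exists_lintegral_diff_le n hl hθ hθ1
  set K : ℝ≥0∞ := ((L + 1 : ℕ) : ℝ≥0∞) * ((2 : ℝ≥0∞) ^ L) ^ θ with hK
  have hKt : K ≠ ∞ := by
    have : ((2 : ℝ≥0∞) ^ L) ^ θ ≠ ∞ := ENNReal.rpow_ne_top_of_nonneg hθ.le (by finiteness)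
    finiteness
  refine ⟨((2 * G + 1) ^ n : ℕ) * (n * C₁) + ((2 * G) ^ n : ℕ) * ((G + 1 : ℕ) * K), by finiteness,
    fun F hF => ?_⟩
  set Ω := meanModulus l θ F (2 * G + 1 + L)
  have hd1 := measurable_diff_uncurry l hF
  have hd2 := measurable_diff_uncurry L hF
  have hm1 : ∀ v w : Fin n → ℝ, Measurable fun y => ‖diff l v F (y + w)‖ₑ ^ θ := fun v w =>
    ((hd1.comp (measurable_const.prodMk (measurable_id.add_const w))).enorm.pow_const θ :)
  have hm2 : ∀ (b : Fin n → ℝ) (c : ℝ), Measurable fun z : (Fin n → ℝ) × (Fin n → ℝ) =>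
      ‖diff L (z.2 - b) F (z.1 + (b + c • (z.2 - b)))‖ₑ ^ θ := by
    intro b c
    have h2 : Measurable fun z : (Fin n → ℝ) × (Fin n → ℝ) =>
      (z.2 - b, z.1 + (b + c • (z.2 - b))) := by fun_prop
    exact (hd2.comp h2).enorm.pow_const θ
  have hm3 : ∀ (b : Fin n → ℝ) (c : ℝ) (A : Set (Fin n → ℝ)), Measurable fun y => ∫⁻ x in A,
      ‖diff L (x - b) F (y + (b + c • (x - b)))‖ₑ ^ θ := fun b c A => (hm2 b c).lintegral_prod_right'
  have hM1 : Measurable fun y => ∑ g : Fin n → Fin (2 * G + 1), ∑ i : Fin n,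
      ‖diff l (Pi.single i 1) F (y + gridPoint g)‖ₑ ^ θ :=
    Finset.measurable_fun_sum _ fun g _ => Finset.measurable_fun_sum _ fun i _ => hm1 _ _
  have hM2 : Measurable fun y => ∑ g : Fin n → Fin (2 * G), ∑ j ∈ Finset.range (G + 1),
      ∫⁻ x in unitCell g, ‖diff L (x - outerPoint G g) F
        (y + (outerPoint G g + (j : ℝ) • (x - outerPoint G g)))‖ₑ ^ θ :=
    Finset.measurable_fun_sum _ fun g _ => Finset.measurable_fun_sum _ fun j _ => hm3 _ _ _
  unfold boxModulus
  simp only [diff_comp_add]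
  refine ⟨hM1.add hM2, ?_⟩
  rw [lintegral_add_left hM1, lintegral_finsetSum _ fun g _ =>
    Finset.measurable_fun_sum _ fun i _ => hm1 _ _, lintegral_finsetSum _ fun g _ =>
    Finset.measurable_fun_sum _ fun j _ => hm3 _ _ _, add_mul]
  have hbox1 : ∀ y ∈ box n 1, ‖y‖ ≤ 1 := fun y hy => by simpa using norm_le_of_mem_box hy
  have hcb : ∀ R : ℝ, MeasurableSet (Metric.closedBall (0 : Fin n → ℝ) R) := fun R =>
    Metric.isClosed_closedBall.measurableSet
  refine add_le_add ?_ ?_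
  · calc _ ≤ ∑ _g : Fin n → Fin (2 * G + 1), ∑ _i : Fin n, C₁ * Ω := by
          refine Finset.sum_le_sum fun g _ => ?_
          rw [lintegral_finsetSum _ fun i _ => hm1 _ _]
          refine Finset.sum_le_sum fun i _ => ?_
          simp_rw [add_comm _ (gridPoint g)]
          refine (setLIntegral_comp_add_le (fun x => ‖diff l (Pi.single i 1) F x‖ₑ ^ θ) (gridPoint g)
            (measurableSet_box 1) (hcb (2 * G + 1)) fun y hy => ?_).trans
            ((hW F hF _ _ ?_).trans (mul_le_mul_right (meanModulus_mono l θ F ?_) _))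
          · rw [mem_closedBall_zero_iff]
            refine (norm_add_le _ _).trans (add_le_add ?_ (hbox1 y hy))
            rw [pi_norm_le_iff_of_nonneg (by positivity)]
            intro a
            rw [gridPoint, Real.norm_natCast]
            exact_mod_cast Nat.lt_succ_iff.1 (g a).2
          · rw [Pi.norm_single]
            simp
          · have : (l : ℝ) ≤ L := by exact_mod_cast hlL
            linarith
      _ = _ := by
          simp only [Finset.sum_const, Finset.card_univ, Fintype.card_fin, Fintype.card_fun, nsmul_eq_mul]
          ring
  · calc _ ≤ ∑ _g : Fin n → Fin (2 * G), ∑ _j ∈ Finset.range (G + 1), K * Ω := by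
          refine Finset.sum_le_sum fun g _ => ?_
          rw [lintegral_finsetSum _ fun j _ => hm3 _ _ _]
          refine Finset.sum_le_sum fun j hj => ?_
          have hj' : j ≤ G := Nat.lt_succ_iff.1 (Finset.mem_range.1 hj)
          set b := outerPoint G g
          rw [lintegral_lintegral_swap (hm2 b j).aemeasurable]
          have h1 : ∀ x ∈ unitCell g, ∫⁻ y in box n 1,
              ‖diff L (x - b) F (y + (b + (j : ℝ) • (x - b)))‖ₑ ^ θ ≤
              K * ∫⁻ z in Metric.closedBall 0 ((2 * G + 1 : ℝ) + L), ‖diff l (-b + x) F z‖ₑ ^ θ := by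
            intro x hx
            simp_rw [add_comm _ (b + (j : ℝ) • (x - b))]
            refine (setLIntegral_comp_add_le (fun z => ‖diff L (x - b) F z‖ₑ ^ θ) _
              (measurableSet_box 1) (hcb (2 * G + 1)) fun y hy => ?_).trans ?_
            · rw [mem_closedBall_zero_iff]
              have h3 := norm_le_of_mem_box (outerPoint_add_mem_box hx hj')
              push_cast at h3
              exact (norm_add_le _ _).trans (add_le_add h3 (hbox1 y hy))
            · rw [neg_add_eq_sub]
              exact lintegral_diff_higher_le hlL hθ hθ1 hF _ (norm_sub_outerPoint_le G hx)
          refine (setLIntegral_mono' (measurableSet_unitCell g) h1).trans ?_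
          rw [lintegral_const_mul' _ _ hKt]
          refine mul_le_mul_right ?_ _
          -- The step runs over the cell minus its outer vertex, a set in the unit ball, so the
          -- integral over the cell is part of the average over steps.
          refine setLIntegral_comp_add_le (fun h => ∫⁻ z in Metric.closedBall 0 ((2 * G + 1 : ℝ) + L),
            ‖diff l h F z‖ₑ ^ θ) (-b) (measurableSet_unitCell g) Metric.isOpen_ball.measurableSet
            fun x hx => ?_
          rw [mem_ball_zero_iff, neg_add_eq_sub]
          exact lt_of_le_of_lt (norm_sub_outerPoint_le G hx) one_lt_two
      _ = _ := by
          simp only [Finset.sum_const, Finset.card_univ, Finset.card_range, Fintype.card_fin,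
            Fintype.card_fun, nsmul_eq_mul]
          ring

/-- A Whitney-type inequality in the mean of order `θ ≤ 1`. -/
theorem exists_polynomial_approx (n : ℕ) {l : ℕ} (hl : 1 ≤ l) {θ : ℝ} (hθ : 0 < θ) (hθ1 : θ ≤ 1) (R : ℕ) :
    ∃ (R' : ℕ) (C : ℝ≥0∞), C ≠ ∞ ∧ ∀ f : (Fin n → ℝ) → ℝ, Measurable f →
      (∀ ρ : ℝ, ∫⁻ x in Metric.closedBall 0 ρ, ‖f x‖ₑ ^ θ ≠ ∞) → ∃ P ∈ polySpace n l,
        ∫⁻ x in Metric.closedBall 0 (R : ℝ), ‖f x - P x‖ₑ ^ θ ≤ C * meanModulus l θ f R' := by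
  obtain ⟨G, hG, C₁, hC₁, hP⟩ := exists_polynomial_on_box n hl hθ hθ1 (R + 1)
  set L := (n + 1) * l with hL
  have hlL : l ≤ L := by rw [hL]; nlinarith
  obtain ⟨C₂, hC₂, hM⟩ := exists_lintegral_boxModulus_le n hl hlL G hθ hθ1
  refine ⟨(R + 1) + (2 * G + 1 + L), C₁ * C₂, ENNReal.mul_ne_top hC₁ hC₂, fun f hf hfint => ?_⟩
  -- For y in [0, 1]ⁿ the ball of radius R translated by c - y lies in [0, 2 G]ⁿ, since R + 1 ≤ G.
  set c : Fin n → ℝ := fun _ => (R : ℝ) + 1 with hc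
  have hcn : ‖c‖ ≤ R + 1 := by
    rw [pi_norm_le_iff_of_nonneg (by positivity)]
    intro i
    rw [hc, Real.norm_eq_abs, abs_of_nonneg (by positivity)]
  set F : (Fin n → ℝ) → ℝ := fun x => f (-c + x) with hF
  have hFm : Measurable F := hf.comp (measurable_id.const_add (-c))
  obtain ⟨hmeas, hInt⟩ := hM F hFm
  have hvol : volume (box n 1) = 1 := by
    rw [box, Real.volume_Icc_pi]
    simp
  -- Some translation has a box modulus no larger than the average. This choice, like that of the
  -- polynomial, is not linear in f.
  obtain ⟨y, hy, hyle⟩ := exists_le_setLAverage (μ := volume) (s := box n 1) (by rw [hvol]; simp)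
    (by rw [hvol]; simp) hmeas.aemeasurable
  rw [setLAverage_eq, hvol, div_one] at hyle
  have hcb : ∀ R : ℝ, MeasurableSet (Metric.closedBall (0 : Fin n → ℝ) R) := fun R =>
    Metric.isClosed_closedBall.measurableSet
  have hyn : ‖y‖ ≤ 1 := by simpa using norm_le_of_mem_box hy
  obtain ⟨P, hPmem, hPle⟩ := hP (fun x => F (y + x)) (hFm.comp (measurable_id.const_add y)) (by
    refine ne_top_of_le_ne_top (hfint (R + 1 + 1 + 2 * G)) ?_
    have e : ∀ x, F (y + x) = f ((-c + y) + x) := fun x => by rw [hF]; simp only [add_assoc]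
    simp_rw [e]
    refine setLIntegral_comp_add_le (fun x => ‖f x‖ₑ ^ θ) _ (measurableSet_box _) (hcb _) fun x hx => ?_
    rw [mem_closedBall_zero_iff]
    have h1 := norm_le_of_mem_box hx
    push_cast at h1
    have h2 := norm_add_le (-c + y) x
    have h3 := norm_add_le (-c) y
    rw [norm_neg] at h3
    linarith)
  refine ⟨fun z => P ((1 : ℝ) • z + (c - y)), comp_affine_mem_polySpace hPmem 1 (c - y), ?_⟩
  have hmm : meanModulus l θ F (2 * G + 1 + L) ≤ meanModulus l θ f ((R + 1 + (2 * G + 1 + L) : ℕ) : ℝ) := by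
    refine lintegral_mono fun h => ?_
    simp_rw [hF, diff_comp_add]
    refine setLIntegral_comp_add_le (fun x => ‖diff l h f x‖ₑ ^ θ) _ (hcb _) (hcb _) fun x hx => ?_
    rw [mem_closedBall_zero_iff] at hx ⊢
    push_cast
    have h3 := norm_add_le (-c) x
    rw [norm_neg] at h3
    linarith
  calc ∫⁻ x in Metric.closedBall 0 (R : ℝ), ‖f x - P ((1 : ℝ) • x + (c - y))‖ₑ ^ θ
      = ∫⁻ x in Metric.closedBall 0 (R : ℝ), ‖F (y + ((c - y) + x)) - P ((c - y) + x)‖ₑ ^ θ := by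
        refine lintegral_congr fun x => ?_
        rw [one_smul, add_comm x, hF]
        congr 4
        abel
    _ ≤ ∫⁻ x in box n (2 * G), ‖F (y + x) - P x‖ₑ ^ θ := by
        refine setLIntegral_comp_add_le (fun x => ‖F (y + x) - P x‖ₑ ^ θ) _ (hcb _) (measurableSet_box _)
          fun x hx => ?_
        rw [mem_closedBall_zero_iff] at hx
        rw [mem_box]
        intro i
        have h1 := (norm_le_pi_norm x i).trans hx
        rw [Real.norm_eq_abs, abs_le] at h1
        have h2 := mem_box.1 hy i
        have h3 : (R : ℝ) + 1 ≤ G := by exact_mod_cast hG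
        simp only [Pi.add_apply, Pi.sub_apply, hc]
        push_cast at h2 ⊢
        constructor <;> linarith [h1.1, h1.2, h2.1, h2.2]
    _ ≤ C₁ * boxModulus l L G θ fun x => F (y + x) := hPle
    _ ≤ C₁ * (C₂ * meanModulus l θ f ((R + 1 + (2 * G + 1 + L) : ℕ) : ℝ)) := by
        gcongr
        exact hyle.trans (hInt.trans (by gcongr))
    _ = _ := by rw [mul_assoc]

/-! ## Local approximation at the dyadic scales -/

/-- The set of the points at distance at most `2^{-k} R` from `2^{-k} m`. -/
def dyadicBall (k : ℕ) (m : Fin n → ℤ) (R : ℝ) : Set (Fin n → ℝ) :=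
  {x | ‖-(fun i => (m i : ℝ)) + (2 : ℝ) ^ k • x‖ ≤ R}

lemma measurableSet_dyadicBall (k : ℕ) (m : Fin n → ℤ) (R : ℝ) : MeasurableSet (dyadicBall k m R) :=
  (isClosed_le (by fun_prop) continuous_const).measurableSet

lemma mem_dyadicBall {k : ℕ} {m : Fin n → ℤ} {R : ℝ} (hR : 0 ≤ R) {x : Fin n → ℝ} :
    x ∈ dyadicBall k m R ↔ ∀ i, |(2 : ℝ) ^ k * x i - m i| ≤ R := by
  change ‖_‖ ≤ R ↔ _
  rw [pi_norm_le_iff_of_nonneg hR]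
  refine forall_congr' fun i => ?_
  rw [Pi.add_apply, Pi.neg_apply, Pi.smul_apply, smul_eq_mul, Real.norm_eq_abs, neg_add_eq_sub]

/-- `2^{2kn} ∫_{‖h‖ < 2^{1-k}} ∫_{Q_{k,m}} |Δ^l(h) f(x)|^θ dx dh`. -/
def cellModulus (l : ℕ) (θ : ℝ) (f : (Fin n → ℝ) → ℝ) (k : ℕ) (m : Fin n → ℤ) : ℝ≥0∞ :=
  ENNReal.ofReal (((2 : ℝ) ^ k) ^ n) * (ENNReal.ofReal (((2 : ℝ) ^ k) ^ n) *
    ∫⁻ h in cube 0 (2 * (2 * (1 / 2) ^ k)), ∫⁻ x in hcube k m, ‖diff l h f x‖ₑ ^ θ)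

lemma dyadicBall_subset (k : ℕ) (m : Fin n → ℤ) (R : ℕ) :
    dyadicBall k m R ⊆ ⋃ e ∈ nbhd n (R + 1), hcube k (m + e) := by
  intro x hx
  rw [mem_dyadicBall (by positivity)] at hx
  refine Set.mem_biUnion (x := idx k x - m) ?_ (by simp [hcube])
  rw [Finset.mem_coe, mem_nbhd]
  intro i
  have h1 := abs_le.1 (hx i)
  have h2 := Int.floor_le ((2 : ℝ) ^ k * x i)
  have h3 := Int.lt_floor_add_one ((2 : ℝ) ^ k * x i)
  rw [Pi.sub_apply, idx, abs_le]
  constructor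
  · have : (-(R : ℝ) - 1) < (⌊(2 : ℝ) ^ k * x i⌋ : ℝ) - m i := by linarith [h1.1]
    have h4 : (-(R : ℤ) - 1) < ⌊(2 : ℝ) ^ k * x i⌋ - m i := by exact_mod_cast this
    push_cast
    omega
  · have : (⌊(2 : ℝ) ^ k * x i⌋ : ℝ) - m i ≤ R := by linarith [h1.2]
    have h4 : ⌊(2 : ℝ) ^ k * x i⌋ - m i ≤ R := by exact_mod_cast this
    push_cast
    omega

lemma setLIntegral_dyadicBall_le (k : ℕ) (m : Fin n → ℤ) (R : ℕ) (F : (Fin n → ℝ) → ℝ≥0∞) :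
    ∫⁻ x in dyadicBall k m R, F x ≤ ∑ e ∈ nbhd n (R + 1), ∫⁻ x in hcube k (m + e), F x := by
  refine (lintegral_mono_set (dyadicBall_subset k m R)).trans ?_
  rw [← Finset.tsum_subtype (nbhd n (R + 1)) fun e => ∫⁻ x in hcube k (m + e), F x]
  have h := lintegral_iUnion_le (μ := volume) (fun e : nbhd n (R + 1) => hcube k (m + (e : Fin n → ℤ))) F
  rwa [Set.iUnion_subtype] at h

lemma lintegral_scaled_modulus (l : ℕ) (θ : ℝ) {f : (Fin n → ℝ) → ℝ} (k : ℕ) (m : Fin n → ℤ) (R : ℕ) :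
    meanModulus l θ (fun u => f (((2 : ℝ) ^ k)⁻¹ • (fun i => (m i : ℝ)) + ((2 : ℝ) ^ k)⁻¹ • u)) R =
    ENNReal.ofReal (((2 : ℝ) ^ k) ^ n) * (ENNReal.ofReal (((2 : ℝ) ^ k) ^ n) *
      ∫⁻ h in cube 0 (2 * (2 * (1 / 2) ^ k)), ∫⁻ x in dyadicBall k m R, ‖diff l h f x‖ₑ ^ θ) := by
  set c : ℝ := ((2 : ℝ) ^ k)⁻¹ with hc
  have hc0 : 0 < c := by positivity
  have hcc : (2 : ℝ) ^ k * c = 1 := mul_inv_cancel₀ (by positivity)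
  have hcn : ((c ^ n)⁻¹) = ((2 : ℝ) ^ k) ^ n := by rw [hc, inv_pow, inv_inv]
  set M : Fin n → ℝ := fun i => (m i : ℝ)
  have hcb : ∀ R : ℝ, MeasurableSet (Metric.closedBall (0 : Fin n → ℝ) R) := fun R =>
    Metric.isClosed_closedBall.measurableSet
  have hin : ∀ v : Fin n → ℝ, ∫⁻ u in Metric.closedBall 0 (R : ℝ),
      ‖diff l v (fun u => f (c • M + c • u)) u‖ₑ ^ θ =
      ENNReal.ofReal (((2 : ℝ) ^ k) ^ n) * ∫⁻ x in dyadicBall k m R, ‖diff l (c • v) f x‖ₑ ^ θ := by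
    intro v
    rw [← lintegral_indicator (hcb _), ← lintegral_indicator (measurableSet_dyadicBall k m R), ← hcn,
      ← lintegral_comp_affine _ (c • M) hc0]
    refine lintegral_congr fun u => ?_
    have hiff : u ∈ Metric.closedBall (0 : Fin n → ℝ) R ↔ c • M + c • u ∈ dyadicBall k m R := by
      rw [mem_closedBall_zero_iff]
      change _ ↔ ‖-M + (2 : ℝ) ^ k • (c • M + c • u)‖ ≤ R
      rw [← smul_add, smul_smul, hcc, one_smul, neg_add_cancel_left]
    by_cases hu : u ∈ Metric.closedBall (0 : Fin n → ℝ) R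
    · rw [Set.indicator_of_mem hu, Set.indicator_of_mem (hiff.1 hu), diff_comp_affine]
    · rw [Set.indicator_of_notMem hu, Set.indicator_of_notMem (fun h => hu (hiff.2 h))]
  unfold meanModulus
  simp_rw [hin]
  rw [lintegral_const_mul' _ _ ENNReal.ofReal_ne_top]
  congr 1
  have hcubem : MeasurableSet (cube (0 : Fin n → ℝ) (2 * (2 * (1 / 2) ^ k))) := measurableSet_cube _ _
  rw [← lintegral_indicator Metric.isOpen_ball.measurableSet, ← lintegral_indicator hcubem, ← hcn,
    ← lintegral_comp_affine _ 0 hc0]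
  refine lintegral_congr fun v => ?_
  have hiff : v ∈ Metric.ball (0 : Fin n → ℝ) 2 ↔ 0 + c • v ∈ cube (0 : Fin n → ℝ) (2 * (2 * (1 / 2) ^ k)) := by
    rw [mem_ball_zero_iff, pi_norm_lt_iff (by norm_num)]
    refine forall_congr' fun i => ?_
    rw [zero_add, Pi.smul_apply, Pi.zero_apply, sub_zero, smul_eq_mul, abs_mul, abs_of_pos hc0,
      Real.norm_eq_abs, one_div_pow, ← one_div_pow, one_div, inv_pow, ← hc]
    rw [show 2 * (2 * c) / 2 = c * 2 by ring]
    exact (mul_lt_mul_iff_right₀ hc0).symm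
  by_cases hv : v ∈ Metric.ball (0 : Fin n → ℝ) 2
  · rw [Set.indicator_of_mem hv, Set.indicator_of_mem (hiff.1 hv), zero_add]
  · rw [Set.indicator_of_notMem hv, Set.indicator_of_notMem (fun h => hv (hiff.2 h))]

/-- Near-best local polynomials at the dyadic scales. -/
theorem exists_local_polynomial (n : ℕ) {l : ℕ} (hl : 1 ≤ l) {θ : ℝ} (hθ : 0 < θ) (hθ1 : θ ≤ 1) (R : ℕ) :
    ∃ (c : ℕ) (C : ℝ≥0∞), C ≠ ∞ ∧ ∀ f : (Fin n → ℝ) → ℝ, Measurable f →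
      (∀ K : Set (Fin n → ℝ), IsCompact K → ∫⁻ x in K, ‖f x‖ₑ ^ θ ≠ ∞) →
      ∀ (k : ℕ) (m : Fin n → ℤ), ∃ P ∈ polySpace n l,
        ENNReal.ofReal (((2 : ℝ) ^ k) ^ n) * ∫⁻ x in dyadicBall k m R, ‖f x - P x‖ₑ ^ θ ≤
          C * ∑ e ∈ nbhd n c, cellModulus l θ f k (m + e) := by
  obtain ⟨R', C, hC, hW⟩ := exists_polynomial_approx n hl hθ hθ1 R
  refine ⟨R' + 1, C, hC, fun f hf hfint k m => ?_⟩
  set c : ℝ := ((2 : ℝ) ^ k)⁻¹ with hc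
  have hc0 : 0 < c := by positivity
  have h20 : (0 : ℝ) < 2 ^ k := by positivity
  have hcc : c * (2 : ℝ) ^ k = 1 := inv_mul_cancel₀ (by positivity)
  have hcn : ((c ^ n)⁻¹) = ((2 : ℝ) ^ k) ^ n := by rw [hc, inv_pow, inv_inv]
  set M : Fin n → ℝ := fun i => (m i : ℝ) with hM
  have hcb : ∀ R : ℝ, MeasurableSet (Metric.closedBall (0 : Fin n → ℝ) R) := fun R =>
    Metric.isClosed_closedBall.measurableSet
  -- The unit-scale inequality is applied to u ↦ f(2^{-k} (m + u)); the class of polynomials is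
  -- invariant under affine changes of this kind.
  obtain ⟨P, hP, hPle⟩ := hW (fun u => f (c • M + c • u))
    (hf.comp ((measurable_id.const_smul c).const_add _)) (by
      intro ρ
      have h1 : IsCompact ((fun u : Fin n → ℝ => c • M + c • u) '' Metric.closedBall 0 ρ) :=
        (isCompact_closedBall _ _).image (by fun_prop)
      have h2 : ∫⁻ u in Metric.closedBall 0 ρ, ‖f (c • M + c • u)‖ₑ ^ θ ≤
          ENNReal.ofReal ((c ^ n)⁻¹) *
            ∫⁻ x in (fun u : Fin n → ℝ => c • M + c • u) '' Metric.closedBall 0 ρ, ‖f x‖ₑ ^ θ := by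
        rw [← lintegral_indicator h1.measurableSet, ← lintegral_comp_affine _ (c • M) hc0,
          ← lintegral_indicator (hcb _)]
        refine lintegral_mono fun u => ?_
        by_cases hu : u ∈ Metric.closedBall (0 : Fin n → ℝ) ρ
        · rw [Set.indicator_of_mem hu, Set.indicator_of_mem (Set.mem_image_of_mem _ hu)]
        · rw [Set.indicator_of_notMem hu]
          exact zero_le
      exact ne_top_of_le_ne_top (ENNReal.mul_ne_top ENNReal.ofReal_ne_top (hfint _ h1)) h2)
  refine ⟨fun x => P ((2 : ℝ) ^ k • x + -M), comp_affine_mem_polySpace hP _ _, ?_⟩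
  have h1 : ENNReal.ofReal (((2 : ℝ) ^ k) ^ n) *
      ∫⁻ x in dyadicBall k m R, ‖f x - P ((2 : ℝ) ^ k • x + -M)‖ₑ ^ θ =
      ∫⁻ u in Metric.closedBall 0 (R : ℝ), ‖f (c • M + c • u) - P u‖ₑ ^ θ := by
    rw [← lintegral_indicator (hcb _), ← lintegral_indicator (measurableSet_dyadicBall k m R)]
    have h2 := lintegral_comp_affine ((Metric.closedBall (0 : Fin n → ℝ) (R : ℝ)).indicator fun u =>
      ‖f (c • M + c • u) - P u‖ₑ ^ θ) (-M) h20
    have h3 : ∀ x, (dyadicBall k m R).indicator (fun x => ‖f x - P ((2 : ℝ) ^ k • x + -M)‖ₑ ^ θ) x =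
        (Metric.closedBall (0 : Fin n → ℝ) (R : ℝ)).indicator (fun u =>
          ‖f (c • M + c • u) - P u‖ₑ ^ θ) (-M + (2 : ℝ) ^ k • x) := by
      intro x
      have hiff : x ∈ dyadicBall k m R ↔ -M + (2 : ℝ) ^ k • x ∈ Metric.closedBall (0 : Fin n → ℝ) (R : ℝ) := by
        rw [mem_closedBall_zero_iff]
        rfl
      by_cases hx : x ∈ dyadicBall k m R
      · rw [Set.indicator_of_mem hx, Set.indicator_of_mem (hiff.1 hx), ← smul_add, add_neg_cancel_left,
          smul_smul, hcc, one_smul, add_comm]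
      · rw [Set.indicator_of_notMem hx, Set.indicator_of_notMem (fun h => hx (hiff.2 h))]
    rw [lintegral_congr h3, h2, ← mul_assoc, ← ENNReal.ofReal_mul (by positivity),
      mul_inv_cancel₀ (by positivity), ENNReal.ofReal_one, one_mul]
  rw [h1]
  refine hPle.trans (mul_le_mul_right ?_ _)
  rw [lintegral_scaled_modulus]
  unfold cellModulus
  rw [← Finset.mul_sum, ← Finset.mul_sum]
  refine mul_le_mul_right (mul_le_mul_right ?_ _) _
  have hm : ∀ A : Set (Fin n → ℝ), Measurable fun h => ∫⁻ x in A, ‖diff l h f x‖ₑ ^ θ := by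
    intro A
    have : Measurable fun z : (Fin n → ℝ) × (Fin n → ℝ) => ‖diff l z.1 f z.2‖ₑ ^ θ :=
      (measurable_diff_uncurry l hf).enorm.pow_const θ
    exact this.lintegral_prod_right'
  rw [← lintegral_finsetSum _ fun e _ => hm _]
  exact lintegral_mono fun h => setLIntegral_dyadicBall_le k m R' _

lemma exists_enorm_le_dyadicBall (n l R : ℕ) {θ : ℝ} (hθ : 0 < θ) (hθ1 : θ ≤ 1) :
    ∃ C : ℝ≥0∞, C ≠ ∞ ∧ ∀ P ∈ polySpace n l, ∀ (k : ℕ) (m : Fin n → ℤ), ∀ x ∈ dyadicBall k m R,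
      ‖P x‖ₑ ^ θ ≤
        C * (ENNReal.ofReal (((2 : ℝ) ^ k) ^ n) * ∫⁻ z in dyadicBall k m l, ‖P z‖ₑ ^ θ) := by
  obtain ⟨C, hC, h⟩ := exists_enorm_le_of_mem_polySpace n l R hθ hθ1
  refine ⟨C, hC, fun P hP k m x hx => ?_⟩
  set c : ℝ := ((2 : ℝ) ^ k)⁻¹ with hc
  have hc0 : 0 < c := by positivity
  have hcc : c * (2 : ℝ) ^ k = 1 := inv_mul_cancel₀ (by positivity)
  have hcn : ((c ^ n)⁻¹) = ((2 : ℝ) ^ k) ^ n := by rw [hc, inv_pow, inv_inv]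
  set M : Fin n → ℝ := fun i => (m i : ℝ) with hM
  have h1 := h (fun u => P (c • u + c • M)) (comp_affine_mem_polySpace hP c (c • M))
    (-M + (2 : ℝ) ^ k • x) hx
  have h2 : c • (-M + (2 : ℝ) ^ k • x) + c • M = x := by
    rw [← smul_add, neg_add_eq_sub, sub_add_cancel, smul_smul, hcc, one_smul]
  beta_reduce at h1
  rw [h2] at h1
  refine h1.trans (mul_le_mul_right ?_ _)
  rw [← lintegral_indicator (measurableSet_dyadicBall k m l), ← hcn, ← lintegral_comp_affine _ (c • M) hc0,
    ← lintegral_indicator measurableSet_Icc]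
  refine lintegral_mono fun u => ?_
  by_cases hu : u ∈ Set.Icc (0 : Fin n → ℝ) (fun _ => (l : ℝ))
  · have : c • M + c • u ∈ dyadicBall k m l := by
      change ‖-M + (2 : ℝ) ^ k • (c • M + c • u)‖ ≤ l
      rw [← smul_add, smul_smul, mul_comm, hcc, one_smul, neg_add_cancel_left,
        pi_norm_le_iff_of_nonneg (by positivity)]
      intro i
      rw [Real.norm_eq_abs, abs_of_nonneg (hu.1 i)]
      exact hu.2 i
    rw [Set.indicator_of_mem hu, Set.indicator_of_mem this, add_comm]
  · rw [Set.indicator_of_notMem hu]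
    exact zero_le

lemma exists_enorm_splineCoeff_le (n : ℕ) {l : ℕ} (ω : Fin (l + 1) → ℝ) {θ : ℝ} (hθ : 0 < θ)
    (hθ1 : θ ≤ 1) : ∃ C : ℝ≥0∞, C ≠ ∞ ∧ ∀ P ∈ polySpace n l, ∀ (k : ℕ) (m : Fin n → ℤ),
      ‖splineCoeff ω k m P‖ₑ ^ θ ≤
        C * (ENNReal.ofReal (((2 : ℝ) ^ k) ^ n) * ∫⁻ z in dyadicBall k m l, ‖P z‖ₑ ^ θ) := by
  obtain ⟨C, hC, h⟩ := exists_enorm_le_dyadicBall n l l hθ hθ1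
  refine ⟨∑ κ : Fin n → Fin (l + 1), ‖∏ i, ω (κ i)‖ₑ ^ θ * C, ?_, fun P hP k m => ?_⟩
  · exact (ENNReal.sum_lt_top.2 fun κ _ => ENNReal.mul_lt_top
      (ENNReal.rpow_lt_top_of_nonneg hθ.le enorm_ne_top) hC.lt_top).ne
  unfold splineCoeff
  refine (enorm_sum_rpow_le _ hθ hθ1 _).trans ?_
  rw [Finset.sum_mul]
  refine Finset.sum_le_sum fun κ _ => ?_
  rw [enorm_mul, ENNReal.mul_rpow_of_nonneg _ _ hθ.le, mul_assoc]
  refine mul_le_mul_right (h P hP k m _ ?_) _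
  change ‖-(fun i => (m i : ℝ)) + (2 : ℝ) ^ k • _‖ ≤ _
  rw [smul_smul, mul_inv_cancel₀ (by positivity), one_smul, neg_add_cancel_left,
    pi_norm_le_iff_of_nonneg (by positivity)]
  intro i
  rw [gridPoint, Real.norm_natCast]
  exact_mod_cast Nat.lt_succ_iff.1 (κ i).2

/-! ### Quasi-interpolating splines and their errors. -/

/-- The normalised error `2^{kn} ∫ |f - P|^θ` near `2^{-k} m`. -/
def localError (θ : ℝ) (f P : (Fin n → ℝ) → ℝ) (k : ℕ) (m : Fin n → ℤ) (R : ℝ) : ℝ≥0∞ :=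
  ENNReal.ofReal (((2 : ℝ) ^ k) ^ n) * ∫⁻ x in dyadicBall k m R, ‖f x - P x‖ₑ ^ θ

lemma localError_mono {θ : ℝ} {f P : (Fin n → ℝ) → ℝ} {k : ℕ} {m m' : Fin n → ℤ} {R R' : ℝ}
    (h : dyadicBall k m R ⊆ dyadicBall k m' R') :
    localError θ f P k m R ≤ localError θ f P k m' R' :=
  mul_le_mul_right (lintegral_mono_set h) _

/-- This and the next inclusion fix the radius 3 l + 2. Shifts of size at most 2 l + 1 added to the
radius l give 3 l + 1, and the passage to the parent cube adds one more before the scale is halved.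
-/
lemma dyadicBall_add_subset {l k : ℕ} {m e : Fin n → ℤ} (he : e ∈ nbhd n (l + l + 1)) :
    dyadicBall k (m + e) l ⊆ dyadicBall k m (3 * l + 2 : ℕ) := by
  intro x hx
  rw [mem_dyadicBall (by positivity)] at hx ⊢
  intro i
  have h1 := abs_le.1 (hx i)
  have h2 : |((e i : ℤ) : ℝ)| ≤ l + l + 1 := by exact_mod_cast mem_nbhd.1 he i
  rw [abs_le] at h2
  rw [Pi.add_apply] at h1
  push_cast at h1 ⊢
  rw [abs_le]
  constructor <;> linarith [h1.1, h1.2, h2.1, h2.2]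

lemma dyadicBall_succ_add_subset {l k : ℕ} {M e : Fin n → ℤ} (he : e ∈ nbhd n (l + l + 1)) :
    dyadicBall (k + 1) (M + e) l ⊆ dyadicBall k (par 1 M) (3 * l + 2 : ℕ) := by
  intro x hx
  rw [mem_dyadicBall (by positivity)] at hx ⊢
  intro i
  have h1 := abs_le.1 (hx i)
  have h2 : |((e i : ℤ) : ℝ)| ≤ l + l + 1 := by exact_mod_cast mem_nbhd.1 he i
  rw [abs_le] at h2
  have h3 : ((2 * par 1 M i : ℤ) : ℝ) ≤ M i ∧ ((M i : ℤ) : ℝ) ≤ ((2 * par 1 M i + 1 : ℤ) : ℝ) := by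
    constructor <;> rw [Int.cast_le] <;> simp only [par] <;> omega
  rw [Pi.add_apply, pow_succ] at h1
  push_cast at h1 h3 ⊢
  have : (0 : ℝ) ≤ l := by positivity
  rw [abs_le]
  constructor <;> linarith [h1.1, h1.2, h2.1, h2.2, h3.1, h3.2]

lemma localError_succ_le {θ : ℝ} {f P : (Fin n → ℝ) → ℝ} {l k : ℕ} {M e : Fin n → ℤ}
    (he : e ∈ nbhd n (l + l + 1)) : localError θ f P (k + 1) (M + e) l ≤
      2 ^ n * localError θ f P k (par 1 M) (3 * l + 2 : ℕ) := by
  unfold localError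
  rw [← mul_assoc]
  refine mul_le_mul' (le_of_eq ?_) (lintegral_mono_set (dyadicBall_succ_add_subset he))
  rw [pow_succ, mul_pow, mul_comm, ENNReal.ofReal_mul (by positivity)]
  congr 1
  rw [ENNReal.ofReal_pow (by norm_num)]
  norm_num

lemma enorm_sub_rpow_le {θ : ℝ} (hθ : 0 < θ) (hθ1 : θ ≤ 1) (x y z : ℝ) :
    ‖x - y‖ₑ ^ θ ≤ ‖z - x‖ₑ ^ θ + ‖z - y‖ₑ ^ θ := by
  have h : x - y = (z - y) + -(z - x) := by ring
  rw [h, add_comm (‖z - x‖ₑ ^ θ)]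
  refine (ENNReal.rpow_le_rpow (enorm_add_le _ _) hθ.le).trans ?_
  rw [enorm_neg]
  exact ENNReal.rpow_add_le_add_rpow _ _ hθ.le hθ1

lemma mean_sub_le {θ : ℝ} (hθ : 0 < θ) (hθ1 : θ ≤ 1) {f P : (Fin n → ℝ) → ℝ} (Q : (Fin n → ℝ) → ℝ)
    (hf : Measurable f) (hP : Measurable P) (k : ℕ) (m : Fin n → ℤ) (R : ℝ) :
    ENNReal.ofReal (((2 : ℝ) ^ k) ^ n) * ∫⁻ z in dyadicBall k m R, ‖P z - Q z‖ₑ ^ θ ≤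
      localError θ f P k m R + localError θ f Q k m R := by
  unfold localError
  rw [← mul_add, ← lintegral_add_left (f := fun x => ‖f x - P x‖ₑ ^ θ) ((hf.sub hP).enorm.pow_const θ)]
  exact mul_le_mul_right (lintegral_mono fun z => enorm_sub_rpow_le hθ hθ1 _ _ _) _

lemma exists_enorm_splineCoeff_sub_le (n : ℕ) {l : ℕ} (ω : Fin (l + 1) → ℝ) {θ : ℝ} (hθ : 0 < θ)
    (hθ1 : θ ≤ 1) : ∃ C : ℝ≥0∞, C ≠ ∞ ∧ ∀ f : (Fin n → ℝ) → ℝ, Measurable f →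
      ∀ P ∈ polySpace n l, ∀ Q ∈ polySpace n l, ∀ (k : ℕ) (m : Fin n → ℤ),
      ‖splineCoeff ω k m P - splineCoeff ω k m Q‖ₑ ^ θ ≤
        C * (localError θ f P k m l + localError θ f Q k m l) := by
  obtain ⟨C, hC, h⟩ := exists_enorm_splineCoeff_le n ω hθ hθ1
  refine ⟨C, hC, fun f hf P hP Q hQ k m => ?_⟩
  rw [← splineCoeff_sub]
  exact (h (P - Q) (Submodule.sub_mem _ hP hQ) k m).trans (mul_le_mul_right
    (mean_sub_le hθ hθ1 Q hf (continuous_of_mem_polySpace hP).measurable k m l) _)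

lemma enorm_le_rpow_add {θ : ℝ} (hθ : 0 < θ) {x C u v : ℝ≥0∞} (h : x ^ θ ≤ C * (u + v)) :
    x ≤ C ^ (1 / θ) * ENNReal.LpAddConst (ENNReal.ofReal (1 / θ))⁻¹ * (u ^ (1 / θ) + v ^ (1 / θ)) := by
  have h1 := ENNReal.rpow_le_rpow h (one_div_pos.2 hθ).le
  rw [← ENNReal.rpow_mul, mul_one_div_cancel hθ.ne', ENNReal.rpow_one,
    ENNReal.mul_rpow_of_nonneg _ _ (one_div_pos.2 hθ).le] at h1
  refine h1.trans ?_
  rw [mul_assoc]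
  exact mul_le_mul_right (ENNReal.rpow_add_le_mul_rpow_add_rpow' _ _ (one_div_pos.2 hθ).le) _

/-- The property of `ω` that makes the quasi-interpolant reproduce polynomials. -/
def IsReproducing {l : ℕ} (ω : Fin (l + 1) → ℝ) : Prop :=
  ∀ q : Polynomial ℝ, q.natDegree ≤ l → ∀ x : ℝ,
    ∑' m : ℤ, (∑ g, ω g * q.eval ((m : ℝ) + (g : ℕ))) * bspline l (x - m) = q.eval x

/-- The quasi-interpolating spline of level `k` built from local polynomials. -/
def quasiSpline {l : ℕ} (ω : Fin (l + 1) → ℝ) (P : ℕ → (Fin n → ℤ) → (Fin n → ℝ) → ℝ) (k : ℕ) :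
    (Fin n → ℝ) → ℝ :=
  splineSum l k fun m => splineCoeff ω k m (P k m)

/-- Because Q is reproduced, subtracting it from the spline subtracts its coefficients, each of
which then compares two local polynomials near the same point. -/
lemma quasiSpline_sub {l : ℕ} (hl : 1 ≤ l) {ω : Fin (l + 1) → ℝ} (hω : IsReproducing ω)
    (P : ℕ → (Fin n → ℤ) → (Fin n → ℝ) → ℝ) (k : ℕ) {Q : (Fin n → ℝ) → ℝ} (hQ : Q ∈ polySpace n l) :
    quasiSpline ω P k - Q =
      splineSum l k fun m => splineCoeff ω k m (P k m) - splineCoeff ω k m Q := by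
  conv_lhs => rw [← splineSum_splineCoeff hl hω k hQ]
  exact (splineSum_sub hl k _ _).symm

lemma sum_nbhd_add_const_le (c : ℕ) (X : (Fin n → ℤ) → ℝ≥0∞) (Y : ℝ≥0∞) :
    ∑ e ∈ nbhd n c, (X e + Y) = ∑ e ∈ nbhd n c, X e + (nbhd n c).card * Y := by
  rw [Finset.sum_add_distrib, Finset.sum_const, nsmul_eq_mul]

lemma zero_mem_nbhd (n c : ℕ) : (0 : Fin n → ℤ) ∈ nbhd n c := mem_nbhd.2 fun i => by simp

/-- Near x both splines are compared with one reference polynomial, that of the cube of level k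
containing x. Each difference is a spline whose coefficients measure the discrepancy of two
polynomials approximating f on overlapping sets, hence are bounded by the two local errors. The
spline of level k is smooth at its own scale and a fortiori at the finer one. -/
lemma exists_isBlock_quasiSpline (n : ℕ) {l : ℕ} (hl : 1 ≤ l) {ω : Fin (l + 1) → ℝ}
    (hω : IsReproducing ω) {θ : ℝ} (hθ : 0 < θ) (hθ1 : θ ≤ 1) :
    ∃ C : ℝ≥0∞, C ≠ ∞ ∧ ∀ f : (Fin n → ℝ) → ℝ, Measurable f →
      ∀ P : ℕ → (Fin n → ℤ) → (Fin n → ℝ) → ℝ, (∀ k m, P k m ∈ polySpace n l) → ∀ k,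
      IsBlock (k + 1) l (quasiSpline ω P (k + 1) - quasiSpline ω P k) fun M =>
        C * (∑ e ∈ nbhd n (l + l + 1),
            localError θ f (P (k + 1) (M + e)) (k + 1) (M + e) (3 * l + 2 : ℕ) ^ (1 / θ) +
          ∑ e ∈ nbhd n (l + l + 1),
            localError θ f (P k (par 1 M + e)) k (par 1 M + e) (3 * l + 2 : ℕ) ^ (1 / θ)) := by
  obtain ⟨C₁, hC₁, hB⟩ := exists_isBlock_splineSum n hl
  obtain ⟨C₂, hC₂, hS⟩ := exists_enorm_splineCoeff_sub_le n ω hθ hθ1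
  set c := l + l + 1 with hc
  have hθ' : 0 ≤ 1 / θ := (one_div_pos.2 hθ).le
  set K : ℝ≥0∞ := (C₂ * 2 ^ n) ^ (1 / θ) * ENNReal.LpAddConst (ENNReal.ofReal (1 / θ))⁻¹ with hK
  have hKt : K ≠ ∞ := ENNReal.mul_ne_top (ENNReal.rpow_ne_top_of_nonneg hθ' (by finiteness))
    (ENNReal.LpAddConst_lt_top _).ne
  have h2n : (1 : ℝ≥0∞) ≤ 2 ^ n := one_le_pow₀ one_le_two
  have hcard : (1 : ℝ≥0∞) ≤ (nbhd n c).card := by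
    exact_mod_cast Finset.card_pos.2 ⟨0, zero_mem_nbhd n c⟩
  refine ⟨C₁ * K * (3 * (nbhd n c).card), by finiteness, fun f hf P hP k x h i hi hh => ?_⟩
  set E : ℕ → (Fin n → ℤ) → ℝ≥0∞ := fun k m => localError θ f (P k m) k m (3 * l + 2 : ℕ) with hE
  set ε : ℕ → (Fin n → ℤ) → ℝ≥0∞ := fun k m => E k m ^ (1 / θ) with hε
  set M := idx (k + 1) x with hM
  have hpar : par 1 M = idx k x := par_idx k 1 x
  set m := idx k x with hm
  set Q := P k m with hQ
  have hself : ∀ k m, localError θ f (P k m) k m l ≤ E k m := fun k m => localError_mono (by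
    intro y hy
    rw [mem_dyadicBall (by positivity)] at hy ⊢
    intro i
    refine (hy i).trans ?_
    push_cast
    linarith [(Nat.cast_nonneg l : (0 : ℝ) ≤ l)])
  have e1 : ∀ e ∈ nbhd n c, ‖splineCoeff ω (k + 1) (M + e) (P (k + 1) (M + e)) -
      splineCoeff ω (k + 1) (M + e) Q‖ₑ ≤ K * (ε (k + 1) (M + e) + ε k m) := by
    intro e he
    refine enorm_le_rpow_add hθ ((hS f hf _ (hP _ _) Q (hP _ _) _ _).trans ?_)
    rw [mul_assoc]
    refine mul_le_mul_right ?_ _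
    rw [mul_add]
    refine add_le_add ((hself _ _).trans (le_mul_of_one_le_left zero_le h2n)) ?_
    have := localError_succ_le (θ := θ) (f := f) (P := Q) (k := k) (M := M) he
    rwa [hpar] at this
  have e2 : ∀ e ∈ nbhd n c, ‖splineCoeff ω k (m + e) (P k (m + e)) -
      splineCoeff ω k (m + e) Q‖ₑ ≤ K * (ε k (m + e) + ε k m) := by
    intro e he
    refine enorm_le_rpow_add hθ ((hS f hf _ (hP _ _) Q (hP _ _) _ _).trans ?_)
    rw [mul_assoc]
    refine mul_le_mul_right (le_trans ?_ (le_mul_of_one_le_left zero_le h2n)) _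
    exact add_le_add (hself _ _) (localError_mono (dyadicBall_add_subset he))
  have hdec : diff i h (quasiSpline ω P (k + 1) - quasiSpline ω P k) x =
      diff i h (quasiSpline ω P (k + 1) - Q) x - diff i h (quasiSpline ω P k - Q) x := by
    simp only [diff_sub, Pi.sub_apply]
    ring
  rw [hdec, quasiSpline_sub hl hω P _ (hP _ _), quasiSpline_sub hl hω P _ (hP _ _)]
  have hh' : ‖h‖ ≤ ((2 : ℝ) ^ k)⁻¹ := hh.trans (by
    gcongr
    · norm_num
    · omega)
  have b1 := hB (k + 1) (fun m => splineCoeff ω (k + 1) m (P (k + 1) m) - splineCoeff ω (k + 1) m Q)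
    x h i hi hh
  have b2 := hB k (fun m => splineCoeff ω k m (P k m) - splineCoeff ω k m Q) x h i hi hh'
  rw [← hM] at b1
  rw [← hm] at b2
  have s0 : ε k m ≤ ∑ e ∈ nbhd n c, ε k (m + e) := by
    have := Finset.single_le_sum (f := fun e => ε k (m + e)) (fun _ _ => zero_le) (zero_mem_nbhd n c)
    simpa using this
  have s1 : ∑ e ∈ nbhd n c, ‖splineCoeff ω (k + 1) (M + e) (P (k + 1) (M + e)) -
      splineCoeff ω (k + 1) (M + e) Q‖ₑ ≤ K * (∑ e ∈ nbhd n c, ε (k + 1) (M + e) +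
        (nbhd n c).card * ∑ e ∈ nbhd n c, ε k (m + e)) := by
    refine (Finset.sum_le_sum e1).trans ?_
    rw [← Finset.mul_sum, sum_nbhd_add_const_le]
    gcongr
  have s2 : ∑ e ∈ nbhd n c, ‖splineCoeff ω k (m + e) (P k (m + e)) -
      splineCoeff ω k (m + e) Q‖ₑ ≤ K * (∑ e ∈ nbhd n c, ε k (m + e) +
        (nbhd n c).card * ∑ e ∈ nbhd n c, ε k (m + e)) := by
    refine (Finset.sum_le_sum e2).trans ?_
    rw [← Finset.mul_sum, sum_nbhd_add_const_le]
    gcongr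
  set X := ∑ e ∈ nbhd n c, ε (k + 1) (M + e) with hX
  set Y := ∑ e ∈ nbhd n c, ε k (m + e) with hY
  beta_reduce
  rw [hpar]
  change _ ≤ C₁ * K * (3 * (nbhd n c).card) * (X + Y) * _
  set s := ENNReal.ofReal (2 ^ (k + 1) * ‖h‖) with hs
  have hss : ENNReal.ofReal (2 ^ k * ‖h‖) ^ i ≤ s ^ i := by
    refine pow_le_pow_left' (ENNReal.ofReal_le_ofReal ?_) i
    gcongr
    · norm_num
    · omega
  refine (enorm_sub_le).trans ((add_le_add (b1.trans (mul_le_mul_left (mul_le_mul_right s1 _) _))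
    (b2.trans (mul_le_mul' (mul_le_mul_right s2 _) hss))).trans ?_)
  rw [← add_mul, ← mul_add, ← mul_add]
  refine mul_le_mul_left ?_ _
  rw [mul_assoc C₁, mul_assoc C₁, mul_assoc K]
  refine mul_le_mul_right (mul_le_mul_right ?_ _) _
  set N : ℝ≥0∞ := ((nbhd n c).card : ℝ≥0∞)
  calc X + N * Y + (Y + N * Y) = X + Y + 2 * (N * Y) := by ring
    _ ≤ N * (X + Y) + 2 * (N * (X + Y)) := by
      gcongr
      · exact le_mul_of_one_le_left zero_le hcard
      · exact le_add_self
    _ = _ := by ring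

lemma exists_enorm_quasiSpline_sub_le (n : ℕ) {l : ℕ} (hl : 1 ≤ l) {ω : Fin (l + 1) → ℝ}
    (hω : IsReproducing ω) {θ : ℝ} (hθ : 0 < θ) (hθ1 : θ ≤ 1) :
    ∃ C : ℝ≥0∞, C ≠ ∞ ∧ ∀ f : (Fin n → ℝ) → ℝ, Measurable f →
      ∀ P : ℕ → (Fin n → ℤ) → (Fin n → ℝ) → ℝ, (∀ k m, P k m ∈ polySpace n l) → ∀ k x,
      ‖quasiSpline ω P k x - P k (idx k x) x‖ₑ ^ θ ≤ C * ∑ e ∈ nbhd n (l + l + 1),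
        localError θ f (P k (idx k x + e)) k (idx k x + e) (3 * l + 2 : ℕ) := by
  obtain ⟨C₁, hC₁, hB⟩ := exists_isBlock_splineSum n hl
  obtain ⟨C₂, hC₂, hS⟩ := exists_enorm_splineCoeff_sub_le n ω hθ hθ1
  set c := l + l + 1 with hc
  have hC₁' : C₁ ^ θ ≠ ∞ := ENNReal.rpow_ne_top_of_nonneg hθ.le hC₁
  refine ⟨C₁ ^ θ * (C₂ * (1 + (nbhd n c).card)), by finiteness, fun f hf P hP k x => ?_⟩
  set m := idx k x with hm
  set Q := P k m with hQ
  set E : (Fin n → ℤ) → ℝ≥0∞ := fun m => localError θ f (P k m) k m (3 * l + 2 : ℕ) with hE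
  have h1 := congrFun (quasiSpline_sub hl hω P k (hP k m)) x
  rw [Pi.sub_apply] at h1
  rw [h1]
  refine (ENNReal.rpow_le_rpow ((hB k _).enorm_le x) hθ.le).trans ?_
  rw [ENNReal.mul_rpow_of_nonneg _ _ hθ.le, mul_assoc]
  refine mul_le_mul_right ((sum_rpow_le_of_le_one _ hθ hθ1 _).trans ?_) _
  calc _ ≤ ∑ e ∈ nbhd n c, C₂ * (E (m + e) + E m) := by
        refine Finset.sum_le_sum fun e he => (hS f hf _ (hP _ _) Q (hP _ _) _ _).trans ?_
        refine mul_le_mul_right (add_le_add (localError_mono ?_)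
          (localError_mono (dyadicBall_add_subset he))) _
        have := dyadicBall_add_subset (l := l) (k := k) (m := m + e) (zero_mem_nbhd n _)
        rwa [add_zero] at this
    _ = C₂ * (∑ e ∈ nbhd n c, E (m + e) + (nbhd n c).card * E m) := by
        rw [← Finset.mul_sum, sum_nbhd_add_const_le]
    _ ≤ C₂ * (∑ e ∈ nbhd n c, E (m + e) + (nbhd n c).card * ∑ e ∈ nbhd n c, E (m + e)) := by
        gcongr
        have := Finset.single_le_sum (f := fun e => E (m + e)) (fun _ _ => zero_le) (zero_mem_nbhd n c)
        simpa using this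
    _ = _ := by ring

lemma hcube_subset_dyadicBall {k : ℕ} {m : Fin n → ℤ} {R : ℝ} (hR : 1 ≤ R) :
    hcube k m ⊆ dyadicBall k m R := by
  intro x hx
  rw [mem_dyadicBall (by linarith)]
  intro i
  have h : ⌊(2 : ℝ) ^ k * x i⌋ = m i := congrFun hx i
  have h1 := Int.floor_le ((2 : ℝ) ^ k * x i)
  have h2 := Int.lt_floor_add_one ((2 : ℝ) ^ k * x i)
  rw [h] at h1 h2
  rw [abs_le]
  constructor <;> linarith

lemma ofReal_two_pow (k n : ℕ) : ENNReal.ofReal (((2 : ℝ) ^ k) ^ n) = 2 ^ (k * n) := by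
  rw [← pow_mul, ENNReal.ofReal_pow (by norm_num)]
  norm_num

/-- Compare the spline with the polynomial of the cube, and the polynomial with f. The resulting
bound on each cube is what makes the splines converge to f in the mean. -/
lemma exists_lintegral_quasiSpline_sub_le (n : ℕ) {l : ℕ} (hl : 1 ≤ l) {ω : Fin (l + 1) → ℝ}
    (hω : IsReproducing ω) {θ : ℝ} (hθ : 0 < θ) (hθ1 : θ ≤ 1) :
    ∃ C : ℝ≥0∞, C ≠ ∞ ∧ ∀ f : (Fin n → ℝ) → ℝ, Measurable f →
      ∀ P : ℕ → (Fin n → ℤ) → (Fin n → ℝ) → ℝ, (∀ k m, P k m ∈ polySpace n l) → ∀ k m,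
      ∫⁻ x in hcube k m, ‖quasiSpline ω P k x - f x‖ₑ ^ θ ≤
        ((2 : ℝ≥0∞) ^ (k * n))⁻¹ * (C * ∑ e ∈ nbhd n (l + l + 1),
          localError θ f (P k (m + e)) k (m + e) (3 * l + 2 : ℕ)) := by
  obtain ⟨C, hC, h⟩ := exists_enorm_quasiSpline_sub_le n hl hω hθ hθ1
  refine ⟨C + 1, by finiteness, fun f hf P hP k m => ?_⟩
  set E : (Fin n → ℤ) → ℝ≥0∞ := fun m => localError θ f (P k m) k m (3 * l + 2 : ℕ) with hE
  set c := l + l + 1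
  have h1 : ∀ x ∈ hcube k m, ‖quasiSpline ω P k x - f x‖ₑ ^ θ ≤
      C * ∑ e ∈ nbhd n c, E (m + e) + ‖f x - P k m x‖ₑ ^ θ := by
    intro x hx
    have hx' : idx k x = m := hx
    have h2 := h f hf P hP k x
    rw [hx'] at h2
    refine (enorm_sub_rpow_le hθ hθ1 _ _ (P k m x)).trans (add_le_add ?_ ?_)
    · rwa [← enorm_neg, neg_sub]
    · rw [← enorm_neg, neg_sub]
  refine (setLIntegral_mono' (measurableSet_hcube k m) h1).trans ?_
  rw [lintegral_add_left measurable_const, setLIntegral_const, volume_hcube, add_mul, mul_add, one_mul,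
    mul_comm]
  refine add_le_add le_rfl ?_
  have h2 : ∫⁻ x in hcube k m, ‖f x - P k m x‖ₑ ^ θ ≤ ((2 : ℝ≥0∞) ^ (k * n))⁻¹ * E m := by
    rw [hE]
    beta_reduce
    rw [localError, ofReal_two_pow, ← mul_assoc, ENNReal.inv_mul_cancel (by simp) (by simp), one_mul]
    refine lintegral_mono_set (hcube_subset_dyadicBall ?_)
    push_cast
    linarith [(Nat.cast_nonneg l : (0 : ℝ) ≤ l)]
  refine h2.trans (mul_le_mul_right ?_ _)
  have := Finset.single_le_sum (f := fun e => E (m + e)) (fun _ _ => zero_le) (zero_mem_nbhd n c)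
  simpa only [add_zero] using this

/-! ## Pointwise convergence for continuous functions -/

lemma eventually_forall_near {x : Fin n → ℝ} {p : (Fin n → ℝ) → Prop} (hp : ∀ᶠ z in 𝓝 x, p z) (c : ℝ) :
    ∀ᶠ k : ℕ in atTop, ∀ z, ‖z - x‖ ≤ c * ((2 : ℝ) ^ k)⁻¹ → p z := by
  obtain ⟨ρ, hρ, h⟩ := Metric.eventually_nhds_iff.1 hp
  have h1 : Tendsto (fun k : ℕ => c * ((2 : ℝ) ^ k)⁻¹) atTop (𝓝 0) := by
    have := (tendsto_pow_atTop_nhds_zero_of_lt_one (r := (1 / 2 : ℝ)) (by norm_num) (by norm_num)).const_mul c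
    simpa using this
  filter_upwards [h1.eventually (gt_mem_nhds hρ)] with k hk z hz
  refine h ?_
  rw [dist_eq_norm]
  exact hz.trans_lt hk

lemma eventually_enorm_sub_le {f : (Fin n → ℝ) → ℝ} (hf : Continuous f) {θ : ℝ} (hθ : 0 < θ)
    (x : Fin n → ℝ) {η : ℝ≥0∞} (hη : 0 < η) : ∀ᶠ z in 𝓝 x, ‖f x - f z‖ₑ ^ θ ≤ η := by
  have h : Continuous fun z => ‖f x - f z‖ₑ ^ θ :=
    ENNReal.continuous_rpow_const.comp (continuous_const.sub hf).enorm
  have h1 := h.tendsto x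
  rw [sub_self, enorm_zero, ENNReal.zero_rpow_of_pos hθ] at h1
  exact (ENNReal.tendsto_nhds_zero.1 h1) η hη

lemma norm_sub_le_of_abs_le {k : ℕ} {x z : Fin n → ℝ} {c : ℝ} (hc : 0 ≤ c)
    (h : ∀ i, |(2 : ℝ) ^ k * z i - (2 : ℝ) ^ k * x i| ≤ c) : ‖z - x‖ ≤ c * ((2 : ℝ) ^ k)⁻¹ := by
  rw [pi_norm_le_iff_of_nonneg (by positivity)]
  intro i
  have h1 := h i
  rw [← mul_sub, abs_mul, abs_of_pos (by positivity), mul_comm] at h1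
  rw [Pi.sub_apply, Real.norm_eq_abs, ← div_eq_mul_inv, le_div_iff₀ (by positivity)]
  exact h1

lemma abs_sub_idx_le (k : ℕ) (x : Fin n → ℝ) (i : Fin n) : |(2 : ℝ) ^ k * x i - idx k x i| ≤ 1 := by
  have h1 := Int.floor_le ((2 : ℝ) ^ k * x i)
  have h2 := Int.lt_floor_add_one ((2 : ℝ) ^ k * x i)
  rw [idx, abs_le]
  constructor <;> linarith

lemma tendsto_mean_dyadicBall {θ : ℝ} (hθ : 0 < θ) {f : (Fin n → ℝ) → ℝ} (hf : Continuous f) (R : ℕ)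
    (x : Fin n → ℝ) :
    Tendsto (fun k => ENNReal.ofReal (((2 : ℝ) ^ k) ^ n) *
      ∫⁻ z in dyadicBall k (idx k x) R, ‖f x - f z‖ₑ ^ θ) atTop (𝓝 0) := by
  set N : ℝ≥0∞ := ((nbhd n (R + 1)).card : ℝ≥0∞) with hN
  have hN0 : N ≠ 0 := by
    rw [hN, Nat.cast_ne_zero]
    exact (Finset.card_pos.2 ⟨0, zero_mem_nbhd n _⟩).ne'
  rw [ENNReal.tendsto_nhds_zero]
  intro ε hε
  have hη : 0 < ε / N := ENNReal.div_pos hε.ne' (ENNReal.natCast_ne_top _)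
  filter_upwards [eventually_forall_near (eventually_enorm_sub_le hf hθ x hη) (R + 1)] with k hk
  have h1 : ∀ z ∈ dyadicBall k (idx k x) R, ‖f x - f z‖ₑ ^ θ ≤ ε / N := by
    intro z hz
    refine hk z (norm_sub_le_of_abs_le (by positivity) fun i => ?_)
    have h2 := abs_le.1 ((mem_dyadicBall (by positivity)).1 hz i)
    have h3 := abs_le.1 (abs_sub_idx_le k x i)
    rw [abs_le]
    constructor <;> linarith [h2.1, h2.2, h3.1, h3.2]
  have h2 := setLIntegral_dyadicBall_le k (idx k x) R fun _ => ε / N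
  calc _ ≤ ENNReal.ofReal (((2 : ℝ) ^ k) ^ n) * ∫⁻ _ in dyadicBall k (idx k x) R, ε / N :=
        mul_le_mul_right (setLIntegral_mono' (measurableSet_dyadicBall _ _ _) h1) _
    _ ≤ ENNReal.ofReal (((2 : ℝ) ^ k) ^ n) *
        ∑ e ∈ nbhd n (R + 1), ∫⁻ _ in hcube k (idx k x + e), ε / N := mul_le_mul_right h2 _
    _ = N * (ε / N) := by
        simp_rw [setLIntegral_const, volume_hcube]
        rw [Finset.sum_const, nsmul_eq_mul, ofReal_two_pow, ← hN, mul_left_comm, mul_left_comm _ (ε / N),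
          ENNReal.mul_inv_cancel (by simp) (by simp), mul_one]
    _ = ε := ENNReal.mul_div_cancel hN0 (ENNReal.natCast_ne_top _)

lemma diff_sub_const {l : ℕ} (hl : 1 ≤ l) (h : Fin n → ℝ) (f : (Fin n → ℝ) → ℝ) (c : ℝ) (x : Fin n → ℝ) :
    diff l h f x = diff l h (fun z => f z - c) x := by
  have h1 : diff l h (fun _ => c) x = 0 :=
    diff_eq_zero_of_polynomial (Q := Polynomial.C c) (by rw [Polynomial.natDegree_C]; omega) (by simp)
  have h2 := congrFun (diff_sub l h f fun _ => c) x
  rw [Pi.sub_apply, h1, sub_zero] at h2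
  exact h2.symm

/-- Differences of order l ≥ 1 annihilate constants, so f may be replaced by f - f(x), which is
small on the shrinking neighbourhoods; the normalised measure of these stays bounded. -/
lemma tendsto_cellModulus {l : ℕ} (hl : 1 ≤ l) {θ : ℝ} (hθ : 0 < θ) (hθ1 : θ ≤ 1)
    {f : (Fin n → ℝ) → ℝ} (hf : Continuous f) (x : Fin n → ℝ) (e : Fin n → ℤ) :
    Tendsto (fun k => cellModulus l θ f k (idx k x + e)) atTop (𝓝 0) := by
  set N : ℝ≥0∞ := 4 ^ n * ((l + 1 : ℕ) * ((2 : ℝ≥0∞) ^ l) ^ θ) with hN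
  have h2l : ((2 : ℝ≥0∞) ^ l) ^ θ ≠ ∞ := ENNReal.rpow_ne_top_of_nonneg hθ.le (by finiteness)
  have hNt : N ≠ ∞ := by finiteness
  have hN0 : N ≠ 0 := by
    refine mul_ne_zero (by simp) (mul_ne_zero (by simp) ?_)
    rw [ne_eq, ENNReal.rpow_eq_zero_iff]
    simp
  rw [ENNReal.tendsto_nhds_zero]
  intro ε hε
  have hη : 0 < ε / N := ENNReal.div_pos hε.ne' hNt
  set E : ℝ := ‖fun i => (e i : ℝ)‖ with hE
  filter_upwards [eventually_forall_near (eventually_enorm_sub_le hf hθ x hη) (E + 2 + 2 * l)] with k hk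
  have h20 : (0 : ℝ) < 2 ^ k := by positivity
  have h1 : ∀ h ∈ cube (0 : Fin n → ℝ) (2 * (2 * (1 / 2) ^ k)), ∀ y ∈ hcube k (idx k x + e),
      ‖diff l h f y‖ₑ ^ θ ≤ (l + 1 : ℕ) * ((2 : ℝ≥0∞) ^ l) ^ θ * (ε / N) := by
    intro h hh y hy
    rw [diff_sub_const hl h f (f x)]
    refine (ENNReal.rpow_le_rpow (enorm_diff_le l h _ y) hθ.le).trans
      ((sum_rpow_le_of_le_one _ hθ hθ1 _).trans ?_)
    have h3 : ∀ j ∈ Finset.range (l + 1), ((2 : ℝ≥0∞) ^ l * ‖f (y + (j : ℝ) • h) - f x‖ₑ) ^ θ ≤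
        ((2 : ℝ≥0∞) ^ l) ^ θ * (ε / N) := by
      intro j hj
      rw [ENNReal.mul_rpow_of_nonneg _ _ hθ.le, ← enorm_neg, neg_sub]
      refine mul_le_mul_right (hk _ (norm_sub_le_of_abs_le (by positivity) fun i => ?_)) _
      have hj' : (j : ℝ) ≤ l := by exact_mod_cast Nat.lt_succ_iff.1 (Finset.mem_range.1 hj)
      have h4 : |(2 : ℝ) ^ k * h i| ≤ 2 := by
        have h5 := hh i
        rw [Pi.zero_apply, sub_zero, one_div, inv_pow] at h5
        rw [abs_mul, abs_of_pos h20]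
        have h6 : (2 : ℝ) ^ k * |h i| ≤ 2 ^ k * (2 * (2 * (2 ^ k)⁻¹) / 2) := by gcongr
        refine h6.trans (le_of_eq ?_)
        field_simp
      have h5 : |(j : ℝ) * ((2 : ℝ) ^ k * h i)| ≤ 2 * l := by
        rw [abs_mul, abs_of_nonneg (Nat.cast_nonneg j), mul_comm 2]
        exact mul_le_mul hj' h4 (abs_nonneg _) (by positivity)
      have h6 : |(e i : ℝ)| ≤ E := norm_le_pi_norm (fun i => (e i : ℝ)) i
      have h7 := abs_sub_idx_le k y i
      rw [show idx k y = idx k x + e from hy, Pi.add_apply, Int.cast_add] at h7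
      have h8 := abs_sub_idx_le k x i
      rw [abs_le] at h5 h6 h7 h8 ⊢
      have h9 : (2 : ℝ) ^ k * (y + (j : ℝ) • h) i - 2 ^ k * x i =
          2 ^ k * y i + j * (2 ^ k * h i) - 2 ^ k * x i := by
        simp only [Pi.add_apply, Pi.smul_apply, smul_eq_mul]
        ring
      rw [h9]
      constructor <;> linarith [h5.1, h5.2, h6.1, h6.2, h7.1, h7.2, h8.1, h8.2]
    refine (Finset.sum_le_sum h3).trans (le_of_eq ?_)
    rw [Finset.sum_const, Finset.card_range, nsmul_eq_mul, mul_assoc]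
  set B := (l + 1 : ℕ) * ((2 : ℝ≥0∞) ^ l) ^ θ * (ε / N) with hB
  unfold cellModulus
  calc _ ≤ ENNReal.ofReal (((2 : ℝ) ^ k) ^ n) * (ENNReal.ofReal (((2 : ℝ) ^ k) ^ n) *
        ∫⁻ _ in cube (0 : Fin n → ℝ) (2 * (2 * (1 / 2) ^ k)), ∫⁻ _ in hcube k (idx k x + e), B) := by
        refine mul_le_mul_right (mul_le_mul_right ?_ _) _
        exact setLIntegral_mono' (measurableSet_cube _ _) fun h hh =>
          setLIntegral_mono' (measurableSet_hcube _ _) fun y hy => h1 h hh y hy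
    _ = 4 ^ n * B := by
        rw [setLIntegral_const, setLIntegral_const, volume_hcube, volume_cube, ofReal_two_pow]
        have h3 : ENNReal.ofReal (2 * (2 * (1 / 2) ^ k)) ^ n = 4 ^ n * ((2 : ℝ≥0∞) ^ (k * n))⁻¹ := by
          rw [← ofReal_two_pow, ← ENNReal.ofReal_inv_of_pos (by positivity),
            ← ENNReal.ofReal_pow (by positivity), ← mul_assoc, mul_pow,
            ENNReal.ofReal_mul (by positivity), one_div, inv_pow, inv_pow, ENNReal.ofReal_pow (by norm_num)]
          norm_num
        have h4 : (2 : ℝ≥0∞) ^ (k * n) * ((2 : ℝ≥0∞) ^ (k * n))⁻¹ = 1 :=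
          ENNReal.mul_inv_cancel (by simp) (by simp)
        rw [h3]
        calc _ = ((2 : ℝ≥0∞) ^ (k * n) * ((2 : ℝ≥0∞) ^ (k * n))⁻¹) *
              ((2 : ℝ≥0∞) ^ (k * n) * ((2 : ℝ≥0∞) ^ (k * n))⁻¹) * (4 ^ n * B) := by ring
          _ = _ := by rw [h4, one_mul, one_mul]
    _ = N * (ε / N) := by rw [hB, hN]; ring
    _ = ε := ENNReal.mul_div_cancel hN0 hNt

/-- Convergence at every point, not merely almost everywhere, is what allows evaluation on the
plane. The local polynomial is close to f(x) at x because its deviation there is bounded by a mean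
deviation, to which both the continuity of f and the local error contribute little. -/
lemma tendsto_quasiSpline {l : ℕ} (hl : 1 ≤ l) {ω : Fin (l + 1) → ℝ}
    (hω : IsReproducing ω) {θ : ℝ} (hθ : 0 < θ) (hθ1 : θ ≤ 1) {f : (Fin n → ℝ) → ℝ} (hf : Continuous f)
    {P : ℕ → (Fin n → ℤ) → (Fin n → ℝ) → ℝ} (hP : ∀ k m, P k m ∈ polySpace n l) (x : Fin n → ℝ)
    (hE : ∀ e, Tendsto (fun k => localError θ f (P k (idx k x + e)) k (idx k x + e) (3 * l + 2 : ℕ))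
      atTop (𝓝 0)) :
    Tendsto (fun k => quasiSpline ω P k x) atTop (𝓝 (f x)) := by
  obtain ⟨C₁, hC₁, h1⟩ := exists_enorm_quasiSpline_sub_le n hl hω hθ hθ1
  obtain ⟨C₂, hC₂, h2⟩ := exists_enorm_le_dyadicBall n l 1 hθ hθ1
  have hbd : ∀ k, ‖quasiSpline ω P k x - f x‖ₑ ^ θ ≤ C₁ * ∑ e ∈ nbhd n (l + l + 1),
      localError θ f (P k (idx k x + e)) k (idx k x + e) (3 * l + 2 : ℕ) +
      C₂ * (ENNReal.ofReal (((2 : ℝ) ^ k) ^ n) *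
          (∫⁻ z in dyadicBall k (idx k x) l, ‖f x - f z‖ₑ ^ θ) +
        localError θ f (P k (idx k x + 0)) k (idx k x + 0) (3 * l + 2 : ℕ)) := by
    intro k
    refine (enorm_sub_rpow_le hθ hθ1 _ _ (P k (idx k x) x)).trans (add_le_add ?_ ?_)
    · rw [← enorm_neg, neg_sub]
      exact h1 f hf.measurable P hP k x
    · have hx : x ∈ dyadicBall k (idx k x) ((1 : ℕ) : ℝ) :=
        hcube_subset_dyadicBall (by simp) (show x ∈ hcube k (idx k x) from rfl)
      have h3 := h2 (P k (idx k x) - fun _ => f x)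
        (Submodule.sub_mem _ (hP _ _) (const_mem_polySpace hl _)) k (idx k x) x hx
      simp only [Pi.sub_apply] at h3
      refine h3.trans (mul_le_mul_right ?_ _)
      refine (mean_sub_le hθ hθ1 (fun _ => f x) hf.measurable
        (continuous_of_mem_polySpace (hP _ _)).measurable k _ _).trans ?_
      rw [add_comm, add_zero]
      refine add_le_add (le_of_eq ?_) (localError_mono ?_)
      · unfold localError
        congr 1
        refine lintegral_congr fun z => ?_
        rw [← enorm_neg, neg_sub]
      · have := dyadicBall_add_subset (l := l) (k := k) (m := idx k x) (zero_mem_nbhd n _)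
        rwa [add_zero] at this
  have hlim : Tendsto (fun k => ‖quasiSpline ω P k x - f x‖ₑ ^ θ) atTop (𝓝 0) := by
    refine tendsto_of_tendsto_of_tendsto_of_le_of_le tendsto_const_nhds ?_ (fun _ => zero_le) hbd
    have hs := tendsto_finsetSum (nbhd n (l + l + 1)) fun e _ => hE e
    rw [Finset.sum_const_zero] at hs
    have hs1 := ENNReal.Tendsto.const_mul hs (Or.inr hC₁)
    have hs2 := ENNReal.Tendsto.const_mul ((tendsto_mean_dyadicBall hθ hf l x).add (hE 0)) (Or.inr hC₂)
    have hs3 := hs1.add hs2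
    simpa using hs3
  have h4 := (ENNReal.continuous_rpow_const (y := 1 / θ)).tendsto (0 : ℝ≥0∞) |>.comp hlim
  rw [ENNReal.zero_rpow_of_pos (one_div_pos.2 hθ)] at h4
  rw [tendsto_iff_edist_tendsto_0]
  refine h4.congr fun k => ?_
  rw [Function.comp_apply, ← ENNReal.rpow_mul, mul_one_div_cancel hθ.ne', ENNReal.rpow_one, edist_eq_enorm_sub]

/-! ## The sequence of local moduli of smoothness -/

/-- The local means of `|f|^θ` at level `0` and of the differences of `f` at the levels `k ≥ 1`. -/
def cellMean (l : ℕ) (θ : ℝ) (f : (Fin n → ℝ) → ℝ) : ℕ → (Fin n → ℤ) → ℝ≥0∞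
  | 0, m => ∫⁻ x in hcube 0 m, ‖f x‖ₑ ^ θ
  | k + 1, m => cellModulus l θ f (k + 1) m

lemma hcube_subset_cube {k : ℕ} {m : Fin n → ℤ} {x : Fin n → ℝ} (hx : x ∈ hcube k m) :
    hcube k m ⊆ cube x (2 * (1 / 2) ^ k) := by
  intro y hy i
  have hx' : ⌊(2 : ℝ) ^ k * x i⌋ = m i := congrFun hx i
  have hy' : ⌊(2 : ℝ) ^ k * y i⌋ = m i := congrFun hy i
  have h := Int.abs_sub_lt_one_of_floor_eq_floor (hy'.trans hx'.symm)
  rw [← mul_sub, abs_mul, abs_of_pos (by positivity)] at h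
  rw [mul_div_cancel_left₀ _ (by norm_num), one_div, inv_pow, ← one_div, lt_div_iff₀ (by positivity), mul_comm]
  exact h

/-- Comparison of L_θ with L_r on a finite measure. A total mass of at least 1 lets its power 1/θ -
1/r be replaced by 1/θ, uniformly in r. -/
lemma eLpNorm_ofReal_le {α : Type*} [MeasurableSpace α] {μ : Measure α} {θ : ℝ} (hθ : 0 < θ)
    {r : ℝ≥0∞} (hθr : ENNReal.ofReal θ ≤ r) {g : α → ℝ} (hg : AEStronglyMeasurable g μ)
    (hμ : 1 ≤ μ Set.univ) :
    (∫⁻ z, ‖g z‖ₑ ^ θ ∂μ) ^ (1 / θ) ≤ eLpNorm g r μ * μ Set.univ ^ (1 / θ) := by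
  have h := eLpNorm_le_eLpNorm_mul_rpow_measure_univ hθr hg
  rw [eLpNorm_eq_lintegral_rpow_enorm_toReal (by simpa using hθ) ENNReal.ofReal_ne_top,
    ENNReal.toReal_ofReal hθ.le] at h
  refine h.trans (mul_le_mul_right (ENNReal.rpow_le_rpow_of_exponent_le hμ ?_) _)
  have : 0 ≤ 1 / r.toReal := by positivity
  linarith

lemma exists_cellMean_zero_le (n : ℕ) (l : ℕ) {θ : ℝ} (hθ : 0 < θ) {r : ℝ≥0∞} (hθr : ENNReal.ofReal θ ≤ r) :
    ∃ C : ℝ≥0∞, C ≠ ∞ ∧ ∀ f : (Fin n → ℝ) → ℝ, Measurable f → ∀ m, ∀ x ∈ hcube 0 m,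
      cellMean l θ f 0 m ^ (1 / θ) ≤ C * eLpNorm f r (volume.restrict (cube x 2)) := by
  have hθ' : 0 ≤ 1 / θ := (one_div_pos.2 hθ).le
  refine ⟨((2 : ℝ≥0∞) ^ n) ^ (1 / θ), ENNReal.rpow_ne_top_of_nonneg hθ' (by finiteness),
    fun f hf m x hx => ?_⟩
  have hμ : (volume.restrict (cube x 2)) Set.univ = (2 : ℝ≥0∞) ^ n := by
    rw [Measure.restrict_apply_univ, volume_cube]
    norm_num
  have h1 := eLpNorm_ofReal_le (μ := volume.restrict (cube x 2)) hθ hθr hf.aestronglyMeasurable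
    (by rw [hμ]; exact one_le_pow₀ one_le_two)
  rw [hμ, mul_comm] at h1
  refine le_trans (ENNReal.rpow_le_rpow (lintegral_mono_set ?_) hθ') h1
  have := hcube_subset_cube hx
  simpa using this

/-- The cube of x with side 2^{1-k} contains the dyadic cube of x, and the sets of steps coincide.
The factor 4^n compares the normalisations, and the normalised measure has mass 2^n. -/
lemma exists_cellModulus_le (n : ℕ) (l : ℕ) {θ : ℝ} (hθ : 0 < θ) {r : ℝ≥0∞} (hθr : ENNReal.ofReal θ ≤ r) :
    ∃ C : ℝ≥0∞, C ≠ ∞ ∧ ∀ f : (Fin n → ℝ) → ℝ, Measurable f → ∀ k m, ∀ x ∈ hcube k m,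
      cellModulus l θ f k m ^ (1 / θ) ≤ C * delta l r x (2 * (1 / 2) ^ k) f := by
  have hθ' : 0 ≤ 1 / θ := (one_div_pos.2 hθ).le
  have hc1 : ((4 : ℝ≥0∞) ^ n) ^ (1 / θ) ≠ ∞ := ENNReal.rpow_ne_top_of_nonneg hθ' (by finiteness)
  have hc2 : ((2 : ℝ≥0∞) ^ n) ^ (1 / θ) ≠ ∞ := ENNReal.rpow_ne_top_of_nonneg hθ' (by finiteness)
  refine ⟨((4 : ℝ≥0∞) ^ n) ^ (1 / θ) * ((2 : ℝ≥0∞) ^ n) ^ (1 / θ), by finiteness, fun f hf k m x hx => ?_⟩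
  set s : ℝ := 2 * (1 / 2) ^ k with hs
  have hs0 : 0 < s := by positivity
  set κ := ENNReal.ofReal ((s ^ (2 * n))⁻¹) with hκ
  set μ := κ • (volume : Measure ((Fin n → ℝ) × (Fin n → ℝ))).restrict (cube 0 (2 * s) ×ˢ cube x s) with hμ
  have hμu : μ Set.univ = 2 ^ n := by
    rw [hμ, Measure.smul_apply, Measure.restrict_apply_univ, Measure.volume_eq_prod, Measure.prod_prod,
      volume_cube, volume_cube, smul_eq_mul, hκ, ← ENNReal.ofReal_pow (by positivity),
      ← ENNReal.ofReal_pow (by positivity), ← ENNReal.ofReal_mul (by positivity),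
      ← ENNReal.ofReal_mul (by positivity)]
    have : (s ^ (2 * n))⁻¹ * ((2 * s) ^ n * s ^ n) = 2 ^ n := by
      have h2 : ∀ u : ℝ, (2 * u) ^ n * u ^ n = u ^ (2 * n) * 2 ^ n := fun u => by
        rw [mul_pow, two_mul, pow_add]
        ring
      rw [inv_mul_eq_iff_eq_mul₀ (by positivity), h2]
    rw [this, ENNReal.ofReal_pow (by norm_num)]
    norm_num
  have hmeas := measurable_diff_uncurry l hf
  have h1 := eLpNorm_ofReal_le (μ := μ) hθ hθr hmeas.aestronglyMeasurable
    (by rw [hμu]; exact one_le_pow₀ one_le_two)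
  rw [hμu] at h1
  have h2 : cellModulus l θ f k m ≤ 4 ^ n * ∫⁻ z, ‖diff l z.1 f z.2‖ₑ ^ θ ∂μ := by
    rw [hμ, lintegral_smul_measure, Measure.volume_eq_prod, ← Measure.prod_restrict,
      lintegral_prod _ (hmeas.enorm.pow_const θ).aemeasurable, smul_eq_mul, ← mul_assoc]
    unfold cellModulus
    rw [← mul_assoc]
    refine mul_le_mul' (le_of_eq ?_) (lintegral_mono fun h => lintegral_mono_set (hcube_subset_cube hx))
    rw [hκ, ← ENNReal.ofReal_mul (by positivity)]
    have h4 : (4 : ℝ≥0∞) ^ n = ENNReal.ofReal ((4 : ℝ) ^ n) := by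
      rw [ENNReal.ofReal_pow (by norm_num)]
      norm_num
    rw [h4, ← ENNReal.ofReal_mul (by positivity)]
    congr 1
    rw [hs, pow_mul, one_div, inv_pow, mul_pow, inv_pow, mul_pow, mul_inv, inv_pow, inv_inv,
      show (2 : ℝ) ^ 2 = 4 by norm_num, ← mul_assoc, mul_inv_cancel₀ (by positivity), one_mul, ← mul_pow, sq]
  calc cellModulus l θ f k m ^ (1 / θ) ≤ (4 ^ n * ∫⁻ z, ‖diff l z.1 f z.2‖ₑ ^ θ ∂μ) ^ (1 / θ) :=
        ENNReal.rpow_le_rpow h2 hθ'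
    _ ≤ (4 ^ n) ^ (1 / θ) * (delta l r x s f * (2 ^ n) ^ (1 / θ)) := by
        rw [ENNReal.mul_rpow_of_nonneg _ _ hθ']
        exact mul_le_mul_right h1 _
    _ = _ := by ring

/-- The converse passage to `lintegral_le_tsum_of_le`: a constant that lies below F on a whole cube
can be integrated against the weight there. -/
lemma tsum_le_lintegral_of_le {p : ℝ} (hp : 0 < p) {T : ℕ → (Fin n → ℤ) → ℝ≥0∞} {t : (Fin n → ℝ) → ℝ}
    (ht : Measurable t) {k : ℕ}
    (hTt : ∀ m, ∫⁻ x in hcube k m, ENNReal.ofReal (t x) ^ p = T k m ^ p)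
    {F : (Fin n → ℝ) → ℝ≥0∞} {Y : (Fin n → ℤ) → ℝ≥0∞} {C : ℝ≥0∞} (hC : C ≠ ∞)
    (h : ∀ m, ∀ x ∈ hcube k m, Y m ≤ C * F x) :
    ∑' m, (Y m * T k m) ^ p ≤ C ^ p * ∫⁻ x, (ENNReal.ofReal (t x) * F x) ^ p := by
  rw [lintegral_eq_tsum_hcube k, ← ENNReal.tsum_mul_left]
  refine ENNReal.tsum_le_tsum fun m => ?_
  rw [ENNReal.mul_rpow_of_nonneg _ _ hp.le, ← hTt,
    ← lintegral_const_mul _ (ht.ennreal_ofReal.pow_const p),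
    ← lintegral_const_mul' _ _ (ENNReal.rpow_ne_top_of_nonneg hp.le hC)]
  refine setLIntegral_mono' (measurableSet_hcube k m) fun x hx => ?_
  rw [← ENNReal.mul_rpow_of_nonneg _ _ hp.le, ← ENNReal.mul_rpow_of_nonneg _ _ hp.le]
  refine ENNReal.rpow_le_rpow ?_ hp.le
  rw [mul_left_comm, mul_comm]
  exact mul_le_mul_right (h m x hx) _

lemma exists_seqSum_cellMean_le {p q : ℝ} (hp : 0 < p) (hq : 0 < q) (l : ℕ) {θ : ℝ} (hθ : 0 < θ)
    {r : ℝ≥0∞} (hθr : ENNReal.ofReal θ ≤ r)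
    {T : ℕ → (Fin n → ℤ) → ℝ≥0∞} {t : ℕ → (Fin n → ℝ) → ℝ} (ht : ∀ k, Measurable (t k))
    (hTt : ∀ k m, ∫⁻ x in hcube k m, ENNReal.ofReal (t k x) ^ p = T k m ^ p) :
    ∃ C : ℝ≥0∞, C ≠ ∞ ∧ ∀ f : (Fin n → ℝ) → ℝ, Measurable f →
      seqSum p q T (fun k m => cellMean l θ f k m ^ (1 / θ)) ≤ C * besovNorm l p q r t f ^ q := by
  obtain ⟨C₀, hC₀, h0⟩ := exists_cellMean_zero_le n l hθ hθr
  obtain ⟨C₁, hC₁, h1⟩ := exists_cellModulus_le n l hθ hθr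
  have hqp : 0 < q / p := div_pos hq hp
  have hc0 : C₀ ^ q ≠ ∞ := ENNReal.rpow_ne_top_of_nonneg hq.le hC₀
  have hc1 : C₁ ^ q ≠ ∞ := ENNReal.rpow_ne_top_of_nonneg hq.le hC₁
  refine ⟨C₀ ^ q + C₁ ^ q, by finiteness, fun f hf => ?_⟩
  unfold seqSum
  rw [tsum_eq_zero_add' ENNReal.summable, add_mul]
  have hpow : ∀ X : ℝ≥0∞, (X ^ p) ^ (q / p) = X ^ q := fun X => by
    rw [← ENNReal.rpow_mul, mul_div_cancel₀ _ hp.ne']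
  refine add_le_add ?_ ?_
  · have h2 := tsum_le_lintegral_of_le hp (ht 0) (hTt 0) (Y := fun m => cellMean l θ f 0 m ^ (1 / θ))
      (F := fun x => eLpNorm f r (volume.restrict (cube x 2))) hC₀ (fun m x hx => h0 f hf m x hx)
    refine (ENNReal.rpow_le_rpow h2 hqp.le).trans ?_
    rw [ENNReal.mul_rpow_of_nonneg _ _ hqp.le, hpow]
    refine mul_le_mul_right ?_ _
    have h3 := ENNReal.rpow_le_rpow (show _ ≤ besovNorm l p q r t f from le_add_self) hq.le
    rwa [← ENNReal.rpow_mul, one_div_mul_eq_div] at h3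
  · calc _ ≤ ∑' k : ℕ, C₁ ^ q * (∫⁻ x, (ENNReal.ofReal (t (k + 1) x) *
          delta l r x (2 * (1 / 2) ^ (k + 1)) f) ^ p) ^ (q / p) := by
          refine ENNReal.tsum_le_tsum fun k => ?_
          have h2 := tsum_le_lintegral_of_le hp (ht (k + 1)) (hTt (k + 1))
            (Y := fun m => cellMean l θ f (k + 1) m ^ (1 / θ))
            (F := fun x => delta l r x (2 * (1 / 2) ^ (k + 1)) f) hC₁ (fun m x hx => h1 f hf _ m x hx)
          refine (ENNReal.rpow_le_rpow h2 hqp.le).trans ?_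
          rw [ENNReal.mul_rpow_of_nonneg _ _ hqp.le, hpow]
      _ ≤ _ := by
          rw [ENNReal.tsum_mul_left]
          refine mul_le_mul_right ?_ _
          have h3 := ENNReal.rpow_le_rpow (show _ ≤ besovNorm l p q r t f from le_self_add) hq.le
          rwa [← ENNReal.rpow_mul, one_div_mul_cancel hq.ne', ENNReal.rpow_one] at h3

/-! ## Monotonicity in the exponent `θ` -/

/-- The normalised sum over the descendants of m is an integral over a unit cube, a probability
space, so power means increase with the exponent. This allows θ to be lowered to at most 1, as the
Whitney-type inequality requires. -/
lemma mean_rpow_le_mean_rpow {θ₀ θ : ℝ} (hθ₀ : 0 < θ₀) (hle : θ₀ ≤ θ) (d : ℕ) (m : Fin n → ℤ)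
    (c : (Fin n → ℤ) → ℝ≥0∞) :
    (((2 : ℝ≥0∞) ^ (d * n))⁻¹ * ∑' M, if par d M = m then c M ^ θ₀ else 0) ^ (1 / θ₀) ≤
      (((2 : ℝ≥0∞) ^ (d * n))⁻¹ * ∑' M, if par d M = m then c M ^ θ else 0) ^ (1 / θ) := by
  have key : ∀ u : ℝ, ((2 : ℝ≥0∞) ^ (d * n))⁻¹ * ∑' M, (if par d M = m then c M ^ u else 0) =
      ∫⁻ x in hcube 0 m, ‖c (idx d x)‖ₑ ^ u := by
    intro u
    rw [setLIntegral_hcube_eq_tsum 0 d, ← ENNReal.tsum_mul_left]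
    refine tsum_congr fun M => ?_
    split_ifs
    · rw [zero_add]
      exact (setLIntegral_idx d M fun M => c M ^ u).symm
    · simp
  have : IsProbabilityMeasure (volume.restrict (hcube 0 m : Set (Fin n → ℝ))) :=
    ⟨by rw [Measure.restrict_apply_univ, volume_hcube]; simp⟩
  rw [key, key]
  have hm : Measurable fun x : Fin n → ℝ => c (idx d x) := measurable_comp_idx d c
  have h := eLpNorm'_le_eLpNorm'_of_exponent_le hθ₀ hle (volume.restrict (hcube 0 m))
    hm.aestronglyMeasurable
  exact h

lemma IsDiscreteWeight.mono_exponent {p θ₀ θ α₁ α₂ : ℝ} {T : ℕ → (Fin n → ℤ) → ℝ≥0∞}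
    (hT : IsDiscreteWeight p θ α₁ α₂ T) (hθ₀ : 0 < θ₀) (hle : θ₀ ≤ θ) :
    IsDiscreteWeight p θ₀ α₁ α₂ T where
  ne_zero := hT.ne_zero
  ne_top := hT.ne_top
  neighbour := hT.neighbour
  upper := hT.upper
  lower := by
    obtain ⟨C, hC, h⟩ := hT.lower
    exact ⟨C, hC, fun k d m c =>
      (mul_le_mul_right (mean_rpow_le_mean_rpow hθ₀ hle d m c) _).trans (h k d m c)⟩

/-! ### From local errors to sequence sums and convergence. -/

lemma IsBlock.mono {k l : ℕ} {φ : (Fin n → ℝ) → ℝ} {b b' : (Fin n → ℤ) → ℝ≥0∞} (hb : IsBlock k l φ b)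
    (h : ∀ m, b m ≤ b' m) : IsBlock k l φ b' := fun x v i hi hv =>
  (hb x v i hi hv).trans (mul_le_mul_left (h _) _)

lemma sum_nbhd_sum_nbhd_le (a b : ℕ) (X : (Fin n → ℤ) → ℝ≥0∞) (m : Fin n → ℤ) :
    ∑ e ∈ nbhd n a, ∑ e' ∈ nbhd n b, X (m + e + e') ≤
      (nbhd n a).card * ∑ e ∈ nbhd n (a + b), X (m + e) := by
  rw [← nsmul_eq_mul]
  refine Finset.sum_le_card_nsmul _ _ _ fun e he => ?_
  have h1 : ∑ e' ∈ nbhd n b, X (m + e + e') =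
      ∑ e' ∈ (nbhd n b).map (addLeftEmbedding e), X (m + e') := by
    rw [Finset.sum_map]
    exact Finset.sum_congr rfl fun e' _ => by rw [addLeftEmbedding_apply, add_assoc]
  rw [h1]
  refine Finset.sum_le_sum_of_subset fun e'' h => ?_
  obtain ⟨e', he', rfl⟩ := Finset.mem_map.1 h
  rw [mem_nbhd] at he he' ⊢
  intro i
  rw [addLeftEmbedding_apply, Pi.add_apply]
  push_cast
  exact (abs_add_le _ _).trans (add_le_add (he i) (he' i))

/-- At level 0 the polynomial 0 is taken, so that the expansion starts with S_0 = 0 and the local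
error there is the mean of |f|^θ, which belongs to the quasi-norm. At all other levels the error is
bounded by moduli of smoothness. -/
lemma exists_local_polynomials (n : ℕ) {l : ℕ} (hl : 1 ≤ l) {θ : ℝ} (hθ : 0 < θ) (hθ1 : θ ≤ 1) :
    ∃ (c : ℕ) (C : ℝ≥0∞), C ≠ ∞ ∧ ∀ f : (Fin n → ℝ) → ℝ, Measurable f →
      (∀ K : Set (Fin n → ℝ), IsCompact K → ∫⁻ x in K, ‖f x‖ₑ ^ θ ≠ ∞) →
      ∃ P : ℕ → (Fin n → ℤ) → (Fin n → ℝ) → ℝ, (∀ k m, P k m ∈ polySpace n l) ∧ (∀ m, P 0 m = 0) ∧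
        ∀ k m, localError θ f (P k m) k m (3 * l + 2 : ℕ) ≤
          C * ∑ e ∈ nbhd n c, cellMean l θ f k (m + e) := by
  obtain ⟨c, C, hC, h⟩ := exists_local_polynomial n hl hθ hθ1 (3 * l + 2)
  refine ⟨max c (3 * l + 2 + 1), C + 1, by finiteness, fun f hf hfint => ?_⟩
  choose P hP hPle using h f hf hfint
  refine ⟨fun k m => if k = 0 then 0 else P k m, fun k m => ?_, fun m => by simp, fun k m => ?_⟩
  · beta_reduce
    split_ifs
    · exact Submodule.zero_mem _
    · exact hP k m
  · rcases Nat.eq_zero_or_pos k with rfl | hk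
    · beta_reduce
      rw [if_pos rfl, localError]
      simp only [pow_zero, one_pow, ENNReal.ofReal_one, one_mul, Pi.zero_apply, sub_zero]
      refine (setLIntegral_dyadicBall_le 0 m (3 * l + 2) fun x => ‖f x‖ₑ ^ θ).trans ?_
      refine le_trans (Finset.sum_le_sum_of_subset (nbhd_mono (le_max_right c _))) ?_
      exact le_mul_of_one_le_left zero_le le_add_self
    · beta_reduce
      rw [if_neg hk.ne']
      refine (hPle k m).trans (mul_le_mul' le_self_add ?_)
      refine le_trans (Finset.sum_le_sum_of_subset (nbhd_mono (le_max_left _ (3 * l + 2 + 1)))) (le_of_eq ?_)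
      refine Finset.sum_congr rfl fun e _ => ?_
      obtain ⟨k, rfl⟩ := Nat.exists_eq_add_of_le' hk
      rfl

lemma sum_rpow_localError_le {θ : ℝ} (hθ : 0 < θ) {X Y : (Fin n → ℤ) → ℝ≥0∞} {C : ℝ≥0∞} {c : ℕ}
    (h : ∀ m, X m ≤ C * ∑ e ∈ nbhd n c, Y (m + e)) (a : ℕ) (m : Fin n → ℤ) :
    ∑ e ∈ nbhd n a, X (m + e) ^ (1 / θ) ≤
      C ^ (1 / θ) * ((nbhd n c).card : ℝ≥0∞) ^ (1 / θ) * (nbhd n a).card *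
        ∑ e ∈ nbhd n (a + c), Y (m + e) ^ (1 / θ) := by
  have hθ' : 0 < 1 / θ := one_div_pos.2 hθ
  rw [mul_assoc _ ((nbhd n a).card : ℝ≥0∞)]
  refine le_trans ?_ (mul_le_mul_right (sum_nbhd_sum_nbhd_le a c (fun m => Y m ^ (1 / θ)) m) _)
  rw [Finset.mul_sum]
  refine Finset.sum_le_sum fun e _ => ?_
  refine (ENNReal.rpow_le_rpow (h _) hθ'.le).trans ?_
  rw [ENNReal.mul_rpow_of_nonneg _ _ hθ'.le, mul_assoc]
  exact mul_le_mul_right (sum_rpow_le _ hθ' _) _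

/-- Neighbours are handled by the comparability of nearby weights. Parents are handled by the upper
condition, in which a single level costs only the constant 2^{α₂ p}. -/
lemma exists_seqSum_shift_le {p q θ α₁ α₂ : ℝ} (hp : 0 < p) (hq : 0 < q)
    {T : ℕ → (Fin n → ℤ) → ℝ≥0∞} (hT : IsDiscreteWeight p θ α₁ α₂ T) (c : ℕ) {K : ℝ≥0∞} (hK : K ≠ ∞) :
    ∃ C : ℝ≥0∞, C ≠ ∞ ∧ ∀ δ b : ℕ → (Fin n → ℤ) → ℝ≥0∞, b 0 = 0 →
      (∀ k M, b (k + 1) M ≤ K * (∑ e ∈ nbhd n c, δ (k + 1) (M + e) +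
        ∑ e ∈ nbhd n c, δ k (par 1 M + e))) →
      seqSum p q T b ≤ C * seqSum p q T δ := by
  obtain ⟨C₁, hC₁, h1⟩ := hT.tsum_shift_le hp c
  obtain ⟨C₂, hC₂, h2⟩ := tsum_parent_le hp hT
  have hqp : 0 < q / p := div_pos hq hp
  set A := ENNReal.LpAddConst (ENNReal.ofReal p)⁻¹ with hA
  set B := ENNReal.LpAddConst (ENNReal.ofReal (q / p))⁻¹ with hB
  have hAt : A ≠ ∞ := (ENNReal.LpAddConst_lt_top _).ne
  have hBt : B ≠ ∞ := (ENNReal.LpAddConst_lt_top _).ne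
  set D : ℝ≥0∞ := C₁ + C₂ * 2 ^ (α₂ * p * (1 : ℕ)) * C₁ with hD
  have h2t : (2 : ℝ≥0∞) ^ (α₂ * p * (1 : ℕ)) ≠ ∞ := by simp [ENNReal.rpow_eq_top_iff]
  have hDt : D ≠ ∞ := by finiteness
  have hKp : K ^ p ≠ ∞ := ENNReal.rpow_ne_top_of_nonneg hp.le hK
  set G : ℝ≥0∞ := (K ^ p * A * D) ^ (q / p) * B with hG
  have hGt : G ≠ ∞ := ENNReal.mul_ne_top (ENNReal.rpow_ne_top_of_nonneg hqp.le (by finiteness)) hBt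
  refine ⟨G * 2, by finiteness, fun δ b hb0 hb => ?_⟩
  have hlev : ∀ k, levelSum p T b (k + 1) ≤
      K ^ p * A * D * (levelSum p T δ (k + 1) + levelSum p T δ k) := by
    intro k
    have e1 : ∀ M, (b (k + 1) M * T (k + 1) M) ^ p ≤ K ^ p * A *
        ((T (k + 1) M * ∑ e ∈ nbhd n c, δ (k + 1) (M + e)) ^ p +
          (T (k + 1) M * ∑ e ∈ nbhd n c, δ k (par 1 M + e)) ^ p) := by
      intro M
      calc _ ≤ (K * (T (k + 1) M * ∑ e ∈ nbhd n c, δ (k + 1) (M + e) +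
            T (k + 1) M * ∑ e ∈ nbhd n c, δ k (par 1 M + e))) ^ p := by
            refine ENNReal.rpow_le_rpow ((mul_le_mul_left (hb k M) _).trans (le_of_eq ?_)) hp.le
            ring
        _ ≤ _ := by
            rw [ENNReal.mul_rpow_of_nonneg _ _ hp.le, mul_assoc]
            exact mul_le_mul_right (ENNReal.rpow_add_le_mul_rpow_add_rpow' _ _ hp.le) _
    refine (ENNReal.tsum_le_tsum e1).trans ?_
    rw [ENNReal.tsum_mul_left, ENNReal.tsum_add, mul_assoc (K ^ p * A)]
    refine mul_le_mul_right ?_ _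
    have e2 := h1 (k + 1) (δ (k + 1))
    have e3 := (h2 k 1 fun M => ∑ e ∈ nbhd n c, δ k (M + e)).trans
      (mul_le_mul_right (h1 k (δ k)) _)
    refine (add_le_add e2 e3).trans ?_
    rw [mul_add, ← mul_assoc]
    refine add_le_add (mul_le_mul_left ?_ _) (mul_le_mul_left ?_ _)
    · exact le_self_add
    · exact le_add_self
  unfold seqSum
  rw [tsum_eq_zero_add' ENNReal.summable]
  have h0 : levelSum p T b 0 = 0 := by
    unfold levelSum
    rw [hb0]
    simp [hp]
  rw [h0, ENNReal.zero_rpow_of_pos hqp, zero_add]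
  calc _ ≤ ∑' k, G * (levelSum p T δ (k + 1) ^ (q / p) + levelSum p T δ k ^ (q / p)) := by
        refine ENNReal.tsum_le_tsum fun k => (ENNReal.rpow_le_rpow (hlev k) hqp.le).trans ?_
        rw [ENNReal.mul_rpow_of_nonneg _ _ hqp.le, hG, mul_assoc (_ ^ (q / p))]
        exact mul_le_mul_right (ENNReal.rpow_add_le_mul_rpow_add_rpow' _ _ hqp.le) _
    _ = G * (∑' k, levelSum p T δ (k + 1) ^ (q / p) + ∑' k, levelSum p T δ k ^ (q / p)) := by
        rw [ENNReal.tsum_mul_left, ENNReal.tsum_add]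
    _ ≤ G * (∑' k, levelSum p T δ k ^ (q / p) + ∑' k, levelSum p T δ k ^ (q / p)) := by
        refine mul_le_mul_right (add_le_add ?_ le_rfl) _
        rw [tsum_eq_zero_add' (f := fun k => levelSum p T δ k ^ (q / p)) ENNReal.summable]
        exact le_add_self
    _ = _ := by ring

lemma levelSum_rpow_le_seqSum {p q : ℝ} (hp : 0 < p) (hq : 0 < q) (T δ : ℕ → (Fin n → ℤ) → ℝ≥0∞)
    (k : ℕ) : levelSum p T δ k ^ (1 / p) ≤ seqSum p q T δ ^ (1 / q) := by
  have h : levelSum p T δ k ^ (q / p) ≤ seqSum p q T δ :=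
    ENNReal.le_tsum (f := fun k => levelSum p T δ k ^ (q / p)) k
  have h1 := ENNReal.rpow_le_rpow h (one_div_pos.2 hq).le
  rw [← ENNReal.rpow_mul] at h1
  convert h1 using 2
  field_simp

/-- The lower condition between levels 0 and k bounds the mean over a unit cube by 2^{-α₁ k} times a
weighted level sum. The level sums are bounded, so α₁ > 0 forces convergence. -/
lemma tendsto_lintegral_of_cell_bound {p q θ α₁ α₂ : ℝ} (hp : 0 < p) (hq : 0 < q) (hθ : 0 < θ)
    {T : ℕ → (Fin n → ℤ) → ℝ≥0∞} (hT : IsDiscreteWeight p θ α₁ α₂ T) (hα₁ : 0 < α₁)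
    {F : ℕ → (Fin n → ℝ) → ℝ≥0∞} {δ : ℕ → (Fin n → ℤ) → ℝ≥0∞} (hδ : seqSum p q T δ ≠ ∞)
    {c : ℕ} {K : ℝ≥0∞} (hK : K ≠ ∞)
    (h : ∀ k m, ∫⁻ x in hcube k m, F k x ≤
      ((2 : ℝ≥0∞) ^ (k * n))⁻¹ * (K * ∑ e ∈ nbhd n c, δ k (m + e)) ^ θ) (m : Fin n → ℤ) :
    Tendsto (fun k => ∫⁻ x in hcube 0 m, F k x) atTop (𝓝 0) := by
  obtain ⟨C₁, hC₁, h1⟩ := hT.lower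
  obtain ⟨C₂, hC₂, h2⟩ := hT.tsum_shift_le hp c
  have hp' : 0 ≤ 1 / p := (one_div_pos.2 hp).le
  set D : ℝ≥0∞ := K * C₂ ^ (1 / p) * seqSum p q T δ ^ (1 / q) with hD
  have hDt : D ≠ ∞ := by
    have a1 : C₂ ^ (1 / p) ≠ ∞ := ENNReal.rpow_ne_top_of_nonneg hp' hC₂
    have a2 : seqSum p q T δ ^ (1 / q) ≠ ∞ := ENNReal.rpow_ne_top_of_nonneg (one_div_pos.2 hq).le hδ
    finiteness
  have key : ∀ k, T 0 m * (∫⁻ x in hcube 0 m, F k x) ^ (1 / θ) ≤ C₁ * 2 ^ (-(α₁ * k)) * D := by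
    intro k
    set d : (Fin n → ℤ) → ℝ≥0∞ := fun M => K * ∑ e ∈ nbhd n c, δ k (M + e) with hd
    have h3 : ∫⁻ x in hcube 0 m, F k x ≤
        ((2 : ℝ≥0∞) ^ (k * n))⁻¹ * ∑' M, if par k M = m then d M ^ θ else 0 := by
      rw [setLIntegral_hcube_eq_tsum 0 k, ← ENNReal.tsum_mul_left]
      refine ENNReal.tsum_le_tsum fun M => ?_
      split_ifs
      · rw [zero_add]
        exact h k M
      · simp
    refine (mul_le_mul_right (ENNReal.rpow_le_rpow h3 (one_div_pos.2 hθ).le) _).trans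
      ((h1 0 k m d).trans (mul_le_mul_right ?_ _))
    rw [zero_add]
    have h4 : (∑' M, if par k M = m then (d M * T k M) ^ p else 0) ≤
        K ^ p * (C₂ * levelSum p T δ k) := by
      refine le_trans ?_ (mul_le_mul_right (h2 k (δ k)) _)
      rw [← ENNReal.tsum_mul_left]
      refine ENNReal.tsum_le_tsum fun M => ?_
      split_ifs
      · rw [hd, ← ENNReal.mul_rpow_of_nonneg _ _ hp.le]
        refine le_of_eq ?_
        congr 1
        ring
      · exact zero_le
    refine (ENNReal.rpow_le_rpow h4 hp').trans ?_
    rw [ENNReal.mul_rpow_of_nonneg _ _ hp', ENNReal.mul_rpow_of_nonneg _ _ hp', ← ENNReal.rpow_mul,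
      mul_one_div_cancel hp.ne', ENNReal.rpow_one, ← mul_assoc]
    exact mul_le_mul_right (levelSum_rpow_le_seqSum hp hq T δ k) _
  have hpow : Tendsto (fun k : ℕ => (2 : ℝ≥0∞) ^ (-(α₁ * k))) atTop (𝓝 0) := by
    have h5 : ∀ k : ℕ, (2 : ℝ≥0∞) ^ (-(α₁ * k)) = ((2 : ℝ≥0∞) ^ (-α₁)) ^ k := fun k => by
      rw [← ENNReal.rpow_natCast, ← ENNReal.rpow_mul, neg_mul]
    simp_rw [h5]
    refine ENNReal.tendsto_pow_atTop_nhds_zero_of_lt_one ?_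
    exact ENNReal.rpow_lt_one_of_one_lt_of_neg ENNReal.one_lt_two (by linarith)
  have hT0 := hT.ne_zero 0 m
  have hTt := hT.ne_top 0 m
  have hb : ∀ k, ∫⁻ x in hcube 0 m, F k x ≤ ((T 0 m)⁻¹ * (C₁ * 2 ^ (-(α₁ * k)) * D)) ^ θ := by
    intro k
    have h6 : (∫⁻ x in hcube 0 m, F k x) ^ (1 / θ) ≤ (T 0 m)⁻¹ * (C₁ * 2 ^ (-(α₁ * k)) * D) := by
      rw [← ENNReal.mul_le_iff_le_inv hT0 hTt]
      exact key k
    have h7 := ENNReal.rpow_le_rpow h6 hθ.le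
    rwa [← ENNReal.rpow_mul, one_div_mul_cancel hθ.ne', ENNReal.rpow_one] at h7
  refine tendsto_of_tendsto_of_tendsto_of_le_of_le tendsto_const_nhds ?_ (fun _ => zero_le) hb
  have h8 : Tendsto (fun k : ℕ => (T 0 m)⁻¹ * (C₁ * 2 ^ (-(α₁ * k)) * D)) atTop (𝓝 0) := by
    have := ENNReal.Tendsto.const_mul (ENNReal.Tendsto.mul_const
      (ENNReal.Tendsto.const_mul hpow (Or.inr hC₁)) (Or.inr hDt)) (Or.inr (ENNReal.inv_ne_top.2 hT0))
    simpa using this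
  have h9 := (ENNReal.continuous_rpow_const (y := θ)).tendsto (0 : ℝ≥0∞) |>.comp h8
  rwa [ENNReal.zero_rpow_of_pos hθ] at h9

/-- By Fatou's lemma the lower limit of the errors has integral zero, so an almost everywhere limit
of the sequence must be f. -/
lemma ae_eq_of_tendsto_lintegral {θ : ℝ} (hθ : 0 < θ) {S : ℕ → (Fin n → ℝ) → ℝ} {f g : (Fin n → ℝ) → ℝ}
    (hS : ∀ k, Measurable (S k)) (hf : Measurable f)
    (h : ∀ m, Tendsto (fun k => ∫⁻ x in hcube 0 m, ‖S k x - f x‖ₑ ^ θ) atTop (𝓝 0))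
    (hg : ∀ᵐ x, Tendsto (fun k => S k x) atTop (𝓝 (g x))) : g =ᵐ[volume] f := by
  have hm : ∀ k, Measurable fun x => ‖S k x - f x‖ₑ ^ θ := fun k => ((hS k).sub hf).enorm.pow_const θ
  have h1 : ∀ m : Fin n → ℤ, ∫⁻ x in hcube 0 m, liminf (fun k => ‖S k x - f x‖ₑ ^ θ) atTop = 0 := by
    intro m
    have h2 := lintegral_liminf_le (u := atTop) (μ := volume.restrict (hcube 0 m)) hm
    rw [(h m).liminf_eq] at h2
    exact le_antisymm h2 zero_le
  have h2 : ∫⁻ x, liminf (fun k => ‖S k x - f x‖ₑ ^ θ) atTop = 0 := by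
    rw [lintegral_eq_tsum_hcube 0]
    simp [h1]
  rw [lintegral_eq_zero_iff (.liminf hm)] at h2
  filter_upwards [h2, hg] with x hx hgx
  have h3 : Tendsto (fun k => ‖S k x - f x‖ₑ ^ θ) atTop (𝓝 (‖g x - f x‖ₑ ^ θ)) :=
    (ENNReal.continuous_rpow_const.tendsto _).comp ((hgx.sub_const (f x)).enorm)
  rw [h3.liminf_eq] at hx
  have h4 : ‖g x - f x‖ₑ = 0 := by
    rcases (ENNReal.rpow_eq_zero_iff.1 hx) with h | h
    · exact h.1
    · exact absurd h.2 (not_lt.2 hθ.le)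
  exact sub_eq_zero.1 (enorm_eq_zero.1 h4)

/-! ### Spline expansions of the functions of the space. -/

/-- The splines `S k` approximate `f`, and `S (k + 1) - S k` is a block with coefficients `b (k + 1)`. -/
structure IsSplineExpansion (l : ℕ) (f : (Fin n → ℝ) → ℝ) (S : ℕ → (Fin n → ℝ) → ℝ)
    (b : ℕ → (Fin n → ℤ) → ℝ≥0∞) : Prop where
  zero : S 0 = 0
  spline : ∀ k, ∃ β, S k = splineSum l k β
  block : ∀ k, IsBlock (k + 1) l (S (k + 1) - S k) (b (k + 1))
  ae_eq : ∀ g : (Fin n → ℝ) → ℝ, (∀ᵐ x, Tendsto (fun k => S k x) atTop (𝓝 (g x))) → g =ᵐ[volume] f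
  tendsto : Continuous f → ∀ x, Tendsto (fun k => S k x) atTop (𝓝 (f x))

lemma MemLpLoc.setLIntegral_ne_top {r : ℝ≥0∞} {f : (Fin n → ℝ) → ℝ} (hf : MemLpLoc r f) {θ : ℝ}
    (hθ : 0 < θ) (hθr : ENNReal.ofReal θ ≤ r) {K : Set (Fin n → ℝ)} (hK : IsCompact K) :
    ∫⁻ x in K, ‖f x‖ₑ ^ θ ≠ ∞ := by
  have : IsFiniteMeasure (volume.restrict K) := ⟨by
    rw [Measure.restrict_apply_univ]
    exact hK.measure_lt_top⟩
  have h := (hf K hK).mono_exponent hθr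
  have h1 := lintegral_rpow_enorm_lt_top_of_eLpNorm_lt_top (by simpa using hθ) ENNReal.ofReal_ne_top h.2
  rw [ENNReal.toReal_ofReal hθ.le] at h1
  exact h1.ne

/-- Every function of the space has a spline expansion with coefficients controlled by its
quasi-norm. -/
theorem exists_isSplineExpansion {p q θ α₁ α₂ : ℝ} (hp : 0 < p) (hq : 0 < q) (hθ : 0 < θ)
    {T : ℕ → (Fin n → ℤ) → ℝ≥0∞} (hT : IsDiscreteWeight p θ α₁ α₂ T) {r : ℝ≥0∞}
    (hθr : ENNReal.ofReal θ ≤ r) {t : ℕ → (Fin n → ℝ) → ℝ} (ht : ∀ k, Measurable (t k))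
    (hTt : ∀ k m, ∫⁻ x in hcube k m, ENNReal.ofReal (t k x) ^ p = T k m ^ p)
    {l : ℕ} (hl : 1 ≤ l) (hα₁ : 0 < α₁) :
    ∃ C : ℝ≥0∞, C ≠ ∞ ∧ ∀ f : (Fin n → ℝ) → ℝ, Measurable f → MemBesov l p q r t f →
      ∃ S b, IsSplineExpansion l f S b ∧ seqSum p q T b ≤ C * besovNorm l p q r t f ^ q := by
  -- The approximation theory needs an exponent at most 1, where |u + v|^θ₀ ≤ |u|^θ₀ + |v|^θ₀; the
  -- weight conditions pass to smaller exponents.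
  set θ₀ := min θ 1 with hθ₀
  have h0 : 0 < θ₀ := lt_min hθ one_pos
  have h01 : θ₀ ≤ 1 := min_le_right _ _
  have hT₀ := hT.mono_exponent h0 (min_le_left _ _)
  have hθr₀ : ENNReal.ofReal θ₀ ≤ r := (ENNReal.ofReal_le_ofReal (min_le_left _ _)).trans hθr
  have h0' : 0 < 1 / θ₀ := one_div_pos.2 h0
  obtain ⟨ω, hω⟩ := exists_quasiInterpolant hl
  obtain ⟨c, C₁, hC₁, hpoly⟩ := exists_local_polynomials n hl h0 h01
  obtain ⟨C₂, hC₂, hblock⟩ := exists_isBlock_quasiSpline n hl hω h0 h01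
  obtain ⟨C₃, hC₃, hInt⟩ := exists_lintegral_quasiSpline_sub_le n hl hω h0 h01
  obtain ⟨C₄, hC₄, hcell⟩ := exists_seqSum_cellMean_le hp hq l h0 hθr₀ ht hTt
  set a := l + l + 1 with ha
  set K : ℝ≥0∞ := C₁ ^ (1 / θ₀) * ((nbhd n c).card : ℝ≥0∞) ^ (1 / θ₀) * (nbhd n a).card with hK
  have hKt : K ≠ ∞ := by
    have a1 : C₁ ^ (1 / θ₀) ≠ ∞ := ENNReal.rpow_ne_top_of_nonneg h0'.le hC₁
    have a2 : ((nbhd n c).card : ℝ≥0∞) ^ (1 / θ₀) ≠ ∞ := ENNReal.rpow_ne_top_of_nonneg h0'.le (by simp)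
    finiteness
  obtain ⟨C₅, hC₅, hseq⟩ := exists_seqSum_shift_le hp hq hT (a + c) (K := C₂ * K) (by finiteness)
  refine ⟨C₅ * C₄, by finiteness, fun f hf hmem => ?_⟩
  obtain ⟨P, hP, hP0, hPle⟩ := hpoly f hf fun K hK => hmem.1.setLIntegral_ne_top h0 hθr₀ hK
  set δ : ℕ → (Fin n → ℤ) → ℝ≥0∞ := fun k m => cellMean l θ₀ f k m ^ (1 / θ₀) with hδ
  have hε : ∀ k m, ∑ e ∈ nbhd n a, localError θ₀ f (P k (m + e)) k (m + e) (3 * l + 2 : ℕ) ^ (1 / θ₀) ≤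
      K * ∑ e ∈ nbhd n (a + c), δ k (m + e) := fun k m =>
    sum_rpow_localError_le h0 (X := fun m => localError θ₀ f (P k m) k m (3 * l + 2 : ℕ)) (hPle k) a m
  have hδle : seqSum p q T δ ≤ C₄ * besovNorm l p q r t f ^ q := hcell f hf
  have hδt : seqSum p q T δ ≠ ∞ := ne_top_of_le_ne_top
    (ENNReal.mul_ne_top hC₄ (ENNReal.rpow_ne_top_of_nonneg hq.le hmem.2.ne)) hδle
  -- The increment from level k - 1 to k sees the errors of both levels, whence the term at the
  -- parent cube. At level 0 there is no increment, since S_0 = 0.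
  set b : ℕ → (Fin n → ℤ) → ℝ≥0∞ := fun k M => if k = 0 then 0 else
    C₂ * K * (∑ e ∈ nbhd n (a + c), δ k (M + e) +
      ∑ e ∈ nbhd n (a + c), δ (k - 1) (par 1 M + e)) with hb
  have hS : ∀ k, Continuous (quasiSpline ω P k) := fun k => continuous_splineSum hl k _
  refine ⟨quasiSpline ω P, b, ⟨?_, fun k => ⟨_, rfl⟩, fun k => ?_, fun g hg => ?_, fun hfc x => ?_⟩, ?_⟩
  · have : (fun m : Fin n → ℤ => splineCoeff ω 0 m (P 0 m)) = 0 := by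
      funext m
      simp [hP0, splineCoeff]
    unfold quasiSpline
    rw [this, splineSum_zero]
  · refine (hblock f hf P hP k).mono fun M => ?_
    simp only [hb, Nat.succ_ne_zero, if_false, Nat.add_sub_cancel]
    rw [mul_assoc C₂, mul_add K]
    exact mul_le_mul_right (add_le_add (hε _ _) (hε _ _)) _
  · refine ae_eq_of_tendsto_lintegral h0 (fun k => (hS k).measurable) hf ?_ hg
    set K' : ℝ≥0∞ := C₃ ^ (1 / θ₀) * ((nbhd n a).card : ℝ≥0∞) ^ (1 / θ₀) * K with hK'
    have hK't : K' ≠ ∞ := by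
      have a1 : C₃ ^ (1 / θ₀) ≠ ∞ := ENNReal.rpow_ne_top_of_nonneg h0'.le hC₃
      have a2 : ((nbhd n a).card : ℝ≥0∞) ^ (1 / θ₀) ≠ ∞ := ENNReal.rpow_ne_top_of_nonneg h0'.le (by simp)
      finiteness
    refine tendsto_lintegral_of_cell_bound hp hq h0 hT₀ hα₁ hδt (c := a + c) hK't fun k m => ?_
    refine (hInt f hf P hP k m).trans (mul_le_mul_right ?_ _)
    rw [← ENNReal.rpow_inv_le_iff h0, ENNReal.mul_rpow_of_nonneg _ _ (inv_pos.2 h0).le, ← one_div, hK',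
      mul_assoc, mul_assoc]
    refine mul_le_mul_right ((sum_rpow_le _ h0' _).trans (mul_le_mul_right (hε k m) _)) _
  · refine tendsto_quasiSpline hl hω h0 h01 hfc hP x fun e => ?_
    have hlim : Tendsto (fun k => C₁ * ∑ e' ∈ nbhd n c, cellModulus l θ₀ f k (idx k x + (e + e')))
        atTop (𝓝 0) := by
      have hs := tendsto_finsetSum (nbhd n c) fun e' _ => tendsto_cellModulus hl h0 h01 hfc x (e + e')
      rw [Finset.sum_const_zero] at hs
      have := ENNReal.Tendsto.const_mul hs (Or.inr hC₁)
      rwa [mul_zero] at this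
    refine tendsto_of_tendsto_of_tendsto_of_le_of_le' tendsto_const_nhds hlim
      (Eventually.of_forall fun _ => zero_le) ?_
    filter_upwards [eventually_ge_atTop 1] with k hk
    refine (hPle k _).trans (mul_le_mul_right (le_of_eq ?_) _)
    refine Finset.sum_congr rfl fun e' _ => ?_
    obtain ⟨k, rfl⟩ := Nat.exists_eq_add_of_le' hk
    rw [add_assoc]
    rfl
  · refine (hseq δ b ?_ fun k M => ?_).trans ?_
    · funext M
      simp [hb]
    · simp [hb]
    · rw [mul_assoc]
      exact mul_le_mul_right hδle _

/-! ## The quasi-norm -/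

/-- A common source for sums and scalar multiples. Unlike the finiteness of the quasi-norm, it has a
constant independent of the functions, as limits require. -/
lemma besovNorm_le_of_le (l : ℕ) {p q : ℝ} (hp : 0 < p) (hq : 0 < q) (r : ℝ≥0∞)
    {t : ℕ → (Fin n → ℝ) → ℝ} (ht : ∀ k, Measurable (t k)) {K : ℝ≥0∞} (hK : K ≠ ∞) :
    ∃ C : ℝ≥0∞, C ≠ ∞ ∧ ∀ φ ψ χ : (Fin n → ℝ) → ℝ, AEStronglyMeasurable φ volume →
      (∀ x s, delta l r x s χ ≤ K * (delta l r x s φ + delta l r x s ψ)) →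
      (∀ x, eLpNorm χ r (volume.restrict (cube x 2)) ≤
        K * (eLpNorm φ r (volume.restrict (cube x 2)) + eLpNorm ψ r (volume.restrict (cube x 2)))) →
      besovNorm l p q r t χ ≤ C * (besovNorm l p q r t φ + besovNorm l p q r t ψ) := by
  have hqp : 0 < q / p := div_pos hq hp
  have hp' : 0 ≤ 1 / p := (one_div_pos.2 hp).le
  have hq' : 0 ≤ 1 / q := (one_div_pos.2 hq).le
  set D := K ^ p * ENNReal.LpAddConst (ENNReal.ofReal p)⁻¹ with hD
  have hDt : D ≠ ∞ :=
    ENNReal.mul_ne_top (ENNReal.rpow_ne_top_of_nonneg hp.le hK) (ENNReal.LpAddConst_lt_top _).ne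
  set E := D ^ (q / p) * ENNReal.LpAddConst (ENNReal.ofReal (q / p))⁻¹ with hE
  have hEt : E ≠ ∞ :=
    ENNReal.mul_ne_top (ENNReal.rpow_ne_top_of_nonneg hqp.le hDt) (ENNReal.LpAddConst_lt_top _).ne
  set C₁ := E ^ (1 / q) * ENNReal.LpAddConst (ENNReal.ofReal (1 / q))⁻¹ with hC₁
  set C₂ := D ^ (1 / p) * ENNReal.LpAddConst (ENNReal.ofReal (1 / p))⁻¹ with hC₂
  have hC₁t : C₁ ≠ ∞ :=
    ENNReal.mul_ne_top (ENNReal.rpow_ne_top_of_nonneg hq' hEt) (ENNReal.LpAddConst_lt_top _).ne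
  have hC₂t : C₂ ≠ ∞ :=
    ENNReal.mul_ne_top (ENNReal.rpow_ne_top_of_nonneg hp' hDt) (ENNReal.LpAddConst_lt_top _).ne
  refine ⟨C₁ + C₂, by finiteness, fun φ ψ χ hφm hd he => ?_⟩
  have split : ∀ {u : ℝ} (_ : 0 ≤ u) {Z W X Y : ℝ≥0∞}, Z ≤ W * (X + Y) →
      Z ^ u ≤ W ^ u * ENNReal.LpAddConst (ENNReal.ofReal u)⁻¹ * (X ^ u + Y ^ u) := by
    intro u hu Z W X Y h
    refine (ENNReal.rpow_le_rpow h hu).trans ?_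
    rw [ENNReal.mul_rpow_of_nonneg _ _ hu, mul_assoc]
    exact mul_le_mul_right (ENNReal.rpow_add_le_mul_rpow_add_rpow' _ _ hu) _
  set Φ : ((Fin n → ℝ) → ℝ) → ℕ → ℝ≥0∞ := fun f k => (∫⁻ x, (ENNReal.ofReal (t (k + 1) x) *
      delta l r x (2 * (1 / 2) ^ (k + 1)) f) ^ p) ^ (q / p) with hΦ
  set Ψ : ((Fin n → ℝ) → ℝ) → ℝ≥0∞ := fun f => ∫⁻ x, (ENNReal.ofReal (t 0 x) *
      eLpNorm f r (volume.restrict (cube x 2))) ^ p with hΨ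
  have hk : ∀ k : ℕ, Φ χ k ≤ E * (Φ φ k + Φ ψ k) := by
    intro k
    refine split hqp.le (lintegral_add_rpow_le (μ := volume) hp hK
      (u := fun x => ENNReal.ofReal (t (k + 1) x) * delta l r x (2 * (1 / 2) ^ (k + 1)) φ)
      (v := fun x => ENNReal.ofReal (t (k + 1) x) * delta l r x (2 * (1 / 2) ^ (k + 1)) ψ)
      ((ht (k + 1)).ennreal_ofReal.mul (measurable_delta l r _ hφm)) (fun x => ?_))
    rw [← mul_add, mul_left_comm]
    exact mul_le_mul_right (hd x _) _
  have h1 : (∑' k, Φ χ k) ^ (1 / q) ≤ C₁ * ((∑' k, Φ φ k) ^ (1 / q) + (∑' k, Φ ψ k) ^ (1 / q)) := by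
    refine split hq' ((ENNReal.tsum_le_tsum hk).trans (le_of_eq ?_))
    rw [ENNReal.tsum_mul_left, ENNReal.tsum_add]
  have h2 : Ψ χ ^ (1 / p) ≤ C₂ * (Ψ φ ^ (1 / p) + Ψ ψ ^ (1 / p)) := by
    refine split hp' (lintegral_add_rpow_le (μ := volume) hp hK
      (u := fun x => ENNReal.ofReal (t 0 x) * eLpNorm φ r (volume.restrict (cube x 2)))
      (v := fun x => ENNReal.ofReal (t 0 x) * eLpNorm ψ r (volume.restrict (cube x 2)))
      ((ht 0).ennreal_ofReal.mul (measurable_localNorm r 2 hφm)) (fun x => ?_))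
    rw [← mul_add, mul_left_comm]
    exact mul_le_mul_right (he x) _
  change (∑' k, Φ χ k) ^ (1 / q) + Ψ χ ^ (1 / p) ≤ (C₁ + C₂) *
    (((∑' k, Φ φ k) ^ (1 / q) + Ψ φ ^ (1 / p)) + ((∑' k, Φ ψ k) ^ (1 / q) + Ψ ψ ^ (1 / p)))
  refine (add_le_add h1 h2).trans ?_
  rw [add_mul]
  refine add_le_add (mul_le_mul_right ?_ _) (mul_le_mul_right ?_ _)
  · exact add_le_add le_self_add le_self_add
  · exact add_le_add le_add_self le_add_self

lemma exists_besovNorm_add_le (l : ℕ) {p q : ℝ} (hp : 0 < p) (hq : 0 < q) (r : ℝ≥0∞)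
    {t : ℕ → (Fin n → ℝ) → ℝ} (ht : ∀ k, Measurable (t k)) :
    ∃ C : ℝ≥0∞, C ≠ ∞ ∧ ∀ φ ψ : (Fin n → ℝ) → ℝ, AEStronglyMeasurable φ volume →
      AEStronglyMeasurable ψ volume →
      besovNorm l p q r t (φ + ψ) ≤ C * (besovNorm l p q r t φ + besovNorm l p q r t ψ) := by
  obtain ⟨C, hC, h⟩ := besovNorm_le_of_le l hp hq r ht (ENNReal.LpAddConst_lt_top r).ne
  exact ⟨C, hC, fun φ ψ hφ hψ => h φ ψ _ hφ (fun x s => delta_add_le l r x s hφ hψ)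
    fun _ => eLpNorm_add_le' hφ.restrict hψ.restrict r⟩

lemma exists_besovNorm_smul_le (l : ℕ) {p q : ℝ} (hp : 0 < p) (hq : 0 < q) (r : ℝ≥0∞)
    {t : ℕ → (Fin n → ℝ) → ℝ} (ht : ∀ k, Measurable (t k)) (c : ℝ) :
    ∃ C : ℝ≥0∞, C ≠ ∞ ∧ ∀ φ : (Fin n → ℝ) → ℝ, AEStronglyMeasurable φ volume →
      besovNorm l p q r t (c • φ) ≤ C * besovNorm l p q r t φ := by
  obtain ⟨C, hC, h⟩ := besovNorm_le_of_le l hp hq r ht (K := ‖c‖ₑ) enorm_ne_top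
  refine ⟨C * 2, by finiteness, fun φ hφ => (h φ φ _ hφ (fun x s => ?_) fun x => ?_).trans (le_of_eq ?_)⟩
  · rw [delta_smul]
    gcongr
    exact le_self_add
  · rw [eLpNorm_const_smul]
    gcongr
    exact le_self_add
  · ring

lemma exists_besovNorm_sub_le (l : ℕ) {p q : ℝ} (hp : 0 < p) (hq : 0 < q) (r : ℝ≥0∞)
    {t : ℕ → (Fin n → ℝ) → ℝ} (ht : ∀ k, Measurable (t k)) :
    ∃ C : ℝ≥0∞, C ≠ ∞ ∧ ∀ φ ψ : (Fin n → ℝ) → ℝ, AEStronglyMeasurable φ volume →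
      AEStronglyMeasurable ψ volume →
      besovNorm l p q r t (φ - ψ) ≤ C * (besovNorm l p q r t φ + besovNorm l p q r t ψ) := by
  obtain ⟨C₁, hC₁, h1⟩ := exists_besovNorm_add_le l hp hq r ht
  obtain ⟨C₂, hC₂, h2⟩ := exists_besovNorm_smul_le l hp hq r ht (-1)
  refine ⟨C₁ * (1 + C₂), by finiteness, fun φ ψ hφ hψ => ?_⟩
  have h3 := h1 φ ((-1 : ℝ) • ψ) hφ (hψ.const_smul _)
  rw [neg_one_smul, ← sub_eq_add_neg] at h3
  refine h3.trans ?_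
  rw [mul_assoc]
  refine mul_le_mul_right ?_ _
  have h4 := h2 ψ hψ
  rw [neg_one_smul] at h4
  refine (add_le_add le_rfl h4).trans ?_
  rw [add_mul, one_mul, mul_add]
  exact add_le_add le_self_add le_add_self

lemma memBesov_sub {l : ℕ} {p q : ℝ} (hp : 0 < p) (hq : 0 < q) {r : ℝ≥0∞}
    {t : ℕ → (Fin n → ℝ) → ℝ} (ht : ∀ k, Measurable (t k)) {φ ψ : (Fin n → ℝ) → ℝ}
    (hφm : AEStronglyMeasurable φ volume) (hψm : AEStronglyMeasurable ψ volume)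
    (hφ : MemBesov l p q r t φ) (hψ : MemBesov l p q r t ψ) : MemBesov l p q r t (φ - ψ) := by
  have h := memBesov_add hp hq ht hφm (hψm.const_smul (-1 : ℝ)) hφ (memBesov_smul hp hq ht (-1) hψm hψ)
  rwa [neg_one_smul, ← sub_eq_add_neg] at h

/-! ## Convergence of sequences with small increments -/

/-- The increments of a sequence of functions. -/
def increment (S : ℕ → (Fin n → ℝ) → ℝ) : ℕ → (Fin n → ℝ) → ℝ
  | 0 => S 0
  | k + 1 => S (k + 1) - S k

lemma sum_increment (S : ℕ → (Fin n → ℝ) → ℝ) (K : ℕ) (x : Fin n → ℝ) :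
    ∑ j ∈ Finset.range (K + 1), increment S j x = S K x := by
  induction K with
  | zero => simp [increment]
  | succ K ih =>
    rw [Finset.sum_range_succ, ih]
    simp [increment]

/-- The part of the coefficients above the level `K`. -/
def tailCoeff (b : ℕ → (Fin n → ℤ) → ℝ≥0∞) (K : ℕ) : ℕ → (Fin n → ℤ) → ℝ≥0∞ :=
  fun k m => if k ≤ K then 0 else b k m

lemma tendsto_seqSum_tailCoeff {p q : ℝ} (hp : 0 < p) (hq : 0 < q) {T b : ℕ → (Fin n → ℤ) → ℝ≥0∞}
    (hb : seqSum p q T b ≠ ∞) : Tendsto (fun K => seqSum p q T (tailCoeff b K)) atTop (𝓝 0) := by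
  have hqp : 0 < q / p := div_pos hq hp
  set f : ℕ → ℝ≥0∞ := fun k => levelSum p T b k ^ (q / p) with hf
  have h1 : ∀ K, seqSum p q T (tailCoeff b K) = ∑' k, f (k + (K + 1)) := by
    intro K
    unfold seqSum
    rw [← ENNReal.summable.sum_add_tsum_nat_add' (k := K + 1)]
    have h2 : ∀ k ∈ Finset.range (K + 1), levelSum p T (tailCoeff b K) k ^ (q / p) = 0 := by
      intro k hk
      have : k ≤ K := Nat.lt_succ_iff.1 (Finset.mem_range.1 hk)
      simp [levelSum, tailCoeff, this, hp, hqp]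
    rw [Finset.sum_eq_zero h2, zero_add]
    refine tsum_congr fun k => ?_
    have : ¬ k + (K + 1) ≤ K := by omega
    simp only [levelSum, tailCoeff, this, if_false, hf]
  simp_rw [h1]
  have h2 := ENNReal.tendsto_sum_nat_add f hb
  exact h2.comp (tendsto_add_atTop_nat 1)

/-- The limit is the series of the increments. Blocks need smoothness l only, while the quasi-norm
may be of any order L ≥ l; this is how the order l' on the plane enters. -/
theorem exists_limit_of_blocks {p q θ α₁ α₂ : ℝ} (hp : 0 < p) (hq : 0 < q) (hθ : 0 < θ)
    {T : ℕ → (Fin n → ℤ) → ℝ≥0∞} (hT : IsDiscreteWeight p θ α₁ α₂ T) {r : ℝ≥0∞} (hr : r ≠ 0)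
    (hθr : ENNReal.ofReal θ ≤ r) {t : ℕ → (Fin n → ℝ) → ℝ} (ht : ∀ k, Measurable (t k))
    (hTt : ∀ k m, ∫⁻ x in hcube k m, ENNReal.ofReal (t k x) ^ p = T k m ^ p)
    {l L : ℕ} (hlL : l ≤ L) (hα₂ : α₂ < l) (hα₁ : n * (1 / θ - (r⁻¹).toReal) < α₁) :
    ∃ C : ℝ≥0∞, C ≠ ∞ ∧ ∀ (S : ℕ → (Fin n → ℝ) → ℝ) (b : ℕ → (Fin n → ℤ) → ℝ≥0∞),
      (∀ k, Measurable (S k)) → S 0 = 0 → (∀ k, IsBlock (k + 1) l (S (k + 1) - S k) (b (k + 1))) →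
      seqSum p q T b ≠ ∞ → ∃ g : (Fin n → ℝ) → ℝ, AEStronglyMeasurable g volume ∧
        (∀ᵐ x, Tendsto (fun k => S k x) atTop (𝓝 (g x))) ∧ MemBesov L p q r t g ∧
        besovNorm L p q r t g ≤ C * seqSum p q T b ^ (1 / q) ∧ (∀ K, MemBesov L p q r t (S K)) ∧
        Tendsto (fun K => besovNorm L p q r t (g - S K)) atTop (𝓝 0) := by
  obtain ⟨C, hC, h⟩ := besovNorm_series_le hp hq hθ hT hr hθr ht hTt hlL hα₂ hα₁
  have hq' : 0 < 1 / q := one_div_pos.2 hq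
  have base : ∀ (S : ℕ → (Fin n → ℝ) → ℝ) (b : ℕ → (Fin n → ℤ) → ℝ≥0∞),
      (∀ k, Measurable (S k)) → S 0 = 0 → (∀ k, IsBlock (k + 1) l (S (k + 1) - S k) (b (k + 1))) →
      seqSum p q T b ≠ ∞ → ∃ g : (Fin n → ℝ) → ℝ, AEStronglyMeasurable g volume ∧
        (∀ᵐ x, Tendsto (fun k => S k x) atTop (𝓝 (g x))) ∧ MemBesov L p q r t g ∧
        besovNorm L p q r t g ≤ C * seqSum p q T b ^ (1 / q) := by
    intro S b hS hS0 hblock hb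
    have hm : ∀ j, Measurable (increment S j) := by
      rintro (_ | j)
      · exact hS 0
      · exact (hS _).sub (hS _)
    have hbl : ∀ j, IsBlock j l (increment S j) (b j) := by
      rintro (_ | j)
      · rw [increment, hS0]
        exact isBlock_zero 0 l _
      · exact hblock j
    obtain ⟨h1, h2, h3⟩ := h (increment S) b hm hbl hb
    have hlim : ∀ᵐ x, Tendsto (fun k => S k x) atTop (𝓝 (∑' j, increment S j x)) := by
      filter_upwards [h1] with x hx
      have hs : Summable fun j => increment S j x := by
        refine Summable.of_nnnorm ?_
        rw [← ENNReal.tsum_coe_ne_top_iff_summable]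
        exact hx.ne
      have h4 := hs.hasSum.tendsto_sum_nat.comp (tendsto_add_atTop_nat 1)
      refine h4.congr fun k => sum_increment S k x
    refine ⟨_, aestronglyMeasurable_of_tendsto_ae atTop (fun k => (hS k).aestronglyMeasurable) hlim, hlim,
      ⟨h2, h3.trans_lt ?_⟩, h3⟩
    exact ENNReal.mul_lt_top hC.lt_top (ENNReal.rpow_lt_top_of_nonneg hq'.le hb)
  refine ⟨C, hC, fun S b hS hS0 hblock hb => ?_⟩
  obtain ⟨g, hgm, hlim, hmem, hle⟩ := base S b hS hS0 hblock hb
  -- The same estimate for the sequence frozen up to level K, whose coefficients vanish up to K. It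
  -- converges to g - S_K, and its sequence sum is the tail of a convergent series.
  have tail : ∀ K, MemBesov L p q r t (g - S K) ∧
      besovNorm L p q r t (g - S K) ≤ C * seqSum p q T (tailCoeff b K) ^ (1 / q) := by
    intro K
    have hle' : seqSum p q T (tailCoeff b K) ≤ seqSum p q T b := by
      refine ENNReal.tsum_le_tsum fun k => ENNReal.rpow_le_rpow (ENNReal.tsum_le_tsum fun m =>
        ENNReal.rpow_le_rpow (mul_le_mul_left ?_ _) hp.le) (div_pos hq hp).le
      unfold tailCoeff
      split_ifs
      · exact zero_le
      · exact le_rfl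
    obtain ⟨g', hgm', hlim', hmem', hle''⟩ := base (fun k => S (max k K) - S K) (tailCoeff b K)
      (fun k => (hS _).sub (hS _)) (by simp) (fun k => by
        rw [sub_sub_sub_cancel_right]
        rcases Nat.lt_or_ge k K with hk | hk
        · rw [max_eq_right hk.le, max_eq_right hk, sub_self]
          exact isBlock_zero _ _ _
        · rw [max_eq_left hk, max_eq_left (by omega)]
          have : tailCoeff b K (k + 1) = b (k + 1) := by
            funext m
            unfold tailCoeff
            rw [if_neg (by omega)]
          rw [this]
          exact hblock k) (ne_top_of_le_ne_top hb hle')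
    have heq : g' =ᵐ[volume] g - S K := by
      filter_upwards [hlim, hlim'] with x hx hx'
      refine tendsto_nhds_unique hx' ((hx.sub_const (S K x)).congr' ?_)
      filter_upwards [eventually_ge_atTop K] with k hk
      rw [max_eq_left hk]
      rfl
    exact ⟨memBesov_congr heq hmem', (besovNorm_congr L p q r t heq) ▸ hle''⟩
  refine ⟨g, hgm, hlim, hmem, hle, fun K => ?_, ?_⟩
  · have h1 := memBesov_sub hp hq ht hgm (hgm.sub (hS K).aestronglyMeasurable) hmem (tail K).1
    rwa [sub_sub_cancel] at h1
  · refine tendsto_of_tendsto_of_tendsto_of_le_of_le tendsto_const_nhds ?_ (fun _ => zero_le)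
      fun K => (tail K).2
    have h1 := (ENNReal.continuous_rpow_const (y := 1 / q)).tendsto (0 : ℝ≥0∞) |>.comp
      (tendsto_seqSum_tailCoeff hp hq hb)
    rw [ENNReal.zero_rpow_of_pos hq'] at h1
    have h2 := ENNReal.Tendsto.const_mul h1 (Or.inr hC)
    rwa [mul_zero] at h2

variable {a b : ℕ}

/-! ## Restriction to the plane -/

/-- The restriction of a function to the plane `{(x, 0)}`. -/
def planeRestrict (f : (Fin (a + b) → ℝ) → ℝ) : (Fin a → ℝ) → ℝ :=
  fun x => f (Fin.append x (0 : Fin b → ℝ))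

lemma append_zero_add_smul (x h : Fin a → ℝ) (c : ℝ) :
    Fin.append (x + c • h) (0 : Fin b → ℝ) =
      Fin.append x (0 : Fin b → ℝ) + c • Fin.append h (0 : Fin b → ℝ) := by
  funext i
  refine Fin.addCases (fun i => ?_) (fun i => ?_) i <;> simp

lemma norm_append_zero_le (h : Fin a → ℝ) : ‖Fin.append h (0 : Fin b → ℝ)‖ ≤ ‖h‖ := by
  rw [pi_norm_le_iff_of_nonneg (norm_nonneg _)]
  intro i
  refine Fin.addCases (fun i => ?_) (fun i => ?_) i
  · rw [Fin.append_left]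
    exact norm_le_pi_norm h i
  · simp

lemma idx_append_zero (k : ℕ) (x : Fin a → ℝ) :
    idx k (Fin.append x (0 : Fin b → ℝ)) = Fin.append (idx k x) (0 : Fin b → ℤ) := by
  funext i
  refine Fin.addCases (fun i => ?_) (fun i => ?_) i <;> simp [idx]

lemma par_append_zero (d : ℕ) (m : Fin a → ℤ) :
    par d (Fin.append m (0 : Fin b → ℤ)) = Fin.append (par d m) (0 : Fin b → ℤ) := by
  funext i
  refine Fin.addCases (fun i => ?_) (fun i => ?_) i <;> simp [par]

lemma append_zero_injective : Function.Injective fun m : Fin a → ℤ => Fin.append m (0 : Fin b → ℤ) :=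
  fun m m' h => funext fun i => by
    have := congrFun h (Fin.castAdd b i)
    simpa using this

lemma diff_planeRestrict (l : ℕ) (f : (Fin (a + b) → ℝ) → ℝ) (h x : Fin a → ℝ) :
    diff l h (planeRestrict f) x = diff l (Fin.append h (0 : Fin b → ℝ)) f (Fin.append x (0 : Fin b → ℝ)) := by
  unfold diff planeRestrict
  exact Finset.sum_congr rfl fun j _ => by rw [append_zero_add_smul]

/-- Appending zeros does not increase the length of a step and sends the cube m of the plane to the
cube (m, 0), so a block restricts with its own coefficients. -/
lemma IsBlock.planeRestrict {k l : ℕ} {φ : (Fin (a + b) → ℝ) → ℝ} {β : (Fin (a + b) → ℤ) → ℝ≥0∞}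
    (hφ : IsBlock k l φ β) :
    IsBlock k l (planeRestrict φ) fun m => β (Fin.append m (0 : Fin b → ℤ)) := by
  intro x h i hi hh
  rw [diff_planeRestrict]
  have h1 := hφ (Fin.append x 0) (Fin.append h 0) i hi ((norm_append_zero_le h).trans hh)
  rw [idx_append_zero] at h1
  refine h1.trans (mul_le_mul_right (pow_le_pow_left' (ENNReal.ofReal_le_ofReal ?_) i) _)
  gcongr
  exact norm_append_zero_le h

/-- Restriction keeps only the terms with index (m, 0); the others are dropped. -/
lemma seqSum_planeRestrict_le {p q : ℝ} (hp : 0 < p) (hq : 0 < q)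
    (T β : ℕ → (Fin (a + b) → ℤ) → ℝ≥0∞) :
    seqSum p q (fun k m => T k (Fin.append m (0 : Fin b → ℤ)))
      (fun k (m : Fin a → ℤ) => β k (Fin.append m (0 : Fin b → ℤ))) ≤ seqSum p q T β :=
  ENNReal.tsum_le_tsum fun k => ENNReal.rpow_le_rpow
    (ENNReal.tsum_comp_le_tsum_of_injective append_zero_injective fun m => (β k m * T k m) ^ p)
    (div_pos hq hp).le

lemma continuous_planeRestrict {f : (Fin (a + b) → ℝ) → ℝ} (hf : Continuous f) :
    Continuous (planeRestrict f) := by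
  refine hf.comp (continuous_pi fun i => ?_)
  refine Fin.addCases (fun i => ?_) (fun i => ?_) i
  · simp only [Fin.append_left]
    exact continuous_apply i
  · simp only [Fin.append_right]
    exact continuous_const

/-! ## The weights on the plane -/

lemma setLIntegral_planeWeight {p : ℝ} (hp : 0 < p) (t : ℕ → (Fin (a + b) → ℝ) → ℝ) (k : ℕ)
    (m : Fin a → ℤ) :
    ∫⁻ x in hcube k m, ENNReal.ofReal (planeWeight p t k x) ^ p =
      ENNReal.ofReal (assocSeq p t k (Fin.append m (0 : Fin b → ℤ))) ^ p := by
  have h1 : ∀ x : Fin a → ℝ, ENNReal.ofReal (planeWeight p t k x) ^ p =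
      2 ^ (k * a) * ENNReal.ofReal (assocSeq p t k (Fin.append (idx k x) (0 : Fin b → ℤ))) ^ p := by
    intro x
    have h2 : planeWeight p t k x =
      (2 : ℝ) ^ ((k : ℝ) * a / p) * assocSeq p t k (Fin.append (idx k x) (0 : Fin b → ℤ)) := rfl
    have h3 := enorm_stepCoeff (n := a) (p := p) k (assocSeq p t k (Fin.append (idx k x) (0 : Fin b → ℤ)))
    have h4 : 0 ≤ assocSeq p t k (Fin.append (idx k x) (0 : Fin b → ℤ)) := ENNReal.toReal_nonneg
    have h5 : 0 ≤ planeWeight p t k x := h2 ▸ mul_nonneg (by positivity) h4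
    rw [← h2, Real.enorm_eq_ofReal h5, Real.enorm_eq_ofReal h4] at h3
    rw [h3, ENNReal.mul_rpow_of_nonneg _ _ hp.le, normFactor_rpow hp]
  simp_rw [h1]
  rw [setLIntegral_idx k m fun m =>
    2 ^ (k * a) * ENNReal.ofReal (assocSeq p t k (Fin.append m (0 : Fin b → ℤ))) ^ p, ← mul_assoc,
    ENNReal.inv_mul_cancel (by simp) (by simp), one_mul]

/-- The lower and neighbour conditions come from the class of the plane weight. The upper condition
is inherited from the full weight with its own exponent α₂: the descendants of (m, 0) that meet the
plane in the same way, with index (M, 0), are among all descendants of (m, 0). Hence smoothness l >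
α₂ also suffices on the plane. -/
lemma isDiscreteWeight_plane {p θ' α₁ α₂ α₃ α₁' α₂' α₃' : ℝ} {σ : ℝ≥0∞} (hp : 0 < p) (hθ' : 0 < θ')
    (hθp' : θ' ≤ p) {t : ℕ → (Fin (a + b) → ℝ) → ℝ} (ht : MemX p α₁ α₂ α₃ σ (ENNReal.ofReal p) t)
    (ht' : MemX p α₁' α₂' α₃' (sigmaExp p θ') (ENNReal.ofReal p) (planeWeight (a := a) (b := b) p t)) :
    IsDiscreteWeight p θ' α₁' α₂
      fun k (m : Fin a → ℤ) => ENNReal.ofReal (assocSeq p t k (Fin.append m (0 : Fin b → ℤ))) := by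
  have heq : (fun k (m : Fin a → ℤ) => ENNReal.ofReal (assocSeq p (planeWeight (a := a) (b := b) p t) k m)) =
      fun k (m : Fin a → ℤ) => ENNReal.ofReal (assocSeq p t k (Fin.append m (0 : Fin b → ℤ))) := by
    funext k m
    have h := (IsAdmissible.setLIntegral_rpow hp ht'.admissible k m).symm.trans
      (setLIntegral_planeWeight hp t k m)
    exact ENNReal.rpow_left_injective hp.ne' h
  have h := ht'.isDiscreteWeight hp hθ' hθp'
  rw [heq] at h
  refine ⟨h.ne_zero, h.ne_top, h.neighbour, ?_, h.lower⟩
  obtain ⟨C, hC, hU⟩ := ht.upper_discrete hp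
  refine ⟨C, hC, fun k d m => le_trans ?_ (hU k d (Fin.append m (0 : Fin b → ℤ)))⟩
  refine le_trans (le_of_eq ?_) (ENNReal.tsum_comp_le_tsum_of_injective append_zero_injective _)
  refine tsum_congr fun M => ?_
  rw [par_append_zero]
  have : Fin.append (par d M) (0 : Fin b → ℤ) = Fin.append m (0 : Fin b → ℤ) ↔ par d M = m :=
    append_zero_injective.eq_iff
  simp only [this]

/-! ## Extension of blocks from the plane -/

/-- The projection to the plane. -/
def planePart {α : Type*} (x : Fin (a + b) → α) : Fin a → α := fun i => x (Fin.castAdd b i)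

/-- The projection to the orthogonal complement of the plane. -/
def normalPart {α : Type*} (x : Fin (a + b) → α) : Fin b → α := fun i => x (Fin.natAdd a i)

/-- The product of a function on the plane and a compactly supported spline in the normal variables. -/
def extendBlock (l k : ℕ) (φ : (Fin a → ℝ) → ℝ) (x : Fin (a + b) → ℝ) : ℝ :=
  φ (planePart x) * ((bspline l 1 ^ b)⁻¹ * tensorSpline l k (fun _ : Fin b => (-1 : ℤ)) (normalPart x))

/-- The shift by -1 makes every normal factor take the value at 1 on the plane, which is nonzero,
and the prefactor divides it out at every scale. -/
lemma planeRestrict_extendBlock {l : ℕ} (hl : 1 ≤ l) (k : ℕ) (φ : (Fin a → ℝ) → ℝ) :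
    planeRestrict (b := b) (extendBlock l k φ) = φ := by
  funext x
  have h1 : planePart (Fin.append x (0 : Fin b → ℝ)) = x := funext fun i => by simp [planePart]
  have h2 : normalPart (Fin.append x (0 : Fin b → ℝ)) = 0 := funext fun i => by simp [normalPart]
  have h3 : tensorSpline l k (fun _ : Fin b => (-1 : ℤ)) 0 = bspline l 1 ^ b := by
    rw [tensorSpline_eq]
    simp
  unfold planeRestrict extendBlock
  rw [h1, h2, h3, inv_mul_cancel₀ (pow_ne_zero _ (bspline_at_one_ne_zero hl)), mul_one]

lemma continuous_extendBlock (l k : ℕ) {φ : (Fin a → ℝ) → ℝ} (hφ : Continuous φ) :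
    Continuous (extendBlock (b := b) l k φ) := by
  have h1 : Continuous (planePart : (Fin (a + b) → ℝ) → Fin a → ℝ) :=
    continuous_pi fun i => continuous_apply _
  have h2 : Continuous (normalPart : (Fin (a + b) → ℝ) → Fin b → ℝ) :=
    continuous_pi fun i => continuous_apply _
  exact (hφ.comp h1).mul (continuous_const.mul ((continuous_tensorSpline l k _).comp h2))

lemma diff_comp_planePart (i : ℕ) (φ : (Fin a → ℝ) → ℝ) (h x : Fin (a + b) → ℝ) :
    diff i h (fun y => φ (planePart y)) x = diff i (planePart h) φ (planePart x) := rfl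

lemma diff_comp_normalPart (i : ℕ) (φ : (Fin b → ℝ) → ℝ) (h x : Fin (a + b) → ℝ) :
    diff i h (fun y => φ (normalPart y)) x = diff i (normalPart h) φ (normalPart x) := rfl

lemma norm_planePart_le (h : Fin (a + b) → ℝ) : ‖planePart h‖ ≤ ‖h‖ := by
  rw [pi_norm_le_iff_of_nonneg (norm_nonneg _)]
  exact fun i => norm_le_pi_norm h _

lemma norm_normalPart_le (h : Fin (a + b) → ℝ) : ‖normalPart h‖ ≤ ‖h‖ := by
  rw [pi_norm_le_iff_of_nonneg (norm_nonneg _)]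
  exact fun i => norm_le_pi_norm h _

-- The product rule for differences gives the bound near the plane. Far from it all points x + jh
-- with j ≤ l miss the support of the bump: they move the index by at most l + 1, and the bump
-- reaches l cubes from -1, so indices beyond 2 l + 2 are safe.
open Classical in
lemma exists_isBlock_extendBlock (a b : ℕ) {l : ℕ} (hl : 1 ≤ l) :
    ∃ C : ℝ≥0∞, C ≠ ∞ ∧ ∀ (k : ℕ) (φ : (Fin a → ℝ) → ℝ) (β : (Fin a → ℤ) → ℝ≥0∞), IsBlock k l φ β →
      IsBlock k l (extendBlock (b := b) l k φ) fun m =>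
        if normalPart m ∈ nbhd b (2 * l + 2) then C * β (planePart m) else 0 := by
  obtain ⟨C, hC, hspl⟩ := exists_enorm_diff_tensorSpline_le b hl
  set κ : ℝ := (bspline l 1 ^ b)⁻¹ with hκ
  refine ⟨3 ^ l * (‖κ‖ₑ * C), by finiteness, fun k φ β hφ x h i hi hh => ?_⟩
  have h20 : (0 : ℝ) < 2 ^ k := by positivity
  set s := ENNReal.ofReal (2 ^ k * ‖h‖) with hs
  have hs1 : s ≤ 1 := by
    rw [hs, ← ENNReal.ofReal_one]
    refine ENNReal.ofReal_le_ofReal ?_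
    calc (2 : ℝ) ^ k * ‖h‖ ≤ 2 ^ k * (2 ^ k)⁻¹ := by gcongr
      _ = 1 := mul_inv_cancel₀ h20.ne'
  have hmono : ∀ {d : ℕ} (v : Fin d → ℝ), ‖v‖ ≤ ‖h‖ → ∀ j : ℕ, ENNReal.ofReal (2 ^ k * ‖v‖) ^ j ≤ s ^ j := by
    intro d v hv j
    refine pow_le_pow_left' (ENNReal.ofReal_le_ofReal ?_) j
    gcongr
  beta_reduce
  split_ifs with hmem
  · have h1 := enorm_diff_mul_le hs1 h x i (fun y => φ (planePart y))
      (fun y => κ * tensorSpline l k (fun _ : Fin b => (-1 : ℤ)) (normalPart y)) (β (planePart (idx k x)))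
      (‖κ‖ₑ * C) (fun j hj => by
        rw [diff_comp_planePart]
        exact (hφ _ _ j (hj.trans hi) ((norm_planePart_le h).trans hh)).trans
          (mul_le_mul_right (hmono _ (norm_planePart_le h) j) _))
      (fun j hj => by
        have h2 := congrFun (diff_const_smul j h κ
          fun y : Fin (a + b) → ℝ => tensorSpline l k (fun _ : Fin b => (-1 : ℤ)) (normalPart y)) x
        rw [Pi.smul_apply, diff_comp_normalPart, smul_eq_mul] at h2
        change ‖diff j h (κ • fun y : Fin (a + b) → ℝ =>
          tensorSpline l k (fun _ : Fin b => (-1 : ℤ)) (normalPart y)) x‖ₑ ≤ _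
        rw [h2, enorm_mul, mul_assoc]
        refine mul_le_mul_right ?_ _
        exact (hspl k _ _ _ j (hj.trans hi) ((norm_normalPart_le h).trans hh)).trans
          (mul_le_mul_right (hmono _ (norm_normalPart_le h) j) _))
    refine h1.trans (mul_le_mul_left ?_ _)
    calc 3 ^ i * (β (planePart (idx k x)) * (‖κ‖ₑ * C))
        ≤ 3 ^ l * (β (planePart (idx k x)) * (‖κ‖ₑ * C)) := by
          gcongr
          norm_num
      _ = _ := by ring
  · have hz : ∀ j ∈ Finset.range (i + 1), extendBlock (b := b) l k φ (x + (j : ℝ) • h) = 0 := by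
      intro j hj
      have hjl : (j : ℝ) ≤ l := by
        have := Finset.mem_range.1 hj
        exact_mod_cast (by omega : j ≤ l)
      have hidx : idx k (normalPart (x + (j : ℝ) • h)) - idx k (normalPart x) ∈ nbhd b (l + 1) := by
        refine idx_sub_mem_nbhd fun c => ?_
        have : normalPart (x + (j : ℝ) • h) c - normalPart x c = j * h (Fin.natAdd a c) := by
          simp [normalPart]
        rw [this, abs_mul, abs_of_nonneg (Nat.cast_nonneg j), div_eq_mul_inv]
        exact mul_le_mul hjl ((norm_le_pi_norm h _).trans hh) (abs_nonneg _) (by positivity)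
      have hzero : tensorSpline l k (fun _ : Fin b => (-1 : ℤ)) (normalPart (x + (j : ℝ) • h)) = 0 := by
        refine tensorSpline_eq_zero hl fun hcon => hmem ?_
        rw [mem_nbhd] at hcon hidx ⊢
        intro c
        have h1 := abs_le.1 (hcon c)
        have h2 := abs_le.1 (hidx c)
        have h3 : normalPart (idx k x) c = idx k (normalPart x) c := rfl
        rw [Pi.sub_apply] at h1 h2
        rw [h3, abs_le]
        push_cast at h1 h2 ⊢
        constructor <;> linarith [h1.1, h1.2, h2.1, h2.2]
      unfold extendBlock
      rw [hzero]
      simp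
    have : diff i h (extendBlock (b := b) l k φ) x = 0 := by
      unfold diff
      exact Finset.sum_eq_zero fun j hj => by rw [hz j hj, mul_zero]
    rw [this]
    simp

-- For each m' only boundedly many normal indices occur, and there the weight is comparable with
-- that of (m', 0) by the neighbour condition.
open Classical in
lemma exists_seqSum_extendBlock_le {p q θ α₁ α₂ : ℝ} (hp : 0 < p) (hq : 0 < q)
    {T : ℕ → (Fin (a + b) → ℤ) → ℝ≥0∞} (hT : IsDiscreteWeight p θ α₁ α₂ T) (c : ℕ) {K : ℝ≥0∞} (hK : K ≠ ∞) :
    ∃ C : ℝ≥0∞, C ≠ ∞ ∧ ∀ β : ℕ → (Fin a → ℤ) → ℝ≥0∞,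
      seqSum p q T (fun k m => if normalPart m ∈ nbhd b c then K * β k (planePart m) else 0) ≤
        C * seqSum p q (fun k m => T k (Fin.append m (0 : Fin b → ℤ))) β := by
  obtain ⟨C, hC, hN⟩ := hT.neighbour_iterate c
  have hqp : 0 < q / p := div_pos hq hp
  set D : ℝ≥0∞ := (nbhd b c).card * (K * C) ^ p with hD
  have hDt : D ≠ ∞ := ENNReal.mul_ne_top (by simp) (ENNReal.rpow_ne_top_of_nonneg hp.le (by finiteness))
  refine ⟨D ^ (q / p), ENNReal.rpow_ne_top_of_nonneg hqp.le hDt, fun β => ?_⟩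
  unfold seqSum
  rw [← ENNReal.tsum_mul_left]
  refine ENNReal.tsum_le_tsum fun k => ?_
  rw [← ENNReal.mul_rpow_of_nonneg _ _ hqp.le]
  refine ENNReal.rpow_le_rpow ?_ hqp.le
  unfold levelSum
  rw [← (Fin.appendEquiv a b).tsum_eq, ENNReal.summable.tsum_prod' fun _ => ENNReal.summable, ← ENNReal.tsum_mul_left]
  refine ENNReal.tsum_le_tsum fun m' => ?_
  have h1 : ∀ m'' : Fin b → ℤ, (fun m : Fin (a + b) → ℤ =>
      ((if normalPart m ∈ nbhd b c then K * β k (planePart m) else 0) * T k m) ^ p)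
      (Fin.appendEquiv a b (m', m'')) ≤ if m'' ∈ nbhd b c then
        (K * C) ^ p * (β k m' * T k (Fin.append m' (0 : Fin b → ℤ))) ^ p else 0 := by
    intro m''
    have e0 : Fin.appendEquiv a b (m', m'') = Fin.append m' m'' := rfl
    have e1 : normalPart (Fin.append m' m'') = m'' := funext fun i => by simp [normalPart]
    have e2 : planePart (Fin.append m' m'') = m' := funext fun i => by simp [planePart]
    beta_reduce
    rw [e0, e1, e2]
    split_ifs with hm
    · rw [← ENNReal.mul_rpow_of_nonneg _ _ hp.le]
      refine ENNReal.rpow_le_rpow ?_ hp.le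
      have h2 := hN k (Fin.append m' m'') (Fin.append m' (0 : Fin b → ℤ)) fun i => by
        refine Fin.addCases (fun i => ?_) (fun i => ?_) i
        · simp
        · simpa using mem_nbhd.1 hm i
      calc _ ≤ K * β k m' * (C * T k (Fin.append m' (0 : Fin b → ℤ))) := mul_le_mul_right h2 _
        _ = _ := by ring
    · simp [hp]
  refine (ENNReal.tsum_le_tsum h1).trans (le_of_eq ?_)
  rw [tsum_eq_sum (s := nbhd b c) fun m hm => if_neg hm,
    Finset.sum_congr rfl fun m hm => if_pos hm, Finset.sum_const, nsmul_eq_mul, hD, mul_assoc]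

/-! ## Consequences of the spline expansion -/

lemma IsSplineExpansion.continuous {l : ℕ} (hl : 1 ≤ l) {f : (Fin n → ℝ) → ℝ} {S : ℕ → (Fin n → ℝ) → ℝ}
    {b : ℕ → (Fin n → ℤ) → ℝ≥0∞} (h : IsSplineExpansion l f S b) (k : ℕ) : Continuous (S k) := by
  obtain ⟨β, hβ⟩ := h.spline k
  rw [hβ]
  exact continuous_splineSum hl k β

lemma rpow_one_div_le_of_le {q : ℝ} (hq : 0 < q) {X C N : ℝ≥0∞} (h : X ≤ C * N ^ q) :
    X ^ (1 / q) ≤ C ^ (1 / q) * N := by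
  have h1 := ENNReal.rpow_le_rpow h (one_div_pos.2 hq).le
  rwa [ENNReal.mul_rpow_of_nonneg _ _ (one_div_pos.2 hq).le, ← ENNReal.rpow_mul,
    mul_one_div_cancel hq.ne', ENNReal.rpow_one] at h1

/-- Zero quasi-norm makes all coefficients of the spline expansion vanish, so every spline is zero
and so is f. Without this, limits in the plane space, and hence traces, would not be unique as
classes of functions. -/
lemma ae_eq_zero_of_besovNorm_eq_zero {p q θ α₁ α₂ : ℝ} (hp : 0 < p) (hq : 0 < q) (hθ : 0 < θ)
    {T : ℕ → (Fin n → ℤ) → ℝ≥0∞} (hT : IsDiscreteWeight p θ α₁ α₂ T) {r : ℝ≥0∞}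
    (hθr : ENNReal.ofReal θ ≤ r) {t : ℕ → (Fin n → ℝ) → ℝ} (ht : ∀ k, Measurable (t k))
    (hTt : ∀ k m, ∫⁻ x in hcube k m, ENNReal.ofReal (t k x) ^ p = T k m ^ p)
    {l : ℕ} (hl : 1 ≤ l) (hα₁ : 0 < α₁) {f : (Fin n → ℝ) → ℝ} (hf : AEStronglyMeasurable f volume)
    (hmem : MemBesov l p q r t f) (h0 : besovNorm l p q r t f = 0) : f =ᵐ[volume] 0 := by
  obtain ⟨C, hC, h⟩ := exists_isSplineExpansion hp hq hθ hT hθr ht hTt hl hα₁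
  have hmk := hf.ae_eq_mk
  refine hmk.trans ?_
  obtain ⟨S, b, hS, hb⟩ := h (hf.mk f) hf.stronglyMeasurable_mk.measurable (memBesov_congr hmk hmem)
  rw [← besovNorm_congr l p q r t hmk, h0, ENNReal.zero_rpow_of_pos hq, mul_zero] at hb
  have hb0 : ∀ k m, b k m = 0 := by
    intro k m
    have h1 := ENNReal.tsum_eq_zero.1 (le_antisymm hb zero_le) k
    have h2 : levelSum p T b k = 0 := by
      rcases ENNReal.rpow_eq_zero_iff.1 h1 with h | h
      · exact h.1
      · exact absurd h.2 (not_lt.2 (div_pos hq hp).le)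
    have h3 := ENNReal.tsum_eq_zero.1 h2 m
    rcases ENNReal.rpow_eq_zero_iff.1 h3 with h | h
    · exact (mul_eq_zero.1 h.1).resolve_right (hT.ne_zero k m)
    · exact absurd h.2 (not_lt.2 hp.le)
  have hS0 : ∀ k x, S k x = 0 := by
    intro k x
    induction k with
    | zero => rw [hS.zero]; rfl
    | succ k ih =>
      have h1 := (hS.block k).enorm_le x
      rw [hb0, nonpos_iff_eq_zero, enorm_eq_zero, Pi.sub_apply, ih, sub_zero] at h1
      exact h1
  exact (hS.ae_eq 0 (Eventually.of_forall fun x => by simp [hS0])).symm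

lemma IsSpline.continuous {l : ℕ} (hl : 1 ≤ l) {S : (Fin n → ℝ) → ℝ} (hS : IsSpline l S) : Continuous S := by
  obtain ⟨k, β, h⟩ := hS
  have : S = splineSum l k β := funext h
  rw [this]
  exact continuous_splineSum hl k β

/-! ## Traces as limits of restrictions of continuous functions -/

/-- `φ` is a limit of continuous functions whose restrictions to the plane tend to `ψ`. -/
def IsLimitTrace (l l' : ℕ) (p q : ℝ) (r r' : ℝ≥0∞) (t : ℕ → (Fin (a + b) → ℝ) → ℝ)
    (φ : (Fin (a + b) → ℝ) → ℝ) (ψ : (Fin a → ℝ) → ℝ) : Prop :=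
  ∃ S : ℕ → (Fin (a + b) → ℝ) → ℝ, (∀ j, Continuous (S j) ∧ MemBesov l p q r t (S j)) ∧
    Tendsto (fun j => besovNorm l p q r t (φ - S j)) atTop (𝓝 0) ∧
    Tendsto (fun j => besovNorm l' p q r' (planeWeight p t) (ψ - planeRestrict (S j))) atTop (𝓝 0)

/-- Restriction to the plane is bounded on the continuous functions of the space. -/
def RestrictionBounded (a b l l' : ℕ) (p q : ℝ) (r r' : ℝ≥0∞) (t : ℕ → (Fin (a + b) → ℝ) → ℝ) : Prop :=
  ∃ C : ℝ≥0∞, C ≠ ∞ ∧ ∀ f : (Fin (a + b) → ℝ) → ℝ, Continuous f → MemBesov l p q r t f →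
    MemBesov l' p q r' (planeWeight (a := a) p t) (planeRestrict f) ∧
    besovNorm l' p q r' (planeWeight (a := a) p t) (planeRestrict f) ≤ C * besovNorm l p q r t f

lemma tendsto_zero_of_le_const_mul {x y : ℕ → ℝ≥0∞} {C : ℝ≥0∞} (hC : C ≠ ∞) (h : ∀ j, x j ≤ C * y j)
    (hy : Tendsto y atTop (𝓝 0)) : Tendsto x atTop (𝓝 0) := by
  refine tendsto_of_tendsto_of_tendsto_of_le_of_le tendsto_const_nhds ?_ (fun _ => zero_le) h
  have := ENNReal.Tendsto.const_mul hy (Or.inr hC)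
  rwa [mul_zero] at this

lemma tendsto_add_zero {x y : ℕ → ℝ≥0∞} (hx : Tendsto x atTop (𝓝 0)) (hy : Tendsto y atTop (𝓝 0)) :
    Tendsto (fun j => x j + y j) atTop (𝓝 0) := by
  have := hx.add hy
  rwa [add_zero] at this

section
variable {l l' : ℕ} {p q : ℝ} {r r' : ℝ≥0∞} {t : ℕ → (Fin (a + b) → ℝ) → ℝ}

/-- If S_j and W_j both converge to φ, then S_j - W_j tends to 0, and bounded restriction carries
this to the plane. Continuous functions are used instead of splines because the approximants of an
extension are products of splines of different orders. -/
lemma IsLimitTrace.tendsto (hp : 0 < p) (hq : 0 < q) (ht : ∀ k, Measurable (t k))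
    (hR : RestrictionBounded a b l l' p q r r' t)
    {φ : (Fin (a + b) → ℝ) → ℝ} {ψ : (Fin a → ℝ) → ℝ} (hφ : AEStronglyMeasurable φ volume)
    (hψ : AEStronglyMeasurable ψ volume) (h : IsLimitTrace l l' p q r r' t φ ψ)
    {W : ℕ → (Fin (a + b) → ℝ) → ℝ} (hW : ∀ j, Continuous (W j) ∧ MemBesov l p q r t (W j))
    (hlim : Tendsto (fun j => besovNorm l p q r t (φ - W j)) atTop (𝓝 0)) :
    Tendsto (fun j => besovNorm l' p q r' (planeWeight p t) (ψ - planeRestrict (W j))) atTop (𝓝 0) := by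
  obtain ⟨S, hS, h1, h2⟩ := h
  obtain ⟨C, hC, hR⟩ := hR
  obtain ⟨C₁, hC₁, hsub⟩ := exists_besovNorm_sub_le l hp hq r ht
  obtain ⟨C₂, hC₂, hadd⟩ := exists_besovNorm_add_le l' hp hq r' (measurable_planeWeight (a := a) p t)
  have hSm : ∀ j, AEStronglyMeasurable (S j) volume := fun j => (hS j).1.aestronglyMeasurable
  have hWm : ∀ j, AEStronglyMeasurable (W j) volume := fun j => (hW j).1.aestronglyMeasurable
  have h3 : Tendsto (fun j => besovNorm l p q r t (S j - W j)) atTop (𝓝 0) := by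
    refine tendsto_zero_of_le_const_mul hC₁ (fun j => ?_) (tendsto_add_zero hlim h1)
    have := hsub (φ - W j) (φ - S j) (hφ.sub (hWm j)) (hφ.sub (hSm j))
    rwa [sub_sub_sub_cancel_left] at this
  have h4 : Tendsto (fun j => besovNorm l' p q r' (planeWeight p t) (planeRestrict (S j - W j))) atTop (𝓝 0) :=
    tendsto_zero_of_le_const_mul hC (fun j => (hR _ ((hS j).1.sub (hW j).1)
      (memBesov_sub hp hq ht (hSm j) (hWm j) (hS j).2 (hW j).2)).2) h3
  refine tendsto_zero_of_le_const_mul hC₂ (fun j => ?_) (tendsto_add_zero h2 h4)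
  have h5 := hadd (ψ - planeRestrict (S j)) (planeRestrict (S j - W j))
    (hψ.sub (continuous_planeRestrict (hS j).1).aestronglyMeasurable)
    (continuous_planeRestrict ((hS j).1.sub (hW j).1)).aestronglyMeasurable
  have h6 : ψ - planeRestrict (S j) + planeRestrict (S j - W j) = ψ - planeRestrict (W j) := by
    funext x
    simp [planeRestrict]
  rwa [h6] at h5

lemma IsLimitTrace.ae_eq (hp : 0 < p) (hq : 0 < q) (ht : ∀ k, Measurable (t k))
    (hR : RestrictionBounded a b l l' p q r r' t)
    (hzero : ∀ f : (Fin a → ℝ) → ℝ, AEStronglyMeasurable f volume →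
      MemBesov l' p q r' (planeWeight p t) f → besovNorm l' p q r' (planeWeight p t) f = 0 → f =ᵐ[volume] 0)
    {φ : (Fin (a + b) → ℝ) → ℝ} {ψ ψ' : (Fin a → ℝ) → ℝ} (hφ : AEStronglyMeasurable φ volume)
    (hψ : AEStronglyMeasurable ψ volume) (hψ' : AEStronglyMeasurable ψ' volume)
    (hm : MemBesov l' p q r' (planeWeight p t) ψ) (hm' : MemBesov l' p q r' (planeWeight p t) ψ')
    (h : IsLimitTrace l l' p q r r' t φ ψ) (h' : IsLimitTrace l l' p q r r' t φ ψ') : ψ =ᵐ[volume] ψ' := by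
  obtain ⟨C, hC, hsub⟩ := exists_besovNorm_sub_le l' hp hq r' (measurable_planeWeight (a := a) p t)
  obtain ⟨S, hS, h1, h2⟩ := h
  have h3 := h'.tendsto hp hq ht hR hφ hψ' hS h1
  have h4 : Tendsto (fun _ : ℕ => besovNorm l' p q r' (planeWeight p t) (ψ - ψ')) atTop (𝓝 0) := by
    refine tendsto_zero_of_le_const_mul hC (fun j => ?_) (tendsto_add_zero h2 h3)
    have hRS := (continuous_planeRestrict (hS j).1).aestronglyMeasurable (μ := volume)
    have := hsub (ψ - planeRestrict (S j)) (ψ' - planeRestrict (S j)) (hψ.sub hRS) (hψ'.sub hRS)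
    rwa [sub_sub_sub_cancel_right] at this
  have h5 := hzero (ψ - ψ') (hψ.sub hψ') (memBesov_sub hp hq (measurable_planeWeight p t) hψ hψ' hm hm')
    (tendsto_nhds_unique tendsto_const_nhds h4)
  filter_upwards [h5] with x hx
  exact sub_eq_zero.1 hx

lemma IsLimitTrace.congr {φ φ' : (Fin (a + b) → ℝ) → ℝ} {ψ ψ' : (Fin a → ℝ) → ℝ} (hφ : φ =ᵐ[volume] φ')
    (hψ : ψ =ᵐ[volume] ψ') (h : IsLimitTrace l l' p q r r' t φ ψ) : IsLimitTrace l l' p q r r' t φ' ψ' := by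
  obtain ⟨S, hS, h1, h2⟩ := h
  refine ⟨S, hS, h1.congr fun j => ?_, h2.congr fun j => ?_⟩
  · exact besovNorm_congr l p q r t (hφ.sub (ae_eq_refl _))
  · exact besovNorm_congr l' p q r' _ (hψ.sub (ae_eq_refl _))

lemma IsLimitTrace.add (hp : 0 < p) (hq : 0 < q) (ht : ∀ k, Measurable (t k))
    {φ φ' : (Fin (a + b) → ℝ) → ℝ} {ψ ψ' : (Fin a → ℝ) → ℝ} (hφ : AEStronglyMeasurable φ volume)
    (hφ' : AEStronglyMeasurable φ' volume) (hψ : AEStronglyMeasurable ψ volume)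
    (hψ' : AEStronglyMeasurable ψ' volume)
    (h : IsLimitTrace l l' p q r r' t φ ψ) (h' : IsLimitTrace l l' p q r r' t φ' ψ') :
    IsLimitTrace l l' p q r r' t (φ + φ') (ψ + ψ') := by
  obtain ⟨S, hS, h1, h2⟩ := h
  obtain ⟨S', hS', h1', h2'⟩ := h'
  obtain ⟨C, hC, hadd⟩ := exists_besovNorm_add_le l hp hq r ht
  obtain ⟨C', hC', hadd'⟩ := exists_besovNorm_add_le l' hp hq r' (measurable_planeWeight (a := a) p t)
  have hSm : ∀ j, AEStronglyMeasurable (S j) volume := fun j => (hS j).1.aestronglyMeasurable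
  have hSm' : ∀ j, AEStronglyMeasurable (S' j) volume := fun j => (hS' j).1.aestronglyMeasurable
  refine ⟨fun j => S j + S' j, fun j => ⟨(hS j).1.add (hS' j).1,
    memBesov_add hp hq ht (hSm j) (hSm' j) (hS j).2 (hS' j).2⟩, ?_, ?_⟩
  · refine tendsto_zero_of_le_const_mul hC (fun j => ?_) (tendsto_add_zero h1 h1')
    have := hadd (φ - S j) (φ' - S' j) (hφ.sub (hSm j)) (hφ'.sub (hSm' j))
    rwa [sub_add_sub_comm] at this
  · refine tendsto_zero_of_le_const_mul hC' (fun j => ?_) (tendsto_add_zero h2 h2')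
    have := hadd' (ψ - planeRestrict (S j)) (ψ' - planeRestrict (S' j))
      (hψ.sub (continuous_planeRestrict (hS j).1).aestronglyMeasurable)
      (hψ'.sub (continuous_planeRestrict (hS' j).1).aestronglyMeasurable)
    rwa [sub_add_sub_comm] at this

lemma IsLimitTrace.smul (hp : 0 < p) (hq : 0 < q) (ht : ∀ k, Measurable (t k)) (c : ℝ)
    {φ : (Fin (a + b) → ℝ) → ℝ} {ψ : (Fin a → ℝ) → ℝ} (hφ : AEStronglyMeasurable φ volume)
    (hψ : AEStronglyMeasurable ψ volume) (h : IsLimitTrace l l' p q r r' t φ ψ) :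
    IsLimitTrace l l' p q r r' t (c • φ) (c • ψ) := by
  obtain ⟨S, hS, h1, h2⟩ := h
  obtain ⟨C, hC, hsmul⟩ := exists_besovNorm_smul_le l hp hq r ht c
  obtain ⟨C', hC', hsmul'⟩ := exists_besovNorm_smul_le l' hp hq r' (measurable_planeWeight (a := a) p t) c
  have hSm : ∀ j, AEStronglyMeasurable (S j) volume := fun j => (hS j).1.aestronglyMeasurable
  refine ⟨fun j => c • S j, fun j => ⟨(hS j).1.const_smul c,
    memBesov_smul hp hq ht c (hSm j) (hS j).2⟩, ?_, ?_⟩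
  · refine tendsto_zero_of_le_const_mul hC (fun j => ?_) h1
    have := hsmul (φ - S j) (hφ.sub (hSm j))
    rwa [smul_sub] at this
  · refine tendsto_zero_of_le_const_mul hC' (fun j => ?_) h2
    have := hsmul' (ψ - planeRestrict (S j))
      (hψ.sub (continuous_planeRestrict (hS j).1).aestronglyMeasurable)
    rwa [smul_sub] at this

/-- The formal part of the trace theorem: bounded restriction of continuous functions,
existence of traces and of extensions give the trace operator and its right inverse. -/
theorem exists_trace_and_extension (hp : 0 < p) (hq : 0 < q) (hl : 1 ≤ l) (ht : ∀ k, Measurable (t k))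
    (hR : RestrictionBounded a b l l' p q r r' t)
    (hzero : ∀ f : (Fin a → ℝ) → ℝ, AEStronglyMeasurable f volume →
      MemBesov l' p q r' (planeWeight p t) f → besovNorm l' p q r' (planeWeight p t) f = 0 → f =ᵐ[volume] 0)
    (htr : ∃ C : ℝ≥0∞, C ≠ ∞ ∧ ∀ φ : (Fin (a + b) → ℝ) → ℝ, Measurable φ → MemBesov l p q r t φ →
      ∃ ψ : (Fin a → ℝ) → ℝ, AEStronglyMeasurable ψ volume ∧ MemBesov l' p q r' (planeWeight p t) ψ ∧
        besovNorm l' p q r' (planeWeight p t) ψ ≤ C * besovNorm l p q r t φ ∧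
        IsLimitTrace l l' p q r r' t φ ψ ∧ ∃ S : ℕ → (Fin (a + b) → ℝ) → ℝ,
          (∀ j, IsSpline l (S j) ∧ MemBesov l p q r t (S j)) ∧
          Tendsto (fun j => besovNorm l p q r t (φ - S j)) atTop (𝓝 0))
    (hext : ∃ C : ℝ≥0∞, C ≠ ∞ ∧ ∀ ψ : (Fin a → ℝ) → ℝ, Measurable ψ →
      MemBesov l' p q r' (planeWeight p t) ψ →
      ∃ φ : (Fin (a + b) → ℝ) → ℝ, AEStronglyMeasurable φ volume ∧ MemBesov l p q r t φ ∧
        besovNorm l p q r t φ ≤ C * besovNorm l' p q r' (planeWeight p t) ψ ∧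
        IsLimitTrace l l' p q r r' t φ ψ) :
    (∃ Tr : besovSpace l hp hq r ht →ₗ[ℝ] besovSpace l' hp hq r' (measurable_planeWeight (a := a) (b := b) p t),
      (∀ φ ψ, IsTrace l l' p q r r' t φ.1 ψ ↔ ψ = (Tr φ).1) ∧
      (∃ C : ℝ≥0, ∀ φ, besovNorm l' p q r' (planeWeight p t) (Tr φ).1 ≤ C * besovNorm l p q r t φ.1) ∧
      ∃ Ext : besovSpace l' hp hq r' (measurable_planeWeight (a := a) (b := b) p t) → besovSpace l hp hq r ht,
        (∃ C : ℝ≥0, ∀ ψ, besovNorm l p q r t (Ext ψ).1 ≤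
          C * besovNorm l' p q r' (planeWeight p t) ψ.1) ∧
        ∀ ψ, Tr (Ext ψ) = ψ) ∧
    traceSpace l l' p q r r' t =
      (besovSpace l' hp hq r' (measurable_planeWeight (a := a) (b := b) p t) :
          Set ((Fin a → ℝ) →ₘ[volume] ℝ)) ∧
    ∃ C₁ C₂ : ℝ≥0, ∀ ψ ∈ traceSpace l l' p q r r' t,
      besovNorm l' p q r' (planeWeight p t) ψ ≤ C₁ * traceNorm l l' p q r r' t ψ ∧
      traceNorm l l' p q r r' t ψ ≤ C₂ * besovNorm l' p q r' (planeWeight p t) ψ := by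
  have ht' := measurable_planeWeight (a := a) (b := b) p t
  obtain ⟨C₁, hC₁, htr⟩ := htr
  obtain ⟨C₂, hC₂, hext⟩ := hext
  have hrel : ∀ φ : besovSpace l hp hq r ht, ∃ ψ : besovSpace l' hp hq r' ht',
      IsLimitTrace l l' p q r r' t φ.1 ψ.1 ∧
      besovNorm l' p q r' (planeWeight p t) ψ.1 ≤ C₁ * besovNorm l p q r t φ.1 := by
    intro φ
    obtain ⟨ψ, hψm, hψ, hle, hlim, -⟩ := htr φ.1 φ.1.measurable φ.2
    have hmk := (AEEqFun.coeFn_mk ψ hψm).symm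
    refine ⟨⟨AEEqFun.mk ψ hψm, memBesov_congr hmk hψ⟩, hlim.congr (ae_eq_refl _) hmk, ?_⟩
    rw [← besovNorm_congr l' p q r' _ hmk]
    exact hle
  have huniq : ∀ (φ : (Fin (a + b) → ℝ) →ₘ[volume] ℝ) (ψ ψ' : (Fin a → ℝ) →ₘ[volume] ℝ),
      MemBesov l' p q r' (planeWeight p t) ψ → MemBesov l' p q r' (planeWeight p t) ψ' →
      IsLimitTrace l l' p q r r' t φ ψ → IsLimitTrace l l' p q r r' t φ ψ' → ψ = ψ' :=
    fun φ ψ ψ' hψ hψ' h h' => AEEqFun.ext (h.ae_eq hp hq ht hR hzero φ.aestronglyMeasurable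
      ψ.aestronglyMeasurable ψ'.aestronglyMeasurable hψ hψ' h')
  choose tr htr1 htr2 using hrel
  -- A trace in the sense of splines is a limit trace, because splines are continuous, so it is
  -- unique. Conversely a limit trace passes to all approximating spline sequences, and one such
  -- sequence is supplied by the expansion.
  have hiff : ∀ (φ : besovSpace l hp hq r ht) (ψ : (Fin a → ℝ) →ₘ[volume] ℝ),
      IsTrace l l' p q r r' t φ.1 ψ ↔ ψ = (tr φ).1 := by
    intro φ ψ
    constructor
    · rintro ⟨-, hψ, ⟨S, hS⟩, hall⟩
      refine huniq φ.1 ψ (tr φ).1 hψ (tr φ).2 ⟨S, fun j => ⟨(hS.1 j).1.continuous hl, (hS.1 j).2⟩, hS.2,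
        hall S hS⟩ (htr1 φ)
    · rintro rfl
      obtain ⟨-, -, -, -, -, S, hS, hSlim⟩ := htr φ.1 φ.1.measurable φ.2
      refine ⟨φ.2, (tr φ).2, ⟨S, hS, hSlim⟩, fun W hW => ?_⟩
      exact (htr1 φ).tendsto hp hq ht hR φ.1.aestronglyMeasurable (tr φ).1.aestronglyMeasurable
        (fun j => ⟨(hW.1 j).1.continuous hl, (hW.1 j).2⟩) hW.2
  let Tr : besovSpace l hp hq r ht →ₗ[ℝ] besovSpace l' hp hq r' ht' :=
    { toFun := tr
      map_add' := fun φ φ' => Subtype.ext (huniq (φ + φ').1 _ _ (tr (φ + φ')).2 (tr φ + tr φ').2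
        (htr1 (φ + φ')) (((htr1 φ).add hp hq ht φ.1.aestronglyMeasurable φ'.1.aestronglyMeasurable
          (tr φ).1.aestronglyMeasurable (tr φ').1.aestronglyMeasurable (htr1 φ')).congr
          (AEEqFun.coeFn_add φ.1 φ'.1).symm (AEEqFun.coeFn_add (tr φ).1 (tr φ').1).symm))
      map_smul' := fun c φ => Subtype.ext (huniq (c • φ).1 _ _ (tr (c • φ)).2 (c • tr φ).2
        (htr1 (c • φ)) (((htr1 φ).smul hp hq ht c φ.1.aestronglyMeasurable
          (tr φ).1.aestronglyMeasurable).congr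
          (AEEqFun.coeFn_smul c φ.1).symm (AEEqFun.coeFn_smul c (tr φ).1).symm)) }
  have hextrel : ∀ ψ : besovSpace l' hp hq r' ht', ∃ φ : besovSpace l hp hq r ht,
      IsLimitTrace l l' p q r r' t φ.1 ψ.1 ∧
      besovNorm l p q r t φ.1 ≤ C₂ * besovNorm l' p q r' (planeWeight p t) ψ.1 := by
    intro ψ
    obtain ⟨φ, hφm, hφ, hle, hlim⟩ := hext ψ.1 ψ.1.measurable ψ.2
    have hmk := (AEEqFun.coeFn_mk φ hφm).symm
    refine ⟨⟨AEEqFun.mk φ hφm, memBesov_congr hmk hφ⟩, hlim.congr hmk (ae_eq_refl _), ?_⟩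
    rw [← besovNorm_congr l p q r _ hmk]
    exact hle
  choose ext hext1 hext2 using hextrel
  have htrext : ∀ ψ, tr (ext ψ) = ψ := fun ψ =>
    Subtype.ext (huniq (ext ψ).1 _ _ (tr (ext ψ)).2 ψ.2 (htr1 _) (hext1 ψ))
  have hspace : ∀ ψ : (Fin a → ℝ) →ₘ[volume] ℝ, ∀ hψ : MemBesov l' p q r' (planeWeight p t) ψ,
      IsTrace l l' p q r r' t (ext ⟨ψ, hψ⟩).1 ψ := fun ψ hψ => (hiff _ _).2 (by rw [htrext])
  refine ⟨⟨Tr, hiff, ⟨C₁.toNNReal, fun φ => ?_⟩, ext, ⟨C₂.toNNReal, fun ψ => ?_⟩, htrext⟩, ?_,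
    C₁.toNNReal + 1, C₂.toNNReal, ?_⟩
  · rw [ENNReal.coe_toNNReal hC₁]
    exact htr2 φ
  · rw [ENNReal.coe_toNNReal hC₂]
    exact hext2 ψ
  · refine Set.ext fun ψ => ⟨?_, fun hψ => ⟨_, hspace ψ hψ⟩⟩
    rintro ⟨φ, hφ⟩
    exact hφ.2.1
  · rintro ψ ⟨φ₀, hφ₀⟩
    have hψ : MemBesov l' p q r' (planeWeight p t) ψ := hφ₀.2.1
    constructor
    -- The summand 1 makes the constant nonzero, so that it can be divided out before taking the
    -- infimum.
    · have hc0 : ((C₁.toNNReal + 1 : ℝ≥0) : ℝ≥0∞) ≠ 0 := by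
        rw [ENNReal.coe_ne_zero]
        positivity
      rw [← ENNReal.inv_mul_le_iff hc0 ENNReal.coe_ne_top]
      refine le_iInf₂ fun φ hφ => ?_
      rw [ENNReal.inv_mul_le_iff hc0 ENNReal.coe_ne_top]
      have h1 := (hiff ⟨φ, hφ.1⟩ ψ).1 hφ
      rw [h1]
      refine (htr2 ⟨φ, hφ.1⟩).trans (mul_le_mul_left ?_ _)
      rw [ENNReal.coe_add, ENNReal.coe_toNNReal hC₁]
      exact le_self_add
    · rw [ENNReal.coe_toNNReal hC₂]
      refine le_trans ?_ (hext2 ⟨ψ, hψ⟩)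
      unfold traceNorm
      exact iInf₂_le (ext ⟨ψ, hψ⟩).1 (hspace ψ hψ)

end

/-! ### The trace and extension estimates in discrete form. -/

/-- The discrete form of the hypotheses of the trace theorem. -/
structure IsTraceSetting (a b l l' : ℕ) (p q θ θ' α₁ α₁' α₂ : ℝ) (r r' : ℝ≥0∞)
    (t : ℕ → (Fin (a + b) → ℝ) → ℝ) (T : ℕ → (Fin (a + b) → ℤ) → ℝ≥0∞) : Prop where
  hp : 0 < p
  hq : 0 < q
  hl : 1 ≤ l
  hll' : l ≤ l'
  hθ : 0 < θ
  hθr : ENNReal.ofReal θ ≤ r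
  hθ' : 0 < θ'
  hθr' : ENNReal.ofReal θ' ≤ r'
  ht : ∀ k, Measurable (t k)
  weight : IsDiscreteWeight p θ α₁ α₂ T
  plane_weight : IsDiscreteWeight p θ' α₁' α₂
    fun k (m : Fin a → ℤ) => T k (Fin.append m (0 : Fin b → ℤ))
  hTt : ∀ k m, ∫⁻ x in hcube k m, ENNReal.ofReal (t k x) ^ p = T k m ^ p
  hTt' : ∀ k (m : Fin a → ℤ), ∫⁻ x in hcube k m, ENNReal.ofReal (planeWeight p t k x) ^ p =
    T k (Fin.append m (0 : Fin b → ℤ)) ^ p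
  hα₂ : α₂ < l
  hα₁ : ((a + b : ℕ) : ℝ) * (1 / θ - (r⁻¹).toReal) < α₁
  hα₁' : (a : ℝ) * (1 / θ' - (r'⁻¹).toReal) < α₁'

lemma pos_of_exponent_lt {n : ℕ} {θ α : ℝ} {r : ℝ≥0∞} (hθ : 0 < θ) (hθr : ENNReal.ofReal θ ≤ r)
    (h : (n : ℝ) * (1 / θ - (r⁻¹).toReal) < α) : 0 < α := by
  refine lt_of_le_of_lt (mul_nonneg (Nat.cast_nonneg n) (sub_nonneg.2 ?_)) h
  have h1 : r⁻¹ ≤ ENNReal.ofReal (1 / θ) := by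
    rw [one_div, ENNReal.ofReal_inv_of_pos hθ]
    exact ENNReal.inv_le_inv.2 hθr
  exact ENNReal.toReal_le_of_le_ofReal (one_div_pos.2 hθ).le h1

namespace IsTraceSetting

variable {l l' : ℕ} {p q θ θ' α₁ α₁' α₂ : ℝ} {r r' : ℝ≥0∞} {t : ℕ → (Fin (a + b) → ℝ) → ℝ}
  {T : ℕ → (Fin (a + b) → ℤ) → ℝ≥0∞}

lemma ne_zero (h : IsTraceSetting a b l l' p q θ θ' α₁ α₁' α₂ r r' t T) : r ≠ 0 := fun h0 => by
  have := h.hθr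
  rw [h0, nonpos_iff_eq_zero, ENNReal.ofReal_eq_zero] at this
  linarith [h.hθ]

lemma plane_ne_zero (h : IsTraceSetting a b l l' p q θ θ' α₁ α₁' α₂ r r' t T) : r' ≠ 0 := fun h0 => by
  have := h.hθr'
  rw [h0, nonpos_iff_eq_zero, ENNReal.ofReal_eq_zero] at this
  linarith [h.hθ']

/-- Expand f into splines on the whole space, restrict their increments, and sum them as blocks on
the plane. Identifying the limit with a restriction of f is a separate matter and needs continuity.
-/
lemma exists_restricted_limit (h : IsTraceSetting a b l l' p q θ θ' α₁ α₁' α₂ r r' t T) :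
    ∃ C : ℝ≥0∞, C ≠ ∞ ∧ ∀ f : (Fin (a + b) → ℝ) → ℝ, Measurable f → MemBesov l p q r t f →
      ∃ S β, IsSplineExpansion l f S β ∧ seqSum p q T β ≠ ∞ ∧
      ∃ g : (Fin a → ℝ) → ℝ, AEStronglyMeasurable g volume ∧
        (∀ᵐ x, Tendsto (fun k => planeRestrict (S k) x) atTop (𝓝 (g x))) ∧
        MemBesov l' p q r' (planeWeight p t) g ∧
        besovNorm l' p q r' (planeWeight p t) g ≤ C * besovNorm l p q r t f ∧
        Tendsto (fun K => besovNorm l' p q r' (planeWeight p t) (g - planeRestrict (S K))) atTop (𝓝 0) := by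
  obtain ⟨C₁, hC₁, hexp⟩ := exists_isSplineExpansion h.hp h.hq h.hθ h.weight h.hθr h.ht h.hTt h.hl
    (pos_of_exponent_lt h.hθ h.hθr h.hα₁)
  obtain ⟨C₂, hC₂, hlim⟩ := exists_limit_of_blocks h.hp h.hq h.hθ' h.plane_weight h.plane_ne_zero h.hθr'
    (measurable_planeWeight p t) h.hTt' h.hll' h.hα₂ h.hα₁'
  have hq' : 0 ≤ 1 / q := (one_div_pos.2 h.hq).le
  have hC₁' : C₁ ^ (1 / q) ≠ ∞ := ENNReal.rpow_ne_top_of_nonneg hq' hC₁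
  refine ⟨C₂ * C₁ ^ (1 / q), by finiteness, fun f hf hmem => ?_⟩
  obtain ⟨S, β, hS, hβ⟩ := hexp f hf hmem
  have hβt : seqSum p q T β ≠ ∞ := ne_top_of_le_ne_top
    (ENNReal.mul_ne_top hC₁ (ENNReal.rpow_ne_top_of_nonneg h.hq.le hmem.2.ne)) hβ
  have hle := seqSum_planeRestrict_le h.hp h.hq T β
  obtain ⟨g, hgm, hg, hgmem, hgle, -, hgt⟩ := hlim (fun k => planeRestrict (S k))
    (fun k m => β k (Fin.append m (0 : Fin b → ℤ)))
    (fun k => (continuous_planeRestrict (hS.continuous h.hl k)).measurable)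
    (by rw [hS.zero]; rfl) (fun k => (hS.block k).planeRestrict) (ne_top_of_le_ne_top hβt hle)
  refine ⟨S, β, hS, hβt, g, hgm, hg, hgmem, hgle.trans ?_, hgt⟩
  rw [mul_assoc]
  refine mul_le_mul_right ((ENNReal.rpow_le_rpow hle hq').trans (rpow_one_div_le_of_le h.hq hβ)) _

/-- For continuous f the splines converge to f at every point of the plane, so the limit of their
restrictions is the restriction of f. -/
lemma restrictionBounded (h : IsTraceSetting a b l l' p q θ θ' α₁ α₁' α₂ r r' t T) :
    RestrictionBounded a b l l' p q r r' t := by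
  obtain ⟨C, hC, hlim⟩ := h.exists_restricted_limit
  refine ⟨C, hC, fun f hf hmem => ?_⟩
  obtain ⟨S, β, hS, -, g, -, hg, hgmem, hgle, -⟩ := hlim f hf.measurable hmem
  have heq : g =ᵐ[volume] planeRestrict f := by
    filter_upwards [hg] with x hx
    exact tendsto_nhds_unique hx (hS.tendsto hf _)
  exact ⟨memBesov_congr heq hgmem, besovNorm_congr l' p q r' _ heq ▸ hgle⟩

/-- One and the same sequence of splines converges to φ in the space and, restricted, to ψ on the
plane. It also shows that φ can be approximated by splines. -/
lemma exists_trace (h : IsTraceSetting a b l l' p q θ θ' α₁ α₁' α₂ r r' t T) :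
    ∃ C : ℝ≥0∞, C ≠ ∞ ∧ ∀ φ : (Fin (a + b) → ℝ) → ℝ, Measurable φ → MemBesov l p q r t φ →
      ∃ ψ : (Fin a → ℝ) → ℝ, AEStronglyMeasurable ψ volume ∧ MemBesov l' p q r' (planeWeight p t) ψ ∧
        besovNorm l' p q r' (planeWeight p t) ψ ≤ C * besovNorm l p q r t φ ∧
        IsLimitTrace l l' p q r r' t φ ψ ∧ ∃ S : ℕ → (Fin (a + b) → ℝ) → ℝ,
          (∀ j, IsSpline l (S j) ∧ MemBesov l p q r t (S j)) ∧
          Tendsto (fun j => besovNorm l p q r t (φ - S j)) atTop (𝓝 0) := by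
  obtain ⟨C, hC, hlim⟩ := h.exists_restricted_limit
  obtain ⟨_, _, hlim₀⟩ := exists_limit_of_blocks h.hp h.hq h.hθ h.weight h.ne_zero h.hθr
    h.ht h.hTt le_rfl h.hα₂ h.hα₁
  refine ⟨C, hC, fun φ hφ hmem => ?_⟩
  obtain ⟨S, β, hS, hβ, ψ, hψm, -, hψ, hψle, hψt⟩ := hlim φ hφ hmem
  obtain ⟨g, -, hg, -, -, hSmem, hgt⟩ := hlim₀ S β (fun k => (hS.continuous h.hl k).measurable) hS.zero
    hS.block hβ
  have heq := hS.ae_eq g hg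
  have hφt : Tendsto (fun j => besovNorm l p q r t (φ - S j)) atTop (𝓝 0) :=
    hgt.congr fun j => besovNorm_congr l p q r t (heq.sub (ae_eq_refl _))
  refine ⟨ψ, hψm, hψ, hψle, ⟨S, fun j => ⟨hS.continuous h.hl j, hSmem j⟩, hφt, hψt⟩, S,
    fun j => ⟨?_, hSmem j⟩, hφt⟩
  obtain ⟨γ, hγ⟩ := hS.spline j
  rw [hγ]
  exact isSpline_splineSum l j γ

-- The increments of a spline expansion of ψ on the plane, of order l' and a fortiori of order l,
-- are extended one by one, each with a bump of its own scale.
open Classical in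
lemma exists_extension (h : IsTraceSetting a b l l' p q θ θ' α₁ α₁' α₂ r r' t T) :
    ∃ C : ℝ≥0∞, C ≠ ∞ ∧ ∀ ψ : (Fin a → ℝ) → ℝ, Measurable ψ →
      MemBesov l' p q r' (planeWeight p t) ψ →
      ∃ φ : (Fin (a + b) → ℝ) → ℝ, AEStronglyMeasurable φ volume ∧ MemBesov l p q r t φ ∧
        besovNorm l p q r t φ ≤ C * besovNorm l' p q r' (planeWeight p t) ψ ∧
        IsLimitTrace l l' p q r r' t φ ψ := by
  obtain ⟨C₁, hC₁, hexp⟩ := exists_isSplineExpansion h.hp h.hq h.hθ' h.plane_weight h.hθr'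
    (measurable_planeWeight p t) h.hTt' (h.hl.trans h.hll') (pos_of_exponent_lt h.hθ' h.hθr' h.hα₁')
  obtain ⟨_, _, hlim'⟩ := exists_limit_of_blocks h.hp h.hq h.hθ' h.plane_weight h.plane_ne_zero h.hθr'
    (measurable_planeWeight p t) h.hTt' h.hll' h.hα₂ h.hα₁'
  obtain ⟨C₂, hC₂, hlim⟩ := exists_limit_of_blocks h.hp h.hq h.hθ h.weight h.ne_zero h.hθr
    h.ht h.hTt le_rfl h.hα₂ h.hα₁
  obtain ⟨C₃, hC₃, hblock⟩ := exists_isBlock_extendBlock a b h.hl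
  obtain ⟨C₄, hC₄, hseq⟩ := exists_seqSum_extendBlock_le (a := a) (b := b) h.hp h.hq h.weight (2 * l + 2) hC₃
  have hq' : 0 ≤ 1 / q := (one_div_pos.2 h.hq).le
  have hC₁' : (C₄ * C₁) ^ (1 / q) ≠ ∞ := ENNReal.rpow_ne_top_of_nonneg hq' (by finiteness)
  refine ⟨C₂ * (C₄ * C₁) ^ (1 / q), by finiteness, fun ψ hψ hmem => ?_⟩
  obtain ⟨S', β', hS', hβ'⟩ := hexp ψ hψ hmem
  have hl' := h.hl.trans h.hll'
  have hN : besovNorm l' p q r' (planeWeight p t) ψ ^ q ≠ ∞ :=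
    ENNReal.rpow_ne_top_of_nonneg h.hq.le hmem.2.ne
  obtain ⟨g', -, hg', -, -, -, hgt'⟩ := hlim' S' β' (fun k => (hS'.continuous hl' k).measurable) hS'.zero
    (fun k => (hS'.block k).mono_order h.hll') (ne_top_of_le_ne_top (by finiteness) hβ')
  have heq := hS'.ae_eq g' hg'
  -- Each increment is extended separately, since a bump at scale 2^{-(k+1)} matches only the
  -- increment of level k + 1. On the plane the sum telescopes to the spline of level K.
  set S : ℕ → (Fin (a + b) → ℝ) → ℝ := fun K x =>
    ∑ k ∈ Finset.range K, extendBlock l (k + 1) (S' (k + 1) - S' k) x with hS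
  have hScont : ∀ K, Continuous (S K) := fun K => continuous_finsetSum _ fun k _ =>
    continuous_extendBlock l (k + 1) ((hS'.continuous hl' (k + 1)).sub (hS'.continuous hl' k))
  have hSdiff : ∀ k, S (k + 1) - S k = extendBlock l (k + 1) (S' (k + 1) - S' k) := by
    intro k
    funext x
    simp [hS, Finset.sum_range_succ]
  have hSplane : ∀ K, planeRestrict (S K) = S' K := by
    intro K
    induction K with
    | zero =>
      rw [hS'.zero]
      rfl
    | succ K ih =>
      have h1 : S (K + 1) = S K + extendBlock l (K + 1) (S' (K + 1) - S' K) := by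
        rw [← hSdiff, add_sub_cancel]
      have h2 : planeRestrict (S (K + 1)) = planeRestrict (S K) +
          planeRestrict (b := b) (extendBlock l (K + 1) (S' (K + 1) - S' K)) := by
        rw [h1]
        rfl
      rw [h2, ih, planeRestrict_extendBlock h.hl, add_sub_cancel]
  have hβ := (hseq β').trans (mul_le_mul_right hβ' C₄)
  rw [← mul_assoc] at hβ
  obtain ⟨φ, hφm, -, hφ, hφle, hSmem, hφt⟩ := hlim S _ (fun k => (hScont k).measurable)
    (by funext x; simp [hS]) (fun k => by
      rw [hSdiff]
      exact hblock (k + 1) _ _ ((hS'.block k).mono_order h.hll'))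
    (ne_top_of_le_ne_top (by finiteness) hβ)
  refine ⟨φ, hφm, hφ, hφle.trans ?_, S, fun j => ⟨hScont j, hSmem j⟩, hφt, ?_⟩
  · rw [mul_assoc]
    exact mul_le_mul_right (rpow_one_div_le_of_le h.hq hβ) _
  · refine hgt'.congr fun j => ?_
    rw [hSplane]
    exact besovNorm_congr l' p q r' _ (heq.sub (ae_eq_refl _))

end IsTraceSetting

end VarBesov

end

/-! ### The trace theorem. -/

theorem theorem6p1 {a b : ℕ} (ha : 1 ≤ a) (hb : 1 ≤ b)
    {p q : ℝ} (hp : 0 < p) (hq : 0 < q)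
    (r : ℝ≥0∞) (hr : 0 < r) (θ : ℝ) (hθ : 0 < θ) (hθp : θ ≤ p) (hθr : ENNReal.ofReal θ ≤ r)
    (l : ℕ) (hl : 1 ≤ l) (α₁ α₂ α₃ : ℝ) (hα₃ : 0 ≤ α₃)
    (hα₁ : ((a + b : ℕ) : ℝ) * (1 / θ - (r⁻¹).toReal) < α₁) (hα₂ : α₂ < l)
    (t : ℕ → (Fin (a + b) → ℝ) → ℝ)
    (ht : VarBesov.MemX p α₁ α₂ α₃ (VarBesov.sigmaExp p θ) (ENNReal.ofReal p) t)
    (r' : ℝ≥0∞) (hr' : 0 < r') (θ' : ℝ) (hθ' : 0 < θ') (hθp' : θ' ≤ p)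
    (hθr' : ENNReal.ofReal θ' ≤ r')
    (l' : ℕ) (hl' : l ≤ l') (α₁' α₂' α₃' : ℝ) (hα₃' : 0 ≤ α₃')
    (hα₁' : (a : ℝ) * (1 / θ' - (r'⁻¹).toReal) < α₁') (hα₂' : α₂' < l')
    (ht' : VarBesov.MemXTilde p α₁' α₂' α₃' (VarBesov.sigmaExp p θ') (ENNReal.ofReal p)
      (VarBesov.planeWeight (a := a) (b := b) p t)) :
    (∃ Tr : VarBesov.besovSpace l hp hq r ht.admissible.measurable →ₗ[ℝ]
        VarBesov.besovSpace l' hp hq r' (VarBesov.measurable_planeWeight (a := a) (b := b) p t),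
      (∀ φ ψ, VarBesov.IsTrace l l' p q r r' t φ.1 ψ ↔ ψ = (Tr φ).1) ∧
      (∃ C : ℝ≥0, ∀ φ, VarBesov.besovNorm l' p q r' (VarBesov.planeWeight p t) (Tr φ).1 ≤
        C * VarBesov.besovNorm l p q r t φ.1) ∧
      ∃ Ext : VarBesov.besovSpace l' hp hq r'
            (VarBesov.measurable_planeWeight (a := a) (b := b) p t) →
          VarBesov.besovSpace l hp hq r ht.admissible.measurable,
        (∃ C : ℝ≥0, ∀ ψ, VarBesov.besovNorm l p q r t (Ext ψ).1 ≤
          C * VarBesov.besovNorm l' p q r' (VarBesov.planeWeight p t) ψ.1) ∧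
        ∀ ψ, Tr (Ext ψ) = ψ) ∧
    VarBesov.traceSpace l l' p q r r' t =
      (VarBesov.besovSpace l' hp hq r'
        (VarBesov.measurable_planeWeight (a := a) (b := b) p t) :
          Set ((Fin a → ℝ) →ₘ[volume] ℝ)) ∧
    ∃ C₁ C₂ : ℝ≥0, ∀ ψ ∈ VarBesov.traceSpace l l' p q r r' t,
      VarBesov.besovNorm l' p q r' (VarBesov.planeWeight p t) ψ ≤
        C₁ * VarBesov.traceNorm l l' p q r r' t ψ ∧
      VarBesov.traceNorm l l' p q r r' t ψ ≤
        C₂ * VarBesov.besovNorm l' p q r' (VarBesov.planeWeight p t) ψ := by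
  have hset : VarBesov.IsTraceSetting a b l l' p q θ θ' α₁ α₁' α₂ r r' t
      fun k m => ENNReal.ofReal (VarBesov.assocSeq p t k m) :=
    { hp := hp
      hq := hq
      hl := hl
      hll' := hl'
      hθ := hθ
      hθr := hθr
      hθ' := hθ'
      hθr' := hθr'
      ht := ht.admissible.measurable
      weight := ht.isDiscreteWeight hp hθ hθp
      plane_weight := VarBesov.isDiscreteWeight_plane hp hθ' hθp' ht ht'.1
      hTt := ht.admissible.setLIntegral_rpow hp
      hTt' := VarBesov.setLIntegral_planeWeight hp t
      hα₂ := hα₂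
      hα₁ := hα₁
      hα₁' := hα₁' }
  exact VarBesov.exists_trace_and_extension hp hq hl ht.admissible.measurable hset.restrictionBounded
    (fun f hf hmem h0 => VarBesov.ae_eq_zero_of_besovNorm_eq_zero hp hq hθ' hset.plane_weight hθr'
      (VarBesov.measurable_planeWeight p t) hset.hTt' (hl.trans hl')
      (VarBesov.pos_of_exponent_lt hθ' hθr' hα₁') hf hmem h0)
    hset.exists_trace hset.exists_extension
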